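/- **Setting.** Let $T>0$, let $w=(w^1,\dots,w^m)$ be a Brownian motion on a probability space $(\Omega,\mathcal A,\mathbb P)$ with augmented natural filtration $\mathbb F=(\mathcal F_t)_{0\le t\le T}$, let $\mathcal U\subset\mathbb R^{d}$, and let $b:[0,T]\times\mathbb R^n\times\mathcal U\to\mathbb R^n$, $\sigma=(\sigma^1,\dots,\sigma^m):[0,T]\times\mathbb R^n\to\mathbb R^{n\times m}$, $g:[0,T]\times\mathbb R^n\times\mathcal U\to\mathbb R$, $\Lambda:\mathbb R^n\to\mathbb R$. Assume: $b,\sigma$ are continuous, $\|b(t,x,u)\|+\|\sigma(t,x)\|\le C(1+\|x\|+\|u\|)$, and $\|b(t,x,u)-b(s,y,u)\|+\|\sigma(t,x)-\sigma(s,y)\|\le C(|t-s|+\|x-y\|)$; $\sigma$ is differentiable in $x$ with $\sigma_x$ continuous and bounded; $g$ is measurable. Let $p\ge 2$ be such that $|\Lambda(x)|\le C(1+\|x\|^p)$ and $|g(t,x,u)|\le C(1+\|x\|^p+\|u\|^p)$. For $t\in[0,T]$ and $x\in\mathbb R^n$ a strategy $\mathbf u\in\mathcal U_{\mathbb F}(t)$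 is an $\mathbb F$-progressively measurable $\mathcal U$-valued process on $[t,T]$ with $\mathbb E\int_t^T\|u_s\|^pds<\infty$ for which the solution $(x_s)$ of the Itô equation $dx_s=b(s,x_s,u_s)ds+\sigma(s,x_s)dw_s$, $x_t=x$, satisfies $\mathbb E\sup_{s\in[t,T]}\|x_s\|^p<\infty$. Put $J(t,x;\mathbf u)=\mathbb E[\Lambda(x_T)+\int_t^Tg(s,x_s,u_s)ds]$ and $V(t,x)=\sup_{\mathbf u\in\mathcal U_{\mathbb F}(t)}J(t,x;\mathbf u)$. Let $\sigma^i_x\sigma^i$ be the vector with entries $\sum_j(\partial\sigma^{ki}/\partial x_j)\sigma^{ji}$, let $\bar b=b-\frac12\sum_i\sigma^i_x\sigma^i$ and $A^uV=V_t+V_x^\top b(t,x,u)+\frac12\mathrm{tr}(V_{xx}\sigma\sigma^\top)$. A process $y$ is Stratonovich integrable with respect to $w^i$ on $[0,t]$ if it is measurable with $\int_0^t|y_s|ds<\infty$ a.s. and the sums $\int_0^ty_s\sum_j\frac{w^i_{t_{j+1}}-w^i_{t_j}}{t_{j+1}-t_j}1_{(t_j,t_{j+1}]}(s)\,ds$ converge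 in probability as the mesh of the partition $0=t_0<\dots<t_N=t$ tends to $0$; the limit is $\int_0^ty_s\circ dw^i_s$. Let $\mathcal U(0)$ be the set of the $\mathcal B([0,T])\otimes\mathcal F_T$-measurable $\mathcal U$-valued (possibly anticipating) controls $\mathbf u$ that have a state process, i.e. a measurable process $(x_t)$ with a.s. continuous paths solving $$x_t=x+\int_0^t\bar b(s,x_s,u_s)ds+\sum_{i=1}^m\int_0^t\sigma^i(s,x_s)\circ dw^i_s,\qquad 0\le t\le T.$$ **Hypotheses.** (a) $V\in C^{1,2}([0,T)\times\mathbb R^n)$, $V$ is continuous on $[0,T]\times\mathbb R^n$ with $|V(t,x)|\le C(1+\|x\|^p)$, $V(T,\cdot)=\Lambda$, and there is $u^*:[0,T]\times\mathbb R^n\to\mathcal U$ with $$g(t,x,u^*(t,x))+A^{u^*(t,x)}V(t,x)=\max_{u\in\mathcal U}\{g(t,x,u)+A^uV(t,x)\}=0\quad\text{on }[0,T)\times\mathbb R^n,$$ such that for every initial state $x$ the feedback strategy $u^*_t=u^*(t,x^*_t)$, with state process $x^*$, exists and is admissible at time $0$. (b) For every $x$, every $\mathbf u\in\mathcal U(0)$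 and every state process $(x_t)$ of $\mathbf u$ started at $x$, the Stratonovich–Itô formula holds: for $0\le t\le T$, a.s., $$V(t,x_t)=V(0,x_0)+\int_0^t[V_t+V_x^\top\bar b](s,x_s,u_s)ds+\sum_{i=1}^m\int_0^t[V_x^\top\sigma^i](s,x_s)\circ dw^i_s,$$ all the integrals being defined, and the $dt$-integral in the following definition exists a.s.: $$h^*_v(\mathbf u,\mathbf w)=\sum_{i=1}^m\int_0^T[V_x^\top\sigma^i](t,x_t)\circ dw^i_t-\frac12\int_0^T\Big[V_x^\top\Big(\sum_{i=1}^m\sigma^i_x\sigma^i\Big)+\mathrm{tr}(V_{xx}\sigma\sigma^\top)\Big](t,x_t)\,dt.$$ **Conclusions.** 1. For every $x$ and every $\mathbf u\in\mathcal U_{\mathbb F}(0)$, $h^*_v(\mathbf u,\mathbf w)$ is the Itô integral $\int_0^TV_x(t,x_t)^\top\sigma(t,x_t)\,dw_t$, and $h^*_v$ is dual feasible: $h^*_v(\mathbf u,\mathbf w)$ is integrable and $\mathbb E_{0,x}[h^*_v(\mathbf u,\mathbf w)]\le0$. If moreover $\|V_x(t,x)^\top\sigma(t,x)\|\le C(1+\|x\|^p)$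 on $[0,T)\times\mathbb R^n$, then $\mathbb E_{0,x}[h^*_v(\mathbf u,\mathbf w)]=0$. 2. For every $x$, where the supremum of the (uncountable) family of random variables is the essential supremum, $$V(0,x)=\mathbb E_{0,x}\Big[\sup_{\mathbf u\in\mathcal U(0)}\Big\{\Lambda(x_T)+\int_0^Tg(t,x_t,u_t)dt-h^*_v(\mathbf u,\mathbf w)\Big\}\Big],$$ and almost surely $$V(0,x)=\sup_{\mathbf u\in\mathcal U(0)}\Big\{\Lambda(x_T)+\int_0^Tg(t,x_t,u_t)dt-h^*_v(\mathbf u,\mathbf w)\Big\}=\Lambda(x^*_T)+\int_0^Tg(t,x^*_t,u^*_t)dt-h^*_v(\mathbf u^*,\mathbf w);$$ in particular $\mathbf u^*\in\mathcal U(0)$ with state process $x^*$. (The objective counts as $-\infty$ where $\int_0^T|g(t,x_t,u_t)|dt=\infty$.) -/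

import Mathlib

open MeasureTheory ProbabilityTheory Filter Topology Set
open scoped NNReal ENNReal

namespace ControlledDiffusion

/-- The Euclidean space `ℝⁿ`. -/
abbrev E (n : ℕ) : Type := EuclideanSpace ℝ (Fin n)

section StochasticCalculus

variable {Ω : Type*} [mΩ : MeasurableSpace Ω] {m : ℕ}
variable {F : Type*} [NormedAddCommGroup F] [NormedSpace ℝ F]

/-- An `m`-dimensional standard Brownian motion `w = (w¹, …, wᵐ)`. -/
structure IsBrownianMotion (w : Fin m → ℝ≥0 → Ω → ℝ) (P : Measure Ω) : Prop where
  measurable : ∀ i t, Measurable (w i t)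
  brownian : ∀ i, IsBrownianReal (w i) P
  indep : iIndepFun (fun i ω (t : ℝ≥0) => w i t ω) P

/-- The natural filtration of `w`, augmented by the null sets of `P`. -/
@[reducible]
def augFiltration (w : Fin m → ℝ≥0 → Ω → ℝ) (P : Measure Ω) (t : ℝ) : MeasurableSpace Ω :=
  mΩ ⊓ eventuallyMeasurableSpace
    (⨆ (i : Fin m) (s : ℝ≥0) (_ : (s : ℝ) ≤ t), MeasurableSpace.comap (w i s) inferInstance) (ae P)

/-- Measurability of the process `u` on `[a, t] × Ω` with respect to `𝓑([a, t]) ⊗ 𝒢`. -/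
def JointlyMeasurableOn {β : Type*} [MeasurableSpace β] (𝒢 : MeasurableSpace Ω) (a t : ℝ)
    (u : ℝ → Ω → β) : Prop :=
  Measurable[(inferInstance : MeasurableSpace (Icc a t)).prod 𝒢]
    (fun q : Icc a t × Ω => u q.1 q.2)

/-- Progressive measurability on `[a, T]`. -/
def ProgressiveOn {β : Type*} [MeasurableSpace β] (ℱ : ℝ → MeasurableSpace Ω) (a T : ℝ)
    (u : ℝ → Ω → β) : Prop :=
  ∀ t ∈ Icc a T, JointlyMeasurableOn (ℱ t) a t u

/-- A finite partition `a = t₀ < t₁ < ⋯ < t_N = b` of `[a, b]`. -/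
structure Partition (a b : ℝ) where
  N : ℕ
  pt : Fin (N + 1) → ℝ
  strictMono : StrictMono pt
  first : pt 0 = a
  last : pt (Fin.last N) = b

/-- The mesh of a partition. -/
noncomputable def Partition.mesh {a b : ℝ} (I : Partition a b) : ℝ :=
  ⨆ j : Fin I.N, (I.pt j.succ - I.pt j.castSucc)

/-- The increment of `v` over the `j`-th interval of the partition. -/
def Partition.incr {a b : ℝ} (I : Partition a b) (v : ℝ≥0 → Ω → ℝ) (j : Fin I.N) (ω : Ω) : ℝ :=
  v (I.pt j.succ).toNNReal ω - v (I.pt j.castSucc).toNNReal ω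

/-! ### The Itô integral -/

/-- Bounded adapted step processes `∑ⱼ ξⱼ 1_{(tⱼ, tⱼ₊₁]}` on `[a, b]`, with `m` components in `F`
(one for each coordinate of the Brownian motion). -/
structure StepProcess (ℱ : ℝ → MeasurableSpace Ω) (m : ℕ) (F : Type*) [NormedAddCommGroup F]
    (a b : ℝ) where
  part : Partition a b
  coeff : Fin part.N → Fin m → Ω → F
  adapted : ∀ j i, StronglyMeasurable[ℱ (part.pt j.castSucc)] (coeff j i)
  bounded : ∃ C : ℝ, ∀ j i ω, ‖coeff j i ω‖ ≤ C

/-- The value of a step process. -/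
noncomputable def StepProcess.val {ℱ : ℝ → MeasurableSpace Ω} {a b : ℝ}
    (S : StepProcess ℱ m F a b) (i : Fin m) (t : ℝ) (ω : Ω) : F :=
  ∑ j, (Ioc (S.part.pt j.castSucc) (S.part.pt j.succ)).indicator (fun _ => S.coeff j i ω) t

/-- The elementary stochastic integral of a step process. -/
noncomputable def StepProcess.integral {ℱ : ℝ → MeasurableSpace Ω} {a b : ℝ}
    (S : StepProcess ℱ m F a b) (w : Fin m → ℝ≥0 → Ω → ℝ) (ω : Ω) : F :=
  ∑ j, ∑ i, S.part.incr (w i) j ω • S.coeff j i ω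

/-- `Y` is (a version of) the Itô integral `∑ᵢ ∫ₐᵇ Φⁱ dwⁱ`: there are bounded adapted step
processes `Sₖ` with `∫ₐᵇ ‖Sₖ - Φ‖² dt → 0` in probability and `∫ₐᵇ Sₖ dw → Y` in probability. -/
def IsItoIntegral (P : Measure Ω) (w : Fin m → ℝ≥0 → Ω → ℝ) (Φ : Fin m → ℝ → Ω → F) (a b : ℝ)
    (Y : Ω → F) : Prop :=
  ∃ S : ℕ → StepProcess (augFiltration w P) m F a b,
    (∀ ε : ℝ≥0∞, 0 < ε → Tendsto
      (fun k => P {ω | ε ≤ ∫⁻ t in Icc a b, ∑ i, ‖(S k).val i t ω - Φ i t ω‖ₑ ^ 2})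
      atTop (𝓝 0)) ∧
    TendstoInMeasure P (fun k => (S k).integral w) atTop Y

/-! ### The Stratonovich integral -/

/-- `S^I = ∫ₐᵇ y_t ∑ⱼ (w_{tⱼ₊₁} - w_{tⱼ}) / (tⱼ₊₁ - tⱼ) 1_{(tⱼ, tⱼ₊₁]}(t) dt`. -/
noncomputable def stratonovichSum (v : ℝ≥0 → Ω → ℝ) (y : ℝ → Ω → F) {a b : ℝ}
    (I : Partition a b) (ω : Ω) : F :=
  ∑ j : Fin I.N, (I.incr v j ω / (I.pt j.succ - I.pt j.castSucc)) •
    ∫ t in (I.pt j.castSucc)..(I.pt j.succ), y t ω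

/-- `Y` is (a version of) the Stratonovich integral `∫ₐᵇ y ∘ dv` of the measurable, not
necessarily adapted, process `y`: the sums `S^I` converge to `Y` in probability as `|I| → 0`. -/
structure IsStratonovichIntegral (P : Measure Ω) (v : ℝ≥0 → Ω → ℝ) (y : ℝ → Ω → F) (a b : ℝ)
    (Y : Ω → F) : Prop where
  measurable : AEStronglyMeasurable (Function.uncurry y) ((volume.restrict (Icc a b)).prod P)
  integrable : ∀ᵐ ω ∂P, IntegrableOn (fun t => y t ω) (Icc a b)
  tendsto : TendstoInMeasure P (fun I : Partition a b => stratonovichSum v y I)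
    (comap Partition.mesh (𝓝 0)) Y

/-- Stratonovich integrability on `[a, b]`. -/
def StratonovichIntegrable (P : Measure Ω) (v : ℝ≥0 → Ω → ℝ) (y : ℝ → Ω → F) (a b : ℝ) : Prop :=
  ∃ Y, IsStratonovichIntegral P v y a b Y

open Classical in
/-- The Stratonovich integral `∫ₐᵇ y ∘ dv` (determined up to almost sure equality). -/
noncomputable def stratonovichIntegral (P : Measure Ω) (v : ℝ≥0 → Ω → ℝ) (y : ℝ → Ω → F)
    (a b : ℝ) : Ω → F :=
  if h : StratonovichIntegrable P v y a b then h.choose else 0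

/-- `Z` is the essential supremum of the family `𝒮` of extended real random variables. -/
structure IsEssSup (P : Measure Ω) (𝒮 : Set (Ω → EReal)) (Z : Ω → EReal) : Prop where
  aemeasurable : AEMeasurable Z P
  upper : ∀ Y ∈ 𝒮, Y ≤ᵐ[P] Z
  least : ∀ Z' : Ω → EReal, AEMeasurable Z' P → (∀ Y ∈ 𝒮, Y ≤ᵐ[P] Z') → Z ≤ᵐ[P] Z'

end StochasticCalculus

/-! ### The control problem -/

/-- The data of a controlled diffusion `dx = b(t, x, u) dt + ∑ᵢ σⁱ(t, x) dwⁱ` on `[0, T]` with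
states in `ℝⁿ`, controls in `U ⊆ ℝᵈ`, an `m`-dimensional noise (`σ i` is the `i`-th column of the
diffusion matrix), running reward `g` and final reward `Λ`. -/
structure ControlProblem (n m d : ℕ) where
  T : ℝ
  U : Set (E d)
  b : ℝ → E n → E d → E n
  σ : Fin m → ℝ → E n → E n
  g : ℝ → E n → E d → ℝ
  Λ : E n → ℝ

namespace ControlProblem

variable {n m d : ℕ} (D : ControlProblem n m d)

/-- The Euclidean (Frobenius) norm of the matrix with columns `A i`. -/
noncomputable def matNorm (A : Fin m → E n) : ℝ := √(∑ i, ‖A i‖ ^ 2)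

/-- The standing assumptions on the data; `p` bounds the exponents of the polynomial growth of the
rewards. -/
structure StandingAssumptions (p : ℝ) : Prop where
  T_pos : 0 < D.T
  continuous_b : ContinuousOn (fun q : ℝ × E n × E d => D.b q.1 q.2.1 q.2.2)
    (Icc 0 D.T ×ˢ univ ×ˢ D.U)
  continuous_σ : ∀ i, ContinuousOn (fun q : ℝ × E n => D.σ i q.1 q.2) (Icc 0 D.T ×ˢ univ)
  growth : ∃ C : ℝ, ∀ t ∈ Icc 0 D.T, ∀ x, ∀ u ∈ D.U,
    ‖D.b t x u‖ + matNorm (fun i => D.σ i t x) ≤ C * (1 + ‖x‖ + ‖u‖)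
  lipschitz : ∃ C : ℝ, ∀ t ∈ Icc 0 D.T, ∀ s ∈ Icc 0 D.T, ∀ x y, ∀ u ∈ D.U,
    ‖D.b t x u - D.b s y u‖ + matNorm (fun i => D.σ i t x - D.σ i s y)
      ≤ C * (|t - s| + ‖x - y‖)
  differentiable_σ : ∀ i, ∀ t ∈ Icc 0 D.T, Differentiable ℝ (D.σ i t)
  continuous_fderiv_σ : ∀ i, ContinuousOn (fun q : ℝ × E n => fderiv ℝ (D.σ i q.1) q.2)
    (Icc 0 D.T ×ˢ univ)
  bounded_fderiv_σ : ∃ C : ℝ, ∀ i, ∀ t ∈ Icc 0 D.T, ∀ x, ‖fderiv ℝ (D.σ i t) x‖ ≤ C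
  measurable_g : Measurable (fun q : Icc 0 D.T × E n × D.U => D.g q.1 q.2.1 q.2.2)
  growth_Λ : ∃ C : ℝ, ∀ x, |D.Λ x| ≤ C * (1 + ‖x‖ ^ p)
  growth_g : ∃ C : ℝ, ∀ t ∈ Icc 0 D.T, ∀ x, ∀ u ∈ D.U,
    |D.g t x u| ≤ C * (1 + ‖x‖ ^ p + ‖u‖ ^ p)

/-! #### Differential operators -/

/-- `V_t`, the derivative with respect to `t ∈ [0, T]` (one-sided at the end points). -/
noncomputable def dt (V : ℝ → E n → ℝ) (t : ℝ) (x : E n) : ℝ :=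
  derivWithin (fun s => V s x) (Icc 0 D.T) t

/-- `V_x`, the gradient in the state. -/
noncomputable def grad (V : ℝ → E n → ℝ) (t : ℝ) (x : E n) : E n := gradient (V t) x

/-- `V_xx`, the Hessian in the state. -/
noncomputable def hess (V : ℝ → E n → ℝ) (t : ℝ) (x : E n) : E n →L[ℝ] E n :=
  fderiv ℝ (gradient (V t)) x

/-- `V ∈ C^{1,2}([0, T) × ℝⁿ)`. -/
structure IsC12 (V : ℝ → E n → ℝ) : Prop where
  diff_t : ∀ t ∈ Ico 0 D.T, ∀ x, DifferentiableWithinAt ℝ (fun s => V s x) (Icc 0 D.T) t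
  diff_x : ∀ t ∈ Ico 0 D.T, Differentiable ℝ (V t)
  diff_xx : ∀ t ∈ Ico 0 D.T, Differentiable ℝ (gradient (V t))
  cont_t : ContinuousOn (fun q : ℝ × E n => D.dt V q.1 q.2) (Ico 0 D.T ×ˢ univ)
  cont_x : ContinuousOn (fun q : ℝ × E n => grad V q.1 q.2) (Ico 0 D.T ×ˢ univ)
  cont_xx : ContinuousOn (fun q : ℝ × E n => hess V q.1 q.2) (Ico 0 D.T ×ˢ univ)

/-- `V` is continuous on `[0, T] × ℝⁿ` with polynomial growth in `x` of order at most `p`. -/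
structure IsCp (p : ℝ) (V : ℝ → E n → ℝ) : Prop where
  cont : ContinuousOn (fun q : ℝ × E n => V q.1 q.2) (Icc 0 D.T ×ˢ univ)
  growth : ∃ C : ℝ, ∀ t ∈ Icc 0 D.T, ∀ x, |V t x| ≤ C * (1 + ‖x‖ ^ p)

/-- `tr(V_xx σσᵀ)(t, x)`. -/
noncomputable def traceTerm (V : ℝ → E n → ℝ) (t : ℝ) (x : E n) : ℝ :=
  ∑ i, inner ℝ (D.σ i t x) (hess V t x (D.σ i t x))

/-- `∑ᵢ σⁱ_x σⁱ (t, x)`. -/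
noncomputable def σσx (t : ℝ) (x : E n) : E n := ∑ i, fderiv ℝ (D.σ i t) x (D.σ i t x)

/-- The Stratonovich drift `b̄ = b - ½ ∑ᵢ σⁱ_x σⁱ`. -/
noncomputable def bbar (t : ℝ) (x : E n) (u : E d) : E n := D.b t x u - (1 / 2 : ℝ) • D.σσx t x

/-- The operator `A^u V = V_t + V_xᵀ b + ½ tr(V_xx σσᵀ)`. -/
noncomputable def A (V : ℝ → E n → ℝ) (t : ℝ) (x : E n) (u : E d) : ℝ :=
  D.dt V t x + inner ℝ (grad V t x) (D.b t x u) + 1 / 2 * D.traceTerm V t x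

section Processes

variable {Ω : Type*} [mΩ : MeasurableSpace Ω] (P : Measure Ω) (w : Fin m → ℝ≥0 → Ω → ℝ)

/-! #### Admissible strategies and the value function -/

/-- `X` is a pathwise solution on `[a, T]` of the Itô equation
`X_t = x + ∫ₐᵗ b(s, X_s, u_s) ds + ∫ₐᵗ σ(s, X_s) dw_s`. -/
structure IsItoSolution (a : ℝ) (x : E n) (u : ℝ → Ω → E d) (X : ℝ → Ω → E n) : Prop where
  progressive : ProgressiveOn (augFiltration w P) a D.T X
  continuous : ∀ᵐ ω ∂P, ContinuousOn (fun t => X t ω) (Icc a D.T)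
  integrable : ∀ᵐ ω ∂P, IntegrableOn (fun s => D.b s (X s ω) (u s ω)) (Icc a D.T)
  equation : ∀ t ∈ Icc a D.T, IsItoIntegral P w (fun i s ω => D.σ i s (X s ω)) a t
    (fun ω => X t ω - x - ∫ s in a..t, D.b s (X s ω) (u s ω))

/-- `u` is an admissible (non-anticipative) strategy at time `a` for the initial state `x`, with
state process `X`; `p` is the order of the moments (`p = 2`: square integrability). -/
structure Admissible (p a : ℝ) (x : E n) (u : ℝ → Ω → E d) (X : ℝ → Ω → E n) : Prop where
  progressive : ProgressiveOn (augFiltration w P) a D.T u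
  mem : ∀ t ∈ Icc a D.T, ∀ ω, u t ω ∈ D.U
  state : D.IsItoSolution P w a x u X
  moment_u : ∫⁻ ω, (∫⁻ t in Icc a D.T, ‖u t ω‖ₑ ^ p) ∂P < ∞
  moment_X : ∫⁻ ω, (⨆ t ∈ Icc a D.T, ‖X t ω‖ₑ ^ p) ∂P < ∞

/-- The reward functional `J(a, x; u) = E[Λ(X_T) + ∫ₐᵀ g(s, X_s, u_s) ds]`. -/
noncomputable def J (a : ℝ) (u : ℝ → Ω → E d) (X : ℝ → Ω → E n) : ℝ :=
  ∫ ω, (D.Λ (X D.T ω) + ∫ s in a..D.T, D.g s (X s ω) (u s ω)) ∂P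

/-- `V(t, x)` is the supremum of `J(t, x; u)` over the admissible strategies `u` at time `t`. -/
def IsValueFunction (p : ℝ) (V : ℝ → E n → ℝ) : Prop :=
  ∀ t ∈ Icc 0 D.T, ∀ x,
    IsLUB {r : ℝ | ∃ u X, D.Admissible P w p t x u X ∧ r = D.J P t u X} (V t x)

/-- The strategy `u_t = φ(t, X_t)` given by the feedback `φ` along the state process `X`. -/
def feedback (φ : ℝ → E n → E d) (X : ℝ → Ω → E n) : ℝ → Ω → E d := fun t ω => φ t (X t ω)

/-- The assumptions of the verification theorem: `V ∈ C^{1,2} ∩ C_p` solves the HJB equation with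
terminal value `Λ`, the feedback `ustar` attains the maximum in the HJB equation, and the strategy
it defines is admissible at time `0`. -/
structure VerificationAssumptions (p : ℝ) (V : ℝ → E n → ℝ) (ustar : ℝ → E n → E d) : Prop where
  isC12 : D.IsC12 V
  isCp : D.IsCp p V
  terminal : ∀ x, V D.T x = D.Λ x
  mem : ∀ t ∈ Icc 0 D.T, ∀ x, ustar t x ∈ D.U
  isGreatest : ∀ t ∈ Ico 0 D.T, ∀ x,
    IsGreatest ((fun u => D.g t x u + D.A V t x u) '' D.U)
      (D.g t x (ustar t x) + D.A V t x (ustar t x))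
  hjb : ∀ t ∈ Ico 0 D.T, ∀ x, D.g t x (ustar t x) + D.A V t x (ustar t x) = 0
  admissible : ∀ x, ∃ X, D.Admissible P w p 0 x (feedback ustar X) X

/-! #### Anticipating controls -/

/-- `u ∈ 𝒰(0)` is a measurable, possibly anticipating control, and `X` is a state process for it
with initial state `x`, that is, a solution of the Stratonovich equation
`X_t = x + ∫₀ᵗ b̄(s, X_s, u_s) ds + ∑ᵢ ∫₀ᵗ σⁱ(s, X_s) ∘ dwⁱ_s`. -/
structure IsAnticipatingPair (x : E n) (u : ℝ → Ω → E d) (X : ℝ → Ω → E n) : Prop where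
  measurable_u : JointlyMeasurableOn (augFiltration w P D.T) 0 D.T u
  mem : ∀ t ∈ Icc 0 D.T, ∀ ω, u t ω ∈ D.U
  measurable_X : JointlyMeasurableOn (augFiltration w P D.T) 0 D.T X
  continuous : ∀ᵐ ω ∂P, ContinuousOn (fun t => X t ω) (Icc 0 D.T)
  integrable : ∀ᵐ ω ∂P, IntegrableOn (fun s => D.bbar s (X s ω) (u s ω)) (Icc 0 D.T)
  stratonovich : ∀ t ∈ Icc 0 D.T, ∀ i,
    StratonovichIntegrable P (w i) (fun s ω => D.σ i s (X s ω)) 0 t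
  equation : ∀ t ∈ Icc 0 D.T, ∀ᵐ ω ∂P,
    X t ω = x + (∫ s in (0 : ℝ)..t, D.bbar s (X s ω) (u s ω))
      + ∑ i, stratonovichIntegral P (w i) (fun s ω => D.σ i s (X s ω)) 0 t ω

/-- The integrand `V_x(t, X_t)ᵀ σⁱ(t, X_t)`. -/
noncomputable def integrand (V : ℝ → E n → ℝ) (X : ℝ → Ω → E n) (i : Fin m) (t : ℝ) (ω : Ω) : ℝ :=
  inner ℝ (grad V t (X t ω)) (D.σ i t (X t ω))

/-- The Itô formula for the Stratonovich integral is valid for `V(t, X_t)` on `[0, T]` (in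
particular, all the integrals in it exist). -/
structure StratonovichItoFormula (V : ℝ → E n → ℝ) (u : ℝ → Ω → E d) (X : ℝ → Ω → E n) : Prop where
  integrable : ∀ᵐ ω ∂P, IntegrableOn
    (fun s => D.dt V s (X s ω) + inner ℝ (grad V s (X s ω)) (D.bbar s (X s ω) (u s ω)))
    (Icc 0 D.T)
  stratonovich : ∀ t ∈ Icc 0 D.T, ∀ i, StratonovichIntegrable P (w i) (D.integrand V X i) 0 t
  formula : ∀ t ∈ Icc 0 D.T, ∀ᵐ ω ∂P,
    V t (X t ω) = V 0 (X 0 ω)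
      + (∫ s in (0 : ℝ)..t,
          (D.dt V s (X s ω) + inner ℝ (grad V s (X s ω)) (D.bbar s (X s ω) (u s ω))))
      + ∑ i, stratonovichIntegral P (w i) (D.integrand V X i) 0 t ω

/-- The integrand `V_xᵀ (∑ᵢ σⁱ_x σⁱ) + tr(V_xx σσᵀ)` of the correction term. -/
noncomputable def correction (V : ℝ → E n → ℝ) (X : ℝ → Ω → E n) (t : ℝ) (ω : Ω) : ℝ :=
  inner ℝ (grad V t (X t ω)) (D.σσx t (X t ω)) + D.traceTerm V t (X t ω)

/-- The value function-based penalty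
`h = ∑ᵢ ∫₀ᵀ [V_xᵀ σⁱ] ∘ dwⁱ - ½ ∫₀ᵀ [V_xᵀ (∑ᵢ σⁱ_x σⁱ) + tr(V_xx σσᵀ)] dt`
(it depends on the control only through the state process `X`). -/
noncomputable def valuePenalty (V : ℝ → E n → ℝ) (_u : ℝ → Ω → E d) (X : ℝ → Ω → E n) (ω : Ω) :
    ℝ :=
  (∑ i, stratonovichIntegral P (w i) (D.integrand V X i) 0 D.T ω)
    - 1 / 2 * ∫ t in (0 : ℝ)..D.T, D.correction V X t ω

/-- `h` is a dual feasible penalty: `E[h] ≤ 0` for every initial state and every admissible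
strategy at time `0`. -/
def DualFeasible (p : ℝ) (h : (ℝ → Ω → E d) → (ℝ → Ω → E n) → Ω → ℝ) : Prop :=
  ∀ x u X, D.Admissible P w p 0 x u X → Integrable (h u X) P ∧ ∫ ω, h u X ω ∂P ≤ 0

open Classical in
/-- The objective `Λ(X_T) + ∫₀ᵀ g(t, X_t, u_t) dt - h` of the inner problem, with value `-∞` where
the running reward is not integrable in time. -/
noncomputable def innerObjective (h : (ℝ → Ω → E d) → (ℝ → Ω → E n) → Ω → ℝ)
    (u : ℝ → Ω → E d) (X : ℝ → Ω → E n) (ω : Ω) : EReal :=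
  if IntegrableOn (fun t => D.g t (X t ω) (u t ω)) (Icc 0 D.T) then
    ((D.Λ (X D.T ω) + (∫ t in (0 : ℝ)..D.T, D.g t (X t ω) (u t ω)) - h u X ω : ℝ) : EReal)
  else ⊥

/-- The objectives of the inner problem over all the (possibly anticipating) controls. -/
def innerObjectives (h : (ℝ → Ω → E d) → (ℝ → Ω → E n) → Ω → ℝ) (x : E n) : Set (Ω → EReal) :=
  {Y | ∃ u X, D.IsAnticipatingPair P w x u X ∧ Y = D.innerObjective h u X}

end Processes

end ControlProblem

end ControlledDiffusion

open ControlledDiffusion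

set_option linter.unusedSectionVars false

/-! Along a state process `X` of a control `u`, let `N_t = V(t, X_t) - V(0, X_0) - ∫₀ᵗ A^u V ds`
(`valueIntegral`). The Stratonovich drift and half of the correction integrand add up to `A^u V`
(`A_eq`), so the assumed Stratonovich–Itô formula says that the penalty equals `N_T`, with no
adaptedness involved. The penalised objective is therefore `V(0, x) + ∫₀ᵀ (g + A^u V) dt`. The HJB
equation makes the integrand nonpositive for every control, anticipating or not, and zero along
`ustar`. Thus `V(0, x)` is an almost sure upper bound which `ustar` attains, provided that the
feedback strategy is one of the anticipating controls.

Two facts about adapted controls carry the rest.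

An Itô solution solves the Stratonovich equation (`Admissible.isAnticipatingPair`). A Stratonovich
sum multiplies the increment of `w` by the mean of the integrand over a cell, that is, by the
average over `θ ∈ [0, 1]` of its values at `t_j + θ (t_{j+1} - t_j)`. For fixed `θ`, a Taylor
expansion and second moments of products of increments give the Itô sum plus `θ` times the
covariation; averaging over `θ` produces the factor `1/2` (`IsItoProcess.stratonovich_sum_tendsto`).

For an admissible strategy, `N` is the stochastic integral of `V_xᵀσ`. Before `T` this is Itô's
formula (`IsItoProcess.ito_formula`). The derivatives of `V` need not extend to `T`, but `N` is
continuous on `[0, T]`, and a stochastic integral with bounded paths has finite quadratic variation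
up to `T` (`IsItoIntegralProcess.ae_sqDist_lt_top`); hence the integral over `[0, s]` approximates
the one over `[0, T]` (`IsItoIntegralProcess.isItoIntegral`). By the HJB inequality `N_t ≥ V(t, X_t)
- V(0, x) + ∫₀ᵗ g ds`, which is bounded below by an integrable variable, so stopped integrals of
mean zero and Fatou's lemma give `E N_T ≤ 0` (`integrable_and_integral_nonpos`). If `‖V_xᵀσ‖` has
growth of order `p`, the integrand is dominated by an integrable `Z`; stopping at level `k` gives
mean zero approximations with second moment at most `k T E Z`, and balancing this against `k P(Z >
k) → 0` gives `E N_T = 0` (`integral_eq_zero`).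

The stochastic calculus itself rests on step processes: orthogonality of martingale differences
gives the isometry, stopping gives Lenglart's inequality, and `ItoLim` is the resulting closure in
probability. Estimates are made on events of large probability on which the paths are bounded and
have a common modulus of continuity. -/

namespace ControlledDiffusion

section MartingaleDifferences

variable {Ω : Type*} {mΩ : MeasurableSpace Ω} {P : Measure Ω}

/-! ### Martingale differences -/

/-- `d` is a square integrable `ℋ`-measurable random variable that is orthogonal to every
`𝒢`-measurable one. -/
structure IsMDiff {Ω : Type*} {mΩ : MeasurableSpace Ω} (P : Measure Ω) (𝒢 ℋ : MeasurableSpace Ω)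
    (d : Ω → ℝ) : Prop where
  meas : StronglyMeasurable[ℋ] d
  memLp : MemLp d 2 P
  orth : ∀ η : Ω → ℝ, StronglyMeasurable[𝒢] η → Integrable (fun ω => η ω * d ω) P →
    ∫ ω, η ω * d ω ∂P = 0

theorem IsMDiff.add [IsProbabilityMeasure P] {𝒢 ℋ : MeasurableSpace Ω} (h𝒢 : 𝒢 ≤ mΩ)
    {d e : Ω → ℝ} (hd : IsMDiff P 𝒢 ℋ d) (he : IsMDiff P 𝒢 ℋ e) :
    IsMDiff P 𝒢 ℋ (fun ω => d ω + e ω) where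
  meas := hd.meas.add he.meas
  memLp := hd.memLp.add he.memLp
  orth η hη hint := by
    -- Integrability of `η * (d + e)` says nothing about the two products separately. Hence `η` is
    -- truncated to `|η| ≤ n`, and dominated convergence removes the truncation.
    have key : ∀ n : ℕ, ∫ ω, {ω | |η ω| ≤ n}.indicator (fun ω => η ω * (d ω + e ω)) ω ∂P = 0 := by
      intro n
      have hA : MeasurableSet[𝒢] {ω | |η ω| ≤ n} :=
        hη.measurable (measurableSet_le (by fun_prop) (by fun_prop) :
          MeasurableSet {x : ℝ | |x| ≤ n})
      set η' := {ω | |η ω| ≤ n}.indicator η with hη'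
      have hm : StronglyMeasurable[𝒢] η' := hη.indicator hA
      have hb : ∀ ω, ‖η' ω‖ ≤ n := by
        intro ω
        simp only [hη', indicator]
        split_ifs with h
        · exact h
        · simp
      have i1 : Integrable (fun ω => η' ω * d ω) P :=
        (hd.memLp.integrable one_le_two).bdd_mul (hm.mono h𝒢).aestronglyMeasurable
          (Eventually.of_forall hb)
      have i2 : Integrable (fun ω => η' ω * e ω) P :=
        (he.memLp.integrable one_le_two).bdd_mul (hm.mono h𝒢).aestronglyMeasurable
          (Eventually.of_forall hb)
      have e1 : {ω | |η ω| ≤ n}.indicator (fun ω => η ω * (d ω + e ω))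
          = fun ω => η' ω * d ω + η' ω * e ω := by
        funext ω
        simp only [hη', indicator]
        split_ifs <;> ring
      rw [e1, integral_add i1 i2, hd.orth _ hm i1, he.orth _ hm i2, add_zero]
    have hlim : Tendsto (fun n : ℕ => ∫ ω, {ω | |η ω| ≤ n}.indicator
        (fun ω => η ω * (d ω + e ω)) ω ∂P) atTop (𝓝 (∫ ω, η ω * (d ω + e ω) ∂P)) := by
      refine tendsto_integral_of_dominated_convergence (fun ω => ‖η ω * (d ω + e ω)‖) ?_
        hint.norm ?_ ?_
      · intro n
        exact hint.1.indicator (h𝒢 _ (hη.measurable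
          (measurableSet_le (by fun_prop) (by fun_prop) : MeasurableSet {x : ℝ | |x| ≤ n})))
      · intro n
        exact Eventually.of_forall fun ω => norm_indicator_le_norm_self _ _
      · refine Eventually.of_forall fun ω => ?_
        refine tendsto_const_nhds.congr' ?_
        obtain ⟨N, hN⟩ := exists_nat_ge |η ω|
        filter_upwards [eventually_ge_atTop N] with n hn
        rw [indicator_of_mem]
        exact hN.trans (by exact_mod_cast hn)
    simp only [key] at hlim
    exact tendsto_nhds_unique hlim tendsto_const_nhds

theorem IsMDiff.zero {𝒢 ℋ : MeasurableSpace Ω} : IsMDiff P 𝒢 ℋ (fun _ => 0) where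
  meas := @stronglyMeasurable_const _ _ ℋ _ _
  memLp := MemLp.zero'
  orth := by simp

theorem IsMDiff.sum [IsProbabilityMeasure P] {𝒢 ℋ : MeasurableSpace Ω} (h𝒢 : 𝒢 ≤ mΩ)
    {ι : Type*} (s : Finset ι) {d : ι → Ω → ℝ} (hd : ∀ i ∈ s, IsMDiff P 𝒢 ℋ (d i)) :
    IsMDiff P 𝒢 ℋ (fun ω => ∑ i ∈ s, d i ω) := by
  classical
  induction s using Finset.induction_on with
  | empty => simpa using IsMDiff.zero
  | insert a s ha ih =>
    simp only [Finset.sum_insert ha]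
    exact (hd a (by simp)).add h𝒢 (ih fun i hi => hd i (by simp [hi]))

theorem IsMDiff.bdd_mul {𝒢 ℋ : MeasurableSpace Ω} (h𝒢 : 𝒢 ≤ ℋ)
    (hℋ : ℋ ≤ mΩ) {d ξ : Ω → ℝ} (hd : IsMDiff P 𝒢 ℋ d) (hξ : StronglyMeasurable[𝒢] ξ) {C : ℝ}
    (hC : ∀ ω, |ξ ω| ≤ C) : IsMDiff P 𝒢 ℋ (fun ω => ξ ω * d ω) where
  meas := (hξ.mono h𝒢).mul hd.meas
  memLp := by
    refine MemLp.of_le_mul (c := C) hd.memLp ?_ (Eventually.of_forall fun ω => ?_)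
    · exact ((hξ.mono (h𝒢.trans hℋ)).aestronglyMeasurable).mul hd.memLp.1
    · rw [norm_mul]
      exact mul_le_mul_of_nonneg_right (hC ω) (norm_nonneg _)
  orth η hη hint := by
    have h := hd.orth (fun ω => η ω * ξ ω) (hη.mul hξ) (by simpa [mul_assoc] using hint)
    simpa [mul_assoc] using h

theorem IsMDiff.mono {𝒢 𝒢' ℋ ℋ' : MeasurableSpace Ω} (h𝒢 : 𝒢' ≤ 𝒢) (hℋ : ℋ ≤ ℋ') {d : Ω → ℝ}
    (hd : IsMDiff P 𝒢 ℋ d) : IsMDiff P 𝒢' ℋ' d where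
  meas := hd.meas.mono hℋ
  memLp := hd.memLp
  orth η hη hint := hd.orth η (hη.mono h𝒢) hint

theorem IsMDiff.integral_eq_zero [IsProbabilityMeasure P] {𝒢 ℋ : MeasurableSpace Ω} {d : Ω → ℝ}
    (hd : IsMDiff P 𝒢 ℋ d) : ∫ ω, d ω ∂P = 0 := by
  have h := hd.orth (fun _ => 1) (@stronglyMeasurable_const _ _ 𝒢 _ _)
    (by simpa using hd.memLp.integrable one_le_two)
  simpa using h

end MartingaleDifferences

/-! ### Brownian increments and the augmented filtration -/

section BrownianFiltration

variable {Ω : Type*} [mΩ : MeasurableSpace Ω] {m : ℕ}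
variable {w : Fin m → ℝ≥0 → Ω → ℝ} {P : Measure Ω}

/-- The increment `wⁱ_t - wⁱ_s`. -/
def dW (w : Fin m → ℝ≥0 → Ω → ℝ) (i : Fin m) (s t : ℝ) (ω : Ω) : ℝ :=
  w i t.toNNReal ω - w i s.toNNReal ω

/-- The natural filtration of `w`. -/
@[reducible]
def natPast (w : Fin m → ℝ≥0 → Ω → ℝ) (t : ℝ) : MeasurableSpace Ω :=
  ⨆ (i : Fin m) (s : ℝ≥0) (_ : (s : ℝ) ≤ t), MeasurableSpace.comap (w i s) inferInstance

theorem augFiltration_le (t : ℝ) : augFiltration w P t ≤ mΩ := inf_le_left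

theorem measurableSet_augFiltration_iff {t : ℝ} {A : Set Ω} :
    MeasurableSet[augFiltration w P t] A ↔
      MeasurableSet A ∧ ∃ B, MeasurableSet[natPast w t] B ∧ A =ᵐ[P] B :=
  MeasurableSpace.measurableSet_inf

theorem natPast_mono {s t : ℝ} (h : s ≤ t) : natPast w s ≤ natPast w t :=
  iSup_mono fun _ => iSup_mono fun _ => iSup_mono' fun hr => ⟨hr.trans h, le_rfl⟩

theorem augFiltration_mono {s t : ℝ} (h : s ≤ t) : augFiltration w P s ≤ augFiltration w P t := by
  intro A hA
  rw [measurableSet_augFiltration_iff] at hA ⊢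
  obtain ⟨h1, B, h2, h3⟩ := hA
  exact ⟨h1, B, natPast_mono h B h2, h3⟩

theorem natPast_le (hw : IsBrownianMotion w P) (t : ℝ) : natPast w t ≤ mΩ :=
  iSup_le fun i => iSup_le fun s => iSup_le fun _ => (hw.measurable i s).comap_le

theorem natPast_le_augFiltration (hw : IsBrownianMotion w P) (t : ℝ) :
    natPast w t ≤ augFiltration w P t := by
  intro A hA
  rw [measurableSet_augFiltration_iff]
  exact ⟨natPast_le hw t A hA, A, hA, EventuallyEq.rfl⟩

theorem stronglyMeasurable_eval (hw : IsBrownianMotion w P) (i : Fin m) {s t : ℝ} (ht : 0 ≤ t)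
    (hst : s ≤ t) : StronglyMeasurable[augFiltration w P t] (w i s.toNNReal) := by
  refine @Measurable.stronglyMeasurable _ _ (_) _ _ _ _ _ _ ?_
  have h : ((s.toNNReal : ℝ≥0) : ℝ) ≤ t := by
    rw [Real.coe_toNNReal']; exact max_le hst ht
  refine Measurable.mono (comap_measurable (w i s.toNNReal)) ?_ le_rfl
  refine le_trans ?_ (natPast_le_augFiltration hw t)
  exact le_iSup_of_le i (le_iSup_of_le s.toNNReal (le_iSup_of_le h le_rfl))

theorem stronglyMeasurable_dW (hw : IsBrownianMotion w P) (i : Fin m) {r s t : ℝ} (ht : 0 ≤ t)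
    (hr : r ≤ t) (hs : s ≤ t) : StronglyMeasurable[augFiltration w P t] (dW w i r s) :=
  (stronglyMeasurable_eval hw i ht hs).sub (stronglyMeasurable_eval hw i ht hr)

theorem measurable_dW (hw : IsBrownianMotion w P) (i : Fin m) (s t : ℝ) :
    Measurable (dW w i s t) :=
  (hw.measurable i _).sub (hw.measurable i _)

/-- The σ-algebra of the increments after time `s`. -/
@[reducible]
def futureIncr (w : Fin m → ℝ≥0 → Ω → ℝ) (i : Fin m) (s : ℝ≥0) : MeasurableSpace Ω :=
  MeasurableSpace.comap (fun ω (r : ℝ≥0) => w i (s + r) ω - w i s ω) inferInstance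

/-- The family of the pasts and futures of the coordinates is independent. -/
theorem iIndep_past_future [IsProbabilityMeasure P] (hw : IsBrownianMotion w P) (s : ℝ≥0) :
    iIndep (fun q : Fin m × Bool => bif q.2 then
      MeasurableSpace.comap (fun ω (t : Set.Iic s) => w q.1 t ω) inferInstance
      else futureIncr w q.1 s) P := by
  classical
  rw [iIndep_iff]
  intro S f hf
  -- Missing indices are filled with `univ`, so that the past and the future of each coordinate
  -- always occur as a pair.
  set g : Fin m × Bool → Set Ω := fun q => if q ∈ S then f q else univ with hg
  have hgm : ∀ q : Fin m × Bool, MeasurableSet[bif q.2 then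
      MeasurableSpace.comap (fun ω (t : Set.Iic s) => w q.1 t ω) inferInstance
      else futureIncr w q.1 s] (g q) := by
    intro q
    by_cases hq : q ∈ S
    · simpa [hg, hq] using hf q hq
    · simp [hg, hq]
  have h1 : ⋂ q ∈ S, f q = ⋂ i, (g (i, true) ∩ g (i, false)) := by
    ext ω
    simp only [mem_iInter, mem_inter_iff]
    constructor
    · intro h i
      constructor <;>
      · simp only [hg]
        split_ifs with h'
        · exact h _ h'
        · trivial
    · rintro h ⟨i, b⟩ hq
      have := h i
      cases b
      · simpa [hg, hq] using this.2
      · simpa [hg, hq] using this.1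
  have h2 : ∏ q ∈ S, P (f q) = ∏ i, (P (g (i, true)) * P (g (i, false))) := by
    have : ∏ q ∈ S, P (f q) = ∏ q, P (g q) := by
      rw [← Finset.prod_subset (Finset.subset_univ S)]
      · exact Finset.prod_congr rfl fun q hq => by simp [hg, hq]
      · intro q _ hq
        simp [hg, hq]
    rw [this, Fintype.prod_prod_type]
    exact Finset.prod_congr rfl fun i _ => by simp
  rw [h1, h2]
  have hpath : iIndep (fun i => MeasurableSpace.comap (fun ω (t : ℝ≥0) => w i t ω)
      inferInstance) P := hw.indep.iIndep
  have hsub : ∀ i, MeasurableSet[MeasurableSpace.comap (fun ω (t : ℝ≥0) => w i t ω)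
      inferInstance] (g (i, true) ∩ g (i, false)) := by
    intro i
    refine MeasurableSet.inter ?_ ?_
    · have : MeasurableSet[MeasurableSpace.comap (fun ω (t : Set.Iic s) => w i t ω)
        inferInstance] (g (i, true)) := hgm (i, true)
      obtain ⟨A, hA, hA'⟩ := this
      refine ⟨(fun x : ℝ≥0 → ℝ => fun t : Set.Iic s => x t) ⁻¹' A, ?_, ?_⟩
      · exact (measurable_pi_lambda _ fun t => measurable_pi_apply _) hA
      · rw [← hA']; rfl
    · have : MeasurableSet[futureIncr w i s] (g (i, false)) := hgm (i, false)
      obtain ⟨A, hA, hA'⟩ := this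
      refine ⟨(fun x : ℝ≥0 → ℝ => fun r : ℝ≥0 => x (s + r) - x s) ⁻¹' A, ?_, ?_⟩
      · exact (measurable_pi_lambda (fun (x : ℝ≥0 → ℝ) (r : ℝ≥0) => x (s + r) - x s) fun t =>
          (measurable_pi_apply _).sub (measurable_pi_apply _)) hA
      · rw [← hA']; rfl
  rw [hpath.meas_iInter hsub]
  refine Finset.prod_congr rfl fun i _ => ?_
  -- Different coordinates have been separated; within one coordinate the shifted path is
  -- independent of the past.
  have h3 := (hw.brownian i).toIsPreBrownianReal.indepFun_shift s
  rw [IndepFun_iff_Indep, Indep_iff] at h3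
  have a : MeasurableSet[MeasurableSpace.comap (fun ω (t : Set.Iic s) => w i t ω)
        inferInstance] (g (i, true)) := hgm (i, true)
  have b : MeasurableSet[futureIncr w i s] (g (i, false)) := hgm (i, false)
  rw [inter_comm, h3 _ _ b a, mul_comm]

theorem natPast_le_iSup_past (s : ℝ≥0) : natPast w s ≤ ⨆ i, MeasurableSpace.comap
    (fun ω (t : Set.Iic s) => w i t ω) inferInstance := by
  refine iSup_le fun i => iSup_le fun r => iSup_le fun hr => le_iSup_of_le i ?_
  have hr' : r ∈ Set.Iic s := by exact_mod_cast hr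
  rintro _ ⟨A, hA, rfl⟩
  exact ⟨(fun x : Set.Iic s → ℝ => x ⟨r, hr'⟩) ⁻¹' A, measurable_pi_apply _ hA, rfl⟩

/-- Regrouping the independent family separates all pasts from all futures. The augmentation changes
events of the past by null sets only, which leaves the product formula intact. -/
theorem indep_augFiltration_future [IsProbabilityMeasure P] (hw : IsBrownianMotion w P)
    (s : ℝ≥0) : Indep (augFiltration w P s) (⨆ i, futureIncr w i s) P := by
  have hle : ∀ q : Fin m × Bool, (bif q.2 then
      MeasurableSpace.comap (fun ω (t : Set.Iic s) => w q.1 t ω) inferInstance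
      else futureIncr w q.1 s) ≤ mΩ := by
    rintro ⟨i, b⟩
    cases b
    · exact (measurable_pi_lambda _ fun r =>
        (hw.measurable i _).sub (hw.measurable i _)).comap_le
    · exact (measurable_pi_lambda _ fun r => hw.measurable i _).comap_le
  have h := indep_iSup_of_disjoint hle (iIndep_past_future hw s)
    (S := {q | q.2 = true}) (T := {q | q.2 = false})
    (Set.disjoint_left.2 fun q hq hq' => by simp_all)
  have h' : Indep (natPast w s) (⨆ i, futureIncr w i s) P := by
    refine indep_of_indep_of_le h ?_ ?_
    · refine (natPast_le_iSup_past s).trans (iSup_le fun i => ?_)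
      exact le_iSup₂_of_le (i, true) (by simp) le_rfl
    · refine iSup_le fun i => ?_
      exact le_iSup₂_of_le (i, false) (by simp) le_rfl
  rw [Indep_iff] at h' ⊢
  intro A B hA hB
  obtain ⟨-, A', hA', hAA⟩ := measurableSet_augFiltration_iff.1 hA
  rw [measure_congr (hAA.inter (EventuallyEq.refl _ B)), measure_congr hAA]
  exact h' A' B hA' hB

theorem measurable_dW_future (i : Fin m) {s r t : ℝ} (hsr : s ≤ r) (hrt : r ≤ t) :
    Measurable[futureIncr w i s.toNNReal] (dW w i r t) := by
  have h : dW w i r t = (fun x : ℝ≥0 → ℝ => x (t.toNNReal - s.toNNReal) -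
      x (r.toNNReal - s.toNNReal)) ∘ (fun ω (r : ℝ≥0) => w i (s.toNNReal + r) ω -
        w i s.toNNReal ω) := by
    funext ω
    have h1 : s.toNNReal + (t.toNNReal - s.toNNReal) = t.toNNReal :=
      add_tsub_cancel_of_le (Real.toNNReal_le_toNNReal (hsr.trans hrt))
    have h2 : s.toNNReal + (r.toNNReal - s.toNNReal) = r.toNNReal :=
      add_tsub_cancel_of_le (Real.toNNReal_le_toNNReal hsr)
    simp only [Function.comp_apply, h1, h2, dW]
    ring
  rw [h]
  have h0 : Measurable (fun x : ℝ≥0 → ℝ => x (t.toNNReal - s.toNNReal) -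
      x (r.toNNReal - s.toNNReal)) := (measurable_pi_apply _).sub (measurable_pi_apply _)
  exact h0.comp (comap_measurable _)

/-- Increments of all the coordinates after time `s` are independent of the past. -/
theorem indepFun_of_measurable_future [IsProbabilityMeasure P] (hw : IsBrownianMotion w P) {s : ℝ}
    (hs : 0 ≤ s) {η d : Ω → ℝ} (hη : Measurable[augFiltration w P s] η)
    (hd : Measurable[⨆ i, futureIncr w i s.toNNReal] d) : IndepFun η d P := by
  have h := indep_augFiltration_future hw s.toNNReal
  rw [Real.coe_toNNReal _ hs] at h
  rw [IndepFun_iff_Indep]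
  exact indep_of_indep_of_le h hη.comap_le hd.comap_le

theorem indepFun_dW_of_ne (hw : IsBrownianMotion w P) {i k : Fin m} (hik : i ≠ k)
    (s t s' t' : ℝ) : IndepFun (dW w i s t) (dW w k s' t') P :=
  (hw.indep.indepFun hik).comp
    (φ := fun x : ℝ≥0 → ℝ => x t.toNNReal - x s.toNNReal)
    (ψ := fun x : ℝ≥0 → ℝ => x t'.toNNReal - x s'.toNNReal)
    ((measurable_pi_apply _).sub (measurable_pi_apply _))
    ((measurable_pi_apply _).sub (measurable_pi_apply _))

theorem hasLaw_dW (hw : IsBrownianMotion w P) (i : Fin m) {s t : ℝ} (hs : 0 ≤ s) (hst : s ≤ t) :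
    HasLaw (dW w i s t) (gaussianReal 0 (t - s).toNNReal) P := by
  have h := (hw.brownian i).toIsPreBrownianReal.hasLaw_sub t.toNNReal s.toNNReal
  have e : nndist (t.toNNReal : ℝ) (s.toNNReal : ℝ) = (t - s).toNNReal := by
    rw [Real.coe_toNNReal _ hs, Real.coe_toNNReal _ (hs.trans hst)]
    apply NNReal.coe_injective
    rw [coe_nndist, Real.dist_eq, Real.coe_toNNReal _ (sub_nonneg.2 hst),
      abs_of_nonneg (sub_nonneg.2 hst)]
  have h' : HasLaw (w i t.toNNReal - w i s.toNNReal)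
      (gaussianReal 0 (nndist (t.toNNReal : ℝ) (s.toNNReal : ℝ))) P := h
  rw [e] at h'
  exact h'

theorem memLp_dW (hw : IsBrownianMotion w P) (i : Fin m) {s t : ℝ} (hs : 0 ≤ s) (hst : s ≤ t)
    (q : ℝ≥0) : MemLp (dW w i s t) q P := by
  have h := hasLaw_dW hw i hs hst
  have h2 : MemLp id q (P.map (dW w i s t)) := by
    rw [h.map_eq]; exact memLp_id_gaussianReal q
  exact (memLp_map_measure_iff (by fun_prop) h.aemeasurable).1 h2

theorem integral_dW (hw : IsBrownianMotion w P) (i : Fin m) {s t : ℝ} (hs : 0 ≤ s) (hst : s ≤ t) :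
    ∫ ω, dW w i s t ω ∂P = 0 := by
  rw [(hasLaw_dW hw i hs hst).integral_eq, integral_id_gaussianReal]

theorem integral_dW_sq (hw : IsBrownianMotion w P) (i : Fin m) {s t : ℝ} (hs : 0 ≤ s)
    (hst : s ≤ t) : ∫ ω, dW w i s t ω ^ 2 ∂P = t - s := by
  have h := hasLaw_dW hw i hs hst
  have h1 := h.integral_comp (f := fun x : ℝ => x ^ 2) (by fun_prop)
  have h2 : ∫ x, x ^ 2 ∂(gaussianReal 0 (t - s).toNNReal) = t - s := by
    have h3 := variance_fun_id_gaussianReal (μ := 0) (v := (t - s).toNNReal)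
    rw [variance_eq_integral (by fun_prop)] at h3
    simpa [hst] using h3
  rw [← h2, ← h1]
  rfl

/-- The fourth moment of the standard normal distribution. -/
noncomputable def κ₄ : ℝ := ∫ x, x ^ 4 ∂(gaussianReal 0 1)

theorem κ₄_nonneg : 0 ≤ κ₄ := integral_nonneg fun x => by positivity

theorem integral_dW_pow_four (hw : IsBrownianMotion w P) (i : Fin m) {s t : ℝ} (hs : 0 ≤ s)
    (hst : s ≤ t) : ∫ ω, dW w i s t ω ^ 4 ∂P = κ₄ * (t - s) ^ 2 := by
  have h := hasLaw_dW hw i hs hst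
  have h1 := h.integral_comp (f := fun x : ℝ => x ^ 4) (by fun_prop)
  have h2 : ∫ x, x ^ 4 ∂(gaussianReal 0 (t - s).toNNReal) = κ₄ * (t - s) ^ 2 := by
    -- `N(0, t - s)` is the image of `N(0, 1)` under multiplication by `√(t - s)`. The numerical
    -- value of `κ₄` never matters.
    have h3 := gaussianReal_map_const_mul (μ := 0) (v := 1) (√(t - s))
    have h4 : (NNReal.mk (√(t - s) ^ 2) (sq_nonneg _) : ℝ≥0) * 1 = (t - s).toNNReal := by
      apply NNReal.coe_injective
      rw [mul_one, Real.coe_toNNReal _ (sub_nonneg.2 hst)]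
      exact Real.sq_sqrt (sub_nonneg.2 hst)
    rw [h4, mul_zero] at h3
    rw [← h3, integral_map (by fun_prop) (by fun_prop), κ₄, ← integral_mul_const]
    refine integral_congr_ae (Eventually.of_forall fun x => ?_)
    have : √(t - s) ^ 4 = (t - s) ^ 2 := by
      rw [show 4 = 2 * 2 from rfl, pow_mul, Real.sq_sqrt (sub_nonneg.2 hst)]
    simp only
    rw [mul_pow, this, mul_comm]
  rw [← h2, ← h1]
  rfl

/-- A centred square integrable random variable that depends on the increments after `s`. -/
theorem isMDiff_of_future [IsProbabilityMeasure P] (hw : IsBrownianMotion w P) {s t : ℝ}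
    (hs : 0 ≤ s) {d : Ω → ℝ} (hd : StronglyMeasurable[augFiltration w P t] d)
    (hd' : Measurable[⨆ i, futureIncr w i s.toNNReal] d) (h2 : MemLp d 2 P)
    (h0 : ∫ ω, d ω ∂P = 0) : IsMDiff P (augFiltration w P s) (augFiltration w P t) d where
  meas := hd
  memLp := h2
  orth η hη _ := by
    have hi := indepFun_of_measurable_future hw hs hη.measurable hd'
    rw [hi.integral_fun_mul_eq_mul_integral (hη.mono (augFiltration_le s)).aestronglyMeasurable
      h2.1, h0, mul_zero]

theorem futureIncr_le_iSup (i : Fin m) (s : ℝ≥0) : futureIncr w i s ≤ ⨆ i, futureIncr w i s :=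
  le_iSup (fun i => futureIncr w i s) i

theorem isMDiff_dW [IsProbabilityMeasure P] (hw : IsBrownianMotion w P) (i : Fin m) {s t : ℝ}
    (hs : 0 ≤ s) (hst : s ≤ t) :
    IsMDiff P (augFiltration w P s) (augFiltration w P t) (dW w i s t) :=
  isMDiff_of_future hw hs (stronglyMeasurable_dW hw i (hs.trans hst) hst le_rfl)
    ((measurable_dW_future i le_rfl hst).mono (futureIncr_le_iSup i _) le_rfl)
    (memLp_dW hw i hs hst 2) (integral_dW hw i hs hst)

theorem memLp_dW_mul (hw : IsBrownianMotion w P) (i k : Fin m) {s t s' t' : ℝ}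
    (hs : 0 ≤ s) (hst : s ≤ t) (hs' : 0 ≤ s') (hst' : s' ≤ t') :
    MemLp (fun ω => dW w i s t ω * dW w k s' t' ω) 2 P := by
  have : ENNReal.HolderTriple 4 4 2 := ⟨by
    rw [← two_mul, show (4 : ℝ≥0∞) = 2 * 2 by norm_num, ENNReal.mul_inv (by simp) (by simp),
      ← mul_assoc, ENNReal.mul_inv_cancel (by simp) (by simp), one_mul]⟩
  exact MemLp.mul' (p := 4) (q := 4) (memLp_dW hw k hs' hst' 4) (memLp_dW hw i hs hst 4)

theorem integral_dW_mul (hw : IsBrownianMotion w P) (i k : Fin m) {s t : ℝ}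
    (hs : 0 ≤ s) (hst : s ≤ t) :
    ∫ ω, dW w i s t ω * dW w k s t ω ∂P = if i = k then t - s else 0 := by
  split_ifs with h
  · subst h
    rw [← integral_dW_sq hw i hs hst]
    simp [sq]
  · rw [(indepFun_dW_of_ne hw h s t s t).integral_fun_mul_eq_mul_integral
      (measurable_dW hw i s t).aestronglyMeasurable (measurable_dW hw k s t).aestronglyMeasurable,
      integral_dW hw i hs hst, zero_mul]

/-- A product of two increments is its mean plus a variable orthogonal to the past. This is the
source of the Itô isometry and of the second order term in Itô's formula. -/
theorem isMDiff_dW_mul [IsProbabilityMeasure P] (hw : IsBrownianMotion w P) (i k : Fin m)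
    {s t : ℝ} (hs : 0 ≤ s) (hst : s ≤ t) :
    IsMDiff P (augFiltration w P s) (augFiltration w P t)
      (fun ω => dW w i s t ω * dW w k s t ω - if i = k then t - s else 0) := by
  have hm : ∀ i : Fin m, Measurable[⨆ i, futureIncr w i s.toNNReal] (dW w i s t) := fun i =>
    (measurable_dW_future i le_rfl hst).mono (futureIncr_le_iSup i _) le_rfl
  have h2 := memLp_dW_mul hw i k hs hst hs hst
  refine isMDiff_of_future hw hs ?_ (((hm i).mul (hm k)).sub_const _) ?_ ?_
  · exact ((stronglyMeasurable_dW hw i (hs.trans hst) hst le_rfl).mul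
      (stronglyMeasurable_dW hw k (hs.trans hst) hst le_rfl)).sub
      (@stronglyMeasurable_const _ _ (_) _ _)
  · exact h2.sub (memLp_const _)
  · rw [integral_sub (h2.integrable one_le_two) (integrable_const _),
      integral_dW_mul hw i k hs hst]
    simp

end BrownianFiltration

/-! ### Chebyshev's inequality and orthogonality of martingale differences -/

section MartingaleDifferences

variable {Ω : Type*} {mΩ : MeasurableSpace Ω} {P : Measure Ω}

theorem measure_le_abs_le_of_memLp {f : Ω → ℝ} (hf : MemLp f 2 P) {ε c : ℝ} (hε : 0 < ε)
    (hc : ∫ ω, f ω ^ 2 ∂P ≤ c) :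
    P {ω | ε ≤ |f ω|} ≤ ENNReal.ofReal (c / ε ^ 2) := by
  have h1 : {ω | ε ≤ |f ω|} ⊆ {ω | ENNReal.ofReal (ε ^ 2) ≤ ENNReal.ofReal (f ω ^ 2)} := by
    intro ω hω
    simp only [mem_ofPred_eq] at hω ⊢
    apply ENNReal.ofReal_le_ofReal
    rw [← sq_abs (f ω)]
    exact pow_le_pow_left₀ hε.le hω 2
  have h2 : AEMeasurable (fun ω => ENNReal.ofReal (f ω ^ 2)) P :=
    (hf.1.aemeasurable.pow_const 2).ennreal_ofReal
  have hε' : ENNReal.ofReal (ε ^ 2) ≠ 0 := by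
    simp [hε.ne']
  calc P {ω | ε ≤ |f ω|} ≤ P {ω | ENNReal.ofReal (ε ^ 2) ≤ ENNReal.ofReal (f ω ^ 2)} :=
        measure_mono h1
    _ ≤ (∫⁻ ω, ENNReal.ofReal (f ω ^ 2) ∂P) / ENNReal.ofReal (ε ^ 2) :=
        meas_ge_le_lintegral_div h2 hε' ENNReal.ofReal_ne_top
    _ = ENNReal.ofReal (∫ ω, f ω ^ 2 ∂P) / ENNReal.ofReal (ε ^ 2) := by
        rw [ofReal_integral_eq_lintegral_ofReal hf.integrable_sq
          (Eventually.of_forall fun ω => sq_nonneg _)]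
    _ ≤ ENNReal.ofReal c / ENNReal.ofReal (ε ^ 2) := by
        gcongr
    _ = ENNReal.ofReal (c / ε ^ 2) := (ENNReal.ofReal_div_of_pos (by positivity)).symm

theorem stronglyMeasurable_sum_of_isMDiff {𝒢 : ℕ → MeasurableSpace Ω} (hmono : Monotone 𝒢)
    {d : ℕ → Ω → ℝ} (N : ℕ) (hd : ∀ j < N, IsMDiff P (𝒢 j) (𝒢 (j + 1)) (d j)) :
    StronglyMeasurable[𝒢 N] (fun ω => ∑ j ∈ Finset.range N, d j ω) := by
  refine Finset.stronglyMeasurable_fun_sum _ fun j hj => ?_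
  have hj' := Finset.mem_range.1 hj
  exact (hd j hj').meas.mono (hmono hj')

theorem memLp_sum_of_isMDiff {𝒢 : ℕ → MeasurableSpace Ω}
    {d : ℕ → Ω → ℝ} (N : ℕ) (hd : ∀ j < N, IsMDiff P (𝒢 j) (𝒢 (j + 1)) (d j)) :
    MemLp (fun ω => ∑ j ∈ Finset.range N, d j ω) 2 P :=
  memLp_finsetSum _ fun j hj => (hd j (Finset.mem_range.1 hj)).memLp

/-- Martingale differences are orthogonal. -/
theorem integral_sum_sq_of_isMDiff {𝒢 : ℕ → MeasurableSpace Ω} (hmono : Monotone 𝒢)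
    {d : ℕ → Ω → ℝ} (N : ℕ) (hd : ∀ j < N, IsMDiff P (𝒢 j) (𝒢 (j + 1)) (d j)) :
    ∫ ω, (∑ j ∈ Finset.range N, d j ω) ^ 2 ∂P = ∑ j ∈ Finset.range N, ∫ ω, d j ω ^ 2 ∂P := by
  induction N with
  | zero => simp
  | succ N ih =>
    have hd' : ∀ j < N, IsMDiff P (𝒢 j) (𝒢 (j + 1)) (d j) := fun j hj => hd j (hj.trans (by simp))
    have hS := memLp_sum_of_isMDiff N hd'
    have hN := (hd N (by simp)).memLp
    have hint : Integrable (fun ω => (∑ j ∈ Finset.range N, d j ω) * d N ω) P :=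
      hS.integrable_mul hN
    -- The test variable is a partial sum and is unbounded; for this reason `orth` admits every
    -- measurable test variable whose product with `d` is integrable.
    have h0 := (hd N (by simp)).orth _ (stronglyMeasurable_sum_of_isMDiff hmono N hd') hint
    rw [Finset.sum_range_succ, ← ih hd']
    have e : ∀ ω, (∑ j ∈ Finset.range (N + 1), d j ω) ^ 2 =
        ((∑ j ∈ Finset.range N, d j ω) ^ 2 + d N ω ^ 2)
          + 2 * ((∑ j ∈ Finset.range N, d j ω) * d N ω) := by
      intro ω
      rw [Finset.sum_range_succ]
      ring
    have a1 := hS.integrable_sq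
    have a2 := hN.integrable_sq
    have a3 : Integrable (fun ω => (∑ j ∈ Finset.range N, d j ω) ^ 2 + d N ω ^ 2) P := a1.add a2
    simp_rw [e]
    rw [integral_add a3 (hint.const_mul 2), integral_add a1 a2, integral_const_mul, h0]
    ring

end MartingaleDifferences

/-! ### Step processes, the Itô isometry and Lenglart's inequality -/

section ElementaryProcesses

variable {Ω : Type*} [mΩ : MeasurableSpace Ω] {m : ℕ}
variable {w : Fin m → ℝ≥0 → Ω → ℝ} {P : Measure Ω}

/-- Real valued step processes with nodes `t 0 ≤ t 1 ≤ ⋯ ≤ t N`. -/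
structure Elementary (w : Fin m → ℝ≥0 → Ω → ℝ) (P : Measure Ω) where
  N : ℕ
  t : ℕ → ℝ
  mono : Monotone t
  nonneg : 0 ≤ t 0
  ξ : ℕ → Fin m → Ω → ℝ
  adapted : ∀ j i, StronglyMeasurable[augFiltration w P (t j)] (ξ j i)
  bounded : ∃ C : ℝ, ∀ j i ω, |ξ j i ω| ≤ C

namespace Elementary

/-- The value of the step process. -/
noncomputable def val (S : Elementary w P) (i : Fin m) (r : ℝ) (ω : Ω) : ℝ :=
  ∑ j ∈ Finset.range S.N, (Ioc (S.t j) (S.t (j + 1))).indicator (fun _ => S.ξ j i ω) r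

/-- The increment of the stochastic integral. -/
def incr (S : Elementary w P) (j : ℕ) (ω : Ω) : ℝ :=
  ∑ i, S.ξ j i ω * dW w i (S.t j) (S.t (j + 1)) ω

/-- The stochastic integral. -/
def int (S : Elementary w P) (ω : Ω) : ℝ := ∑ j ∈ Finset.range S.N, S.incr j ω

/-- The increment of the quadratic variation. -/
def qincr (S : Elementary w P) (j : ℕ) (ω : Ω) : ℝ :=
  ∑ i, S.ξ j i ω ^ 2 * (S.t (j + 1) - S.t j)

/-- The quadratic variation. -/
def quad (S : Elementary w P) (ω : Ω) : ℝ := ∑ j ∈ Finset.range S.N, S.qincr j ω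

theorem t_nonneg (S : Elementary w P) (j : ℕ) : 0 ≤ S.t j := S.nonneg.trans (S.mono (Nat.zero_le j))

theorem t_le (S : Elementary w P) (j : ℕ) : S.t j ≤ S.t (j + 1) := S.mono (Nat.le_succ j)

theorem qincr_nonneg (S : Elementary w P) (j : ℕ) (ω : Ω) : 0 ≤ S.qincr j ω :=
  Finset.sum_nonneg fun _ _ => mul_nonneg (sq_nonneg _) (sub_nonneg.2 (S.t_le j))

theorem filtration_mono (S : Elementary w P) : Monotone fun j => augFiltration w P (S.t j) :=
  fun _ _ h => augFiltration_mono (S.mono h)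

theorem measurable_ξ (S : Elementary w P) (j : ℕ) (i : Fin m) : Measurable (S.ξ j i) :=
  ((S.adapted j i).mono (augFiltration_le _)).measurable

theorem isMDiff_incr [IsProbabilityMeasure P] (hw : IsBrownianMotion w P) (S : Elementary w P)
    (j : ℕ) : IsMDiff P (augFiltration w P (S.t j)) (augFiltration w P (S.t (j + 1)))
      (S.incr j) := by
  obtain ⟨C, hC⟩ := S.bounded
  exact IsMDiff.sum (augFiltration_le _) _ fun i _ =>
    (isMDiff_dW hw i (S.t_nonneg j) (S.t_le j)).bdd_mul (augFiltration_mono (S.t_le j))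
      (augFiltration_le _) (S.adapted j i) (hC j i)

theorem integrable_qincr [IsProbabilityMeasure P] (S : Elementary w P) (j : ℕ) :
    Integrable (S.qincr j) P := by
  obtain ⟨C, hC⟩ := S.bounded
  refine integrable_finsetSum _ fun i _ => Integrable.mul_const ?_ _
  refine Integrable.of_bound ((S.measurable_ξ j i).pow_const 2).aestronglyMeasurable (C ^ 2)
    (Eventually.of_forall fun ω => ?_)
  rw [Real.norm_eq_abs, abs_pow]
  exact pow_le_pow_left₀ (abs_nonneg _) (hC j i ω) 2

/-- Expanding the square gives coefficients known at `t j` times products of increments. By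
`isMDiff_dW_mul` each product may be replaced by its mean, which is the step length on the diagonal
and zero off it. -/
theorem integral_incr_sq [IsProbabilityMeasure P] (hw : IsBrownianMotion w P)
    (S : Elementary w P) (j : ℕ) : ∫ ω, S.incr j ω ^ 2 ∂P = ∫ ω, S.qincr j ω ∂P := by
  obtain ⟨C, hC⟩ := S.bounded
  have h0 : 0 ≤ S.t j := S.t_nonneg j
  have h1 := S.t_le j
  have hm : ∀ i k, StronglyMeasurable[augFiltration w P (S.t j)] (fun ω => S.ξ j i ω * S.ξ j k ω)
      := fun i k =>
    (S.adapted j i).mul (S.adapted j k)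
  have hb : ∀ i k, ∀ ω, ‖S.ξ j i ω * S.ξ j k ω‖ ≤ C * C := fun i k ω => by
    rw [norm_mul]
    exact mul_le_mul (hC j i ω) (hC j k ω) (norm_nonneg _) ((abs_nonneg _).trans (hC j i ω))
  have hint : ∀ i k, Integrable (fun ω => S.ξ j i ω * S.ξ j k ω *
      (dW w i (S.t j) (S.t (j + 1)) ω * dW w k (S.t j) (S.t (j + 1)) ω)) P := fun i k =>
    ((memLp_dW_mul hw i k h0 h1 h0 h1).integrable one_le_two).bdd_mul
      ((hm i k).mono (augFiltration_le _)).aestronglyMeasurable (Eventually.of_forall (hb i k))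
  have hint1 : ∀ i k, Integrable (fun ω => S.ξ j i ω * S.ξ j k ω) P := fun i k =>
    Integrable.of_bound ((hm i k).mono (augFiltration_le _)).aestronglyMeasurable (C * C)
      (Eventually.of_forall (hb i k))
  have key : ∀ i k, ∫ ω, S.ξ j i ω * S.ξ j k ω *
      (dW w i (S.t j) (S.t (j + 1)) ω * dW w k (S.t j) (S.t (j + 1)) ω) ∂P =
      (∫ ω, S.ξ j i ω * S.ξ j k ω ∂P) * (if i = k then S.t (j + 1) - S.t j else 0) := by
    intro i k
    have h2 := (isMDiff_dW_mul hw i k h0 h1).orth _ (hm i k) (by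
      simp only [mul_sub]
      exact (hint i k).sub ((hint1 i k).mul_const _))
    simp only [mul_sub] at h2
    rw [integral_sub (hint i k) ((hint1 i k).mul_const _), integral_mul_const, sub_eq_zero] at h2
    exact h2
  have e1 : ∀ ω, S.incr j ω ^ 2 = ∑ i, ∑ k, S.ξ j i ω * S.ξ j k ω *
      (dW w i (S.t j) (S.t (j + 1)) ω * dW w k (S.t j) (S.t (j + 1)) ω) := by
    intro ω
    rw [incr, sq, Finset.sum_mul_sum]
    refine Finset.sum_congr rfl fun i _ => Finset.sum_congr rfl fun k _ => by ring
  simp_rw [e1]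
  rw [integral_finsetSum _ fun i _ => integrable_finsetSum _ fun k _ => hint i k]
  simp_rw [integral_finsetSum _ fun k _ => hint _ k, key]
  simp only [mul_ite, mul_zero, Finset.sum_ite_eq, Finset.mem_univ, if_true]
  unfold qincr
  rw [integral_finsetSum]
  · refine Finset.sum_congr rfl fun i _ => ?_
    rw [integral_mul_const]
    simp only [sq]
  · intro i _
    simpa only [sq] using (hint1 i i).mul_const _

theorem memLp_int [IsProbabilityMeasure P] (hw : IsBrownianMotion w P) (S : Elementary w P) :
    MemLp S.int 2 P :=
  memLp_sum_of_isMDiff (𝒢 := fun j => augFiltration w P (S.t j)) S.N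
    fun j _ => S.isMDiff_incr hw j

theorem integral_int [IsProbabilityMeasure P] (hw : IsBrownianMotion w P) (S : Elementary w P) :
    ∫ ω, S.int ω ∂P = 0 := by
  unfold int
  rw [integral_finsetSum _ fun j _ => ((S.isMDiff_incr hw j).memLp.integrable one_le_two)]
  exact Finset.sum_eq_zero fun j _ => (S.isMDiff_incr hw j).integral_eq_zero

theorem integrable_quad [IsProbabilityMeasure P] (S : Elementary w P) : Integrable S.quad P :=
  integrable_finsetSum _ fun j _ => S.integrable_qincr j

/-- The Itô isometry. -/
theorem integral_int_sq [IsProbabilityMeasure P] (hw : IsBrownianMotion w P)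
    (S : Elementary w P) : ∫ ω, S.int ω ^ 2 ∂P = ∫ ω, S.quad ω ∂P := by
  have h := integral_sum_sq_of_isMDiff S.filtration_mono S.N fun j _ => S.isMDiff_incr hw j
  unfold int quad
  rw [h, integral_finsetSum _ fun j _ => S.integrable_qincr j]
  exact Finset.sum_congr rfl fun j _ => S.integral_incr_sq hw j

/-- Stopping of a step process: the coefficients are multiplied by indicators of
adapted events. -/
noncomputable def stopAt (S : Elementary w P) (A : ℕ → Set Ω)
    (hA : ∀ j, MeasurableSet[augFiltration w P (S.t j)] (A j)) : Elementary w P where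
  N := S.N
  t := S.t
  mono := S.mono
  nonneg := S.nonneg
  ξ j i := (A j).indicator (S.ξ j i)
  adapted j i := (S.adapted j i).indicator (hA j)
  bounded := by
    obtain ⟨C, hC⟩ := S.bounded
    refine ⟨C, fun j i ω => ?_⟩
    simp only [indicator]
    split_ifs
    · exact hC j i ω
    · simpa using (abs_nonneg _).trans (hC j i ω)

theorem stopAt_incr (S : Elementary w P) (A : ℕ → Set Ω)
    (hA : ∀ j, MeasurableSet[augFiltration w P (S.t j)] (A j)) (j : ℕ) :
    (S.stopAt A hA).incr j = (A j).indicator (S.incr j) := by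
  funext ω
  simp only [incr, stopAt, indicator]
  split_ifs <;> simp

theorem stopAt_qincr (S : Elementary w P) (A : ℕ → Set Ω)
    (hA : ∀ j, MeasurableSet[augFiltration w P (S.t j)] (A j)) (j : ℕ) :
    (S.stopAt A hA).qincr j = (A j).indicator (S.qincr j) := by
  funext ω
  simp only [qincr, stopAt, indicator]
  split_ifs <;> simp

theorem measurable_qincr (S : Elementary w P) {j k : ℕ} (h : j ≤ k) :
    Measurable[augFiltration w P (S.t k)] (S.qincr j) := by
  refine @Finset.measurable_fun_sum _ _ _ _ _ _ (_) _ _ fun i _ => ?_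
  have := ((S.adapted j i).mono (S.filtration_mono h)).measurable
  exact (this.pow_const 2).mul_const _

/-- The events on which the quadratic variation up to the end of the `j`-th interval is
at most `δ`. -/
def quadLe (S : Elementary w P) (δ : ℝ) (j : ℕ) : Set Ω :=
  {ω | ∑ l ∈ Finset.range (j + 1), S.qincr l ω ≤ δ}

/-- The coefficient on the `j`-th interval is known at the left end `t j`, so the event looks one
interval ahead and is still adapted. Stopping by it therefore keeps the quadratic variation below
`δ` without overshoot. -/
theorem measurableSet_quadLe (S : Elementary w P) (δ : ℝ) (j : ℕ) :
    MeasurableSet[augFiltration w P (S.t j)] (S.quadLe δ j) := by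
  have h : Measurable[augFiltration w P (S.t j)] fun ω => ∑ l ∈ Finset.range (j + 1), S.qincr l ω :=
    @Finset.measurable_fun_sum _ _ _ _ _ _ (_) _ _ fun l hl =>
      S.measurable_qincr (Nat.lt_succ_iff.1 (Finset.mem_range.1 hl))
  exact h measurableSet_Iic

theorem sum_indicator_quadLe_le (S : Elementary w P) {δ : ℝ} (hδ : 0 ≤ δ) (N : ℕ) (ω : Ω) :
    ∑ j ∈ Finset.range N, (S.quadLe δ j).indicator (S.qincr j) ω ≤ δ := by
  induction N with
  | zero => simpa using hδ
  | succ N ih =>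
    rw [Finset.sum_range_succ]
    by_cases h : ω ∈ S.quadLe δ N
    · rw [indicator_of_mem h]
      have h' : ∑ l ∈ Finset.range (N + 1), S.qincr l ω ≤ δ := h
      rw [Finset.sum_range_succ] at h'
      refine le_trans ?_ h'
      gcongr with j
      exact indicator_le_self' (fun _ _ => S.qincr_nonneg j _) _
    · rw [indicator_of_notMem h, add_zero]
      exact ih

/-- Lenglart's inequality. -/
theorem measure_inter_le [IsProbabilityMeasure P] (hw : IsBrownianMotion w P)
    (S : Elementary w P) (A : Set Ω) {δ ε : ℝ} (hδ : 0 ≤ δ) (hε : 0 < ε) :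
    P (A ∩ {ω | ε ≤ |S.int ω|}) ≤ P (A ∩ {ω | δ < S.quad ω}) + ENNReal.ofReal (δ / ε ^ 2) := by
  -- The stopped process has second moment at most `δ` by the isometry, and it coincides with `S`
  -- wherever the full quadratic variation is at most `δ`.
  set S' := S.stopAt (S.quadLe δ) (S.measurableSet_quadLe δ) with hS'
  have h1 : ∫ ω, S'.int ω ^ 2 ∂P ≤ δ := by
    rw [S'.integral_int_sq hw]
    have : ∫ ω, S'.quad ω ∂P ≤ ∫ _, δ ∂P := by
      refine integral_mono S'.integrable_quad (integrable_const _) fun ω => ?_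
      have : S'.quad ω = ∑ j ∈ Finset.range S.N, (S.quadLe δ j).indicator (S.qincr j) ω := by
        unfold quad
        exact Finset.sum_congr rfl fun j _ => by rw [hS', stopAt_qincr]
      rw [this]
      exact S.sum_indicator_quadLe_le hδ _ ω
    simpa using this
  have h2 := measure_le_abs_le_of_memLp (S'.memLp_int hw) hε h1
  refine le_trans (measure_mono ?_) ((measure_union_le _ _).trans (add_le_add le_rfl h2))
  rintro ω ⟨hωA, hω⟩
  by_cases hq : δ < S.quad ω
  · exact Or.inl ⟨hωA, hq⟩
  · right
    have e : S'.int ω = S.int ω := by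
      unfold int
      refine Finset.sum_congr rfl fun j hj => ?_
      rw [hS', stopAt_incr, indicator_of_mem]
      refine le_trans ?_ (not_lt.1 hq)
      exact Finset.sum_le_sum_of_subset_of_nonneg
        (Finset.range_subset_range.2 (Finset.mem_range.1 hj)) fun l _ _ => S.qincr_nonneg l ω
    simp only [mem_ofPred_eq, e]
    exact hω

theorem val_of_mem (S : Elementary w P) {j : ℕ} (hj : j < S.N) {r : ℝ}
    (hr : r ∈ Ioc (S.t j) (S.t (j + 1))) (i : Fin m) (ω : Ω) : S.val i r ω = S.ξ j i ω := by
  unfold val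
  rw [Finset.sum_eq_single j]
  · rw [indicator_of_mem hr]
  · intro k _ hk
    rw [indicator_of_notMem]
    rintro ⟨h1, h2⟩
    rcases lt_or_gt_of_ne hk with h | h
    · exact absurd (h2.trans (S.mono h)) (not_le.2 hr.1)
    · exact absurd (hr.2.trans (S.mono h)) (not_le.2 h1)
  · intro h
    simp [hj] at h

theorem val_of_notMem (S : Elementary w P) {r : ℝ}
    (hr : r ∉ Ioc (S.t 0) (S.t S.N)) (i : Fin m) (ω : Ω) : S.val i r ω = 0 := by
  refine Finset.sum_eq_zero fun k hk => indicator_of_notMem ?_ _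
  rintro ⟨h1, h2⟩
  exact hr ⟨(S.mono (Nat.zero_le k)).trans_lt h1, h2.trans (S.mono (Finset.mem_range.1 hk))⟩

theorem exists_mem_Ioc {t : ℕ → ℝ} {N : ℕ} {r : ℝ} (hr : r ∈ Ioc (t 0) (t N)) :
    ∃ j < N, r ∈ Ioc (t j) (t (j + 1)) := by
  classical
  have hex : ∃ j, r ≤ t j := ⟨N, hr.2⟩
  have h1 := Nat.find_spec hex
  have h2 : Nat.find hex ≤ N := Nat.find_min' hex hr.2
  have h3 : Nat.find hex ≠ 0 := by
    intro h
    rw [h] at h1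
    exact absurd h1 (not_le.2 hr.1)
  obtain ⟨j, hj⟩ := Nat.exists_eq_succ_of_ne_zero h3
  refine ⟨j, by omega, ?_, by rw [← Nat.succ_eq_add_one, ← hj]; exact h1⟩
  exact not_le.1 (Nat.find_min hex (by omega))

theorem measurable_val (S : Elementary w P) (i : Fin m) (ω : Ω) :
    Measurable fun r => S.val i r ω :=
  Finset.measurable_fun_sum _ fun _ _ => measurable_const.indicator measurableSet_Ioc

theorem ofReal_quad_le (S : Elementary w P) (ω : Ω) :
    ENNReal.ofReal (S.quad ω) ≤ ∫⁻ r, ∑ i, ‖S.val i r ω‖ₑ ^ 2 := by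
  have hdisj : Set.PairwiseDisjoint (↑(Finset.range S.N))
      fun j => Ioc (S.t j) (S.t (j + 1)) := by
    intro j _ k _ hjk
    refine Set.disjoint_left.2 fun r hr hr' => ?_
    rcases lt_or_gt_of_ne hjk with h | h
    · exact absurd (hr.2.trans (S.mono h)) (not_le.2 hr'.1)
    · exact absurd (hr'.2.trans (S.mono h)) (not_le.2 hr.1)
  calc ENNReal.ofReal (S.quad ω)
      = ∑ j ∈ Finset.range S.N, ∫⁻ r in Ioc (S.t j) (S.t (j + 1)), ∑ i, ‖S.val i r ω‖ₑ ^ 2 := by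
        unfold quad
        rw [ENNReal.ofReal_sum_of_nonneg fun j _ => S.qincr_nonneg j ω]
        refine Finset.sum_congr rfl fun j hj => ?_
        rw [setLIntegral_congr_fun (g := fun _ => ∑ i, ‖S.ξ j i ω‖ₑ ^ 2) measurableSet_Ioc]
        · rw [lintegral_const, Measure.restrict_apply_univ, Real.volume_Ioc, qincr,
            ENNReal.ofReal_sum_of_nonneg, Finset.sum_mul]
          · refine Finset.sum_congr rfl fun i _ => ?_
            rw [ENNReal.ofReal_mul (sq_nonneg _), ← sq_abs, ENNReal.ofReal_pow (abs_nonneg _),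
              Real.enorm_eq_ofReal_abs]
          · exact fun i _ => mul_nonneg (sq_nonneg _) (sub_nonneg.2 (S.t_le j))
        · intro r hr
          simp only
          refine Finset.sum_congr rfl fun i _ => ?_
          rw [S.val_of_mem (Finset.mem_range.1 hj) hr]
    _ = ∫⁻ r in ⋃ j ∈ Finset.range S.N, Ioc (S.t j) (S.t (j + 1)), ∑ i, ‖S.val i r ω‖ₑ ^ 2 :=
        (lintegral_biUnion_finset hdisj (fun _ _ => measurableSet_Ioc) _).symm
    _ ≤ _ := setLIntegral_le_lintegral _ _

/-! ### Common refinements -/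

/-- With the nodes clamped to `[a, b]` by `cl`, every summand is an increment of `c * w ∘ cl`, and
the sum telescopes. Step processes live on half-open intervals `(a, b]`, so the right end of a cell
decides whether the cell counts. -/
theorem sum_indicator_dW {t : ℕ → ℝ} (ht : Monotone t) {N : ℕ} {a b : ℝ} (hab : a ≤ b)
    (ha : ∃ j ≤ N, t j = a) (hb : ∃ j ≤ N, t j = b) (i : Fin m) (c : ℝ) (ω : Ω) :
    ∑ j ∈ Finset.range N, (Ioc a b).indicator (fun _ => c) (t (j + 1)) * dW w i (t j) (t (j + 1)) ω
      = c * dW w i a b ω := by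
  obtain ⟨ja, hja, rfl⟩ := ha
  obtain ⟨jb, hjb, rfl⟩ := hb
  set cl : ℝ → ℝ := fun y => max (t ja) (min (t jb) y) with hcl
  have key : ∀ j ∈ Finset.range N, (Ioc (t ja) (t jb)).indicator (fun _ => c) (t (j + 1)) *
      dW w i (t j) (t (j + 1)) ω =
      c * w i (cl (t (j + 1))).toNNReal ω - c * w i (cl (t j)).toNNReal ω := by
    intro j _
    have hj := ht (Nat.le_succ j)
    by_cases h1 : t (j + 1) ≤ t ja
    · rw [indicator_of_notMem fun h => absurd h.1 (not_lt.2 h1)]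
      have e1 : cl (t (j + 1)) = t ja := by
        simp only [hcl]; rw [max_eq_left]; exact (min_le_right _ _).trans h1
      have e2 : cl (t j) = t ja := by
        simp only [hcl]; rw [max_eq_left]; exact (min_le_right _ _).trans (hj.trans h1)
      rw [e1, e2]; ring
    by_cases h2 : t (j + 1) ≤ t jb
    · rw [indicator_of_mem (show _ ∈ Ioc _ _ from ⟨not_le.1 h1, h2⟩)]
      have h3 : t ja ≤ t j := by
        apply ht
        by_contra h
        exact h1 (ht (by omega))
      have e1 : cl (t (j + 1)) = t (j + 1) := by
        simp only [hcl]; rw [min_eq_right h2, max_eq_right (not_le.1 h1).le]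
      have e2 : cl (t j) = t j := by
        simp only [hcl]; rw [min_eq_right (hj.trans h2), max_eq_right h3]
      rw [e1, e2, dW]; ring
    · rw [indicator_of_notMem fun h => absurd h.2 h2]
      have h3 : t jb ≤ t j := by
        apply ht
        by_contra h
        exact h2 (ht (by omega))
      have e1 : cl (t (j + 1)) = t jb := by
        simp only [hcl]; rw [min_eq_left (not_le.1 h2).le, max_eq_right hab]
      have e2 : cl (t j) = t jb := by
        simp only [hcl]; rw [min_eq_left h3, max_eq_right hab]
      rw [e1, e2]; ring
  rw [Finset.sum_congr rfl key, Finset.sum_range_sub (fun j => c * w i (cl (t j)).toNNReal ω)]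
  have e1 : cl (t N) = t jb := by
    simp only [hcl]; rw [min_eq_left (ht hjb), max_eq_right hab]
  have e2 : cl (t 0) = t ja := by
    simp only [hcl]
    rw [max_eq_left]; exact (min_le_right _ _).trans (ht (Nat.zero_le _))
  rw [e1, e2, dW]; ring

/-- The nodes of `S` are among `t 0, …, t N`. -/
def RefinedBy (S : Elementary w P) (t : ℕ → ℝ) (N : ℕ) : Prop :=
  ∀ k ≤ S.N, ∃ j ≤ N, t j = S.t k

theorem RefinedBy.int_eq {S : Elementary w P} {t : ℕ → ℝ} {N : ℕ} (h : S.RefinedBy t N)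
    (ht : Monotone t) (ω : Ω) :
    S.int ω = ∑ j ∈ Finset.range N, ∑ i, S.val i (t (j + 1)) ω * dW w i (t j) (t (j + 1)) ω := by
  simp only [val, Finset.sum_mul]
  rw [Finset.sum_congr rfl fun j _ => Finset.sum_comm, Finset.sum_comm]
  unfold int incr
  refine Finset.sum_congr rfl fun k hk => ?_
  rw [Finset.sum_comm]
  refine Finset.sum_congr rfl fun i _ => ?_
  have hk' := Finset.mem_range.1 hk
  rw [sum_indicator_dW ht (S.t_le k) (h k hk'.le) (h (k + 1) hk')]

/-- No node of `S` lies strictly inside a cell of the refinement. A cell is thus contained in an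
interval of `S` or disjoint from it, and its right end tells which. -/
theorem RefinedBy.mem_iff {S : Elementary w P} {t : ℕ → ℝ} {N : ℕ} (h : S.RefinedBy t N)
    (ht : Monotone t) {j : ℕ} {r : ℝ} (hr : r ∈ Ioc (t j) (t (j + 1))) {k : ℕ} (hk : k < S.N) :
    r ∈ Ioc (S.t k) (S.t (k + 1)) ↔ t (j + 1) ∈ Ioc (S.t k) (S.t (k + 1)) := by
  obtain ⟨a, -, ha⟩ := h k hk.le
  obtain ⟨b, -, hb⟩ := h (k + 1) hk
  rw [← ha, ← hb]
  constructor
  · rintro ⟨h1, h2⟩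
    refine ⟨h1.trans_le hr.2, ?_⟩
    apply ht
    by_contra hlt
    exact absurd (h2.trans (ht (by omega : b ≤ j))) (not_le.2 hr.1)
  · rintro ⟨h1, h2⟩
    refine ⟨?_, hr.2.trans h2⟩
    refine lt_of_le_of_lt (ht ?_) hr.1
    by_contra hlt
    exact absurd h1 (not_lt.2 (ht (by omega)))

theorem RefinedBy.val_eq {S : Elementary w P} {t : ℕ → ℝ} {N : ℕ} (h : S.RefinedBy t N)
    (ht : Monotone t) {j : ℕ} {r : ℝ} (hr : r ∈ Ioc (t j) (t (j + 1))) (i : Fin m) (ω : Ω) :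
    S.val i r ω = S.val i (t (j + 1)) ω := by
  refine Finset.sum_congr rfl fun k hk => ?_
  simp only [indicator, h.mem_iff ht hr (Finset.mem_range.1 hk)]

/-- Although the value is read off at the right end of the cell, it is a coefficient attached to a
node of `S` at or before the left end, and is therefore known there. -/
theorem RefinedBy.stronglyMeasurable {S : Elementary w P} {t : ℕ → ℝ} {N : ℕ}
    (h : S.RefinedBy t N) (ht : Monotone t) (j : ℕ) (i : Fin m) :
    StronglyMeasurable[augFiltration w P (t j)] (S.val i (t (j + 1))) := by
  refine @Finset.stronglyMeasurable_fun_sum _ _ _ _ _ _ (_) _ _ fun k hk => ?_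
  simp only [indicator]
  split_ifs with hmem
  · obtain ⟨a, -, ha⟩ := h k (Finset.mem_range.1 hk).le
    refine (S.adapted k i).mono (augFiltration_mono ?_)
    rw [← ha] at hmem ⊢
    apply ht
    by_contra hlt
    exact absurd hmem.1 (not_lt.2 (ht (by omega)))
  · exact @stronglyMeasurable_const _ _ (_) _ _

theorem RefinedBy.val_of_notMem {S : Elementary w P} {t : ℕ → ℝ} {N : ℕ}
    (h : S.RefinedBy t N) (ht : Monotone t) {r : ℝ} (hr : r ∉ Ioc (t 0) (t N)) (i : Fin m)
    (ω : Ω) : S.val i r ω = 0 := by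
  refine S.val_of_notMem (fun hr' => hr ?_) i ω
  obtain ⟨a, ha, ha'⟩ := h 0 (Nat.zero_le _)
  obtain ⟨b, hb, hb'⟩ := h S.N le_rfl
  rw [← ha', ← hb'] at hr'
  exact ⟨(ht (Nat.zero_le a)).trans_lt hr'.1, hr'.2.trans (ht hb)⟩

theorem abs_val_le (S : Elementary w P) {C : ℝ} (hC : ∀ j i ω, |S.ξ j i ω| ≤ C) (i : Fin m) (r : ℝ)
    (ω : Ω) : |S.val i r ω| ≤ C := by
  by_cases hr : r ∈ Ioc (S.t 0) (S.t S.N)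
  · obtain ⟨j, hj, hr'⟩ := exists_mem_Ioc hr
    rw [S.val_of_mem hj hr']
    exact hC j i ω
  · rw [S.val_of_notMem hr, abs_zero]
    exact (abs_nonneg _).trans (hC 0 i ω)

end Elementary

theorem exists_monotone_enum (Q : Finset ℝ) (hQ : Q.Nonempty) :
    ∃ (t : ℕ → ℝ) (N : ℕ), Monotone t ∧ (∀ j, t j ∈ Q) ∧ ∀ x ∈ Q, ∃ j ≤ N, t j = x := by
  have hc : 0 < Q.card := Finset.card_pos.2 hQ
  refine ⟨fun j => Q.orderEmbOfFin rfl ⟨min j (Q.card - 1), by omega⟩, Q.card - 1, ?_, ?_, ?_⟩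
  · intro j k hjk
    apply (Q.orderEmbOfFin rfl).monotone
    simp only [Fin.mk_le_mk]
    omega
  · intro j
    exact Finset.orderEmbOfFin_mem _ _ _
  · intro x hx
    have : x ∈ Set.range (Q.orderEmbOfFin rfl) := by
      rw [Finset.range_orderEmbOfFin]; exact hx
    obtain ⟨j, hj⟩ := this
    refine ⟨j, by omega, ?_⟩
    rw [← hj]
    exact congrArg _ (Fin.ext (by simp only; omega))

namespace Elementary

/-- The difference of two step processes is a step process. -/
theorem exists_sub (S₁ S₂ : Elementary w P) : ∃ S : Elementary w P,
    (∀ i r ω, S.val i r ω = S₁.val i r ω - S₂.val i r ω) ∧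
      ∀ ω, S.int ω = S₁.int ω - S₂.int ω := by
  classical
  -- On the common refinement of both node sets the two processes are subtracted cell by cell.
  set Q : Finset ℝ := (Finset.range (S₁.N + 1)).image S₁.t ∪ (Finset.range (S₂.N + 1)).image S₂.t
  have hQ : Q.Nonempty := ⟨S₁.t 0, Finset.mem_union_left _ (Finset.mem_image_of_mem _ (by simp))⟩
  obtain ⟨t, N, ht, htQ, hQt⟩ := exists_monotone_enum Q hQ
  have r1 : S₁.RefinedBy t N := fun k hk => hQt _ (Finset.mem_union_left _
    (Finset.mem_image_of_mem _ (Finset.mem_range.2 (Nat.lt_succ_of_le hk))))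
  have r2 : S₂.RefinedBy t N := fun k hk => hQt _ (Finset.mem_union_right _
    (Finset.mem_image_of_mem _ (Finset.mem_range.2 (Nat.lt_succ_of_le hk))))
  obtain ⟨C₁, hC₁⟩ := S₁.bounded
  obtain ⟨C₂, hC₂⟩ := S₂.bounded
  let S : Elementary w P :=
    { N := N
      t := t
      mono := ht
      nonneg := by
        rcases Finset.mem_union.1 (htQ 0) with h | h <;>
        · obtain ⟨k, -, hk⟩ := Finset.mem_image.1 h
          rw [← hk]
          exact Elementary.t_nonneg _ k
      ξ := fun j i ω => S₁.val i (t (j + 1)) ω - S₂.val i (t (j + 1)) ω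
      adapted := fun j i => (r1.stronglyMeasurable ht j i).sub (r2.stronglyMeasurable ht j i)
      bounded := ⟨C₁ + C₂, fun j i ω => (abs_sub _ _).trans
        (add_le_add (S₁.abs_val_le hC₁ i _ ω) (S₂.abs_val_le hC₂ i _ ω))⟩ }
  refine ⟨S, fun i r ω => ?_, fun ω => ?_⟩
  · by_cases hr : r ∈ Ioc (t 0) (t N)
    · obtain ⟨j, hj, hr'⟩ := exists_mem_Ioc hr
      rw [S.val_of_mem (j := j) hj hr', r1.val_eq ht hr', r2.val_eq ht hr']
    · rw [S.val_of_notMem hr, r1.val_of_notMem ht hr, r2.val_of_notMem ht hr, sub_zero]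
  · rw [r1.int_eq ht, r2.int_eq ht, ← Finset.sum_sub_distrib]
    refine Finset.sum_congr rfl fun j _ => ?_
    rw [← Finset.sum_sub_distrib]
    exact Finset.sum_congr rfl fun i _ => sub_mul _ _ _

end Elementary

end ElementaryProcesses

/-! ### Bounds and moduli of continuity with large probability -/

section Paths

variable {Ω : Type*} {mΩ : MeasurableSpace Ω} {P : Measure Ω}
variable {F : Type*} [NormedAddCommGroup F] [MeasurableSpace F] [BorelSpace F]
  [SecondCountableTopology F]

theorem exists_measure_compl_le [IsFiniteMeasure P] {A : ℕ → Set Ω}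
    (hA : ∀ n, MeasurableSet (A n)) (hmono : Monotone A) (hae : ∀ᵐ ω ∂P, ∃ n, ω ∈ A n)
    {η : ℝ≥0∞} (hη : 0 < η) : ∃ n, P (A n)ᶜ ≤ η := by
  have h1 : Tendsto (fun n => P (A n)ᶜ) atTop (𝓝 (P (⋂ n, (A n)ᶜ))) :=
    tendsto_measure_iInter_atTop (fun n => (hA n).compl.nullMeasurableSet)
      (fun i j hij => compl_subset_compl.2 (hmono hij)) ⟨0, measure_ne_top _ _⟩
  have h2 : P (⋂ n, (A n)ᶜ) = 0 := by
    rw [← compl_iUnion]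
    refine measure_mono_null ?_ (ae_iff.1 hae)
    intro ω hω
    simpa using hω
  rw [h2] at h1
  obtain ⟨n, hn⟩ := (h1.eventually (ge_mem_nhds hη)).exists
  exact ⟨n, hn⟩

/-- With large probability, the paths of a continuous process have a given modulus of
continuity. -/
theorem exists_modulus [IsFiniteMeasure P] {a b : ℝ} {Y : ℝ → Ω → F}
    (hm : ∀ r ∈ Icc a b, Measurable (Y r)) (hc : ∀ᵐ ω ∂P, ContinuousOn (fun r => Y r ω) (Icc a b))
    {ε : ℝ} (hε : 0 < ε) {η : ℝ≥0∞} (hη : 0 < η) :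
    ∃ h > 0, ∃ A, MeasurableSet A ∧ P Aᶜ ≤ η ∧ ∀ ω ∈ A, ContinuousOn (fun r => Y r ω) (Icc a b) ∧
      ∀ r ∈ Icc a b, ∀ s ∈ Icc a b, |r - s| ≤ h → ‖Y r ω - Y s ω‖ ≤ ε := by
  obtain ⟨D, hDc, hD⟩ := TopologicalSpace.exists_countable_dense (Icc a b)
  obtain ⟨B, hBs, hBm, hB0⟩ := exists_measurable_superset_of_null (ae_iff.1 hc)
  have hB : ∀ ω ∉ B, ContinuousOn (fun r => Y r ω) (Icc a b) := by
    intro ω hω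
    by_contra h
    exact hω (hBs h)
  -- The event is measurable because only countably many times are tested; `B` is a measurable null
  -- set containing the discontinuous paths.
  set A : ℕ → Set Ω := fun n => Bᶜ ∩ ⋂ q ∈ D, ⋂ q' ∈ D,
    {ω | |(q : ℝ) - q'| < 1 / ((n : ℝ) + 1) → ‖Y q ω - Y q' ω‖ ≤ ε} with hA
  have hAm : ∀ n, MeasurableSet (A n) := by
    intro n
    refine hBm.compl.inter (MeasurableSet.biInter hDc fun q _ =>
      MeasurableSet.biInter hDc fun q' _ => ?_)
    by_cases h : |(q : ℝ) - q'| < 1 / ((n : ℝ) + 1)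
    · simp only [h, forall_const]
      exact measurableSet_le ((hm q q.2).sub (hm q' q'.2)).norm measurable_const
    · simp only [h, false_imp_iff]
      exact MeasurableSet.univ
  have hmono : Monotone A := by
    intro n k hnk ω hω
    simp only [hA, mem_inter_iff, mem_iInter, mem_ofPred_eq] at hω ⊢
    refine ⟨hω.1, fun q hq q' hq' hlt => hω.2 q hq q' hq' (hlt.trans_le ?_)⟩
    have : (n : ℝ) ≤ k := by exact_mod_cast hnk
    gcongr
  have hae : ∀ᵐ ω ∂P, ∃ n, ω ∈ A n := by
    have hBae : ∀ᵐ ω ∂P, ω ∉ B := measure_eq_zero_iff_ae_notMem.1 hB0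
    filter_upwards [hBae] with ω hω
    have huc := isCompact_Icc.uniformContinuousOn_of_continuous (hB ω hω)
    rw [Metric.uniformContinuousOn_iff_le] at huc
    obtain ⟨δ, hδ, hδ'⟩ := huc ε hε
    obtain ⟨n, hn⟩ := exists_nat_one_div_lt hδ
    refine ⟨n, hω, ?_⟩
    simp only [mem_iInter, mem_ofPred_eq]
    intro q _ q' _ hlt
    rw [← dist_eq_norm]
    exact hδ' q q.2 q' q'.2 (by rw [Real.dist_eq]; exact (hlt.trans hn).le)
  obtain ⟨n, hn⟩ := exists_measure_compl_le hAm hmono hae hη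
  have hpos : (0 : ℝ) < 1 / ((n : ℝ) + 1) := by positivity
  -- Pairs of times satisfying the strict inequality form an open set, so the estimate passes from
  -- dense pairs to all of them. Halving the constant turns `≤ h` into that strict inequality.
  refine ⟨1 / ((n : ℝ) + 1) / 2, by positivity, A n, hAm n, hn, fun ω hω => ⟨hB ω hω.1, ?_⟩⟩
  have hcont : Continuous fun r : Icc a b => Y r ω :=
      continuousOn_iff_continuous_domRestrict.1 (hB ω hω.1)
  have hopen : IsOpen {z : Icc a b × Icc a b | |(z.1 : ℝ) - z.2| < 1 / ((n : ℝ) + 1)} :=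
    isOpen_lt (by fun_prop) continuous_const
  have hclosed : IsClosed {z : Icc a b × Icc a b | ‖Y z.1 ω - Y z.2 ω‖ ≤ ε} :=
    isClosed_le ((hcont.comp continuous_fst).sub (hcont.comp continuous_snd)).norm continuous_const
  have hsub := (hD.prod hD).open_subset_closure_inter hopen
  have hsub2 : closure ({z : Icc a b × Icc a b | |(z.1 : ℝ) - z.2| < 1 / ((n : ℝ) + 1)} ∩ D ×ˢ D)
      ⊆ {z : Icc a b × Icc a b | ‖Y z.1 ω - Y z.2 ω‖ ≤ ε} := by
    refine closure_minimal ?_ hclosed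
    rintro ⟨q, q'⟩ ⟨h1, h2, h3⟩
    have := hω.2
    simp only [mem_iInter, mem_ofPred_eq] at this
    exact this q h2 q' h3 h1
  intro r hr s hs hrs
  have hlt : |r - s| < 1 / ((n : ℝ) + 1) := lt_of_le_of_lt hrs (half_lt_self hpos)
  exact hsub2 (hsub (show ((⟨r, hr⟩, ⟨s, hs⟩) : Icc a b × Icc a b) ∈ _ from hlt))

/-- With large probability, the paths of a continuous process are bounded by a given constant. -/
theorem exists_bound [IsFiniteMeasure P] {a b : ℝ} {Y : ℝ → Ω → F}
    (hm : ∀ r ∈ Icc a b, Measurable (Y r)) (hc : ∀ᵐ ω ∂P, ContinuousOn (fun r => Y r ω) (Icc a b))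
    {η : ℝ≥0∞} (hη : 0 < η) :
    ∃ K : ℕ, ∃ A, MeasurableSet A ∧ P Aᶜ ≤ η ∧ ∀ ω ∈ A, ContinuousOn (fun r => Y r ω) (Icc a b) ∧
      ∀ r ∈ Icc a b, ‖Y r ω‖ ≤ K := by
  obtain ⟨D, hDc, hD⟩ := TopologicalSpace.exists_countable_dense (Icc a b)
  obtain ⟨B, hBs, hBm, hB0⟩ := exists_measurable_superset_of_null (ae_iff.1 hc)
  have hB : ∀ ω ∉ B, ContinuousOn (fun r => Y r ω) (Icc a b) := by
    intro ω hω
    by_contra h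
    exact hω (hBs h)
  set A : ℕ → Set Ω := fun n => Bᶜ ∩ ⋂ q ∈ D, {ω | ‖Y q ω‖ ≤ n} with hA
  have hAm : ∀ n, MeasurableSet (A n) := fun n =>
    hBm.compl.inter (MeasurableSet.biInter hDc fun q _ =>
      measurableSet_le (hm q q.2).norm measurable_const)
  have hmono : Monotone A := by
    intro n k hnk ω hω
    simp only [hA, mem_inter_iff, mem_iInter, mem_ofPred_eq] at hω ⊢
    exact ⟨hω.1, fun q hq => (hω.2 q hq).trans (by exact_mod_cast hnk)⟩
  have hae : ∀ᵐ ω ∂P, ∃ n, ω ∈ A n := by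
    have hBae : ∀ᵐ ω ∂P, ω ∉ B := measure_eq_zero_iff_ae_notMem.1 hB0
    filter_upwards [hBae] with ω hω
    obtain ⟨C, hC⟩ := isCompact_Icc.exists_bound_of_continuousOn (hB ω hω)
    obtain ⟨n, hn⟩ := exists_nat_ge C
    refine ⟨n, hω, ?_⟩
    simp only [mem_iInter, mem_ofPred_eq]
    exact fun q _ => (hC q q.2).trans hn
  obtain ⟨n, hn⟩ := exists_measure_compl_le hAm hmono hae hη
  refine ⟨n, A n, hAm n, hn, fun ω hω => ⟨hB ω hω.1, fun r hr => ?_⟩⟩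
  have hcont : Continuous fun r : Icc a b => Y r ω :=
      continuousOn_iff_continuous_domRestrict.1 (hB ω hω.1)
  have hclosed : IsClosed {z : Icc a b | ‖Y z ω‖ ≤ n} := isClosed_le hcont.norm continuous_const
  have hsub : closure D ⊆ {z : Icc a b | ‖Y z ω‖ ≤ n} := by
    refine closure_minimal (fun q hq => ?_) hclosed
    have := hω.2
    simp only [mem_iInter, mem_ofPred_eq] at this
    exact this q hq
  exact hsub (hD ⟨r, hr⟩)

end Paths

/-! ### Limits in probability of step integrals, and locality -/

section Limits

variable {Ω : Type*} [mΩ : MeasurableSpace Ω] {m : ℕ}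
variable {w : Fin m → ℝ≥0 → Ω → ℝ} {P : Measure Ω}

theorem enorm_sq_eq (x : ℝ) : ‖x‖ₑ ^ 2 = ENNReal.ofReal (x ^ 2) := by
  rw [← sq_abs, ENNReal.ofReal_pow (abs_nonneg _), Real.enorm_eq_ofReal_abs]

theorem enorm_sub_sq_le (x y : ℝ) : ‖x - y‖ₑ ^ 2 ≤ 2 * ‖x‖ₑ ^ 2 + 2 * ‖y‖ₑ ^ 2 := by
  rw [enorm_sq_eq, enorm_sq_eq, enorm_sq_eq, ← ENNReal.ofReal_ofNat,
    ← ENNReal.ofReal_mul (by norm_num), ← ENNReal.ofReal_mul (by norm_num),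
    ← ENNReal.ofReal_add (by positivity) (by positivity)]
  exact ENNReal.ofReal_le_ofReal (by nlinarith [sq_nonneg (x + y)])

/-- `Y` is a limit in probability of stochastic integrals of step processes that approximate
`Φ` on the whole line. -/
def ItoLim (P : Measure Ω) (w : Fin m → ℝ≥0 → Ω → ℝ) (Φ : Fin m → ℝ → Ω → ℝ) (Y : Ω → ℝ) : Prop :=
  ∃ S : ℕ → Elementary w P,
    (∀ ε : ℝ≥0∞, 0 < ε → Tendsto
      (fun k => P {ω | ε ≤ ∫⁻ r, ∑ i, ‖(S k).val i r ω - Φ i r ω‖ₑ ^ 2}) atTop (𝓝 0)) ∧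
    TendstoInMeasure P (fun k => (S k).int) atTop Y

/-- The factors `2` come from `(x - y)² ≤ 2 x² + 2 y²`. Only monotonicity and the union bound are
used, so `A` may be any set. -/
theorem tendsto_measure_ge_of_le {f g h : ℕ → Ω → ℝ≥0∞} {A : Set Ω}
    (hf : ∀ ε : ℝ≥0∞, 0 < ε → Tendsto (fun k => P {ω | ε ≤ f k ω}) atTop (𝓝 0))
    (hg : ∀ ε : ℝ≥0∞, 0 < ε → Tendsto (fun k => P {ω | ε ≤ g k ω}) atTop (𝓝 0))
    (hle : ∀ k, ∀ᵐ ω ∂P, ω ∈ A → h k ω ≤ 2 * f k ω + 2 * g k ω) {ε : ℝ≥0∞} (hε : 0 < ε) :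
    Tendsto (fun k => P (A ∩ {ω | ε ≤ h k ω})) atTop (𝓝 0) := by
  have hε' : 0 < ε / 4 := ENNReal.div_pos hε.ne' (by simp)
  have h1 := (hf _ hε').add (hg _ hε')
  rw [add_zero] at h1
  refine tendsto_of_tendsto_of_tendsto_of_le_of_le tendsto_const_nhds h1 (fun _ => zero_le)
    fun k => ?_
  refine le_trans (measure_mono_ae ?_) (measure_union_le _ _)
  filter_upwards [hle k] with ω hω h2
  by_contra hcon
  have h3 : ¬(ω ∈ {ω | ε / 4 ≤ f k ω}) ∧ ¬(ω ∈ {ω | ε / 4 ≤ g k ω}) := by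
    constructor <;> intro h <;> exact hcon (by first | exact Or.inl h | exact Or.inr h)
  simp only [mem_ofPred_eq, not_le] at h3
  have h4 : h k ω < ε := by
    refine (hω h2.1).trans_lt ?_
    by_cases htop : ε = ∞
    · rw [htop] at h3 ⊢
      have : (∞ : ℝ≥0∞) / 4 = ∞ := ENNReal.top_div_of_ne_top (by simp)
      rw [this] at h3
      exact ENNReal.add_lt_top.2 ⟨ENNReal.mul_lt_top (by simp) h3.1,
        ENNReal.mul_lt_top (by simp) h3.2⟩
    have e : ε = 2 * (ε / 4) + 2 * (ε / 4) := by
      rw [← add_mul]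
      norm_num
      rw [ENNReal.mul_div_cancel (by simp) (by simp)]
    rw [e]
    have h5 : ∀ x, x < ε / 4 → 2 * x < 2 * (ε / 4) := fun x hx =>
      (ENNReal.mul_lt_mul_iff_right (by simp) (by simp)).2 hx
    exact ENNReal.add_lt_add (h5 _ h3.1) (h5 _ h3.2)
  exact absurd h2.2 (not_le.2 h4)

/-- The stochastic integral is local. -/
theorem ItoLim.ae_eq_on [IsProbabilityMeasure P] (hw : IsBrownianMotion w P)
    {Φ Φ' : Fin m → ℝ → Ω → ℝ} {Y Y' : Ω → ℝ}
    (hY : ItoLim P w Φ Y) (hY' : ItoLim P w Φ' Y') (A : Set Ω)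
    (hA : ∀ᵐ ω ∂P, ω ∈ A → ∀ i, (fun r => Φ i r ω) =ᵐ[volume] (fun r => Φ' i r ω) ∧
      AEMeasurable (fun r => Φ i r ω) volume) :
    ∀ᵐ ω ∂P, ω ∈ A → Y ω = Y' ω := by
  obtain ⟨S, hS, hSY⟩ := hY
  obtain ⟨S', hS', hSY'⟩ := hY'
  -- On `A` both sequences approximate the same integrand, so the quadratic variation of their
  -- difference tends to zero there; Lenglart's inequality carries this over to the integrals.
  choose D hDv hDi using fun k => (S k).exists_sub (S' k)
  have hquad : ∀ δ : ℝ, 0 < δ → Tendsto (fun k => P (A ∩ {ω | δ < (D k).quad ω})) atTop (𝓝 0) := by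
    intro δ hδ
    have h1 := tendsto_measure_ge_of_le (P := P) (A := A)
      (h := fun k ω => ENNReal.ofReal ((D k).quad ω)) hS hS' (fun k => by
        filter_upwards [hA] with ω hω hωA
        have hω := hω hωA
        refine ((D k).ofReal_quad_le ω).trans ?_
        rw [← lintegral_const_mul' _ _ (by simp), ← lintegral_const_mul' _ _ (by simp),
          ← lintegral_add_left']
        · refine lintegral_mono_ae ?_
          have : ∀ᵐ r ∂(volume : Measure ℝ), ∀ i, Φ i r ω = Φ' i r ω := by
            rw [ae_all_iff]
            exact fun i => (hω i).1
          filter_upwards [this] with r hr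
          rw [Finset.mul_sum, Finset.mul_sum, ← Finset.sum_add_distrib]
          refine Finset.sum_le_sum fun i _ => ?_
          have e : (D k).val i r ω = ((S k).val i r ω - Φ i r ω) -
              ((S' k).val i r ω - Φ' i r ω) := by
            rw [hDv, hr i]; ring
          rw [e]
          exact enorm_sub_sq_le _ _
        · refine AEMeasurable.const_mul ?_ _
          refine Finset.aemeasurable_fun_sum _ fun i _ => ?_
          exact ((((S k).measurable_val i ω).aemeasurable.sub (hω i).2).enorm).pow_const 2)
      (ε := ENNReal.ofReal δ) (by simpa using hδ)
    refine tendsto_of_tendsto_of_tendsto_of_le_of_le tendsto_const_nhds h1 (fun _ => zero_le)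
      fun k => measure_mono ?_
    rintro ω ⟨h2, h3⟩
    exact ⟨h2, ENNReal.ofReal_le_ofReal (le_of_lt h3)⟩
  rw [tendstoInMeasure_iff_norm] at hSY hSY'
  have hzero : ∀ ε : ℝ, 0 < ε → P (A ∩ {ω | 3 * ε ≤ |Y ω - Y' ω|}) = 0 := by
    intro ε hε
    refine le_antisymm ?_ zero_le
    refine ENNReal.le_of_forall_pos_le_add fun η hη _ => ?_
    rw [zero_add]
    -- With this choice the term `δ / ε ^ 2` of Lenglart's inequality is exactly `η`.
    set δ : ℝ := η * ε ^ 2 with hδ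
    have hδ0 : 0 < δ := by positivity
    have h1 := ((hSY ε hε).add (hSY' ε hε)).add (hquad δ hδ0)
    have h2 : Tendsto (fun k => P {ω | ε ≤ ‖(S k).int ω - Y ω‖} + P {ω | ε ≤ ‖(S' k).int ω - Y' ω‖}
        + P (A ∩ {ω | δ < (D k).quad ω}) + (η : ℝ≥0∞)) atTop (𝓝 (0 + 0 + 0 + η)) :=
      h1.add tendsto_const_nhds
    rw [zero_add, zero_add, zero_add] at h2
    refine ge_of_tendsto h2 (Eventually.of_forall fun k => ?_)
    have h3 := (D k).measure_inter_le hw A hδ0.le hε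
    have h4 : ENNReal.ofReal (δ / ε ^ 2) = η := by
      rw [hδ, mul_div_assoc, div_self (by positivity), mul_one, ENNReal.ofReal_coe_nnreal]
    rw [h4] at h3
    calc P (A ∩ {ω | 3 * ε ≤ |Y ω - Y' ω|})
        ≤ P (({ω | ε ≤ ‖(S k).int ω - Y ω‖} ∪ {ω | ε ≤ ‖(S' k).int ω - Y' ω‖}) ∪
            (A ∩ {ω | ε ≤ |(D k).int ω|})) := by
          refine measure_mono ?_
          rintro ω ⟨h5, h6⟩
          by_contra hcon
          simp only [mem_union, mem_inter_iff, mem_ofPred_eq, not_or, not_and, not_le,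
            Real.norm_eq_abs] at hcon
          have h7 := hcon.2 h5
          rw [hDi] at h7
          have h8 : |Y ω - Y' ω| < 3 * ε := by
            have e : Y ω - Y' ω = ((S k).int ω - (S' k).int ω) - ((S k).int ω - Y ω)
              + ((S' k).int ω - Y' ω) := by ring
            rw [e]
            calc _ ≤ |((S k).int ω - (S' k).int ω) - ((S k).int ω - Y ω)| +
                |(S' k).int ω - Y' ω| := abs_add_le _ _
              _ ≤ |(S k).int ω - (S' k).int ω| + |(S k).int ω - Y ω| +
                |(S' k).int ω - Y' ω| := by gcongr; exact abs_sub _ _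
              _ < 3 * ε := by linarith [hcon.1.1, hcon.1.2]
          exact absurd h6 (not_le.2 h8)
      _ ≤ _ := by
        refine (measure_union_le _ _).trans ?_
        rw [add_assoc]
        exact add_le_add (measure_union_le _ _) h3
  have hall : ∀ᵐ ω ∂P, ∀ n : ℕ, ω ∉ A ∩ {ω | 3 * (1 / ((n : ℝ) + 1)) ≤ |Y ω - Y' ω|} :=
    ae_all_iff.2 fun n => measure_eq_zero_iff_ae_notMem.1 (hzero _ (by positivity))
  filter_upwards [hall] with ω hω hωA
  by_contra hne
  have hpos : 0 < |Y ω - Y' ω| / 3 := by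
    have := abs_pos.2 (sub_ne_zero.2 hne)
    positivity
  obtain ⟨n, hn⟩ := exists_nat_one_div_lt hpos
  refine hω n ⟨hωA, ?_⟩
  simp only [mem_ofPred_eq]
  linarith

theorem TendstoInMeasure.sub_real {f g : ℕ → Ω → ℝ} {f' g' : Ω → ℝ}
    (hf : TendstoInMeasure P f atTop f') (hg : TendstoInMeasure P g atTop g') :
    TendstoInMeasure P (fun k ω => f k ω - g k ω) atTop (fun ω => f' ω - g' ω) := by
  rw [tendstoInMeasure_iff_norm] at hf hg ⊢
  intro ε hε
  have h1 := (hf (ε / 2) (by positivity)).add (hg (ε / 2) (by positivity))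
  rw [add_zero] at h1
  refine tendsto_of_tendsto_of_tendsto_of_le_of_le tendsto_const_nhds h1 (fun _ => zero_le)
    fun k => ?_
  refine le_trans (measure_mono ?_) (measure_union_le _ _)
  intro ω hω
  by_contra hcon
  simp only [mem_union, mem_ofPred_eq, not_or, not_le] at hcon hω
  have e : f k ω - g k ω - (f' ω - g' ω) = (f k ω - f' ω) - (g k ω - g' ω) := by ring
  rw [e] at hω
  have := norm_sub_le (f k ω - f' ω) (g k ω - g' ω)
  linarith [hcon.1, hcon.2]

theorem ItoLim.sub {Φ Φ' : Fin m → ℝ → Ω → ℝ} {Y Y' : Ω → ℝ}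
    (hY : ItoLim P w Φ Y) (hY' : ItoLim P w Φ' Y')
    (hΦ : ∀ᵐ ω ∂P, ∀ i, AEMeasurable (fun r => Φ i r ω) volume) :
    ItoLim P w (fun i r ω => Φ i r ω - Φ' i r ω) (fun ω => Y ω - Y' ω) := by
  obtain ⟨S, hS, hSY⟩ := hY
  obtain ⟨S', hS', hSY'⟩ := hY'
  choose D hDv hDi using fun k => (S k).exists_sub (S' k)
  refine ⟨D, fun ε hε => ?_, ?_⟩
  · have h := tendsto_measure_ge_of_le (P := P) (A := univ)
        (h := fun k ω => ∫⁻ r, ∑ i, ‖((S k).val i r ω - Φ i r ω) -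
          ((S' k).val i r ω - Φ' i r ω)‖ₑ ^ 2) hS hS' (fun k => by
        filter_upwards [hΦ] with ω hω _
        rw [← lintegral_const_mul' _ _ (by simp), ← lintegral_const_mul' _ _ (by simp),
          ← lintegral_add_left']
        · refine lintegral_mono fun r => ?_
          rw [Finset.mul_sum, Finset.mul_sum, ← Finset.sum_add_distrib]
          refine Finset.sum_le_sum fun i _ => ?_
          exact enorm_sub_sq_le _ _
        · refine AEMeasurable.const_mul ?_ _
          refine Finset.aemeasurable_fun_sum _ fun i _ => ?_
          exact ((((S k).measurable_val i ω).aemeasurable.sub (hω i)).enorm).pow_const 2) hε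
    refine h.congr fun k => ?_
    rw [univ_inter]
    congr 1
    ext ω
    simp only [mem_ofPred_eq, hDv]
    have e : ∀ i r, (S k).val i r ω - (S' k).val i r ω - (Φ i r ω - Φ' i r ω) =
      ((S k).val i r ω - Φ i r ω) - ((S' k).val i r ω - Φ' i r ω) := fun i r => by ring
    simp only [e]
  · have h := TendstoInMeasure.sub_real hSY hSY'
    have e : (fun k => (D k).int) = fun k ω => (S k).int ω - (S' k).int ω := by
      funext k ω
      exact hDi k ω
    rw [e]
    exact h

theorem ItoLim.congr_left {Φ Φ' : Fin m → ℝ → Ω → ℝ} {Y : Ω → ℝ} (hY : ItoLim P w Φ Y)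
    (h : ∀ i r ω, Φ i r ω = Φ' i r ω) : ItoLim P w Φ' Y := by
  have : Φ = Φ' := by funext i r ω; exact h i r ω
  rwa [← this]

end Limits

/-! ### From vector-valued Itô integrals to scalar ones -/

section FrozenSteps

variable {Ω : Type*} [mΩ : MeasurableSpace Ω] {m : ℕ}
variable {F : Type*} [NormedAddCommGroup F] [NormedSpace ℝ F]
variable {w : Fin m → ℝ≥0 → Ω → ℝ} {P : Measure Ω}

/-- The nodes of a partition as a sequence. -/
def Partition.node {a b : ℝ} (I : Partition a b) (j : ℕ) : ℝ :=
  I.pt ⟨min j I.N, by omega⟩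

theorem Partition.node_mono {a b : ℝ} (I : Partition a b) : Monotone I.node := by
  intro j k hjk
  apply I.strictMono.monotone
  simp only [Fin.mk_le_mk]
  omega

theorem Partition.node_castSucc {a b : ℝ} (I : Partition a b) (j : Fin I.N) :
    I.node j = I.pt j.castSucc :=
  congrArg I.pt (Fin.ext (by simp only [Fin.val_castSucc]; omega))

theorem Partition.node_succ {a b : ℝ} (I : Partition a b) (j : Fin I.N) :
    I.node (j + 1) = I.pt j.succ :=
  congrArg I.pt (Fin.ext (by simp only [Fin.val_succ]; omega))

theorem Partition.node_zero {a b : ℝ} (I : Partition a b) : I.node 0 = a :=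
  (congrArg I.pt (Fin.ext (by simp))).trans I.first

theorem Partition.node_of_le {a b : ℝ} (I : Partition a b) {j : ℕ} (hj : I.N ≤ j) :
    I.node j = b :=
  (congrArg I.pt (Fin.ext (by simp [hj]))).trans I.last

/-- The image of a step process under a linear functional. -/
noncomputable def StepProcess.toElementary {a b : ℝ} (ha : 0 ≤ a)
    (S : StepProcess (augFiltration w P) m F a b) (L : F →L[ℝ] ℝ) : Elementary w P where
  N := S.part.N
  t := S.part.node
  mono := S.part.node_mono
  nonneg := by rw [S.part.node_zero]; exact ha
  ξ j i ω := if h : j < S.part.N then L (S.coeff ⟨j, h⟩ i ω) else 0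
  adapted j i := by
    split_ifs with h
    · have h1 := S.adapted ⟨j, h⟩ i
      rw [← S.part.node_castSucc] at h1
      exact L.continuous.comp_stronglyMeasurable h1
    · exact @stronglyMeasurable_const _ _ (_) _ _
  bounded := by
    obtain ⟨C, hC⟩ := S.bounded
    refine ⟨‖L‖ * max C 0, fun j i ω => ?_⟩
    split_ifs with h
    · refine (L.le_opNorm _).trans ?_
      gcongr
      exact (hC _ _ _).trans (le_max_left _ _)
    · rw [abs_zero]; positivity

theorem StepProcess.toElementary_val {a b : ℝ} (ha : 0 ≤ a)
    (S : StepProcess (augFiltration w P) m F a b) (L : F →L[ℝ] ℝ) (i : Fin m) (r : ℝ) (ω : Ω) :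
    (S.toElementary ha L).val i r ω = L (S.val i r ω) := by
  unfold Elementary.val StepProcess.val
  rw [map_sum, ← Fin.sum_univ_eq_sum_range (fun j => (Ioc ((S.toElementary ha L).t j)
    ((S.toElementary ha L).t (j + 1))).indicator
      (fun _ => (S.toElementary ha L).ξ j i ω) r) (S.toElementary ha L).N]
  refine Finset.sum_congr rfl fun (j : Fin S.part.N) _ => ?_
  have h1 : (S.toElementary ha L).t j = S.part.pt j.castSucc := S.part.node_castSucc j
  have h2 : (S.toElementary ha L).t (j + 1) = S.part.pt j.succ := S.part.node_succ j
  have h3 : (S.toElementary ha L).ξ j i ω = L (S.coeff j i ω) := dif_pos j.2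
  rw [h1, h2, h3]
  by_cases hr : r ∈ Ioc (S.part.pt j.castSucc) (S.part.pt j.succ)
  · rw [indicator_of_mem hr, indicator_of_mem hr]
  · rw [indicator_of_notMem hr, indicator_of_notMem hr, map_zero]

theorem StepProcess.toElementary_int {a b : ℝ} (ha : 0 ≤ a)
    (S : StepProcess (augFiltration w P) m F a b) (L : F →L[ℝ] ℝ) (ω : Ω) :
    (S.toElementary ha L).int ω = L (S.integral w ω) := by
  unfold Elementary.int Elementary.incr StepProcess.integral
  rw [map_sum, ← Fin.sum_univ_eq_sum_range (fun j => ∑ i, (S.toElementary ha L).ξ j i ω *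
    dW w i ((S.toElementary ha L).t j) ((S.toElementary ha L).t (j + 1)) ω)
      (S.toElementary ha L).N]
  refine Finset.sum_congr rfl fun (j : Fin S.part.N) _ => ?_
  have h1 : (S.toElementary ha L).t j = S.part.pt j.castSucc := S.part.node_castSucc j
  have h2 : (S.toElementary ha L).t (j + 1) = S.part.pt j.succ := S.part.node_succ j
  rw [map_sum]
  refine Finset.sum_congr rfl fun i _ => ?_
  have h3 : (S.toElementary ha L).ξ j i ω = L (S.coeff j i ω) := dif_pos j.2
  rw [h1, h2, h3, map_smul, smul_eq_mul, mul_comm]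
  rfl

theorem StepProcess.val_of_notMem {ℱ : ℝ → MeasurableSpace Ω} {a b : ℝ}
    (S : StepProcess ℱ m F a b) {r : ℝ} (hr : r ∉ Ioc a b) (i : Fin m) (ω : Ω) :
    S.val i r ω = 0 := by
  refine Finset.sum_eq_zero fun j _ => indicator_of_notMem (fun h => hr ?_) _
  constructor
  · refine lt_of_le_of_lt ?_ h.1
    exact S.part.first.symm.le.trans (S.part.strictMono.monotone (Fin.zero_le _))
  · refine h.2.trans ?_
    exact (S.part.strictMono.monotone (Fin.le_last _)).trans S.part.last.le

/-- Vector integrals are studied through linear functionals. The integrand is cut off outside `(a,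
b]`, where step processes on `[a, b]` vanish anyway, so that integrals over different intervals can
be compared on the whole line. -/
theorem IsItoIntegral.itoLim {Φ : Fin m → ℝ → Ω → F} {a b : ℝ} (ha : 0 ≤ a) {Y : Ω → F}
    (h : IsItoIntegral P w Φ a b Y) (L : F →L[ℝ] ℝ) :
    ItoLim P w (fun i r ω => (Ioc a b).indicator (fun r => L (Φ i r ω)) r) (fun ω => L (Y ω)) := by
  obtain ⟨S, hS, hY⟩ := h
  refine ⟨fun k => (S k).toElementary ha L, fun ε hε => ?_, ?_⟩
  · set c : ℝ≥0∞ := ‖L‖ₑ ^ 2 + 1 with hc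
    have hc0 : c ≠ 0 := by simp [hc]
    have hct : c ≠ ∞ := by simp [hc]
    refine tendsto_of_tendsto_of_tendsto_of_le_of_le tendsto_const_nhds
      (hS (ε / c) (ENNReal.div_pos hε.ne' hct)) (fun _ => zero_le) fun k => measure_mono ?_
    intro ω hω
    simp only [mem_ofPred_eq] at hω ⊢
    rw [ENNReal.div_le_iff hc0 hct, mul_comm, ← lintegral_const_mul' _ _ hct]
    refine hω.trans ?_
    have e : ∀ r, ∑ i, ‖((S k).toElementary ha L).val i r ω -
        (Ioc a b).indicator (fun r => L (Φ i r ω)) r‖ₑ ^ 2 =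
        (Ioc a b).indicator (fun r => ∑ i, ‖L ((S k).val i r ω - Φ i r ω)‖ₑ ^ 2) r := by
      intro r
      by_cases hr : r ∈ Ioc a b
      · rw [indicator_of_mem hr]
        refine Finset.sum_congr rfl fun i _ => ?_
        rw [indicator_of_mem hr, (S k).toElementary_val, map_sub]
      · rw [indicator_of_notMem hr]
        refine Finset.sum_eq_zero fun i _ => ?_
        rw [indicator_of_notMem hr, (S k).toElementary_val, (S k).val_of_notMem hr]
        simp
    simp only [e]
    rw [lintegral_indicator measurableSet_Ioc]
    refine (lintegral_mono_set Ioc_subset_Icc_self).trans (lintegral_mono fun r => ?_)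
    simp only
    rw [Finset.mul_sum]
    refine Finset.sum_le_sum fun i _ => ?_
    calc ‖L ((S k).val i r ω - Φ i r ω)‖ₑ ^ 2
        ≤ (‖L‖ₑ * ‖(S k).val i r ω - Φ i r ω‖ₑ) ^ 2 := by
          gcongr
          exact L.le_opENorm _
      _ = ‖L‖ₑ ^ 2 * ‖(S k).val i r ω - Φ i r ω‖ₑ ^ 2 := mul_pow _ _ _
      _ ≤ c * ‖(S k).val i r ω - Φ i r ω‖ₑ ^ 2 := by
          gcongr
          simp [hc]
  · rw [tendstoInMeasure_iff_norm] at hY ⊢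
    intro ε hε
    refine tendsto_of_tendsto_of_tendsto_of_le_of_le tendsto_const_nhds
      (hY (ε / (‖L‖ + 1)) (by positivity)) (fun _ => zero_le) fun k => measure_mono ?_
    intro ω hω
    simp only [mem_ofPred_eq] at hω ⊢
    rw [(S k).toElementary_int, ← map_sub] at hω
    rw [div_le_iff₀ (by positivity)]
    calc ε ≤ _ := hω
      _ ≤ ‖L‖ * ‖(S k).integral w ω - Y ω‖ := L.le_opNorm _
      _ ≤ _ := by
        rw [mul_comm]
        gcongr
        linarith

end FrozenSteps

/-! ### Closure properties of stochastic integrals and the localised isometry -/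

section ItoLimits

variable {Ω : Type*} [mΩ : MeasurableSpace Ω] {m : ℕ}
variable {w : Fin m → ℝ≥0 → Ω → ℝ} {P : Measure Ω}

/-- The squared `L²(dr)` distance of two families of paths. -/
noncomputable def sqDist (Φ Ψ : Fin m → ℝ → Ω → ℝ) (ω : Ω) : ℝ≥0∞ :=
  ∫⁻ r, ∑ i, ‖Φ i r ω - Ψ i r ω‖ₑ ^ 2

/-- Almost all paths are measurable. -/
def PathMeas (P : Measure Ω) (Φ : Fin m → ℝ → Ω → ℝ) : Prop :=
  ∀ᵐ ω ∂P, ∀ i, AEMeasurable (fun r => Φ i r ω) volume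

theorem Elementary.pathMeas (S : Elementary w P) : PathMeas P S.val :=
  Eventually.of_forall fun ω i => (S.measurable_val i ω).aemeasurable

theorem PathMeas.sub {Φ Ψ : Fin m → ℝ → Ω → ℝ} (h : PathMeas P Φ) (h' : PathMeas P Ψ) :
    PathMeas P (fun i r ω => Φ i r ω - Ψ i r ω) := by
  filter_upwards [h, h'] with ω h1 h2 i
  exact (h1 i).sub (h2 i)

theorem PathMeas.mul {Φ : Fin m → ℝ → Ω → ℝ} (h : PathMeas P Φ) (ξ : Ω → ℝ) :
    PathMeas P (fun i r ω => ξ ω * Φ i r ω) := by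
  filter_upwards [h] with ω h1 i
  exact (h1 i).const_mul _

theorem PathMeas.sum {ι : Type*} {s : Finset ι} {Φ : ι → Fin m → ℝ → Ω → ℝ}
    (h : ∀ l ∈ s, PathMeas P (Φ l)) : PathMeas P (fun i r ω => ∑ l ∈ s, Φ l i r ω) := by
  have := (Finset.eventually_all s (l := ae P)).2 h
  filter_upwards [this] with ω h1 i
  exact Finset.aemeasurable_fun_sum _ fun l hl => h1 l hl i

theorem sqDist_comm (Φ Ψ : Fin m → ℝ → Ω → ℝ) (ω : Ω) : sqDist Φ Ψ ω = sqDist Ψ Φ ω := by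
  simp only [sqDist, enorm_sub_rev]

theorem sqDist_triangle {Φ Ψ Ξ : Fin m → ℝ → Ω → ℝ} {ω : Ω}
    (h : ∀ i, AEMeasurable (fun r => Φ i r ω) volume)
    (h' : ∀ i, AEMeasurable (fun r => Ψ i r ω) volume) :
    sqDist Φ Ξ ω ≤ 2 * sqDist Φ Ψ ω + 2 * sqDist Ψ Ξ ω := by
  unfold sqDist
  rw [← lintegral_const_mul' _ _ (by simp), ← lintegral_const_mul' _ _ (by simp),
    ← lintegral_add_left']
  · refine lintegral_mono fun r => ?_
    rw [Finset.mul_sum, Finset.mul_sum, ← Finset.sum_add_distrib]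
    refine Finset.sum_le_sum fun i _ => ?_
    have e : Φ i r ω - Ξ i r ω = (Φ i r ω - Ψ i r ω) - (Ξ i r ω - Ψ i r ω) := by ring
    rw [e, enorm_sub_rev (Ψ i r ω)]
    exact enorm_sub_sq_le _ _
  · refine AEMeasurable.const_mul ?_ _
    exact Finset.aemeasurable_fun_sum _ fun i _ => (((h i).sub (h' i)).enorm).pow_const 2

theorem measure_sqDist_le {Φ Ψ Ξ : Fin m → ℝ → Ω → ℝ} (h : PathMeas P Φ) (h' : PathMeas P Ψ)
    {δ : ℝ} : P {ω | ENNReal.ofReal (4 * δ) ≤ sqDist Φ Ξ ω} ≤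
      P {ω | ENNReal.ofReal δ ≤ sqDist Φ Ψ ω} + P {ω | ENNReal.ofReal δ ≤ sqDist Ψ Ξ ω} := by
  refine le_trans (measure_mono_ae ?_) (measure_union_le _ _)
  filter_upwards [h, h'] with ω h1 h2 h3
  by_contra hcon
  have h4 : sqDist Φ Ψ ω < ENNReal.ofReal δ ∧ sqDist Ψ Ξ ω < ENNReal.ofReal δ := by
    constructor <;> refine not_le.1 fun h => hcon ?_
    · exact Or.inl h
    · exact Or.inr h
  refine absurd h3 (not_le.2 ((sqDist_triangle h1 h2).trans_lt ?_))
  have h5 : ∀ x, x < ENNReal.ofReal δ → 2 * x < 2 * ENNReal.ofReal δ := fun x hx =>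
      (ENNReal.mul_lt_mul_iff_right (by simp) (by simp)).2 hx
  refine (ENNReal.add_lt_add (h5 _ h4.1) (h5 _ h4.2)).trans_le ?_
  rw [← add_mul, ENNReal.ofReal_mul (by norm_num)]
  norm_num

/-- One `ε` serves both as tolerance and as probability; a sequence is recovered by taking `ε = 1 /
(k + 1)`. -/
theorem itoLim_iff {Φ : Fin m → ℝ → Ω → ℝ} {Y : Ω → ℝ} : ItoLim P w Φ Y ↔
    ∀ ε : ℝ, 0 < ε → ∃ S : Elementary w P,
      P {ω | ENNReal.ofReal ε ≤ sqDist S.val Φ ω} ≤ ENNReal.ofReal ε ∧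
      P {ω | ε ≤ |S.int ω - Y ω|} ≤ ENNReal.ofReal ε := by
  constructor
  · rintro ⟨S, hS, hY⟩ ε hε
    have hε' : (0 : ℝ≥0∞) < ENNReal.ofReal ε := by simpa using hε
    rw [tendstoInMeasure_iff_norm] at hY
    obtain ⟨k, h1, h2⟩ := (((hS _ hε').eventually (ge_mem_nhds hε')).and
      ((hY ε hε).eventually (ge_mem_nhds hε'))).exists
    exact ⟨S k, h1, h2⟩
  · intro h
    choose S hS hY using fun k : ℕ => h (1 / ((k : ℝ) + 1)) (by positivity)
    have hlim : Tendsto (fun k : ℕ => ENNReal.ofReal (1 / ((k : ℝ) + 1))) atTop (𝓝 0) := by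
      rw [← ENNReal.ofReal_zero]
      exact ENNReal.tendsto_ofReal tendsto_one_div_add_atTop_nhds_zero_nat
    refine ⟨S, fun ε hε => ?_, ?_⟩
    · refine tendsto_of_tendsto_of_tendsto_of_le_of_le' tendsto_const_nhds hlim
        (Eventually.of_forall fun _ => zero_le) ?_
      filter_upwards [hlim.eventually (ge_mem_nhds hε)] with k hk
      refine le_trans (measure_mono fun ω hω => ?_) (hS k)
      exact hk.trans hω
    · rw [tendstoInMeasure_iff_norm]
      intro ε hε
      refine tendsto_of_tendsto_of_tendsto_of_le_of_le' tendsto_const_nhds hlim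
        (Eventually.of_forall fun _ => zero_le) ?_
      filter_upwards [tendsto_one_div_add_atTop_nhds_zero_nat.eventually (ge_mem_nhds hε)] with k hk
      refine le_trans (measure_mono fun ω hω => ?_) (hY k)
      exact hk.trans hω

theorem measure_add_abs_le {f g : Ω → ℝ} (ε δ : ℝ) :
    P {ω | ε + δ ≤ |f ω + g ω|} ≤ P {ω | ε ≤ |f ω|} + P {ω | δ ≤ |g ω|} := by
  refine le_trans (measure_mono ?_) (measure_union_le _ _)
  intro ω hω
  by_contra hcon
  simp only [mem_union, mem_ofPred_eq, not_or, not_le] at hcon hω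
  have := abs_add_le (f ω) (g ω)
  linarith [hcon.1, hcon.2]

/-- A diagonal argument. It permits approximation by processes that are themselves only limits of
step processes, as needed for Itô's formula, where only the gradient is frozen on the cells. -/
theorem ItoLim.of_approx {Φ : Fin m → ℝ → Ω → ℝ} {Y : Ω → ℝ}
    (h : ∀ ε : ℝ, 0 < ε → ∃ Ψ Z, ItoLim P w Ψ Z ∧ PathMeas P Ψ ∧
      P {ω | ENNReal.ofReal ε ≤ sqDist Ψ Φ ω} ≤ ENNReal.ofReal ε ∧
      P {ω | ε ≤ |Z ω - Y ω|} ≤ ENNReal.ofReal ε) : ItoLim P w Φ Y := by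
  rw [itoLim_iff]
  intro ε hε
  obtain ⟨Ψ, Z, hZ, hm, h1, h2⟩ := h (ε / 4) (by positivity)
  obtain ⟨S, h3, h4⟩ := itoLim_iff.1 hZ (ε / 4) (by positivity)
  have hadd : ENNReal.ofReal (ε / 4) + ENNReal.ofReal (ε / 4) ≤ ENNReal.ofReal ε := by
    rw [← ENNReal.ofReal_add (by positivity) (by positivity)]
    exact ENNReal.ofReal_le_ofReal (by linarith)
  refine ⟨S, ?_, ?_⟩
  · have := measure_sqDist_le (Ξ := Φ) S.pathMeas hm (δ := ε / 4)
    rw [show 4 * (ε / 4) = ε by ring] at this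
    exact this.trans ((add_le_add h3 h1).trans hadd)
  · have := measure_add_abs_le (P := P) (f := fun ω => S.int ω - Z ω) (g := fun ω => Z ω - Y ω)
      (ε / 4) (ε / 4)
    refine le_trans (measure_mono fun ω hω => ?_) (this.trans ((add_le_add h4 h2).trans hadd))
    simp only [mem_ofPred_eq] at hω ⊢
    rw [sub_add_sub_cancel]
    linarith

theorem Elementary.itoLim (S : Elementary w P) : ItoLim P w S.val S.int :=
  itoLim_iff.2 fun ε hε => ⟨S, by simp [sqDist, not_le.2 hε], by simp [not_le.2 hε]⟩

theorem ItoLim.zero : ItoLim P w (fun _ _ _ => 0) (fun _ => 0) := by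
  let S : Elementary w P :=
    { N := 0
      t := fun _ => 0
      mono := fun _ _ _ => le_rfl
      nonneg := le_rfl
      ξ := fun _ _ _ => 0
      adapted := fun _ _ => @stronglyMeasurable_const _ _ (_) _ _
      bounded := ⟨0, fun _ _ _ => by simp⟩ }
  have h := S.itoLim
  have e1 : S.val = fun _ _ _ => 0 := by
    funext i r ω
    simp [Elementary.val, S]
  have e2 : S.int = fun _ => 0 := by
    funext ω
    simp [Elementary.int, S]
  rwa [e1, e2] at h

theorem pathMeas_zero : PathMeas P (fun (_ : Fin m) (_ : ℝ) (_ : Ω) => (0 : ℝ)) :=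
  Eventually.of_forall fun _ _ => aemeasurable_const

theorem ItoLim.add {Φ Φ' : Fin m → ℝ → Ω → ℝ} {Y Y' : Ω → ℝ}
    (hY : ItoLim P w Φ Y) (hY' : ItoLim P w Φ' Y') (hΦ : PathMeas P Φ) :
    ItoLim P w (fun i r ω => Φ i r ω + Φ' i r ω) (fun ω => Y ω + Y' ω) := by
  have h := hY.sub (ItoLim.zero.sub hY' pathMeas_zero) hΦ
  simpa using h

theorem ItoLim.sum {ι : Type*} {s : Finset ι} {Φ : ι → Fin m → ℝ → Ω → ℝ} {Y : ι → Ω → ℝ}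
    (hY : ∀ l ∈ s, ItoLim P w (Φ l) (Y l)) (hΦ : ∀ l ∈ s, PathMeas P (Φ l)) :
    ItoLim P w (fun i r ω => ∑ l ∈ s, Φ l i r ω) (fun ω => ∑ l ∈ s, Y l ω) := by
  classical
  induction s using Finset.induction_on with
  | empty => simpa using ItoLim.zero
  | insert a s ha ih =>
    simp only [Finset.sum_insert ha]
    exact (hY a (by simp)).add (ih (fun l hl => hY l (by simp [hl]))
      (fun l hl => hΦ l (by simp [hl]))) (hΦ a (by simp))

theorem ItoLim.congr_right {Φ : Fin m → ℝ → Ω → ℝ} {Y Y' : Ω → ℝ} (hY : ItoLim P w Φ Y)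
    (h : Y =ᵐ[P] Y') : ItoLim P w Φ Y' := by
  obtain ⟨S, h1, h2⟩ := hY
  exact ⟨S, h1, h2.congr_right h⟩

theorem ItoLim.aemeasurable [IsProbabilityMeasure P] (hw : IsBrownianMotion w P)
    {Φ : Fin m → ℝ → Ω → ℝ} {Y : Ω → ℝ} (hY : ItoLim P w Φ Y) : AEMeasurable Y P := by
  obtain ⟨S, -, h2⟩ := hY
  exact h2.aemeasurable fun k => ((S k).memLp_int hw).1.aemeasurable

namespace Elementary

/-- The part of a step process after time `s`, multiplied by a random variable known at `s`. -/
noncomputable def after (S : Elementary w P) (s : ℝ) (ξ : Ω → ℝ)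
    (hξ : StronglyMeasurable[augFiltration w P s] ξ) (hb : ∃ C : ℝ, ∀ ω, |ξ ω| ≤ C) :
    Elementary w P where
  N := S.N
  t j := max (S.t j) s
  mono := fun _ _ h => max_le_max (S.mono h) le_rfl
  nonneg := S.nonneg.trans (le_max_left _ _)
  ξ j i ω := ξ ω * S.ξ j i ω
  adapted j i := (hξ.mono (augFiltration_mono (le_max_right _ _))).mul
    ((S.adapted j i).mono (augFiltration_mono (le_max_left _ _)))
  bounded := by
    obtain ⟨C, hC⟩ := S.bounded
    obtain ⟨C', hC'⟩ := hb
    refine ⟨C' * C, fun j i ω => ?_⟩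
    rw [abs_mul]
    exact mul_le_mul (hC' ω) (hC j i ω) (abs_nonneg _) ((abs_nonneg _).trans (hC' ω))

theorem after_val (S : Elementary w P) (s : ℝ) (ξ : Ω → ℝ)
    (hξ : StronglyMeasurable[augFiltration w P s] ξ) (hb : ∃ C : ℝ, ∀ ω, |ξ ω| ≤ C)
    (i : Fin m) (r : ℝ) (ω : Ω) :
    (S.after s ξ hξ hb).val i r ω = if s < r then ξ ω * S.val i r ω else 0 := by
  have key : ∀ j, (Ioc (max (S.t j) s) (max (S.t (j + 1)) s)).indicator
      (fun _ => ξ ω * S.ξ j i ω) r =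
      if s < r then ξ ω * (Ioc (S.t j) (S.t (j + 1))).indicator (fun _ => S.ξ j i ω) r else 0 := by
    intro j
    simp only [indicator, mem_Ioc, max_lt_iff, le_max_iff]
    by_cases h : s < r
    · have h' : ¬ r ≤ s := not_le.2 h
      simp [h, h']
    · simp [h]
  unfold val
  simp only [after, key]
  split_ifs with h
  · rw [Finset.mul_sum]
  · simp

theorem after_int (S : Elementary w P) (s : ℝ) (ξ : Ω → ℝ)
    (hξ : StronglyMeasurable[augFiltration w P s] ξ) (hb : ∃ C : ℝ, ∀ ω, |ξ ω| ≤ C) (ω : Ω) :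
    (S.after s ξ hξ hb).int ω = ξ ω * (S.after s (fun _ => 1)
      (@stronglyMeasurable_const _ _ (_) _ _) ⟨1, fun _ => by simp⟩).int ω := by
  simp only [int, incr, after, Finset.mul_sum]
  refine Finset.sum_congr rfl fun j _ => Finset.sum_congr rfl fun i _ => by ring

/-- Two step processes that are close to a third process have close integrals. -/
theorem measure_int_sub_le [IsProbabilityMeasure P] (hw : IsBrownianMotion w P)
    (S₁ S₂ : Elementary w P) {Φ : Fin m → ℝ → Ω → ℝ} (hΦ : PathMeas P Φ) {δ ε : ℝ} (hδ : 0 ≤ δ)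
    (hε : 0 < ε) : P {ω | ε ≤ |S₁.int ω - S₂.int ω|} ≤
      P {ω | ENNReal.ofReal δ ≤ sqDist S₁.val Φ ω} + P {ω | ENNReal.ofReal δ ≤ sqDist S₂.val Φ ω}
        + ENNReal.ofReal (4 * δ / ε ^ 2) := by
  obtain ⟨D, hDv, hDi⟩ := S₁.exists_sub S₂
  have h1 := D.measure_inter_le hw univ (δ := 4 * δ) (by positivity) hε
  simp only [univ_inter, hDi] at h1
  refine h1.trans (add_le_add ?_ le_rfl)
  have h2 := measure_sqDist_le (Ξ := S₂.val) S₁.pathMeas hΦ (δ := δ)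
  simp only [sqDist_comm Φ] at h2
  refine (measure_mono fun ω hω => ?_).trans h2
  refine (ENNReal.ofReal_le_ofReal (le_of_lt hω)).trans ((D.ofReal_quad_le ω).trans ?_)
  simp only [hDv]
  exact le_rfl

end Elementary

/-- The approximating step processes are first cut off at time `s`, which does not increase their
distance to `Φ`, since `Φ` vanishes up to `s`. After that, multiplication of the coefficients by `ξ`
keeps them adapted and multiplies the integral by `ξ`. -/
theorem ItoLim.mul [IsProbabilityMeasure P] (hw : IsBrownianMotion w P)
    {Φ : Fin m → ℝ → Ω → ℝ} {Y : Ω → ℝ} (hY : ItoLim P w Φ Y) (hΦ : PathMeas P Φ) {s : ℝ}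
    (h0 : ∀ i r ω, r ≤ s → Φ i r ω = 0) {ξ : Ω → ℝ}
    (hξ : StronglyMeasurable[augFiltration w P s] ξ) {C : ℝ} (hb : ∀ ω, |ξ ω| ≤ C) :
    ItoLim P w (fun i r ω => ξ ω * Φ i r ω) (fun ω => ξ ω * Y ω) := by
  set C' : ℝ := |C| + 1 with hC'
  have hC0 : 0 < C' := by positivity
  have hb' : ∀ ω, |ξ ω| ≤ C' := fun ω => (hb ω).trans ((le_abs_self C).trans (by simp [hC']))
  have hC1 : 1 ≤ C' := by simp [hC']
  rw [itoLim_iff]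
  intro ε hε
  -- The three entries serve, in order, the squared distance, which grows by a factor `C' ^ 2`; the
  -- error of the integral, which grows by `C'`; and the term `4 * δ / (ε / (2 * C')) ^ 2 ≤ ε / 4`
  -- in the comparison of `S` with its cut-off `R`.
  set δ : ℝ := min (ε / (4 * C' ^ 2)) (min (ε / (2 * C')) (ε * (ε / (2 * C')) ^ 2 / 16)) with hδ
  have hδ0 : 0 < δ := by positivity
  have hδ1 : δ ≤ ε / (4 * C' ^ 2) := min_le_left _ _
  have hδ2 : δ ≤ ε / (2 * C') := (min_le_right _ _).trans (min_le_left _ _)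
  have hδ3 : δ ≤ ε * (ε / (2 * C')) ^ 2 / 16 := (min_le_right _ _).trans (min_le_right _ _)
  have hδε : δ ≤ ε / 4 := by
    refine hδ1.trans ?_
    gcongr
    nlinarith
  obtain ⟨S, h1, h2⟩ := itoLim_iff.1 hY δ hδ0
  set R := S.after s (fun _ => 1) (@stronglyMeasurable_const _ _ (_) _ _) ⟨1, fun _ => by simp⟩
    with hR
  have hRq : ∀ ω, sqDist R.val Φ ω ≤ sqDist S.val Φ ω := by
    intro ω
    refine lintegral_mono fun r => Finset.sum_le_sum fun i _ => ?_
    rw [hR, Elementary.after_val]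
    split_ifs with h
    · rw [one_mul]
    · rw [h0 i r ω (not_lt.1 h)]
      simp
  have hRS : P {ω | ε / (2 * C') ≤ |R.int ω - S.int ω|} ≤ ENNReal.ofReal (3 * (ε / 4)) := by
    refine (R.measure_int_sub_le hw S hΦ (δ := δ) hδ0.le (by positivity)).trans ?_
    have e1 : 4 * δ / (ε / (2 * C')) ^ 2 ≤ ε / 4 := by
      rw [div_le_iff₀ (by positivity)]
      linarith
    have e2 : P {ω | ENNReal.ofReal δ ≤ sqDist R.val Φ ω} ≤ ENNReal.ofReal (ε / 4) :=
      (measure_mono fun ω hω => le_trans hω (hRq ω)).trans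
        (h1.trans (ENNReal.ofReal_le_ofReal hδε))
    calc _ ≤ ENNReal.ofReal (ε / 4) + ENNReal.ofReal (ε / 4) + ENNReal.ofReal (ε / 4) :=
          add_le_add (add_le_add e2 (h1.trans (ENNReal.ofReal_le_ofReal hδε)))
            (ENNReal.ofReal_le_ofReal e1)
      _ = ENNReal.ofReal (3 * (ε / 4)) := by
          rw [← ENNReal.ofReal_add (by positivity) (by positivity),
            ← ENNReal.ofReal_add (by positivity) (by positivity)]
          congr 1; ring
  refine ⟨S.after s ξ hξ ⟨C, hb⟩, ?_, ?_⟩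
  · refine (measure_mono fun ω hω => ?_).trans (h1.trans (ENNReal.ofReal_le_ofReal
      (hδε.trans (by linarith))))
    simp only [mem_ofPred_eq] at hω ⊢
    have e : sqDist (S.after s ξ hξ ⟨C, hb⟩).val (fun i r ω => ξ ω * Φ i r ω) ω ≤
        ENNReal.ofReal (C' ^ 2) * sqDist S.val Φ ω := by
      refine le_trans ?_ (mul_le_mul_right (hRq ω) _)
      unfold sqDist
      rw [← lintegral_const_mul' _ _ (by simp)]
      refine lintegral_mono fun r => ?_
      rw [Finset.mul_sum]
      refine Finset.sum_le_sum fun i _ => ?_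
      have e1 : (S.after s ξ hξ ⟨C, hb⟩).val i r ω - ξ ω * Φ i r ω =
          ξ ω * (R.val i r ω - Φ i r ω) := by
        rw [hR, Elementary.after_val, Elementary.after_val]
        split_ifs <;> ring
      rw [e1, enorm_mul, mul_pow]
      gcongr
      rw [enorm_sq_eq, ← sq_abs]
      exact ENNReal.ofReal_le_ofReal (pow_le_pow_left₀ (abs_nonneg _) (hb' ω) 2)
    have h5 := hω.trans e
    have h6 : ENNReal.ofReal ε = ENNReal.ofReal (C' ^ 2) * ENNReal.ofReal (ε / C' ^ 2) := by
      rw [← ENNReal.ofReal_mul (by positivity), mul_div_cancel₀ _ (by positivity)]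
    rw [h6] at h5
    have h7 := (ENNReal.mul_le_mul_iff_right (by simpa using hC0.ne') (by simp)).1 h5
    refine (ENNReal.ofReal_le_ofReal (hδ1.trans ?_)).trans h7
    gcongr
    nlinarith [sq_nonneg C']
  · have e := measure_add_abs_le (P := P) (f := fun ω => R.int ω - S.int ω)
      (g := fun ω => S.int ω - Y ω) (ε / (2 * C')) (ε / (2 * C'))
    refine (measure_mono fun ω hω => ?_).trans (e.trans ((add_le_add hRS
      ((measure_mono fun ω hω => ?_).trans (h2.trans (ENNReal.ofReal_le_ofReal hδε)))).trans ?_))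
    · simp only [mem_ofPred_eq] at hω ⊢
      rw [sub_add_sub_cancel]
      rw [Elementary.after_int, ← mul_sub, abs_mul] at hω
      have h5 : ε ≤ C' * |R.int ω - Y ω| := hω.trans (by gcongr; exact hb' ω)
      have h6 : ε / (2 * C') + ε / (2 * C') = ε / C' := by field_simp; ring
      rw [h6, div_le_iff₀ hC0]
      linarith
    · exact hδ2.trans hω
    · rw [← ENNReal.ofReal_add (by positivity) (by positivity)]
      exact ENNReal.ofReal_le_ofReal (by linarith)

/-- The localised Itô isometry, as an inequality. -/
theorem ItoLim.lintegral_sq_le [IsProbabilityMeasure P] (hw : IsBrownianMotion w P)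
    {Φ : Fin m → ℝ → Ω → ℝ} {Y : Ω → ℝ} (hY : ItoLim P w Φ Y) (hΦ : PathMeas P Φ) {A : Set Ω}
    (hA : MeasurableSet A) {δ : ℝ} (hδ : 0 < δ)
    (hle : ∀ᵐ ω ∂P, ω ∈ A → sqDist Φ (fun _ _ _ => 0) ω ≤ ENNReal.ofReal δ) :
    ∫⁻ ω in A, ‖Y ω‖ₑ ^ 2 ∂P ≤ ENNReal.ofReal (4 * δ) := by
  obtain ⟨S, hS, hSY⟩ := hY
  -- If `S k` is within `δ` of `Φ`, its quadratic variation on `A` is at most `2 * δ + 2 * δ`.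
  -- Stopping at `4 * δ` then has no effect on `A`, while it bounds the second moment everywhere.
  set S' : ℕ → Elementary w P := fun k => (S k).stopAt ((S k).quadLe (4 * δ))
    ((S k).measurableSet_quadLe (4 * δ)) with hS'
  have h1 : ∀ k, ∫ ω, (S' k).int ω ^ 2 ∂P ≤ 4 * δ := by
    intro k
    rw [(S' k).integral_int_sq hw]
    have : ∫ ω, (S' k).quad ω ∂P ≤ ∫ _, 4 * δ ∂P := by
      refine integral_mono (S' k).integrable_quad (integrable_const _) fun ω => ?_
      have : (S' k).quad ω = ∑ j ∈ Finset.range (S k).N,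
          ((S k).quadLe (4 * δ) j).indicator ((S k).qincr j) ω := by
        unfold Elementary.quad
        exact Finset.sum_congr rfl fun j _ => by rw [hS', Elementary.stopAt_qincr]
      rw [this]
      exact (S k).sum_indicator_quadLe_le (by positivity) _ ω
    simpa using this
  have h2 : ∀ k, ∫⁻ ω, ‖A.indicator (S' k).int ω‖ₑ ^ 2 ∂P ≤ ENNReal.ofReal (4 * δ) := by
    intro k
    refine le_trans ?_ (ENNReal.ofReal_le_ofReal (h1 k))
    rw [ofReal_integral_eq_lintegral_ofReal ((S' k).memLp_int hw).integrable_sq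
      (Eventually.of_forall fun ω => sq_nonneg _)]
    refine lintegral_mono fun ω => ?_
    rw [← enorm_sq_eq]
    gcongr
    exact enorm_indicator_le_enorm_self _ _
  have h3 : TendstoInMeasure P (fun k => A.indicator (S' k).int) atTop (A.indicator Y) := by
    rw [tendstoInMeasure_iff_norm] at hSY ⊢
    intro ε hε
    have h4 := (hSY ε hε).add (hS (ENNReal.ofReal δ) (by simpa using hδ))
    rw [add_zero] at h4
    refine tendsto_of_tendsto_of_tendsto_of_le_of_le tendsto_const_nhds h4 (fun _ => zero_le)
      fun k => ?_
    refine le_trans (measure_mono_ae ?_) (measure_union_le _ _)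
    filter_upwards [hle, hΦ] with ω hω hm h5
    by_contra hcon
    have h6 : ‖(S k).int ω - Y ω‖ < ε ∧
        sqDist (S k).val Φ ω < ENNReal.ofReal δ := by
      constructor <;> refine not_le.1 fun h => hcon ?_
      · exact Or.inl h
      · exact Or.inr h
    have h5' : ε ≤ ‖A.indicator (S' k).int ω - A.indicator Y ω‖ := h5
    by_cases hωA : ω ∈ A
    · rw [indicator_of_mem hωA, indicator_of_mem hωA] at h5'
      have hq : (S k).quad ω ≤ 4 * δ := by
        rw [← ENNReal.ofReal_le_ofReal_iff (by positivity)]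
        refine ((S k).ofReal_quad_le ω).trans ?_
        have h7 : sqDist (S k).val (fun _ _ _ => 0) ω ≤ ENNReal.ofReal (4 * δ) := by
          refine (sqDist_triangle (fun i => ((S k).measurable_val i ω).aemeasurable) hm).trans ?_
          rw [show 4 * δ = 2 * δ + 2 * δ by ring, ENNReal.ofReal_add (by positivity)
              (by positivity),
            ENNReal.ofReal_mul (by norm_num)]
          norm_num
          exact add_le_add (mul_le_mul_right h6.2.le _) (mul_le_mul_right (hω hωA) _)
        simpa [sqDist] using h7
      have e : (S' k).int ω = (S k).int ω := by
        unfold Elementary.int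
        refine Finset.sum_congr rfl fun j hj => ?_
        rw [hS', Elementary.stopAt_incr, indicator_of_mem]
        refine le_trans ?_ hq
        exact Finset.sum_le_sum_of_subset_of_nonneg
          (Finset.range_subset_range.2 (Finset.mem_range.1 hj)) fun l _ _ => (S k).qincr_nonneg l ω
      rw [e] at h5'
      exact absurd h5' (not_le.2 h6.1)
    · rw [indicator_of_notMem hωA, indicator_of_notMem hωA, sub_zero, norm_zero] at h5'
      exact absurd h5' (not_le.2 hε)
  -- The uniform second moment bound passes to the limit by Fatou's lemma along an almost surely
  -- convergent subsequence.
  obtain ⟨ns, -, hns⟩ := h3.exists_seq_tendsto_ae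
  have hYm : ∫⁻ ω in A, ‖Y ω‖ₑ ^ 2 ∂P = ∫⁻ ω, ‖A.indicator Y ω‖ₑ ^ 2 ∂P := by
    rw [← lintegral_indicator hA]
    refine lintegral_congr fun ω => ?_
    simp only [indicator]
    split_ifs <;> simp
  rw [hYm]
  calc ∫⁻ ω, ‖A.indicator Y ω‖ₑ ^ 2 ∂P
      ≤ ∫⁻ ω, liminf (fun k => ‖A.indicator (S' (ns k)).int ω‖ₑ ^ 2) atTop ∂P := by
        refine lintegral_mono_ae ?_
        filter_upwards [hns] with ω hω
        rw [((ENNReal.continuous_pow 2).tendsto _ |>.comp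
          ((continuous_enorm.tendsto _).comp hω)).liminf_eq.symm]
        rfl
    _ ≤ liminf (fun k => ∫⁻ ω, ‖A.indicator (S' (ns k)).int ω‖ₑ ^ 2 ∂P) atTop :=
        lintegral_liminf_le' fun k =>
          ((((S' (ns k)).memLp_int hw).1.aemeasurable.indicator hA).enorm.pow_const 2)
    _ ≤ ENNReal.ofReal (4 * δ) := by
        refine (liminf_le_liminf (Eventually.of_forall fun k => h2 (ns k))).trans ?_
        simp

/-- Localised Chebyshev inequality. -/
theorem ItoLim.measure_inter_le [IsProbabilityMeasure P] (hw : IsBrownianMotion w P)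
    {Φ : Fin m → ℝ → Ω → ℝ} {Y : Ω → ℝ} (hY : ItoLim P w Φ Y) (hΦ : PathMeas P Φ) {A : Set Ω}
    (hA : MeasurableSet A) {δ ε : ℝ} (hδ : 0 < δ) (hε : 0 < ε)
    (hle : ∀ᵐ ω ∂P, ω ∈ A → sqDist Φ (fun _ _ _ => 0) ω ≤ ENNReal.ofReal δ) :
    P (A ∩ {ω | ε ≤ |Y ω|}) ≤ ENNReal.ofReal (4 * δ / ε ^ 2) := by
  have h := hY.lintegral_sq_le hw hΦ hA hδ hle
  have hm : AEMeasurable (fun ω => ‖Y ω‖ₑ ^ 2) (P.restrict A) :=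
    ((hY.aemeasurable hw).mono_measure Measure.restrict_le_self).enorm.pow_const 2
  have h1 := meas_ge_le_lintegral_div (μ := P.restrict A) hm (ε := ENNReal.ofReal (ε ^ 2))
    (by simp [hε.ne']) ENNReal.ofReal_ne_top
  rw [ENNReal.ofReal_div_of_pos (by positivity)]
  refine le_trans ?_ (h1.trans (ENNReal.div_le_div_right h _))
  rw [Measure.restrict_apply' hA, inter_comm]
  refine measure_mono (inter_subset_inter_left _ fun ω hω => ?_)
  simp only [mem_ofPred_eq] at hω ⊢
  rw [enorm_sq_eq]
  apply ENNReal.ofReal_le_ofReal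
  rw [← sq_abs (Y ω)]
  exact pow_le_pow_left₀ hε.le hω 2

end ItoLimits

/-! ### Grids and truncation of real numbers -/

/-- A grid `a = t 0 ≤ t 1 ≤ ⋯ ≤ t N = b`. -/
structure Grid (a b : ℝ) where
  N : ℕ
  t : ℕ → ℝ
  mono : Monotone t
  first : t 0 = a
  last : ∀ j, N ≤ j → t j = b

/-- All steps of the grid are at most `h`. -/
def Grid.MeshLe {a b : ℝ} (G : Grid a b) (h : ℝ) : Prop := ∀ j, G.t (j + 1) - G.t j ≤ h

theorem Grid.mem {a b : ℝ} (G : Grid a b) (j : ℕ) : G.t j ∈ Icc a b := by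
  exact ⟨G.first.symm.le.trans (G.mono (Nat.zero_le j)),
    (G.mono (le_max_left j G.N)).trans (G.last _ (le_max_right _ _)).le⟩

theorem Grid.step_nonneg {a b : ℝ} (G : Grid a b) (j : ℕ) : 0 ≤ G.t (j + 1) - G.t j :=
  sub_nonneg.2 (G.mono (Nat.le_succ j))

theorem Grid.sum_step {a b : ℝ} (G : Grid a b) :
    ∑ j ∈ Finset.range G.N, (G.t (j + 1) - G.t j) = b - a := by
  rw [Finset.sum_range_sub, G.last _ le_rfl, G.first]

/-- The uniform grid with `N + 1` steps. -/
noncomputable def Grid.uniform {a b : ℝ} (hab : a ≤ b) (N : ℕ) : Grid a b where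
  N := N + 1
  t j := a + (min j (N + 1) : ℕ) * ((b - a) / ((N : ℝ) + 1))
  mono := by
    intro i j hij
    have h1 : ((min i (N + 1) : ℕ) : ℝ) ≤ ((min j (N + 1) : ℕ) : ℝ) := by
      exact_mod_cast min_le_min hij le_rfl
    have h2 : 0 ≤ (b - a) / ((N : ℝ) + 1) := div_nonneg (sub_nonneg.2 hab) (by positivity)
    simp only
    gcongr
  first := by simp
  last j hj := by
    rw [min_eq_right hj]
    push_cast
    field_simp
    ring

theorem Grid.uniform_meshLe {a b : ℝ} (hab : a ≤ b) (N : ℕ) :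
    (Grid.uniform hab N).MeshLe ((b - a) / ((N : ℝ) + 1)) := by
  intro j
  have h2 : 0 ≤ (b - a) / ((N : ℝ) + 1) := div_nonneg (sub_nonneg.2 hab) (by positivity)
  have h1 : ((min (j + 1) (N + 1) : ℕ) : ℝ) ≤ ((min j (N + 1) : ℕ) : ℝ) + 1 := by
    have : min (j + 1) (N + 1) ≤ min j (N + 1) + 1 := by omega
    exact_mod_cast this
  simp only [Grid.uniform]
  nlinarith

theorem Grid.exists_meshLe {a b : ℝ} (hab : a ≤ b) {h : ℝ} (hh : 0 < h) :
    ∃ G : Grid a b, G.MeshLe h := by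
  obtain ⟨N, hN⟩ := exists_nat_gt ((b - a) / h)
  refine ⟨Grid.uniform hab N, fun j => (Grid.uniform_meshLe hab N j).trans ?_⟩
  rw [div_le_iff₀ (by positivity)]
  rw [div_lt_iff₀ hh] at hN
  nlinarith

theorem Grid.exists_mem {a b : ℝ} (G : Grid a b) {r : ℝ} (hr : r ∈ Ioc a b) :
    ∃ j < G.N, r ∈ Ioc (G.t j) (G.t (j + 1)) := by
  apply Elementary.exists_mem_Ioc
  rwa [G.first, G.last _ le_rfl]

/-- Truncation of real numbers at `±K`. -/
noncomputable def clip (K x : ℝ) : ℝ := max (-K) (min K x)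

theorem continuous_clip (K : ℝ) : Continuous (clip K) := by unfold clip; fun_prop

theorem abs_clip_le {K : ℝ} (hK : 0 ≤ K) (x : ℝ) : |clip K x| ≤ K := by
  rw [abs_le]
  exact ⟨le_max_left _ _, max_le (by linarith) (min_le_left _ _)⟩

theorem clip_of_abs_le {K x : ℝ} (h : |x| ≤ K) : clip K x = x := by
  rw [abs_le] at h
  rw [clip, min_eq_right h.2, max_eq_right h.1]

/-! ### Itô integrals of adapted continuous processes -/

section ContinuousIntegrands

variable {Ω : Type*} [mΩ : MeasurableSpace Ω] {m : ℕ}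
variable {w : Fin m → ℝ≥0 → Ω → ℝ} {P : Measure Ω}

/-- Completeness: the integral exists if the integrand can be approximated by step processes. -/
theorem exists_itoLim [IsProbabilityMeasure P] (hw : IsBrownianMotion w P)
    {Φ : Fin m → ℝ → Ω → ℝ} (hΦ : PathMeas P Φ)
    (h : ∀ ε : ℝ, 0 < ε → ∃ S : Elementary w P,
      P {ω | ENNReal.ofReal ε ≤ sqDist S.val Φ ω} ≤ ENNReal.ofReal ε) : ∃ Y, ItoLim P w Φ Y := by
  -- At rate `8⁻ᵏ`, consecutive integrals differ by `2⁻ᵏ` or more with probability at most `2 * 8⁻ᵏ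
  -- + 4 * 8⁻ᵏ / 4⁻ᵏ ≤ 6 * 2⁻ᵏ`. These are summable, so by Borel–Cantelli the integrals converge
  -- almost surely.
  choose S hS using fun k : ℕ => h ((1 / 8 : ℝ) ^ k) (by positivity)
  have hdiff : ∀ k, P {ω | (1 / 2 : ℝ) ^ k ≤ |(S k).int ω - (S (k + 1)).int ω|} ≤
      ENNReal.ofReal (6 * (1 / 2 : ℝ) ^ k) := by
    intro k
    refine ((S k).measure_int_sub_le hw (S (k + 1)) hΦ (δ := (1 / 8) ^ k) (by positivity)
      (by positivity)).trans ?_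
    have h8 : (1 / 8 : ℝ) ^ k ≤ (1 / 2) ^ k := by gcongr; norm_num
    have h1 : P {ω | ENNReal.ofReal ((1 / 8) ^ k) ≤ sqDist (S (k + 1)).val Φ ω} ≤
        ENNReal.ofReal ((1 / 8 : ℝ) ^ k) := by
      have hle : (1 / 8 : ℝ) ^ (k + 1) ≤ (1 / 8 : ℝ) ^ k :=
        pow_le_pow_of_le_one (by norm_num) (by norm_num) (Nat.le_succ k)
      refine (measure_mono fun ω hω => ?_).trans ((hS (k + 1)).trans
        (ENNReal.ofReal_le_ofReal hle))
      exact (ENNReal.ofReal_le_ofReal hle).trans hω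
    have h2 : 4 * (1 / 8 : ℝ) ^ k / ((1 / 2) ^ k) ^ 2 = 4 * (1 / 2) ^ k := by
      rw [div_eq_iff (by positivity), mul_assoc, ← pow_mul, ← pow_add, show k + k * 2 = 3 * k by
          ring,
        pow_mul (1 / 2 : ℝ)]
      norm_num
    rw [h2]
    refine (add_le_add (add_le_add (hS k) h1) le_rfl).trans ?_
    rw [← ENNReal.ofReal_add (by positivity) (by positivity),
      ← ENNReal.ofReal_add (by positivity) (by positivity)]
    exact ENNReal.ofReal_le_ofReal (by linarith)
  have hsum : ∑' k, P {ω | (1 / 2 : ℝ) ^ k ≤ |(S k).int ω - (S (k + 1)).int ω|} ≠ ∞ := by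
    refine ne_top_of_le_ne_top ?_ (ENNReal.tsum_le_tsum hdiff)
    have hs : Summable fun k : ℕ => 6 * (1 / 2 : ℝ) ^ k :=
      (summable_geometric_of_lt_one (by norm_num) (by norm_num)).mul_left 6
    rw [← ENNReal.ofReal_tsum_of_nonneg (fun k => by positivity) hs]
    exact ENNReal.ofReal_ne_top
  have hae : ∀ᵐ ω ∂P, Tendsto (fun k => (S k).int ω) atTop
      (𝓝 (limUnder atTop fun k => (S k).int ω)) := by
    filter_upwards [ae_eventually_notMem hsum] with ω hω
    refine CauchySeq.tendsto_limUnder ?_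
    refine cauchySeq_of_summable_dist ?_
    refine Summable.of_norm_bounded_eventually_nat (g := fun k : ℕ => (1 / 2 : ℝ) ^ k)
      (summable_geometric_of_lt_one (by norm_num) (by norm_num)) ?_
    filter_upwards [hω] with k hk
    simp only [not_le] at hk
    rw [Real.norm_eq_abs, abs_of_nonneg dist_nonneg, Real.dist_eq]
    exact hk.le
  refine ⟨fun ω => limUnder atTop fun k => (S k).int ω, S, fun ε hε => ?_,
    tendstoInMeasure_of_tendsto_ae (fun k => ((S k).memLp_int hw).1) hae⟩
  have hlim : Tendsto (fun k : ℕ => ENNReal.ofReal ((1 / 8 : ℝ) ^ k)) atTop (𝓝 0) := by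
    rw [← ENNReal.ofReal_zero]
    exact ENNReal.tendsto_ofReal (tendsto_pow_atTop_nhds_zero_of_lt_one (by norm_num) (by norm_num))
  refine tendsto_of_tendsto_of_tendsto_of_le_of_le' tendsto_const_nhds hlim
    (Eventually.of_forall fun _ => zero_le) ?_
  filter_upwards [hlim.eventually (ge_mem_nhds hε)] with k hk
  refine le_trans (measure_mono fun ω hω => ?_) (hS k)
  exact hk.trans hω

/-- Adapted processes with almost surely continuous paths on `[a, b]`. -/
structure AdaptedContinuous (P : Measure Ω) (w : Fin m → ℝ≥0 → Ω → ℝ) (a b : ℝ)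
    (Φ : Fin m → ℝ → Ω → ℝ) : Prop where
  adapted : ∀ r ∈ Icc a b, ∀ i, StronglyMeasurable[augFiltration w P r] (Φ i r)
  cont : ∀ᵐ ω ∂P, ∀ i, ContinuousOn (fun r => Φ i r ω) (Icc a b)

/-- The restriction of a process to `(a, b]`. -/
noncomputable def restrictIoc (a b : ℝ) (Φ : Fin m → ℝ → Ω → ℝ) (i : Fin m) (r : ℝ) (ω : Ω) : ℝ :=
  (Ioc a b).indicator (fun r => Φ i r ω) r

theorem restrictIoc_of_mem {a b r : ℝ} (hr : r ∈ Ioc a b) (Φ : Fin m → ℝ → Ω → ℝ) (i : Fin m)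
    (ω : Ω) : restrictIoc a b Φ i r ω = Φ i r ω := indicator_of_mem hr _

theorem restrictIoc_of_notMem {a b r : ℝ} (hr : r ∉ Ioc a b) (Φ : Fin m → ℝ → Ω → ℝ) (i : Fin m)
    (ω : Ω) : restrictIoc a b Φ i r ω = 0 := indicator_of_notMem hr _

theorem pathMeas_restrictIoc {a b : ℝ} {Φ : Fin m → ℝ → Ω → ℝ}
    (h : ∀ᵐ ω ∂P, ∀ i, ContinuousOn (fun r => Φ i r ω) (Ioc a b)) :
    PathMeas P (restrictIoc a b Φ) := by
  filter_upwards [h] with ω hω i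
  exact (aemeasurable_indicator_iff measurableSet_Ioc).2 ((hω i).aemeasurable measurableSet_Ioc)

theorem AdaptedContinuous.pathMeas {a b : ℝ} {Φ : Fin m → ℝ → Ω → ℝ}
    (h : AdaptedContinuous P w a b Φ) : PathMeas P (restrictIoc a b Φ) :=
  pathMeas_restrictIoc (h.cont.mono fun _ hω i => (hω i).mono Ioc_subset_Icc_self)

theorem AdaptedContinuous.mono {a b a' b' : ℝ} {Φ : Fin m → ℝ → Ω → ℝ}
    (h : AdaptedContinuous P w a b Φ) (ha : a ≤ a') (hb : b' ≤ b) :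
    AdaptedContinuous P w a' b' Φ where
  adapted r hr := h.adapted r ⟨ha.trans hr.1, hr.2.trans hb⟩
  cont := h.cont.mono fun _ hω i => (hω i).mono (Icc_subset_Icc ha hb)

/-- The step process with coefficients `ξ` on a grid. -/
def Elementary.ofGrid {a b : ℝ} (ha : 0 ≤ a) (G : Grid a b) (ξ : ℕ → Fin m → Ω → ℝ)
    (hξ : ∀ j i, StronglyMeasurable[augFiltration w P (G.t j)] (ξ j i))
    (hb : ∃ C : ℝ, ∀ j i ω, |ξ j i ω| ≤ C) : Elementary w P where
  N := G.N
  t := G.t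
  mono := G.mono
  nonneg := by rw [G.first]; exact ha
  ξ := ξ
  adapted := hξ
  bounded := hb

/-- The sums `∑ⱼ ∑ᵢ Φⁱ(tⱼ) (wⁱ(tⱼ₊₁) - wⁱ(tⱼ))`. -/
def gridInt (w : Fin m → ℝ≥0 → Ω → ℝ) (Φ : Fin m → ℝ → Ω → ℝ) {a b : ℝ} (G : Grid a b) (ω : Ω) :
    ℝ :=
  ∑ j ∈ Finset.range G.N, ∑ i, Φ i (G.t j) ω * dW w i (G.t j) (G.t (j + 1)) ω

/-- A truncated and discretised process. -/
noncomputable def AdaptedContinuous.sample {a b : ℝ} {Φ : Fin m → ℝ → Ω → ℝ}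
    (h : AdaptedContinuous P w a b Φ) (ha : 0 ≤ a) (G : Grid a b) {K : ℝ} (hK : 0 ≤ K) :
    Elementary w P :=
  Elementary.ofGrid ha G (fun j i ω => clip K (Φ i (G.t j) ω))
    (fun j i => (continuous_clip K).comp_stronglyMeasurable (h.adapted _ (G.mem j) i))
    ⟨K, fun _ _ _ => abs_clip_le hK _⟩

/-- On an event of large probability the paths are bounded by `K`, so that truncation has no effect,
and they vary little over the cells of a fine grid. The event and the mesh do not depend on the
grid, which makes the convergence of the sums uniform over grids of small mesh. -/
theorem AdaptedContinuous.exists_good [IsProbabilityMeasure P] {a b : ℝ} (ha : 0 ≤ a)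
    (hab : a ≤ b) {Φ : Fin m → ℝ → Ω → ℝ} (hΦ : AdaptedContinuous P w a b Φ) {ε : ℝ} (hε : 0 < ε)
    {ρ : ℝ} (hρ : 0 < ρ) :
    ∃ h > 0, ∃ K, ∃ hK : 0 ≤ K, ∃ A, MeasurableSet A ∧ P Aᶜ ≤ ENNReal.ofReal ε ∧
      ∀ G : Grid a b, G.MeshLe h → ∀ ω ∈ A,
        sqDist (hΦ.sample ha G hK).val (restrictIoc a b Φ) ω ≤ ENNReal.ofReal ρ ∧
        (hΦ.sample ha G hK).int ω = gridInt w Φ G ω := by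
  have hm : ∀ r ∈ Icc a b, Measurable fun ω => (fun i => Φ i r ω : Fin m → ℝ) := fun r hr =>
    measurable_pi_lambda _ fun i => ((hΦ.adapted r hr i).mono (augFiltration_le _)).measurable
  have hc : ∀ᵐ ω ∂P, ContinuousOn (fun r => (fun i => Φ i r ω : Fin m → ℝ)) (Icc a b) := by
    filter_upwards [hΦ.cont] with ω hω
    exact continuousOn_pi.2 hω
  have hε2 : (0 : ℝ≥0∞) < ENNReal.ofReal (ε / 2) := by simpa using by positivity
  -- An oscillation of at most `√(ρ / c)` in each of `m` components over an interval of length `b -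
  -- a` costs at most `ρ`; the summand `1` keeps `c` positive if `m = 0` or `a = b`.
  set c : ℝ := m * (b - a) + 1 with hcdef
  have hc0 : 0 < c := by
    have : 0 ≤ (m : ℝ) * (b - a) := mul_nonneg (by positivity) (sub_nonneg.2 hab)
    positivity
  have hη : 0 < √(ρ / c) := Real.sqrt_pos.2 (by positivity)
  obtain ⟨h, hh, A₁, hA₁, hP₁, hmod⟩ := exists_modulus hm hc hη hε2
  obtain ⟨K, A₂, hA₂, hP₂, hbd⟩ := exists_bound hm hc hε2
  refine ⟨h, hh, K, Nat.cast_nonneg K, A₁ ∩ A₂, hA₁.inter hA₂, ?_, fun G hG ω hω => ⟨?_, ?_⟩⟩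
  · rw [compl_inter]
    refine (measure_union_le _ _).trans ((add_le_add hP₁ hP₂).trans ?_)
    rw [← ENNReal.ofReal_add (by positivity) (by positivity), add_halves]
  · have hclip : ∀ r ∈ Icc a b, ∀ i, clip K (Φ i r ω) = Φ i r ω := fun r hr i =>
      clip_of_abs_le ((norm_le_pi_norm (fun i => Φ i r ω) i).trans ((hbd ω hω.2).2 r hr))
    have hpt : ∀ r, ∑ i, ‖(hΦ.sample ha G (Nat.cast_nonneg K)).val i r ω -
        restrictIoc a b Φ i r ω‖ₑ ^ 2 ≤
        (Ioc a b).indicator (fun _ => (m : ℝ≥0∞) * ENNReal.ofReal (ρ / c)) r := by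
      intro r
      by_cases hr : r ∈ Ioc a b
      · obtain ⟨j, hj, hrj⟩ := G.exists_mem hr
        rw [indicator_of_mem hr]
        have : ∀ i ∈ (Finset.univ : Finset (Fin m)),
            ‖(hΦ.sample ha G (Nat.cast_nonneg K)).val i r ω - restrictIoc a b Φ i r ω‖ₑ ^ 2
            ≤ ENNReal.ofReal (ρ / c) := by
          intro i _
          rw [(hΦ.sample ha G (Nat.cast_nonneg K)).val_of_mem hj hrj, restrictIoc_of_mem hr]
          have e : (hΦ.sample ha G (Nat.cast_nonneg K)).ξ j i ω = Φ i (G.t j) ω :=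
            hclip _ (G.mem j) i
          rw [e, enorm_sq_eq]
          apply ENNReal.ofReal_le_ofReal
          have h1 := (hmod ω hω.1).2 (G.t j) (G.mem j) r (Ioc_subset_Icc_self hr) (by
            rw [abs_sub_comm, abs_of_nonneg (sub_nonneg.2 hrj.1.le)]
            exact (sub_le_sub_right hrj.2 _).trans (hG j))
          have h2 := (norm_le_pi_norm ((fun i => Φ i (G.t j) ω) - fun i => Φ i r ω) i).trans h1
          rw [← sq_abs, ← Real.sq_sqrt (show 0 ≤ ρ / c by positivity)]
          exact pow_le_pow_left₀ (abs_nonneg _) h2 2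
        refine (Finset.sum_le_sum this).trans ?_
        simp
      · rw [indicator_of_notMem hr]
        refine le_of_eq (Finset.sum_eq_zero fun i _ => ?_)
        rw [restrictIoc_of_notMem hr, (hΦ.sample ha G (Nat.cast_nonneg K)).val_of_notMem]
        · simp
        · change r ∉ Ioc (G.t 0) (G.t G.N)
          rwa [G.first, G.last _ le_rfl]
    refine (lintegral_mono hpt).trans ?_
    rw [lintegral_indicator measurableSet_Ioc, lintegral_const, Measure.restrict_apply_univ,
      Real.volume_Ioc, ← ENNReal.ofReal_natCast, ← ENNReal.ofReal_mul (by positivity),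
      ← ENNReal.ofReal_mul (by positivity)]
    apply ENNReal.ofReal_le_ofReal
    rw [mul_right_comm, mul_div_assoc', div_le_iff₀ hc0]
    nlinarith
  · have hclip : ∀ r ∈ Icc a b, ∀ i, clip K (Φ i r ω) = Φ i r ω := fun r hr i =>
      clip_of_abs_le ((norm_le_pi_norm (fun i => Φ i r ω) i).trans ((hbd ω hω.2).2 r hr))
    refine Finset.sum_congr rfl fun j _ => Finset.sum_congr rfl fun i _ => ?_
    change clip K (Φ i (G.t j) ω) * _ = _
    rw [hclip _ (G.mem j)]
    rfl

/-- The Itô integral of an adapted continuous process exists. -/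
theorem AdaptedContinuous.exists_itoLim [IsProbabilityMeasure P] (hw : IsBrownianMotion w P)
    {a b : ℝ} (ha : 0 ≤ a) (hab : a ≤ b) {Φ : Fin m → ℝ → Ω → ℝ}
    (hΦ : AdaptedContinuous P w a b Φ) : ∃ Y, ItoLim P w (restrictIoc a b Φ) Y := by
  refine ControlledDiffusion.exists_itoLim hw hΦ.pathMeas fun ε hε => ?_
  obtain ⟨h, hh, K, hK, A, -, hPA, hgood⟩ := hΦ.exists_good ha hab hε (half_pos hε)
  obtain ⟨G, hG⟩ := Grid.exists_meshLe hab hh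
  refine ⟨hΦ.sample ha G hK, (measure_mono fun ω hω hωA => ?_).trans hPA⟩
  have h1 := le_trans hω (hgood G hG ω hωA).1
  rw [ENNReal.ofReal_le_ofReal_iff (by positivity)] at h1
  linarith

/-- The Itô integral of an adapted continuous process is the limit of the sums `gridInt`. -/
theorem AdaptedContinuous.gridInt_tendsto [IsProbabilityMeasure P] (hw : IsBrownianMotion w P)
    {a b : ℝ} (ha : 0 ≤ a) (hab : a ≤ b) {Φ : Fin m → ℝ → Ω → ℝ}
    (hΦ : AdaptedContinuous P w a b Φ) {Y : Ω → ℝ} (hY : ItoLim P w (restrictIoc a b Φ) Y)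
    {ε : ℝ} (hε : 0 < ε) : ∃ h > 0, ∀ G : Grid a b, G.MeshLe h →
      P {ω | ε ≤ |gridInt w Φ G ω - Y ω|} ≤ ENNReal.ofReal ε := by
  -- Chosen so that the localised Chebyshev bound `4 * ρ / ε ^ 2` is `ε / 2`.
  set ρ : ℝ := ε / 2 * ε ^ 2 / 4 with hρ
  obtain ⟨h, hh, K, hK, A, hA, hPA, hgood⟩ := hΦ.exists_good ha hab (half_pos hε)
    (ρ := ρ) (by positivity)
  refine ⟨h, hh, fun G hG => ?_⟩
  set S := hΦ.sample ha G hK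
  have hsub := S.itoLim.sub hY S.pathMeas
  have h1 := hsub.measure_inter_le hw (S.pathMeas.sub hΦ.pathMeas) hA (δ := ρ) (ε := ε)
    (by positivity) hε (Eventually.of_forall fun ω hω => by
      simpa [sqDist] using (hgood G hG ω hω).1)
  have e : 4 * ρ / ε ^ 2 = ε / 2 := by rw [hρ]; field_simp
  rw [e] at h1
  calc P {ω | ε ≤ |gridInt w Φ G ω - Y ω|}
      ≤ P (Aᶜ ∪ A ∩ {ω | ε ≤ |S.int ω - Y ω|}) := by
        refine measure_mono fun ω hω => ?_
        by_cases hωA : ω ∈ A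
        · refine Or.inr ⟨hωA, ?_⟩
          simp only [mem_ofPred_eq] at hω ⊢
          rwa [(hgood G hG ω hωA).2]
        · exact Or.inl hωA
    _ ≤ ENNReal.ofReal (ε / 2) + ENNReal.ofReal (ε / 2) :=
        (measure_union_le _ _).trans (add_le_add hPA h1)
    _ = ENNReal.ofReal ε := by
        rw [← ENNReal.ofReal_add (by positivity) (by positivity), add_halves]

end ContinuousIntegrands

/-! ### Taylor estimates for one step of Itô's formula -/

section Deterministic

variable {n m : ℕ}

theorem exists_bound_on_ball {G : Type*} [NormedAddCommGroup G] {a b : ℝ} {f : ℝ → E n → G}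
    (hf : ContinuousOn (fun q : ℝ × E n => f q.1 q.2) (Icc a b ×ˢ univ)) (K : ℝ) :
    ∃ C, 0 ≤ C ∧ ∀ r ∈ Icc a b, ∀ x, ‖x‖ ≤ K → ‖f r x‖ ≤ C := by
  have hc : IsCompact (Icc a b ×ˢ Metric.closedBall (0 : E n) K) :=
    isCompact_Icc.prod (isCompact_closedBall _ _)
  obtain ⟨C, hC⟩ := hc.exists_bound_of_continuousOn
    (hf.mono (prod_mono_right (subset_univ _)))
  refine ⟨max C 0, le_max_right _ _, fun r hr x hx => (hC (r, x) ⟨hr, ?_⟩).trans (le_max_left _ _)⟩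
  simpa using hx

theorem exists_modulus_on_ball {G : Type*} [NormedAddCommGroup G] {a b : ℝ} {f : ℝ → E n → G}
    (hf : ContinuousOn (fun q : ℝ × E n => f q.1 q.2) (Icc a b ×ˢ univ)) (K : ℝ) {ε : ℝ}
    (hε : 0 < ε) : ∃ δ > 0, ∀ r ∈ Icc a b, ∀ s ∈ Icc a b, ∀ x y, ‖x‖ ≤ K → ‖y‖ ≤ K →
      |r - s| ≤ δ → ‖x - y‖ ≤ δ → ‖f r x - f s y‖ ≤ ε := by
  have hc : IsCompact (Icc a b ×ˢ Metric.closedBall (0 : E n) K) :=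
    isCompact_Icc.prod (isCompact_closedBall _ _)
  have huc := hc.uniformContinuousOn_of_continuous (hf.mono (prod_mono_right (subset_univ _)))
  rw [Metric.uniformContinuousOn_iff_le] at huc
  obtain ⟨δ, hδ, h⟩ := huc ε hε
  refine ⟨δ, hδ, fun r hr s hs x y hx hy hrs hxy => ?_⟩
  have := h (r, x) ⟨hr, by simpa using hx⟩ (s, y) ⟨hs, by simpa using hy⟩ (by
    rw [Prod.dist_eq]
    exact max_le (by rwa [Real.dist_eq]) (by rwa [dist_eq_norm]))
  rwa [dist_eq_norm] at this

/-- `V` has the continuous derivatives `vt = V_t`, `p = V_x` and `H = V_xx` on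
`[a, b] × ℝⁿ`. -/
structure C12On (a b : ℝ) (V : ℝ → E n → ℝ) (vt : ℝ → E n → ℝ) (p : ℝ → E n → E n)
    (H : ℝ → E n → E n →L[ℝ] E n) : Prop where
  deriv_t : ∀ r ∈ Icc a b, ∀ x, HasDerivWithinAt (fun r => V r x) (vt r x) (Icc a b) r
  deriv_x : ∀ r ∈ Icc a b, ∀ x, HasGradientAt (V r) (p r x) x
  deriv_xx : ∀ r ∈ Icc a b, ∀ x, HasFDerivAt (p r) (H r x) x
  cont_t : ContinuousOn (fun q : ℝ × E n => vt q.1 q.2) (Icc a b ×ˢ univ)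
  cont_x : ContinuousOn (fun q : ℝ × E n => p q.1 q.2) (Icc a b ×ˢ univ)
  cont_xx : ContinuousOn (fun q : ℝ × E n => H q.1 q.2) (Icc a b ×ˢ univ)

/-- The mean value inequality is applied twice along the segment: to `z ↦ p z - H x z`, and then to
`V` minus its quadratic expansion. The constant `ε` in place of `ε / 2` is good enough. -/
theorem abs_taylor_two_le {V : E n → ℝ} {p : E n → E n} {H : E n → E n →L[ℝ] E n}
    (hV : ∀ x, HasGradientAt V (p x) x) (hp : ∀ x, HasFDerivAt p (H x) x) {x y : E n} {ε : ℝ}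
    (hH : ∀ z ∈ segment ℝ x y, ‖H z - H x‖ ≤ ε) :
    |V y - V x - inner ℝ (p x) (y - x) - 1 / 2 * inner ℝ (H x (y - x)) (y - x)| ≤
      ε * ‖y - x‖ ^ 2 := by
  set v := y - x with hv
  have hε : 0 ≤ ε := (norm_nonneg _).trans (hH x (left_mem_segment ℝ x y))
  have hseg : ∀ l ∈ Icc (0 : ℝ) 1, x + l • v ∈ segment ℝ x y := by
    intro l hl
    rw [segment_eq_image']
    exact ⟨l, hl, rfl⟩
  have h1 : ∀ l ∈ Icc (0 : ℝ) 1, ‖p (x + l • v) - p x - l • H x v‖ ≤ ε * ‖v‖ := by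
    intro l hl
    have h := (convex_segment x y).norm_image_sub_le_of_norm_hasFDerivWithin_le
      (f := fun z => p z - H x z) (f' := fun z => H z - H x) (C := ε)
      (fun z _ => ((hp z).sub (H x).hasFDerivAt).hasFDerivWithinAt) hH
      (left_mem_segment ℝ x y) (hseg l hl)
    have e : p (x + l • v) - H x (x + l • v) - (p x - H x x) = p (x + l • v) - p x - l • H x v := by
      rw [map_add, map_smul]; abel
    rw [e] at h
    refine h.trans ?_
    rw [add_sub_cancel_left, norm_smul, Real.norm_eq_abs, abs_of_nonneg hl.1]
    have : l * ‖v‖ ≤ ‖v‖ := mul_le_of_le_one_left (norm_nonneg _) hl.2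
    gcongr
  have hder : ∀ l ∈ Icc (0 : ℝ) 1, HasDerivWithinAt
      (fun l : ℝ => V (x + l • v) - l * inner ℝ (p x) v - 1 / 2 * l ^ 2 * inner ℝ (H x v) v)
      (inner ℝ (p (x + l • v) - p x - l • H x v) v) (Icc 0 1) l := by
    intro l _
    have a1 : HasDerivAt (fun l : ℝ => x + l • v) v l := by
      simpa using ((hasDerivAt_id l).smul_const v).const_add x
    have a2 : HasDerivAt (fun l : ℝ => V (x + l • v)) (inner ℝ (p (x + l • v)) v) l := by
      have := (hV (x + l • v)).hasFDerivAt.comp_hasDerivAt l a1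
      refine HasDerivAt.congr_deriv this ?_
      simp
    have a3 : HasDerivAt (fun l : ℝ => l * inner ℝ (p x) v) (inner ℝ (p x) v) l := by
      simpa using (hasDerivAt_id l).mul_const (inner ℝ (p x) v)
    have a4 : HasDerivAt (fun l : ℝ => 1 / 2 * l ^ 2 * inner ℝ (H x v) v)
        (l * inner ℝ (H x v) v) l := by
      have := (((hasDerivAt_id l).pow 2).const_mul (1 / 2 : ℝ)).mul_const (inner ℝ (H x v) v)
      refine this.congr_deriv ?_
      simp
    refine ((a2.sub a3).sub a4).hasDerivWithinAt.congr_deriv ?_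
    rw [inner_sub_left, inner_sub_left, inner_smul_left]
    simp
  have hmv := (convex_Icc (0 : ℝ) 1).norm_image_sub_le_of_norm_hasDerivWithin_le hder
    (C := ε * ‖v‖ ^ 2) (fun l hl => by
      refine (norm_inner_le_norm _ _).trans ?_
      have := mul_le_mul_of_nonneg_right (h1 l hl) (norm_nonneg v)
      nlinarith) (left_mem_Icc.2 zero_le_one) (right_mem_Icc.2 zero_le_one)
  have e : x + v = y := by rw [hv]; abel
  simp only [one_smul, zero_smul, add_zero, e, Real.norm_eq_abs, sub_zero] at hmv
  convert hmv using 1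
  · congr 1; ring
  · simp

/-- The one step error in the proof of Itô's formula. -/
theorem abs_ito_step_le {a b : ℝ} {V vt tr : ℝ → E n → ℝ} {p : ℝ → E n → E n}
    {H : ℝ → E n → E n →L[ℝ] E n} (hV : C12On a b V vt p H)
    (htr : ContinuousOn (fun q : ℝ × E n => tr q.1 q.2) (Icc a b ×ˢ univ))
    {x β : ℝ → E n} (hx : ContinuousOn x (Icc a b)) (hβ : IntegrableOn β (Icc a b))
    {t₀ t₁ : ℝ} (h0 : a ≤ t₀) (h01 : t₀ ≤ t₁) (h1 : t₁ ≤ b) {ε C : ℝ} (hε : 0 < ε)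
    (hvt' : ∀ r ∈ Icc t₀ t₁, |vt r (x t₁) - vt r (x r)| ≤ ε)
    (hp' : ∀ r ∈ Icc t₀ t₁, ‖p t₀ (x t₀) - p r (x r)‖ ≤ ε)
    (htr' : ∀ r ∈ Icc t₀ t₁, |tr t₀ (x t₀) - tr r (x r)| ≤ ε)
    (hH : ∀ z ∈ segment ℝ (x t₀) (x t₁), ‖H t₀ z - H t₀ (x t₀)‖ ≤ ε)
    (hC : ‖H t₀ (x t₀)‖ ≤ C) (D : E n) :
    |V t₁ (x t₁) - V t₀ (x t₀)
      - (∫ r in t₀..t₁, (vt r (x r) + inner ℝ (p r (x r)) (β r) + 1 / 2 * tr r (x r)))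
      - inner ℝ (p t₀ (x t₀)) (x t₁ - x t₀ - ∫ r in t₀..t₁, β r)
      - 1 / 2 * (inner ℝ (H t₀ (x t₀) D) D - tr t₀ (x t₀) * (t₁ - t₀))| ≤
    ε * (2 * (t₁ - t₀) + (∫ r in t₀..t₁, ‖β r‖) + 3 * ‖D‖ ^ 2)
      + (2 * ε + C ^ 2 / ε + C) * ‖x t₁ - x t₀ - D‖ ^ 2 := by
  -- The increment of `V` is split at `(t₁, x t₁)`, `(t₀, x t₁)`, `(t₀, x t₀)`. The change in time
  -- is an integral of `vt` with the state frozen at `x t₁`; the change in space is a second order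
  -- Taylor expansion at `(t₀, x t₀)`, in whose quadratic term the increment is replaced by its
  -- noise part `D`.
  have hsub : Icc t₀ t₁ ⊆ Icc a b := Icc_subset_Icc h0 h1
  have hC0 : 0 ≤ C := (norm_nonneg _).trans hC
  have hxI : ContinuousOn x (Icc t₀ t₁) := hx.mono hsub
  have hpath : ∀ {G : Type} [NormedAddCommGroup G] {f : ℝ → E n → G},
      ContinuousOn (fun q : ℝ × E n => f q.1 q.2) (Icc a b ×ˢ univ) →
      ContinuousOn (fun r => f r (x r)) (Icc t₀ t₁) := fun hf =>
    hf.comp (continuousOn_id.prodMk hxI) fun r hr => ⟨hsub hr, mem_univ _⟩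
  have hconst : ∀ {G : Type} [NormedAddCommGroup G] {f : ℝ → E n → G} (y : E n),
      ContinuousOn (fun q : ℝ × E n => f q.1 q.2) (Icc a b ×ˢ univ) →
      ContinuousOn (fun r => f r y) (Icc t₀ t₁) := fun y hf =>
    hf.comp (continuousOn_id.prodMk continuousOn_const) fun r hr => ⟨hsub hr, mem_univ _⟩
  have ivt := (hpath hV.cont_t).intervalIntegrable_of_Icc h01 (μ := volume)
  have ivt1 := (hconst (x t₁) hV.cont_t).intervalIntegrable_of_Icc h01 (μ := volume)
  have itr := (hpath htr).intervalIntegrable_of_Icc h01 (μ := volume)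
  have iβ : IntervalIntegrable β volume t₀ t₁ :=
    (intervalIntegrable_iff_integrableOn_Icc_of_le h01).2 (hβ.mono_set hsub)
  have ipβ : IntervalIntegrable (fun r => inner ℝ (p r (x r)) (β r)) volume t₀ t₁ := by
    rw [intervalIntegrable_iff_integrableOn_Icc_of_le h01]
    obtain ⟨C', hC'⟩ := isCompact_Icc.exists_bound_of_continuousOn (hpath hV.cont_x)
    refine (innerSL ℝ : E n →L[ℝ] E n →L[ℝ] ℝ).integrable_of_bilin_of_bdd_left C' ?_ ?_
      (hβ.mono_set hsub)
    · exact (hpath hV.cont_x).aestronglyMeasurable measurableSet_Icc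
    · filter_upwards [ae_restrict_mem measurableSet_Icc] with r hr
      exact hC' r hr
  have ip0β : IntervalIntegrable (fun r => inner ℝ (p t₀ (x t₀)) (β r)) volume t₀ t₁ :=
    ⟨iβ.1.const_inner _, iβ.2.const_inner _⟩
  -- the time derivative
  have eFTC : ∫ r in t₀..t₁, vt r (x t₁) = V t₁ (x t₁) - V t₀ (x t₁) := by
    refine intervalIntegral.integral_eq_sub_of_hasDerivAt_of_le (f := fun r => V r (x t₁)) h01 ?_
        ?_ ivt1
    · exact fun r hr => ((hV.deriv_t r (hsub hr) (x t₁)).mono hsub).continuousWithinAt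
    · intro r hr
      exact (hV.deriv_t r (hsub (Ioo_subset_Icc_self hr)) (x t₁)).hasDerivAt
        (mem_of_superset (Ioo_mem_nhds hr.1 hr.2) (Ioo_subset_Icc_self.trans hsub))
  have eβ : ∫ r in t₀..t₁, inner ℝ (p t₀ (x t₀)) (β r) =
      inner ℝ (p t₀ (x t₀)) (∫ r in t₀..t₁, β r) :=
    ((innerSL ℝ (p t₀ (x t₀))).intervalIntegral_comp_comm iβ)
  have b1 : |∫ r in t₀..t₁, (vt r (x t₁) - vt r (x r))| ≤ ε * (t₁ - t₀) := by
    have := intervalIntegral.norm_integral_le_of_norm_le_const (a := t₀) (b := t₁)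
      (f := fun r => vt r (x t₁) - vt r (x r)) (C := ε) (fun r hr => by
        rw [uIoc_of_le h01] at hr
        exact hvt' r (Ioc_subset_Icc_self hr))
    rwa [abs_of_nonneg (sub_nonneg.2 h01)] at this
  have b3 : |∫ r in t₀..t₁, (tr t₀ (x t₀) - tr r (x r))| ≤ ε * (t₁ - t₀) := by
    have := intervalIntegral.norm_integral_le_of_norm_le_const (a := t₀) (b := t₁)
      (f := fun r => tr t₀ (x t₀) - tr r (x r)) (C := ε) (fun r hr => by
        rw [uIoc_of_le h01] at hr
        exact htr' r (Ioc_subset_Icc_self hr))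
    rwa [abs_of_nonneg (sub_nonneg.2 h01)] at this
  have b2 : |∫ r in t₀..t₁, (inner ℝ (p t₀ (x t₀)) (β r) - inner ℝ (p r (x r)) (β r))| ≤
      ε * ∫ r in t₀..t₁, ‖β r‖ := by
    rw [← intervalIntegral.integral_const_mul, ← Real.norm_eq_abs]
    refine intervalIntegral.norm_integral_le_of_norm_le h01 ?_ (iβ.norm.const_mul ε)
    refine Eventually.of_forall fun r hr => ?_
    rw [← inner_sub_left]
    exact (norm_inner_le_norm _ _).trans
      (mul_le_mul_of_nonneg_right (hp' r (Ioc_subset_Icc_self hr)) (norm_nonneg _))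
  rw [intervalIntegral.integral_sub ivt1 ivt, eFTC] at b1
  rw [intervalIntegral.integral_sub (by simp) itr, intervalIntegral.integral_const] at b3
  rw [intervalIntegral.integral_sub ip0β ipβ, eβ] at b2
  rw [intervalIntegral.integral_add (ivt.add ipβ) (itr.const_mul _),
    intervalIntegral.integral_add ivt ipβ, intervalIntegral.integral_const_mul]
  have bT := abs_taylor_two_le (hV.deriv_x t₀ (hsub (left_mem_Icc.2 h01)))
    (hV.deriv_xx t₀ (hsub (left_mem_Icc.2 h01))) hH
  set Hx := H t₀ (x t₀)
  set Δ := x t₁ - x t₀ with hΔ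
  set F := Δ - D with hF
  have eΔ : Δ = D + F := by rw [hF]; abel
  have bq : |inner ℝ (Hx Δ) Δ - inner ℝ (Hx D) D| ≤ ε * ‖D‖ ^ 2 + (C ^ 2 / ε + C) * ‖F‖ ^ 2 := by
    have e : inner ℝ (Hx Δ) Δ - inner ℝ (Hx D) D =
        inner ℝ (Hx F) D + inner ℝ (Hx D) F + inner ℝ (Hx F) F := by
      rw [eΔ, map_add, inner_add_left, inner_add_right, inner_add_right]; ring
    have hb : ∀ y z : E n, |inner ℝ (Hx y) z| ≤ C * ‖y‖ * ‖z‖ := fun y z =>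
      (abs_real_inner_le_norm _ _).trans (mul_le_mul_of_nonneg_right
        ((Hx.le_opNorm y).trans (mul_le_mul_of_nonneg_right hC (norm_nonneg _))) (norm_nonneg _))
    have h3 : |inner ℝ (Hx Δ) Δ - inner ℝ (Hx D) D| ≤
        C * ‖F‖ * ‖D‖ + C * ‖D‖ * ‖F‖ + C * ‖F‖ * ‖F‖ := by
      rw [e]
      exact (abs_add_three _ _ _).trans (add_le_add (add_le_add (hb _ _) (hb _ _)) (hb _ _))
    -- Young's inequality puts the small weight on `‖D‖ ^ 2`, whose sum over a grid is merely
    -- bounded, and the large one on `‖F‖ ^ 2`, whose sum will be of order `ε ^ 2`.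
    have h4 : 2 * (C * ‖F‖) * ‖D‖ ≤ ε * ‖D‖ ^ 2 + C ^ 2 / ε * ‖F‖ ^ 2 := by
      have h5 : ε * ‖D‖ ^ 2 + C ^ 2 / ε * ‖F‖ ^ 2 - 2 * (C * ‖F‖) * ‖D‖ =
          (ε * ‖D‖ - C * ‖F‖) ^ 2 / ε := by field_simp; ring
      have h6 : 0 ≤ (ε * ‖D‖ - C * ‖F‖) ^ 2 / ε := by positivity
      linarith
    nlinarith
  have bΔ : ‖Δ‖ ^ 2 ≤ 2 * ‖D‖ ^ 2 + 2 * ‖F‖ ^ 2 := by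
    have h5 : ‖Δ‖ ≤ ‖D‖ + ‖F‖ := by rw [eΔ]; exact norm_add_le _ _
    nlinarith [sq_nonneg (‖D‖ - ‖F‖), norm_nonneg Δ]
  have bΔ' := mul_le_mul_of_nonneg_left bΔ hε.le
  rw [inner_sub_right]
  rw [smul_eq_mul] at b3
  rw [abs_le] at b1 b2 b3 bT bq ⊢
  have hD2 : 0 ≤ ε * ‖D‖ ^ 2 := by positivity
  have hF2 : 0 ≤ (C ^ 2 / ε + C) * ‖F‖ ^ 2 := by positivity
  have hdt : 0 ≤ ε * (t₁ - t₀) := mul_nonneg hε.le (sub_nonneg.2 h01)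
  constructor <;> linarith [b1.1, b1.2, b2.1, b2.2, b3.1, b3.2, bT.1, bT.2, bq.1, bq.2]

end Deterministic

/-! ### Truncation to a ball -/

section Projection

variable {n : ℕ}

/-- The truncation of vectors to the closed ball of radius `K`. -/
noncomputable def proj (K : ℝ) (x : E n) : E n := (K / max K ‖x‖) • x

theorem continuous_proj {K : ℝ} (hK : 0 < K) : Continuous (proj K : E n → E n) := by
  have h : ∀ x : E n, max K ‖x‖ ≠ 0 := fun x => (lt_max_of_lt_left hK).ne'
  exact (continuous_const.div (continuous_const.max continuous_norm) h).smul continuous_id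

theorem norm_proj_le {K : ℝ} (hK : 0 < K) (x : E n) : ‖proj K x‖ ≤ K := by
  have h : 0 < max K ‖x‖ := lt_max_of_lt_left hK
  rw [proj, norm_smul, Real.norm_eq_abs, abs_of_nonneg (by positivity), div_mul_eq_mul_div,
    div_le_iff₀ h]
  exact mul_le_mul_of_nonneg_left (le_max_right _ _) hK.le

theorem proj_of_norm_le {K : ℝ} (hK : 0 < K) {x : E n} (h : ‖x‖ ≤ K) : proj K x = x := by
  rw [proj, max_eq_left h, div_self hK.ne', one_smul]

end Projection

/-! ### Itô processes and the first order approximation of their noise -/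

section ItoProcesses

variable {Ω : Type*} [mΩ : MeasurableSpace Ω] {n m : ℕ}
variable {w : Fin m → ℝ≥0 → Ω → ℝ} {P : Measure Ω}

theorem sqDist_le_of_abs_le {Φ Ψ : Fin m → ℝ → Ω → ℝ} {ω : Ω} {a b η : ℝ}
    (h0 : ∀ r ∉ Ioc a b, ∀ i, Φ i r ω = Ψ i r ω)
    (h : ∀ r ∈ Ioc a b, ∀ i, |Φ i r ω - Ψ i r ω| ≤ η) :
    sqDist Φ Ψ ω ≤ ENNReal.ofReal (m * η ^ 2 * (b - a)) := by
  have hpt : ∀ r, ∑ i, ‖Φ i r ω - Ψ i r ω‖ₑ ^ 2 ≤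
      (Ioc a b).indicator (fun _ => (m : ℝ≥0∞) * ENNReal.ofReal (η ^ 2)) r := by
    intro r
    by_cases hr : r ∈ Ioc a b
    · rw [indicator_of_mem hr]
      have : ∀ i ∈ (Finset.univ : Finset (Fin m)), ‖Φ i r ω - Ψ i r ω‖ₑ ^ 2
          ≤ ENNReal.ofReal (η ^ 2) := by
        intro i _
        rw [enorm_sq_eq, ← sq_abs]
        exact ENNReal.ofReal_le_ofReal (pow_le_pow_left₀ (abs_nonneg _) (h r hr i) 2)
      refine (Finset.sum_le_sum this).trans ?_
      simp
    · rw [indicator_of_notMem hr]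
      refine le_of_eq (Finset.sum_eq_zero fun i _ => ?_)
      rw [h0 r hr i]
      simp
  refine (lintegral_mono hpt).trans ?_
  rw [lintegral_indicator measurableSet_Ioc, lintegral_const, Measure.restrict_apply_univ,
    Real.volume_Ioc, ← ENNReal.ofReal_natCast, ← ENNReal.ofReal_mul (by positivity),
    ← ENNReal.ofReal_mul (by positivity)]

/-- The step process `ξ 1_{(a, b]}`. -/
noncomputable def Elementary.single {a b : ℝ} (ha : 0 ≤ a) (hab : a ≤ b) (ξ : Fin m → Ω → ℝ)
    (hξ : ∀ i, StronglyMeasurable[augFiltration w P a] (ξ i))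
    (hb : ∃ C : ℝ, ∀ i ω, |ξ i ω| ≤ C) : Elementary w P where
  N := 1
  t j := if j = 0 then a else b
  mono := by
    intro i j hij
    by_cases hi : i = 0 <;> by_cases hj : j = 0 <;> simp [hi, hj, hab]
    omega
  nonneg := by simpa using ha
  ξ j i ω := ξ i ω
  adapted j i := (hξ i).mono (augFiltration_mono (by split_ifs <;> simp [hab]))
  bounded := by
    obtain ⟨C, hC⟩ := hb
    exact ⟨C, fun _ i ω => hC i ω⟩

theorem itoLim_single {a b : ℝ} (ha : 0 ≤ a) (hab : a ≤ b) (ξ : Fin m → Ω → ℝ)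
    (hξ : ∀ i, StronglyMeasurable[augFiltration w P a] (ξ i))
    (hb : ∃ C : ℝ, ∀ i ω, |ξ i ω| ≤ C) :
    ItoLim P w (restrictIoc a b fun i _ ω => ξ i ω) (fun ω => ∑ i, ξ i ω * dW w i a b ω) := by
  have h := (Elementary.single ha hab ξ hξ hb).itoLim
  have e1 : (Elementary.single ha hab ξ hξ hb).val = restrictIoc a b fun i _ ω => ξ i ω := by
    funext i r ω
    simp [Elementary.val, Elementary.single, restrictIoc]
  have e2 : (Elementary.single ha hab ξ hξ hb).int = fun ω => ∑ i, ξ i ω * dW w i a b ω := by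
    funext ω
    simp [Elementary.int, Elementary.incr, Elementary.single]
  rwa [e1, e2] at h

/-- The case `δ = 0` is obtained by enlarging `δ` by `τ / 4` and letting `τ` tend to zero; it occurs
for intervals of length zero and for constant `σ`. -/
theorem ItoLim.lintegral_sq_le_of_nonneg [IsProbabilityMeasure P] (hw : IsBrownianMotion w P)
    {Φ : Fin m → ℝ → Ω → ℝ} {Y : Ω → ℝ} (hY : ItoLim P w Φ Y) (hΦ : PathMeas P Φ) {A : Set Ω}
    (hA : MeasurableSet A) {δ : ℝ} (hδ : 0 ≤ δ)
    (hle : ∀ᵐ ω ∂P, ω ∈ A → sqDist Φ (fun _ _ _ => 0) ω ≤ ENNReal.ofReal δ) :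
    ∫⁻ ω in A, ‖Y ω‖ₑ ^ 2 ∂P ≤ ENNReal.ofReal (4 * δ) := by
  refine ENNReal.le_of_forall_pos_le_add fun τ hτ _ => ?_
  have h := hY.lintegral_sq_le hw hΦ hA (δ := δ + τ / 4) (by positivity) (hle.mono fun ω h h' =>
    (h h').trans (ENNReal.ofReal_le_ofReal (by linarith [τ.coe_nonneg])))
  refine h.trans ?_
  rw [show 4 * (δ + (τ : ℝ) / 4) = 4 * δ + τ by ring, ENNReal.ofReal_add (by positivity) (by simp),
    ENNReal.ofReal_coe_nnreal]

/-- The part `X_r - ∫₀ʳ β_s ds` of a process with drift `β`. -/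
noncomputable def mart (X β : ℝ → Ω → E n) (r : ℝ) (ω : Ω) : E n :=
  X r ω - ∫ s in (0 : ℝ)..r, β s ω

/-- `X` solves `dX = β dt + ∑ᵢ σⁱ(t, X) dwⁱ` on `[0, T]`. -/
structure IsItoProcess (P : Measure Ω) (w : Fin m → ℝ≥0 → Ω → ℝ) (T : ℝ)
    (σ : Fin m → ℝ → E n → E n) (β X : ℝ → Ω → E n) : Prop where
  nonneg : 0 ≤ T
  continuous_σ : ∀ i, ContinuousOn (fun q : ℝ × E n => σ i q.1 q.2) (Icc 0 T ×ˢ univ)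
  adapted : ∀ r ∈ Icc 0 T, StronglyMeasurable[augFiltration w P r] (X r)
  cont : ∀ᵐ ω ∂P, ContinuousOn (fun r => X r ω) (Icc 0 T)
  integrable : ∀ᵐ ω ∂P, IntegrableOn (fun r => β r ω) (Icc 0 T)
  measurable_mart : ∀ r ∈ Icc 0 T, Measurable (mart X β r)
  measurable_var : ∀ r ∈ Icc 0 T, Measurable fun ω => ∫ s in (0 : ℝ)..r, ‖β s ω‖
  ito : ∀ s t, 0 ≤ s → s ≤ t → t ≤ T → ∀ L : E n →L[ℝ] ℝ,
    ItoLim P w (restrictIoc s t fun i r ω => L (σ i r (X r ω)))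
      (fun ω => L (mart X β t ω - mart X β s ω))

namespace IsItoProcess

variable {T : ℝ} {σ : Fin m → ℝ → E n → E n} {β X : ℝ → Ω → E n}

theorem continuousOn_comp {G : Type*} [NormedAddCommGroup G] {a b : ℝ} {f : ℝ → E n → G}
    (hf : ContinuousOn (fun q : ℝ × E n => f q.1 q.2) (Icc a b ×ˢ univ)) {x : ℝ → E n}
    (hx : ContinuousOn x (Icc a b)) : ContinuousOn (fun r => f r (x r)) (Icc a b) :=
  hf.comp (continuousOn_id.prodMk hx) fun _ hr => ⟨hr, mem_univ _⟩

theorem continuous_slice {G : Type*} [NormedAddCommGroup G] {a b : ℝ} {f : ℝ → E n → G}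
    (hf : ContinuousOn (fun q : ℝ × E n => f q.1 q.2) (Icc a b ×ˢ univ)) {r : ℝ}
    (hr : r ∈ Icc a b) : Continuous (f r) := by
  rw [← continuousOn_univ]
  exact hf.comp (continuousOn_const.prodMk continuousOn_id) fun x _ => ⟨hr, mem_univ _⟩

/-- Continuous functions of the state are adapted and continuous. -/
theorem adaptedContinuous (hX : IsItoProcess P w T σ β X) {a b : ℝ} (ha : 0 ≤ a) (hb : b ≤ T)
    {f : Fin m → ℝ → E n → ℝ}
    (hf : ∀ i, ContinuousOn (fun q : ℝ × E n => f i q.1 q.2) (Icc a b ×ˢ univ)) :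
    AdaptedContinuous P w a b (fun i r ω => f i r (X r ω)) where
  adapted r hr i := (continuous_slice (hf i) hr).comp_stronglyMeasurable
    (hX.adapted r ⟨ha.trans hr.1, hr.2.trans hb⟩)
  cont := by
    filter_upwards [hX.cont] with ω hω i
    exact continuousOn_comp (hf i) (hω.mono (Icc_subset_Icc ha hb))

theorem mart_sub (ω : Ω) (hβ : IntegrableOn (fun r => β r ω) (Icc 0 T)) {s t : ℝ}
    (hs : 0 ≤ s) (hst : s ≤ t) (ht : t ≤ T) :
    mart X β t ω - mart X β s ω = X t ω - X s ω - ∫ r in s..t, β r ω := by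
  have h1 : ∀ r ∈ Icc 0 T, IntervalIntegrable (fun r => β r ω) volume 0 r := fun r hr =>
    (intervalIntegrable_iff_integrableOn_Icc_of_le hr.1).2
      (hβ.mono_set (Icc_subset_Icc le_rfl hr.2))
  rw [← intervalIntegral.integral_interval_sub_left (h1 t ⟨hs.trans hst, ht⟩)
    (h1 s ⟨hs, hst.trans ht⟩), mart, mart]
  abel

theorem var_sub (ω : Ω) (hβ : IntegrableOn (fun r => β r ω) (Icc 0 T)) {s t : ℝ}
    (hs : 0 ≤ s) (hst : s ≤ t) (ht : t ≤ T) :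
    (∫ r in (0 : ℝ)..t, ‖β r ω‖) - ∫ r in (0 : ℝ)..s, ‖β r ω‖ = ∫ r in s..t, ‖β r ω‖ := by
  have h1 : ∀ r ∈ Icc 0 T, IntervalIntegrable (fun r => ‖β r ω‖) volume 0 r := fun r hr =>
    (intervalIntegrable_iff_integrableOn_Icc_of_le hr.1).2
      (hβ.mono_set (Icc_subset_Icc le_rfl hr.2)).norm
  exact intervalIntegral.integral_interval_sub_left (h1 t ⟨hs.trans hst, ht⟩)
    (h1 s ⟨hs, hst.trans ht⟩)

theorem continuousOn_var (hT : 0 ≤ T) (ω : Ω) (hβ : IntegrableOn (fun r => β r ω) (Icc 0 T)) :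
    ContinuousOn (fun t => ∫ r in (0 : ℝ)..t, ‖β r ω‖) (Icc 0 T) := by
  have h := intervalIntegral.continuousOn_primitive_interval (f := fun r => ‖β r ω‖)
    (a := 0) (b := T) (μ := volume) (by rw [uIcc_of_le hT]; exact hβ.norm)
  rwa [uIcc_of_le hT] at h

/-- With large probability the state, the drift and the path of the drift are bounded. -/
theorem exists_bound_event [IsProbabilityMeasure P] (hX : IsItoProcess P w T σ β X) {ε : ℝ}
    (hε : 0 < ε) : ∃ K > 0, ∃ A, MeasurableSet A ∧ P Aᶜ ≤ ENNReal.ofReal ε ∧ ∀ ω ∈ A,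
      ContinuousOn (fun r => X r ω) (Icc 0 T) ∧ IntegrableOn (fun r => β r ω) (Icc 0 T) ∧
      (∀ r ∈ Icc 0 T, ‖X r ω‖ ≤ K) ∧ ∫ r in (0 : ℝ)..T, ‖β r ω‖ ≤ K := by
  have hε2 : (0 : ℝ≥0∞) < ENNReal.ofReal (ε / 2) := by simpa using by positivity
  have hm : ∀ r ∈ Icc 0 T, Measurable fun ω => (X r ω, ∫ s in (0 : ℝ)..r, ‖β s ω‖) := fun r hr =>
    ((hX.adapted r hr).mono (augFiltration_le _)).measurable.prodMk (hX.measurable_var r hr)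
  have hc : ∀ᵐ ω ∂P, ContinuousOn (fun r => (X r ω, ∫ s in (0 : ℝ)..r, ‖β s ω‖)) (Icc 0 T) := by
    filter_upwards [hX.cont, hX.integrable] with ω h1 h2
    exact h1.prodMk (continuousOn_var hX.nonneg ω h2)
  obtain ⟨K, A, hA, hPA, hbd⟩ := exists_bound hm hc hε2
  obtain ⟨B, hBs, hBm, hB0⟩ := exists_measurable_superset_of_null (ae_iff.1 hX.integrable)
  refine ⟨K + 1, by positivity, A ∩ Bᶜ, hA.inter hBm.compl, ?_, fun ω hω => ?_⟩
  · rw [compl_inter, compl_compl]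
    refine (measure_union_le _ _).trans ?_
    rw [hB0, add_zero]
    exact hPA.trans (ENNReal.ofReal_le_ofReal (by linarith))
  · have h1 : IntegrableOn (fun r => β r ω) (Icc 0 T) := by
      by_contra h
      exact hω.2 (hBs h)
    obtain ⟨h2, h3⟩ := hbd ω hω.1
    refine ⟨h2.fst, h1, fun r hr => ?_, ?_⟩
    · have := (norm_fst_le _).trans (h3 r hr)
      simp only at this
      linarith
    · have := (le_abs_self _).trans ((norm_snd_le _).trans (h3 T (right_mem_Icc.2 hX.nonneg)))
      simp only at this
      linarith

theorem exists_modulus_event [IsProbabilityMeasure P] (hX : IsItoProcess P w T σ β X) {ε η : ℝ}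
    (hε : 0 < ε) (hη : 0 < η) : ∃ h > 0, ∃ A, MeasurableSet A ∧ P Aᶜ ≤ ENNReal.ofReal ε ∧ ∀ ω ∈ A,
      ∀ r ∈ Icc 0 T, ∀ s ∈ Icc 0 T, |r - s| ≤ h → ‖X r ω - X s ω‖ ≤ η ∧
        |(∫ q in (0 : ℝ)..r, ‖β q ω‖) - ∫ q in (0 : ℝ)..s, ‖β q ω‖| ≤ η := by
  have hε2 : (0 : ℝ≥0∞) < ENNReal.ofReal ε := by simpa using hε
  have hm : ∀ r ∈ Icc 0 T, Measurable fun ω => (X r ω, ∫ s in (0 : ℝ)..r, ‖β s ω‖) := fun r hr =>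
    ((hX.adapted r hr).mono (augFiltration_le _)).measurable.prodMk (hX.measurable_var r hr)
  have hc : ∀ᵐ ω ∂P, ContinuousOn (fun r => (X r ω, ∫ s in (0 : ℝ)..r, ‖β s ω‖)) (Icc 0 T) := by
    filter_upwards [hX.cont, hX.integrable] with ω h1 h2
    exact h1.prodMk (continuousOn_var hX.nonneg ω h2)
  obtain ⟨h, hh, A, hA, hPA, hmod⟩ := exists_modulus hm hc hη hε2
  refine ⟨h, hh, A, hA, hPA, fun ω hω r hr s hs hrs => ?_⟩
  have h1 := (hmod ω hω).2 r hr s hs hrs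
  exact ⟨(norm_fst_le _).trans h1, (norm_snd_le _).trans h1⟩

/-- Itô integrals of `σ(t, X)` multiplied by a random vector known at the initial time. -/
theorem itoLim_inner [IsProbabilityMeasure P] (hw : IsBrownianMotion w P)
    (hX : IsItoProcess P w T σ β X) {s t : ℝ} (hs : 0 ≤ s) (hst : s ≤ t) (ht : t ≤ T) {p : Ω → E n}
    (hp : StronglyMeasurable[augFiltration w P s] p) {C : ℝ} (hC : ∀ ω, ‖p ω‖ ≤ C) :
    ItoLim P w (restrictIoc s t fun i r ω => inner ℝ (p ω) (σ i r (X r ω)))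
      (fun ω => inner ℝ (p ω) (mart X β t ω - mart X β s ω)) := by
  -- Each coordinate of `p` is a bounded scalar known at time `s` and passes through the integral by
  -- `ItoLim.mul`; the inner product is the sum over the coordinates.
  have hcoord : ∀ κ : Fin n, ItoLim P w (fun i r ω => p ω κ * restrictIoc s t (fun i r ω =>
      (EuclideanSpace.proj κ : E n →L[ℝ] ℝ) (σ i r (X r ω))) i r ω)
      (fun ω => p ω κ * (EuclideanSpace.proj κ : E n →L[ℝ] ℝ) (mart X β t ω - mart X β s ω)) ∧
      PathMeas P (fun i r ω => p ω κ * restrictIoc s t (fun i r ω =>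
      (EuclideanSpace.proj κ : E n →L[ℝ] ℝ) (σ i r (X r ω))) i r ω) := by
    intro κ
    have hpm : PathMeas P (restrictIoc s t (fun i r ω =>
      (EuclideanSpace.proj κ : E n →L[ℝ] ℝ) (σ i r (X r ω)))) :=
      (hX.adaptedContinuous hs ht (f := fun i r x => (EuclideanSpace.proj κ : E n →L[ℝ] ℝ)
          (σ i r x))
        fun i => (EuclideanSpace.proj κ : E n →L[ℝ] ℝ).continuous.comp_continuousOn
        ((hX.continuous_σ i).mono (prod_mono_left (Icc_subset_Icc hs ht)))).pathMeas
    refine ⟨(hX.ito s t hs hst ht _).mul hw hpm (s := s) (fun i r ω hr => ?_)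
      ((EuclideanSpace.proj κ : E n →L[ℝ] ℝ).continuous.comp_stronglyMeasurable hp) (C := C)
      fun ω => (PiLp.norm_apply_le (p ω) κ).trans (hC ω), hpm.mul _⟩
    exact restrictIoc_of_notMem (fun h => absurd h.1 (not_lt.2 hr)) _ _ _
  have h := ItoLim.sum (s := Finset.univ) (fun κ _ => (hcoord κ).1) (fun κ _ => (hcoord κ).2)
  have hinner : ∀ x y : E n, ∑ κ, x κ * (EuclideanSpace.proj κ : E n →L[ℝ] ℝ) y = inner ℝ x y := by
    intro x y
    rw [PiLp.inner_apply]
    refine Finset.sum_congr rfl fun κ _ => ?_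
    simp [mul_comm]
  simp only [hinner] at h
  refine h.congr_left fun i r ω => ?_
  by_cases hr : r ∈ Ioc s t
  · simp only [restrictIoc_of_mem hr, hinner]
  · simp [restrictIoc_of_notMem hr]

/-- The noise of the process is close to `∑ᵢ ξⁱ Δwⁱ` if `σ` is close to `ξ`. -/
theorem lintegral_remainder_le [IsProbabilityMeasure P] (hw : IsBrownianMotion w P)
    (hX : IsItoProcess P w T σ β X) {s t : ℝ} (hs : 0 ≤ s) (hst : s ≤ t) (ht : t ≤ T)
    {ξ : Fin m → Ω → E n} (hξ : ∀ i, StronglyMeasurable[augFiltration w P s] (ξ i)) {C : ℝ}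
    (hC : ∀ i ω, ‖ξ i ω‖ ≤ C) {A : Set Ω} (hA : MeasurableSet A) {η : ℝ}
    (hη : ∀ ω ∈ A, ∀ r ∈ Ioc s t, ∀ i, ‖σ i r (X r ω) - ξ i ω‖ ≤ η) :
    ∫⁻ ω in A, ENNReal.ofReal
      (‖mart X β t ω - mart X β s ω - ∑ i, dW w i s t ω • ξ i ω‖ ^ 2) ∂P ≤
      ENNReal.ofReal (4 * n * m * η ^ 2 * (t - s)) := by
  set R : Ω → E n := fun ω => mart X β t ω - mart X β s ω - ∑ i, dW w i s t ω • ξ i ω with hR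
  have hRm : Measurable R := by
    refine ((hX.measurable_mart t ⟨hs.trans hst, ht⟩).sub
      (hX.measurable_mart s ⟨hs, hst.trans ht⟩)).sub ?_
    exact Finset.measurable_fun_sum _ fun i _ => (measurable_dW hw i s t).smul
      ((hξ i).mono (augFiltration_le _)).measurable
  -- Coordinate `κ` of the remainder is the stochastic integral of coordinate `κ` of `σ - ξ`, which
  -- is at most `η` on `A`, so the localised isometry applies. The factor `n` comes from summing
  -- over the coordinates.
  have hcoord : ∀ κ : Fin n, ∫⁻ ω in A, ENNReal.ofReal (R ω κ ^ 2) ∂P ≤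
      ENNReal.ofReal (4 * (m * η ^ 2 * (t - s))) := by
    intro κ
    set L : E n →L[ℝ] ℝ := EuclideanSpace.proj κ with hL
    have hpm : PathMeas P (restrictIoc s t (fun i r ω => L (σ i r (X r ω)))) :=
      (hX.adaptedContinuous hs ht (f := fun i r x => L (σ i r x)) fun i =>
        L.continuous.comp_continuousOn
        ((hX.continuous_σ i).mono (prod_mono_left (Icc_subset_Icc hs ht)))).pathMeas
    have h2 := itoLim_single (P := P) (w := w) hs hst (fun i ω => L (ξ i ω))
      (fun i => L.continuous.comp_stronglyMeasurable (hξ i))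
      ⟨C, fun i ω => (PiLp.norm_apply_le (ξ i ω) κ).trans (hC i ω)⟩
    have hpm2 : PathMeas P (restrictIoc s t fun i (_ : ℝ) ω => L (ξ i ω)) :=
      pathMeas_restrictIoc (Eventually.of_forall fun ω i => continuousOn_const)
    have h3 := (hX.ito s t hs hst ht L).sub h2 hpm
    have h4 := h3.lintegral_sq_le_of_nonneg hw (hpm.sub hpm2) hA (δ := m * η ^ 2 * (t - s))
      (mul_nonneg (by positivity) (sub_nonneg.2 hst)) (Eventually.of_forall fun ω hω => by
        refine sqDist_le_of_abs_le (fun r hr i => ?_) fun r hr i => ?_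
        · simp [restrictIoc_of_notMem hr]
        · rw [restrictIoc_of_mem hr, restrictIoc_of_mem hr, sub_zero, ← map_sub]
          exact (PiLp.norm_apply_le _ κ).trans (hη ω hω r hr i))
    refine le_trans (le_of_eq (lintegral_congr fun ω => ?_)) h4
    rw [enorm_sq_eq]
    have e : R ω κ = L (R ω) := rfl
    rw [e, hR, map_sub, map_sum]
    simp only [map_smul, smul_eq_mul, mul_comm]
  have e : ∀ ω, ENNReal.ofReal (‖R ω‖ ^ 2) = ∑ κ, ENNReal.ofReal (R ω κ ^ 2) := by
    intro ω
    rw [EuclideanSpace.real_norm_sq_eq, ENNReal.ofReal_sum_of_nonneg fun κ _ => sq_nonneg _]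
  have hRκ : ∀ κ, Measurable fun ω => R ω κ := fun κ =>
    (EuclideanSpace.proj κ : E n →L[ℝ] ℝ).measurable.comp hRm
  change ∫⁻ ω in A, ENNReal.ofReal (‖R ω‖ ^ 2) ∂P ≤ _
  simp only [e]
  rw [lintegral_finsetSum _ fun κ _ => ((hRκ κ).pow_const 2).ennreal_ofReal]
  refine (Finset.sum_le_sum fun κ _ => hcoord κ).trans ?_
  rw [Finset.sum_const, Finset.card_univ, Fintype.card_fin, nsmul_eq_mul, ← ENNReal.ofReal_natCast,
    ← ENNReal.ofReal_mul (by positivity)]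
  exact ENNReal.ofReal_le_ofReal (le_of_eq (by ring))

end IsItoProcess

end ItoProcesses

/-! ### Second order martingale terms on a grid -/

section GridMartingales

variable {Ω : Type*} [mΩ : MeasurableSpace Ω] {m : ℕ}
variable {w : Fin m → ℝ≥0 → Ω → ℝ} {P : Measure Ω}

/-- Sums of martingale differences of the order of the step size are small in mean square. -/
theorem integral_grid_sum_sq_le [IsProbabilityMeasure P] {ι : Type*} [Fintype ι] {a b : ℝ}
    (G : Grid a b) {h : ℝ} (hG : G.MeshLe h) {z : ℕ → ι → Ω → ℝ}
    (hz : ∀ j q, IsMDiff P (augFiltration w P (G.t j)) (augFiltration w P (G.t (j + 1))) (z j q))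
    {c : ℝ} (hc : 0 ≤ c) (hz2 : ∀ j q, ∫ ω, z j q ω ^ 2 ∂P ≤ c * (G.t (j + 1) - G.t j) ^ 2)
    {ξ : ℕ → ι → Ω → ℝ} (hξ : ∀ j q, StronglyMeasurable[augFiltration w P (G.t j)] (ξ j q)) {C : ℝ}
    (hC : ∀ j q ω, |ξ j q ω| ≤ C) :
    MemLp (fun ω => ∑ j ∈ Finset.range G.N, ∑ q, ξ j q ω * z j q ω) 2 P ∧
    ∫ ω, (∑ j ∈ Finset.range G.N, ∑ q, ξ j q ω * z j q ω) ^ 2 ∂P ≤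
      Fintype.card ι ^ 2 * C ^ 2 * c * h * (b - a) := by
  have hmono : Monotone fun j => augFiltration w P (G.t j) := fun _ _ h =>
    augFiltration_mono (G.mono h)
  have hd : ∀ j, IsMDiff P (augFiltration w P (G.t j)) (augFiltration w P (G.t (j + 1)))
      (fun ω => ∑ q, ξ j q ω * z j q ω) := fun j =>
    IsMDiff.sum (augFiltration_le _) _ fun q _ => (hz j q).bdd_mul (hmono (Nat.le_succ j))
      (augFiltration_le _) (hξ j q) (hC j q)
  refine ⟨memLp_sum_of_isMDiff (𝒢 := fun j => augFiltration w P (G.t j)) G.N fun j _ => hd j, ?_⟩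
  rw [integral_sum_sq_of_isMDiff hmono G.N fun j _ => hd j]
  -- The second moments are of order `Δt ^ 2 ≤ h * Δt`; after summation a factor `h` is left, which
  -- vanishes with the mesh.
  have hstep : ∀ j, ∫ ω, (∑ q, ξ j q ω * z j q ω) ^ 2 ∂P ≤
      Fintype.card ι ^ 2 * C ^ 2 * c * h * (G.t (j + 1) - G.t j) := by
    intro j
    have hint : ∀ q, Integrable (fun ω => z j q ω ^ 2) P := fun q => (hz j q).memLp.integrable_sq
    have h1 : ∫ ω, (∑ q, ξ j q ω * z j q ω) ^ 2 ∂P ≤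
        ∫ ω, Fintype.card ι * ∑ q, C ^ 2 * z j q ω ^ 2 ∂P := by
      refine integral_mono (hd j).memLp.integrable_sq
        ((integrable_finsetSum _ fun q _ => (hint q).const_mul _).const_mul _) fun ω => ?_
      refine (sq_sum_le_card_mul_sum_sq (s := Finset.univ)
        (f := fun q => ξ j q ω * z j q ω)).trans ?_
      simp only [Finset.card_univ]
      refine mul_le_mul_of_nonneg_left (Finset.sum_le_sum fun q _ => ?_) (by positivity)
      rw [mul_pow, ← sq_abs (ξ j q ω)]
      exact mul_le_mul_of_nonneg_right (pow_le_pow_left₀ (abs_nonneg _) (hC j q ω) 2) (sq_nonneg _)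
    refine h1.trans ?_
    rw [integral_const_mul, integral_finsetSum _ fun q _ => (hint q).const_mul _]
    simp only [integral_const_mul]
    have h2 : ∑ q, C ^ 2 * ∫ ω, z j q ω ^ 2 ∂P ≤
        Fintype.card ι * (C ^ 2 * (c * (h * (G.t (j + 1) - G.t j)))) := by
      rw [← Finset.card_univ, ← nsmul_eq_mul]
      refine Finset.sum_le_card_nsmul _ _ _ fun q _ => ?_
      refine mul_le_mul_of_nonneg_left ((hz2 j q).trans ?_) (sq_nonneg _)
      refine mul_le_mul_of_nonneg_left ?_ hc
      rw [sq]
      exact mul_le_mul_of_nonneg_right (hG j) (G.step_nonneg j)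
    refine (mul_le_mul_of_nonneg_left h2 (by positivity)).trans (le_of_eq (by ring))
  refine (Finset.sum_le_sum fun j _ => hstep j).trans (le_of_eq ?_)
  rw [← Finset.mul_sum, G.sum_step]

theorem measure_grid_sum_le [IsProbabilityMeasure P] {ι : Type*} [Fintype ι] {a b : ℝ}
    (G : Grid a b) {h : ℝ} (hG : G.MeshLe h) {z : ℕ → ι → Ω → ℝ}
    (hz : ∀ j q, IsMDiff P (augFiltration w P (G.t j)) (augFiltration w P (G.t (j + 1))) (z j q))
    {c : ℝ} (hc : 0 ≤ c) (hz2 : ∀ j q, ∫ ω, z j q ω ^ 2 ∂P ≤ c * (G.t (j + 1) - G.t j) ^ 2)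
    {ξ : ℕ → ι → Ω → ℝ} (hξ : ∀ j q, StronglyMeasurable[augFiltration w P (G.t j)] (ξ j q)) {C : ℝ}
    (hC : ∀ j q ω, |ξ j q ω| ≤ C) {ε : ℝ} (hε : 0 < ε) :
    P {ω | ε ≤ |∑ j ∈ Finset.range G.N, ∑ q, ξ j q ω * z j q ω|} ≤
      ENNReal.ofReal (Fintype.card ι ^ 2 * C ^ 2 * c * h * (b - a) / ε ^ 2) := by
  obtain ⟨h1, h2⟩ := integral_grid_sum_sq_le G hG hz hc hz2 hξ hC
  exact measure_le_abs_le_of_memLp h1 hε h2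

/-- The second order martingale differences with two end points. -/
theorem isMDiff_dW_mul_of_le [IsProbabilityMeasure P] (hw : IsBrownianMotion w P) (i k : Fin m)
    {s r t : ℝ} (hs : 0 ≤ s) (hsr : s ≤ r) (hrt : r ≤ t) :
    IsMDiff P (augFiltration w P s) (augFiltration w P t)
      (fun ω => dW w i s t ω * dW w k s r ω - if i = k then r - s else 0) := by
  have h1 := (isMDiff_dW_mul hw i k hs hsr).mono le_rfl (augFiltration_mono hrt)
  -- The increment of `wⁱ` over `[s, t]` is split at `r`. The part after `r` is orthogonal to
  -- everything known at `r`, including the other factor.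
  have h2 : IsMDiff P (augFiltration w P s) (augFiltration w P t)
      (fun ω => dW w k s r ω * dW w i r t ω) := by
    have hk := stronglyMeasurable_dW hw k (hs.trans hsr) hsr le_rfl
    have hd := isMDiff_dW hw i (hs.trans hsr) hrt
    refine ⟨(hk.mono (augFiltration_mono hrt)).mul hd.meas,
      memLp_dW_mul hw k i hs hsr (hs.trans hsr) hrt, fun η hη hint => ?_⟩
    have h := hd.orth (fun ω => η ω * dW w k s r ω) ((hη.mono (augFiltration_mono hsr)).mul hk)
      (by simpa [mul_assoc] using hint)
    simpa [mul_assoc] using h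
  have h3 := h1.add (augFiltration_le _) h2
  convert h3 using 2 with ω
  simp only [dW]
  ring

/-- The constant `2 * κ₄ + 2` comes from `(x y - c)² ≤ x⁴ + y⁴ + 2 c²` and the fourth moments of the
increments. -/
theorem integral_dW_mul_sub_sq_le [IsProbabilityMeasure P] (hw : IsBrownianMotion w P)
    (i k : Fin m) {s r t : ℝ} (hs : 0 ≤ s) (hsr : s ≤ r) (hrt : r ≤ t) :
    ∫ ω, (dW w i s t ω * dW w k s r ω - if i = k then r - s else 0) ^ 2 ∂P ≤
      (2 * κ₄ + 2) * (t - s) ^ 2 := by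
  have hst := hsr.trans hrt
  have h4 : ∀ (i : Fin m) {r : ℝ}, s ≤ r → Integrable (fun ω => dW w i s r ω ^ 4) P := by
    intro i r hr
    have := (memLp_dW hw i hs hr 4).integrable_norm_pow (p := 4) (by norm_num)
    refine this.congr (Eventually.of_forall fun ω => ?_)
    simp only [Real.norm_eq_abs]
    exact Even.pow_abs (by decide) _
  have hrs : (r - s) ^ 2 ≤ (t - s) ^ 2 :=
    pow_le_pow_left₀ (sub_nonneg.2 hsr) (by linarith) 2
  have hle : ∀ ω, (dW w i s t ω * dW w k s r ω - if i = k then r - s else 0) ^ 2 ≤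
      dW w i s t ω ^ 4 + dW w k s r ω ^ 4 + 2 * (t - s) ^ 2 := by
    intro ω
    set x := dW w i s t ω
    set y := dW w k s r ω
    set c : ℝ := if i = k then r - s else 0 with hc
    have h1 : c ^ 2 ≤ (t - s) ^ 2 := by
      rw [hc]; split_ifs
      · exact hrs
      · simpa using sq_nonneg (t - s)
    nlinarith [sq_nonneg (x ^ 2 - y ^ 2), sq_nonneg (x * y + c)]
  have hint : Integrable (fun ω => (dW w i s t ω * dW w k s r ω - if i = k then r - s else 0) ^ 2)
      P := (isMDiff_dW_mul_of_le hw i k hs hsr hrt).memLp.integrable_sq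
  have h5 : Integrable (fun ω => dW w i s t ω ^ 4 + dW w k s r ω ^ 4) P :=
    (h4 i hst).add (h4 k hsr)
  refine (integral_mono hint (h5.add (integrable_const _)) hle).trans ?_
  simp only [Pi.add_apply]
  rw [integral_add h5 (integrable_const _), integral_add (h4 i hst) (h4 k hsr),
    integral_dW_pow_four hw i hs hst, integral_dW_pow_four hw k hs hsr]
  have := mul_le_mul_of_nonneg_left hrs κ₄_nonneg
  simp
  linarith

end GridMartingales

/-! ### The pathwise error of Itô's formula over a grid -/

section Deterministic

variable {n m : ℕ}

theorem intervalIntegrable_generator {a b : ℝ} {V vt tr : ℝ → E n → ℝ} {p : ℝ → E n → E n}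
    {H : ℝ → E n → E n →L[ℝ] E n} (hV : C12On a b V vt p H)
    (htr : ContinuousOn (fun q : ℝ × E n => tr q.1 q.2) (Icc a b ×ˢ univ))
    {x β : ℝ → E n} (hx : ContinuousOn x (Icc a b)) (hβ : IntegrableOn β (Icc a b))
    {t₀ t₁ : ℝ} (h0 : a ≤ t₀) (h01 : t₀ ≤ t₁) (h1 : t₁ ≤ b) :
    IntervalIntegrable (fun r => vt r (x r) + inner ℝ (p r (x r)) (β r) + 1 / 2 * tr r (x r))
      volume t₀ t₁ := by
  have hsub : Icc t₀ t₁ ⊆ Icc a b := Icc_subset_Icc h0 h1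
  have ivt := ((IsItoProcess.continuousOn_comp hV.cont_t hx).mono hsub).intervalIntegrable_of_Icc
    h01 (μ := volume)
  have itr := ((IsItoProcess.continuousOn_comp htr hx).mono hsub).intervalIntegrable_of_Icc
    h01 (μ := volume)
  have hp := (IsItoProcess.continuousOn_comp hV.cont_x hx).mono hsub
  have ipβ : IntervalIntegrable (fun r => inner ℝ (p r (x r)) (β r)) volume t₀ t₁ := by
    rw [intervalIntegrable_iff_integrableOn_Icc_of_le h01]
    obtain ⟨C', hC'⟩ := isCompact_Icc.exists_bound_of_continuousOn hp
    refine (innerSL ℝ : E n →L[ℝ] E n →L[ℝ] ℝ).integrable_of_bilin_of_bdd_left C' ?_ ?_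
      (hβ.mono_set hsub)
    · exact hp.aestronglyMeasurable measurableSet_Icc
    · filter_upwards [ae_restrict_mem measurableSet_Icc] with r hr
      exact hC' r hr
  exact (ivt.add ipβ).add (itr.const_mul _)

/-- The pathwise error of Itô's formula on a grid. -/
theorem abs_ito_sum_le {a b : ℝ} {V vt tr : ℝ → E n → ℝ} {p : ℝ → E n → E n}
    {H : ℝ → E n → E n →L[ℝ] E n} (hV : C12On a b V vt p H)
    (htr : ContinuousOn (fun q : ℝ × E n => tr q.1 q.2) (Icc a b ×ˢ univ))
    {x β : ℝ → E n} (hx : ContinuousOn x (Icc a b)) (hβ : IntegrableOn β (Icc a b))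
    (G : Grid a b) {ρ C K : ℝ} (hρ : 0 < ρ) (hρ1 : ρ ≤ 1)
    (hvt' : ∀ j, ∀ r ∈ Icc (G.t j) (G.t (j + 1)), |vt r (x (G.t (j + 1))) - vt r (x r)| ≤ ρ)
    (hp' : ∀ j, ∀ r ∈ Icc (G.t j) (G.t (j + 1)), ‖p (G.t j) (x (G.t j)) - p r (x r)‖ ≤ ρ)
    (htr' : ∀ j, ∀ r ∈ Icc (G.t j) (G.t (j + 1)), |tr (G.t j) (x (G.t j)) - tr r (x r)| ≤ ρ)
    (hH : ∀ j, ∀ z ∈ segment ℝ (x (G.t j)) (x (G.t (j + 1))),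
      ‖H (G.t j) z - H (G.t j) (x (G.t j))‖ ≤ ρ)
    (hC : ∀ j, ‖H (G.t j) (x (G.t j))‖ ≤ C) (hK : ∫ r in a..b, ‖β r‖ ≤ K)
    (hB : ∀ j, ∫ r in (G.t j)..(G.t (j + 1)), ‖β r‖ ≤ ρ ^ 2) (D : ℕ → E n) :
    |V b (x b) - V a (x a)
      - (∫ r in a..b, (vt r (x r) + inner ℝ (p r (x r)) (β r) + 1 / 2 * tr r (x r)))
      - (∑ j ∈ Finset.range G.N, inner ℝ (p (G.t j) (x (G.t j)))
          (x (G.t (j + 1)) - x (G.t j) - ∫ r in (G.t j)..(G.t (j + 1)), β r))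
      - ∑ j ∈ Finset.range G.N, 1 / 2 * (inner ℝ (H (G.t j) (x (G.t j)) (D j)) (D j)
          - tr (G.t j) (x (G.t j)) * (G.t (j + 1) - G.t j))| ≤
    ρ * (2 * (b - a) + K + 2 * (2 + C ^ 2 + C) * K)
      + 3 * ρ * (∑ j ∈ Finset.range G.N, ‖D j‖ ^ 2)
      + 2 * (2 + C ^ 2 + C) / ρ * ∑ j ∈ Finset.range G.N,
        ‖x (G.t (j + 1)) - x (G.t j) - (∫ r in (G.t j)..(G.t (j + 1)), β r) - D j‖ ^ 2 := by
  have hC0 : 0 ≤ C := (norm_nonneg _).trans (hC 0)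
  have iβ : ∀ j, IntervalIntegrable β volume (G.t j) (G.t (j + 1)) := fun j =>
    (intervalIntegrable_iff_integrableOn_Icc_of_le (G.mono (Nat.le_succ j))).2
      (hβ.mono_set (Icc_subset_Icc (G.mem j).1 (G.mem (j + 1)).2))
  have e1 : V b (x b) - V a (x a) =
      ∑ j ∈ Finset.range G.N, (V (G.t (j + 1)) (x (G.t (j + 1))) - V (G.t j) (x (G.t j))) := by
    rw [Finset.sum_range_sub (fun j => V (G.t j) (x (G.t j))), G.first, G.last _ le_rfl]
  have e2 : ∫ r in a..b, (vt r (x r) + inner ℝ (p r (x r)) (β r) + 1 / 2 * tr r (x r)) =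
      ∑ j ∈ Finset.range G.N, ∫ r in (G.t j)..(G.t (j + 1)),
        (vt r (x r) + inner ℝ (p r (x r)) (β r) + 1 / 2 * tr r (x r)) := by
    rw [intervalIntegral.sum_integral_adjacent_intervals (fun k _ =>
      intervalIntegrable_generator hV htr hx hβ (G.mem k).1 (G.mono (Nat.le_succ k))
        (G.mem (k + 1)).2), G.first, G.last _ le_rfl]
  have e3 : ∫ r in a..b, ‖β r‖ = ∑ j ∈ Finset.range G.N, ∫ r in (G.t j)..(G.t (j + 1)), ‖β r‖ := by
    rw [intervalIntegral.sum_integral_adjacent_intervals (fun k _ => (iβ k).norm), G.first,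
      G.last _ le_rfl]
  rw [e1, e2, ← Finset.sum_sub_distrib, ← Finset.sum_sub_distrib, ← Finset.sum_sub_distrib]
  have hstep : ∀ j ∈ Finset.range G.N, |V (G.t (j + 1)) (x (G.t (j + 1))) - V (G.t j) (x (G.t j))
      - (∫ r in (G.t j)..(G.t (j + 1)),
        (vt r (x r) + inner ℝ (p r (x r)) (β r) + 1 / 2 * tr r (x r)))
      - inner ℝ (p (G.t j) (x (G.t j)))
          (x (G.t (j + 1)) - x (G.t j) - ∫ r in (G.t j)..(G.t (j + 1)), β r)
      - 1 / 2 * (inner ℝ (H (G.t j) (x (G.t j)) (D j)) (D j)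
          - tr (G.t j) (x (G.t j)) * (G.t (j + 1) - G.t j))| ≤
      2 * ρ * (G.t (j + 1) - G.t j) + (ρ + 2 * (2 + C ^ 2 + C) * ρ) *
        (∫ r in (G.t j)..(G.t (j + 1)), ‖β r‖) + 3 * ρ * ‖D j‖ ^ 2 + 2 * (2 + C ^ 2 + C) / ρ *
        ‖x (G.t (j + 1)) - x (G.t j) - (∫ r in (G.t j)..(G.t (j + 1)), β r) - D j‖ ^ 2 := by
    intro j _
    have h01 := G.mono (Nat.le_succ j)
    refine (abs_ito_step_le hV htr hx hβ (G.mem j).1 h01 (G.mem (j + 1)).2 hρ (hvt' j) (hp' j)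
      (htr' j) (hH j) (hC j) (D j)).trans ?_
    set I := ∫ r in (G.t j)..(G.t (j + 1)), β r with hI
    set B := ∫ r in (G.t j)..(G.t (j + 1)), ‖β r‖ with hBdef
    set R := x (G.t (j + 1)) - x (G.t j) - I - D j with hR
    have hIB : ‖I‖ ≤ B := intervalIntegral.norm_integral_le_integral_norm h01
    have hB0 : 0 ≤ B := (norm_nonneg _).trans hIB
    -- The drift over one cell is at most `ρ ^ 2`, so its square, even after division by `ρ`,
    -- contributes only `ρ * B`, and the `B` sum to at most `K`.
    have hI2 : ‖I‖ ^ 2 ≤ ρ ^ 2 * B := by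
      have h1 := hB j
      have h2 : ‖I‖ ^ 2 ≤ B * B := by rw [sq]; exact mul_le_mul hIB hIB (norm_nonneg _) hB0
      exact h2.trans (mul_le_mul_of_nonneg_right h1 hB0)
    have hE : ‖x (G.t (j + 1)) - x (G.t j) - D j‖ ^ 2 ≤ 2 * (ρ ^ 2 * B) + 2 * ‖R‖ ^ 2 := by
      have e : x (G.t (j + 1)) - x (G.t j) - D j = I + R := by rw [hR]; abel
      have h3 : ‖x (G.t (j + 1)) - x (G.t j) - D j‖ ≤ ‖I‖ + ‖R‖ := by
        rw [e]; exact norm_add_le _ _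
      nlinarith [sq_nonneg (‖I‖ - ‖R‖), norm_nonneg (x (G.t (j + 1)) - x (G.t j) - D j)]
    have hcoef : 2 * ρ + C ^ 2 / ρ + C ≤ (2 + C ^ 2 + C) / ρ := by
      rw [le_div_iff₀ hρ, add_mul, add_mul, div_mul_cancel₀ _ hρ.ne']
      nlinarith
    have hcoef0 : 0 ≤ 2 * ρ + C ^ 2 / ρ + C := by positivity
    have h4 : (2 * ρ + C ^ 2 / ρ + C) * ‖x (G.t (j + 1)) - x (G.t j) - D j‖ ^ 2 ≤
        (2 + C ^ 2 + C) / ρ * (2 * (ρ ^ 2 * B) + 2 * ‖R‖ ^ 2) :=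
      mul_le_mul hcoef hE (sq_nonneg _) (hcoef0.trans hcoef)
    have h5 : (2 + C ^ 2 + C) / ρ * (2 * (ρ ^ 2 * B) + 2 * ‖R‖ ^ 2) =
        2 * (2 + C ^ 2 + C) * ρ * B + 2 * (2 + C ^ 2 + C) / ρ * ‖R‖ ^ 2 := by
      field_simp
    rw [h5] at h4
    linarith
  refine (Finset.abs_sum_le_sum_abs _ _).trans ((Finset.sum_le_sum hstep).trans ?_)
  rw [Finset.sum_add_distrib, Finset.sum_add_distrib, Finset.sum_add_distrib, ← Finset.mul_sum,
    ← Finset.mul_sum, ← Finset.mul_sum, ← Finset.mul_sum, G.sum_step, ← e3]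
  have h6 : (ρ + 2 * (2 + C ^ 2 + C) * ρ) * (∫ r in a..b, ‖β r‖) ≤
      (ρ + 2 * (2 + C ^ 2 + C) * ρ) * K := mul_le_mul_of_nonneg_left hK (by positivity)
  linarith

end Deterministic

/-! ### Localised Markov inequality and sums of squared increments -/

section Probabilistic

variable {Ω : Type*} [mΩ : MeasurableSpace Ω] {n m : ℕ}
variable {w : Fin m → ℝ≥0 → Ω → ℝ} {P : Measure Ω}

theorem measure_inter_ge_le {A : Set Ω} (hA : MeasurableSet A) {f : Ω → ℝ} (hf : Measurable f)
    {c κ l : ℝ} (hκ : 0 ≤ κ) (hl : 0 < l)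
    (h : ∫⁻ ω in A, ENNReal.ofReal (f ω) ∂P ≤ ENNReal.ofReal c) :
    P (A ∩ {ω | l ≤ κ * f ω}) ≤ ENNReal.ofReal (κ * c / l) := by
  have h1 := meas_ge_le_lintegral_div (μ := P.restrict A) (f := fun ω => ENNReal.ofReal (κ * f ω))
    (hf.const_mul κ).ennreal_ofReal.aemeasurable (ε := ENNReal.ofReal l)
    (by simpa using hl) ENNReal.ofReal_ne_top
  rw [ENNReal.ofReal_div_of_pos hl]
  have h2 : ∫⁻ ω in A, ENNReal.ofReal (κ * f ω) ∂P ≤ ENNReal.ofReal (κ * c) := by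
    simp only [ENNReal.ofReal_mul hκ]
    rw [lintegral_const_mul' _ _ ENNReal.ofReal_ne_top]
    exact mul_le_mul_right h _
  refine le_trans ?_ (h1.trans (ENNReal.div_le_div_right h2 _))
  rw [Measure.restrict_apply' hA, inter_comm]
  exact measure_mono (inter_subset_inter_left _ fun ω hω => ENNReal.ofReal_le_ofReal hω)

/-- The sum of the squares of the increments of the Brownian motion. -/
def sumSq (w : Fin m → ℝ≥0 → Ω → ℝ) {a b : ℝ} (G : Grid a b) (ω : Ω) : ℝ :=
  ∑ j ∈ Finset.range G.N, ∑ i, dW w i (G.t j) (G.t (j + 1)) ω ^ 2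

theorem measurable_sumSq (hw : IsBrownianMotion w P) {a b : ℝ} (G : Grid a b) :
    Measurable (sumSq w G) :=
  Finset.measurable_fun_sum _ fun _ _ => Finset.measurable_fun_sum _ fun i _ =>
    (measurable_dW hw i _ _).pow_const 2

theorem lintegral_sumSq [IsProbabilityMeasure P] (hw : IsBrownianMotion w P) {a b : ℝ} (ha : 0 ≤ a)
    (G : Grid a b) : ∫⁻ ω, ENNReal.ofReal (sumSq w G ω) ∂P = ENNReal.ofReal (m * (b - a)) := by
  have h0 : ∀ j, 0 ≤ G.t j := fun j => ha.trans (G.mem j).1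
  have hint : ∀ j i, Integrable (fun ω => dW w i (G.t j) (G.t (j + 1)) ω ^ 2) P := fun j i =>
    (memLp_dW hw i (h0 j) (G.mono (Nat.le_succ j)) 2).integrable_sq
  have hint2 : Integrable (sumSq w G) P :=
    integrable_finsetSum _ fun j _ => integrable_finsetSum _ fun i _ => hint j i
  rw [← ofReal_integral_eq_lintegral_ofReal hint2 (Eventually.of_forall fun ω =>
    Finset.sum_nonneg fun j _ => Finset.sum_nonneg fun i _ => sq_nonneg _)]
  congr 1
  unfold sumSq
  rw [integral_finsetSum _ fun j _ => integrable_finsetSum _ fun i _ => hint j i]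
  have e : ∀ j, ∫ ω, ∑ i, dW w i (G.t j) (G.t (j + 1)) ω ^ 2 ∂P =
      m * (G.t (j + 1) - G.t j) := by
    intro j
    rw [integral_finsetSum _ fun i _ => hint j i]
    simp only [integral_dW_sq hw _ (h0 j) (G.mono (Nat.le_succ j))]
    simp
    ring
  simp only [e]
  rw [← Finset.mul_sum, G.sum_step]

theorem sum_restrictIoc_of_mem {a b : ℝ} (G : Grid a b) (f : ℕ → Fin m → ℝ → Ω → ℝ) {j : ℕ}
    (hj : j < G.N) {r : ℝ} (hr : r ∈ Ioc (G.t j) (G.t (j + 1))) (i : Fin m) (ω : Ω) :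
    ∑ l ∈ Finset.range G.N, restrictIoc (G.t l) (G.t (l + 1)) (f l) i r ω = f j i r ω := by
  rw [Finset.sum_eq_single j]
  · exact restrictIoc_of_mem hr _ _ _
  · intro k _ hk
    refine restrictIoc_of_notMem ?_ _ _ _
    rintro ⟨h1, h2⟩
    rcases lt_or_gt_of_ne hk with h | h
    · exact absurd (h2.trans (G.mono h)) (not_le.2 hr.1)
    · exact absurd (hr.2.trans (G.mono h)) (not_le.2 h1)
  · intro h
    simp [hj] at h

theorem sum_restrictIoc_of_notMem {a b : ℝ} (G : Grid a b) (f : ℕ → Fin m → ℝ → Ω → ℝ)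
    {r : ℝ} (hr : r ∉ Ioc a b) (i : Fin m) (ω : Ω) :
    ∑ l ∈ Finset.range G.N, restrictIoc (G.t l) (G.t (l + 1)) (f l) i r ω = 0 := by
  refine Finset.sum_eq_zero fun l _ => restrictIoc_of_notMem (fun h => hr ?_) _ _ _
  exact ⟨(G.mem l).1.trans_lt h.1, h.2.trans (G.mem (l + 1)).2⟩

theorem norm_sum_dW_smul_sq_le {ξ : Fin m → E n} {C : ℝ} (hC : ∀ i, ‖ξ i‖ ≤ C) (c : Fin m → ℝ) :
    ‖∑ i, c i • ξ i‖ ^ 2 ≤ m * C ^ 2 * ∑ i, c i ^ 2 := by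
  have h1 : ‖∑ i, c i • ξ i‖ ≤ ∑ i, |c i| * C := by
    refine (norm_sum_le _ _).trans (Finset.sum_le_sum fun i _ => ?_)
    rw [norm_smul, Real.norm_eq_abs]
    exact mul_le_mul_of_nonneg_left (hC i) (abs_nonneg _)
  refine (pow_le_pow_left₀ (norm_nonneg _) h1 2).trans ?_
  refine (sq_sum_le_card_mul_sum_sq (s := Finset.univ) (f := fun i => |c i| * C)).trans
    (le_of_eq ?_)
  simp only [mul_pow, sq_abs, Finset.card_univ, Fintype.card_fin]
  rw [← Finset.sum_mul]
  ring

/-- Here `c` is the vector of Brownian increments and `δ` the step length: the quadratic form of the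
noise minus the trace term is a combination of the second order martingale differences. -/
theorem inner_sum_sum_sub (L : E n →L[ℝ] E n) (ξ : Fin m → E n) (c : Fin m → ℝ) (δ : ℝ) :
    inner ℝ (L (∑ i, c i • ξ i)) (∑ i, c i • ξ i) - (∑ i, inner ℝ (ξ i) (L (ξ i))) * δ =
      ∑ q : Fin m × Fin m, inner ℝ (L (ξ q.1)) (ξ q.2) *
        (c q.1 * c q.2 - if q.1 = q.2 then δ else 0) := by
  rw [map_sum, sum_inner, Fintype.sum_prod_type, Finset.sum_mul, ← Finset.sum_sub_distrib]
  refine Finset.sum_congr rfl fun i _ => ?_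
  simp only [mul_sub, Finset.sum_sub_distrib, mul_ite, mul_zero, Finset.sum_ite_eq,
    Finset.mem_univ, if_true]
  rw [inner_sum]
  congr 1
  · refine Finset.sum_congr rfl fun k _ => ?_
    rw [map_smul, inner_smul_left, inner_smul_right]
    simp only [conj_trivial]
    ring
  · rw [real_inner_comm]

theorem exists_small {τ c : ℝ} (hτ : 0 < τ) (hc : 0 ≤ c) : ∃ ρ > 0, ρ ≤ 1 ∧ ρ * c ≤ τ := by
  refine ⟨min 1 (τ / (c + 1)), by positivity, min_le_left _ _, ?_⟩
  calc min 1 (τ / (c + 1)) * c ≤ τ / (c + 1) * c :=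
        mul_le_mul_of_nonneg_right (min_le_right _ _) hc
    _ ≤ τ := by
        rw [div_mul_eq_mul_div, div_le_iff₀ (by positivity)]
        nlinarith

end Probabilistic

/-! ### Itô's formula -/

section ItoFormula

variable {Ω : Type*} [mΩ : MeasurableSpace Ω] {n m : ℕ}
variable {w : Fin m → ℝ≥0 → Ω → ℝ} {P : Measure Ω}
variable {T : ℝ} {σ : Fin m → ℝ → E n → E n} {β X : ℝ → Ω → E n}

/-- The remainder `∑ⱼ ‖ΔMⱼ - ∑ᵢ ξⁱⱼ Δwⁱⱼ‖²`. -/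
noncomputable def remSq (w : Fin m → ℝ≥0 → Ω → ℝ) (β X : ℝ → Ω → E n) (ξ : ℕ → Fin m → Ω → E n)
    {a b : ℝ} (G : Grid a b) (ω : Ω) : ℝ :=
  ∑ j ∈ Finset.range G.N, ‖mart X β (G.t (j + 1)) ω - mart X β (G.t j) ω -
    ∑ i, dW w i (G.t j) (G.t (j + 1)) ω • ξ j i ω‖ ^ 2

theorem IsItoProcess.measurable_remainder (hw : IsBrownianMotion w P)
    (hX : IsItoProcess P w T σ β X) {s t : ℝ} (hs : 0 ≤ s) (hst : s ≤ t) (ht : t ≤ T)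
    {ξ : Fin m → Ω → E n} (hξ : ∀ i, Measurable (ξ i)) :
    Measurable fun ω => ‖mart X β t ω - mart X β s ω - ∑ i, dW w i s t ω • ξ i ω‖ ^ 2 := by
  refine (Measurable.norm ?_).pow_const 2
  refine ((hX.measurable_mart t ⟨hs.trans hst, ht⟩).sub
    (hX.measurable_mart s ⟨hs, hst.trans ht⟩)).sub ?_
  exact Finset.measurable_fun_sum _ fun i _ => (measurable_dW hw i s t).smul (hξ i)

theorem IsItoProcess.lintegral_remSq_le [IsProbabilityMeasure P] (hw : IsBrownianMotion w P)
    (hX : IsItoProcess P w T σ β X) {s t : ℝ} (hs : 0 ≤ s) (ht : t ≤ T) (G : Grid s t)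
    {ξ : ℕ → Fin m → Ω → E n}
    (hξ : ∀ j i, StronglyMeasurable[augFiltration w P (G.t j)] (ξ j i)) {C : ℝ}
    (hC : ∀ j i ω, ‖ξ j i ω‖ ≤ C) {A : Set Ω} (hA : MeasurableSet A) {η : ℝ}
    (hη : ∀ ω ∈ A, ∀ j, ∀ r ∈ Ioc (G.t j) (G.t (j + 1)), ∀ i, ‖σ i r (X r ω) - ξ j i ω‖ ≤ η) :
    Measurable (remSq w β X ξ G) ∧ ∫⁻ ω in A, ENNReal.ofReal (remSq w β X ξ G ω) ∂P ≤
      ENNReal.ofReal (4 * n * m * η ^ 2 * (t - s)) := by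
  have hm : ∀ j, Measurable fun ω => ‖mart X β (G.t (j + 1)) ω - mart X β (G.t j) ω -
      ∑ i, dW w i (G.t j) (G.t (j + 1)) ω • ξ j i ω‖ ^ 2 := fun j =>
    hX.measurable_remainder hw (hs.trans (G.mem j).1) (G.mono (Nat.le_succ j))
      ((G.mem (j + 1)).2.trans ht) fun i => ((hξ j i).mono (augFiltration_le _)).measurable
  refine ⟨Finset.measurable_fun_sum _ fun j _ => hm j, ?_⟩
  unfold remSq
  simp only [ENNReal.ofReal_sum_of_nonneg fun _ _ => sq_nonneg _]
  rw [lintegral_finsetSum _ fun j _ => (hm j).ennreal_ofReal]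
  refine (Finset.sum_le_sum fun j _ => hX.lintegral_remainder_le hw (hs.trans (G.mem j).1)
    (G.mono (Nat.le_succ j)) ((G.mem (j + 1)).2.trans ht) (hξ j) (hC j) hA
    fun ω hω => hη ω hω j).trans ?_
  rw [← ENNReal.ofReal_sum_of_nonneg fun j _ => mul_nonneg (by positivity) (G.step_nonneg j),
    ← Finset.mul_sum, G.sum_step]

theorem continuousOn_pi_apply {a b : ℝ} {f : Fin m → ℝ → E n → E n}
    (hf : ∀ i, ContinuousOn (fun q : ℝ × E n => f i q.1 q.2) (Icc a b ×ˢ univ)) :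
    ContinuousOn (fun q : ℝ × E n => (fun i => f i q.1 q.2 : Fin m → E n)) (Icc a b ×ˢ univ) :=
  continuousOn_pi.2 hf

/-- Itô's formula. -/
theorem IsItoProcess.ito_formula [IsProbabilityMeasure P] (hw : IsBrownianMotion w P)
    (hX : IsItoProcess P w T σ β X) {s t : ℝ} (hs : 0 ≤ s) (hst : s ≤ t) (ht : t ≤ T)
    {V vt : ℝ → E n → ℝ} {p : ℝ → E n → E n} {H : ℝ → E n → E n →L[ℝ] E n}
    (hV : C12On s t V vt p H) :
    ItoLim P w (restrictIoc s t fun i r ω => inner ℝ (p r (X r ω)) (σ i r (X r ω)))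
      (fun ω => V t (X t ω) - V s (X s ω) - ∫ r in s..t, (vt r (X r ω) +
        inner ℝ (p r (X r ω)) (β r ω) +
        1 / 2 * ∑ i, inner ℝ (σ i r (X r ω)) (H r (X r ω) (σ i r (X r ω))))) := by
  have hsub : Icc s t ⊆ Icc 0 T := Icc_subset_Icc hs ht
  have hσ : ∀ i, ContinuousOn (fun q : ℝ × E n => σ i q.1 q.2) (Icc s t ×ˢ univ) := fun i =>
    (hX.continuous_σ i).mono (prod_mono_left hsub)
  set tr : ℝ → E n → ℝ := fun r x => ∑ i, inner ℝ (σ i r x) (H r x (σ i r x)) with htrdef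
  have htr : ContinuousOn (fun q : ℝ × E n => tr q.1 q.2) (Icc s t ×ˢ univ) :=
    continuousOn_finsetSum _ fun i _ => (hσ i).inner (hV.cont_xx.clm_apply (hσ i))
  have hΦ : ∀ i, ContinuousOn (fun q : ℝ × E n => inner ℝ (p q.1 q.2) (σ i q.1 q.2))
      (Icc s t ×ˢ univ) := fun i => hV.cont_x.inner (hσ i)
  -- The approximating integrand freezes the gradient at the left end of each cell but leaves `σ(r,
  -- X_r)` untouched. Its integral is then the exact sum of the products `⟨p(t_j, X_{t_j}), ΔM_j⟩`,
  -- with the state truncated to a ball.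
  refine ItoLim.of_approx fun ε hε => ?_
  obtain ⟨K, hK, A₁, hA₁, hP₁, hbd⟩ := hX.exists_bound_event (ε := ε / 8) (by positivity)
  obtain ⟨C, hC0, hC⟩ := exists_bound_on_ball hV.cont_xx K
  obtain ⟨Cσ, hCσ0, hCσ⟩ := exists_bound_on_ball
    (f := fun r x => (fun i => σ i r x : Fin m → E n)) (continuousOn_pi_apply hσ) K
  obtain ⟨Cp, hCp0, hCp⟩ := exists_bound_on_ball hV.cont_x K
  have hts : 0 ≤ t - s := sub_nonneg.2 hst
  -- The summands of `c` belong to the deterministic error, to the sum of `‖D j‖ ^ 2`, to the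
  -- remainders of the noise, and to the distance of the integrands. The two random ones are needed
  -- below `ε ^ 2 / 16 = (ε / 4) * (ε / 4)`, since Markov's inequality is used at level `ε / 4` with
  -- probability `ε / 4`.
  obtain ⟨ρ, hρ, hρ1, hρc⟩ := exists_small (τ := min (ε / 8) (ε ^ 2 / 16))
    (c := (2 * (t - s) + K + 2 * (2 + C ^ 2 + C) * K) + 3 * (m * Cσ ^ 2 * (m * (t - s)))
      + 8 * (2 + C ^ 2 + C) * n * m * (t - s) + m * Cσ ^ 2 * (t - s)) (by positivity)
          (by positivity)
  have hc1 : ρ * (2 * (t - s) + K + 2 * (2 + C ^ 2 + C) * K) ≤ ε / 8 := by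
    refine le_trans ?_ (hρc.trans (min_le_left _ _))
    refine mul_le_mul_of_nonneg_left ?_ hρ.le
    have : 0 ≤ 3 * (m * Cσ ^ 2 * (m * (t - s)))
      + 8 * (2 + C ^ 2 + C) * n * m * (t - s) + m * Cσ ^ 2 * (t - s) := by positivity
    linarith
  have hc2 : ρ * (3 * (m * Cσ ^ 2 * (m * (t - s)))) ≤ ε ^ 2 / 16 := by
    refine le_trans ?_ (hρc.trans (min_le_right _ _))
    refine mul_le_mul_of_nonneg_left ?_ hρ.le
    have : 0 ≤ (2 * (t - s) + K + 2 * (2 + C ^ 2 + C) * K)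
      + 8 * (2 + C ^ 2 + C) * n * m * (t - s) + m * Cσ ^ 2 * (t - s) := by positivity
    linarith
  have hc3 : ρ * (8 * (2 + C ^ 2 + C) * n * m * (t - s)) ≤ ε ^ 2 / 16 := by
    refine le_trans ?_ (hρc.trans (min_le_right _ _))
    refine mul_le_mul_of_nonneg_left ?_ hρ.le
    have : 0 ≤ (2 * (t - s) + K + 2 * (2 + C ^ 2 + C) * K) + 3 * (m * Cσ ^ 2 * (m * (t - s)))
      + m * Cσ ^ 2 * (t - s) := by positivity
    linarith
  have hc4 : ρ * (m * Cσ ^ 2 * (t - s)) ≤ ε / 8 := by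
    refine le_trans ?_ (hρc.trans (min_le_left _ _))
    refine mul_le_mul_of_nonneg_left ?_ hρ.le
    have : 0 ≤ (2 * (t - s) + K + 2 * (2 + C ^ 2 + C) * K) + 3 * (m * Cσ ^ 2 * (m * (t - s)))
      + 8 * (2 + C ^ 2 + C) * n * m * (t - s) := by positivity
    linarith
  obtain ⟨δ₁, hδ₁, hmod₁⟩ := exists_modulus_on_ball hV.cont_t K hρ
  obtain ⟨δ₂, hδ₂, hmod₂⟩ := exists_modulus_on_ball hV.cont_x K hρ
  obtain ⟨δ₃, hδ₃, hmod₃⟩ := exists_modulus_on_ball htr K hρ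
  obtain ⟨δ₄, hδ₄, hmod₄⟩ := exists_modulus_on_ball hV.cont_xx K hρ
  obtain ⟨δ₅, hδ₅, hmod₅⟩ := exists_modulus_on_ball
    (f := fun r x => (fun i => σ i r x : Fin m → E n)) (continuousOn_pi_apply hσ) K hρ
  set δ := min δ₁ (min δ₂ (min δ₃ (min δ₄ δ₅))) with hδdef
  have hδ : 0 < δ := by positivity
  have hle₁ : δ ≤ δ₁ := min_le_left _ _
  have hle₂ : δ ≤ δ₂ := (min_le_right _ _).trans (min_le_left _ _)
  have hle₃ : δ ≤ δ₃ := (min_le_right _ _).trans ((min_le_right _ _).trans (min_le_left _ _))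
  have hle₄ : δ ≤ δ₄ := (min_le_right _ _).trans ((min_le_right _ _).trans
    ((min_le_right _ _).trans (min_le_left _ _)))
  have hle₅ : δ ≤ δ₅ := (min_le_right _ _).trans ((min_le_right _ _).trans
    ((min_le_right _ _).trans (min_le_right _ _)))
  obtain ⟨h₁, hh₁, A₂, hA₂, hP₂, hmodX⟩ := hX.exists_modulus_event (ε := ε / 8)
    (η := min δ (ρ ^ 2)) (by positivity) (by positivity)
  set c5 : ℝ := Fintype.card (Fin m × Fin m) ^ 2 * (C * Cσ * Cσ) ^ 2 * (2 * κ₄ + 2) * (t - s)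
    with hc5
  have hκ := κ₄_nonneg
  -- Chebyshev's inequality at level `ε / 4` bounds the second order martingale by `h * c5 / (ε / 4)
  -- ^ 2`, which has to be at most `ε / 4`.
  obtain ⟨h₂, hh₂, -, hh₂c⟩ := exists_small (τ := (ε / 4) ^ 3) (c := c5) (by positivity)
    (by positivity)
  set h := min (min h₁ δ) h₂ with hhdef
  have hh : 0 < h := by positivity
  obtain ⟨G, hG⟩ := Grid.exists_meshLe hst hh
  have h01 : ∀ j, G.t j ≤ G.t (j + 1) := fun j => G.mono (Nat.le_succ j)
  have hstep : ∀ j, ∀ r ∈ Icc (G.t j) (G.t (j + 1)), r ∈ Icc s t := fun j r hr =>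
    ⟨(G.mem j).1.trans hr.1, hr.2.trans (G.mem (j + 1)).2⟩
  have hdist : ∀ j, ∀ r ∈ Icc (G.t j) (G.t (j + 1)), |G.t j - r| ≤ h ∧ |G.t (j + 1) - r| ≤ h := by
    intro j r hr
    have := hG j
    rw [abs_sub_comm, abs_of_nonneg (sub_nonneg.2 hr.1), abs_of_nonneg (sub_nonneg.2 hr.2)]
    constructor <;> linarith [hr.1, hr.2]
  have hhh₁ : h ≤ h₁ := (min_le_left _ _).trans (min_le_left _ _)
  have hhδ : h ≤ δ := (min_le_left _ _).trans (min_le_right _ _)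
  -- truncated coefficients
  set Y : ℕ → Ω → E n := fun j ω => proj K (X (G.t j) ω) with hY
  have hYm : ∀ j, StronglyMeasurable[augFiltration w P (G.t j)] (Y j) := fun j =>
    (continuous_proj hK).comp_stronglyMeasurable (hX.adapted _ (hsub (G.mem j)))
  have hYK : ∀ j ω, ‖Y j ω‖ ≤ K := fun j ω => norm_proj_le hK _
  set pj : ℕ → Ω → E n := fun j ω => p (G.t j) (Y j ω) with hpj
  have hpjm : ∀ j, StronglyMeasurable[augFiltration w P (G.t j)] (pj j) := fun j =>
    (continuous_slice hV.cont_x (G.mem j)).comp_stronglyMeasurable (hYm j)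
  set ξ : ℕ → Fin m → Ω → E n := fun j i ω => σ i (G.t j) (Y j ω) with hξ
  have hξm : ∀ j i, StronglyMeasurable[augFiltration w P (G.t j)] (ξ j i) := fun j i =>
    (continuous_slice (hσ i) (G.mem j)).comp_stronglyMeasurable (hYm j)
  have hξC : ∀ j i ω, ‖ξ j i ω‖ ≤ Cσ := fun j i ω =>
    (norm_le_pi_norm (fun i => σ i (G.t j) (Y j ω)) i).trans (hCσ _ (G.mem j) _ (hYK j ω))
  set Hj : ℕ → Ω → E n →L[ℝ] E n := fun j ω => H (G.t j) (Y j ω) with hHj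
  have hHm : ∀ j, StronglyMeasurable[augFiltration w P (G.t j)] (Hj j) := fun j =>
    (continuous_slice hV.cont_xx (G.mem j)).comp_stronglyMeasurable (hYm j)
  set A := A₁ ∩ A₂ with hA
  have hAm : MeasurableSet A := hA₁.inter hA₂
  have hYX : ∀ ω ∈ A, ∀ j, Y j ω = X (G.t j) ω := fun ω hω j =>
    proj_of_norm_le hK ((hbd ω hω.1).2.2.1 _ (hsub (G.mem j)))
  have hXmod : ∀ ω ∈ A, ∀ r ∈ Icc s t, ∀ q ∈ Icc s t, |r - q| ≤ h → ‖X r ω - X q ω‖ ≤ δ ∧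
      |(∫ u in (0 : ℝ)..r, ‖β u ω‖) - ∫ u in (0 : ℝ)..q, ‖β u ω‖| ≤ ρ ^ 2 := by
    intro ω hω r hr q hq hrq
    obtain ⟨b1, b2⟩ := hmodX ω hω.2 r (hsub hr) q (hsub hq) (hrq.trans hhh₁)
    exact ⟨b1.trans (min_le_left _ _), b2.trans (min_le_right _ _)⟩
  have hXK : ∀ ω ∈ A, ∀ r ∈ Icc s t, ‖X r ω‖ ≤ K := fun ω hω r hr => (hbd ω hω.1).2.2.1 r (hsub hr)
  -- the martingale terms
  have hZ : ∀ j, ItoLim P w (restrictIoc (G.t j) (G.t (j + 1)) fun i r ω =>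
      inner ℝ (pj j ω) (σ i r (X r ω)))
      (fun ω => inner ℝ (pj j ω) (mart X β (G.t (j + 1)) ω - mart X β (G.t j) ω)) := fun j =>
    hX.itoLim_inner hw (hs.trans (G.mem j).1) (h01 j) ((G.mem (j + 1)).2.trans ht) (hpjm j)
      (C := Cp) fun ω => hCp _ (G.mem j) _ (hYK j ω)
  have hZm : ∀ j, PathMeas P (restrictIoc (G.t j) (G.t (j + 1)) fun i r ω =>
      inner ℝ (pj j ω) (σ i r (X r ω))) := fun j => pathMeas_restrictIoc (by
    filter_upwards [hX.cont] with ω hω i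
    exact continuousOn_const.inner ((continuousOn_comp (hσ i) (hω.mono hsub)).mono
      fun r hr => hstep j r (Ioc_subset_Icc_self hr)))
  have hpX : ∀ ω ∈ A, ∀ j, ∀ r ∈ Icc (G.t j) (G.t (j + 1)),
      ‖p (G.t j) (X (G.t j) ω) - p r (X r ω)‖ ≤ ρ := fun ω hω j r hr =>
    hmod₂ _ (G.mem j) r (hstep j r hr) _ _ (hXK ω hω _ (G.mem j)) (hXK ω hω r (hstep j r hr))
      ((hdist j r hr).1.trans (hhδ.trans hle₂))
      ((hXmod ω hω _ (G.mem j) r (hstep j r hr) (hdist j r hr).1).1.trans hle₂)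
  refine ⟨_, _, ItoLim.sum (s := Finset.range G.N) (fun j _ => hZ j) (fun j _ => hZm j),
    PathMeas.sum fun j _ => hZm j, ?_, ?_⟩
  · refine le_trans (measure_mono (t := Aᶜ) fun ω hω hωA => ?_) ?_
    · have hle : sqDist (fun i r ω => ∑ j ∈ Finset.range G.N, restrictIoc (G.t j) (G.t (j + 1))
          (fun i r ω => inner ℝ (pj j ω) (σ i r (X r ω))) i r ω)
          (restrictIoc s t fun i r ω => inner ℝ (p r (X r ω)) (σ i r (X r ω))) ω ≤
          ENNReal.ofReal (m * (ρ * Cσ) ^ 2 * (t - s)) := by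
        refine sqDist_le_of_abs_le (fun r hr i => ?_) fun r hr i => ?_
        · rw [sum_restrictIoc_of_notMem G _ hr, restrictIoc_of_notMem hr]
        · obtain ⟨j, hj, hrj⟩ := G.exists_mem hr
          rw [sum_restrictIoc_of_mem G _ hj hrj, restrictIoc_of_mem hr, ← inner_sub_left]
          refine (abs_real_inner_le_norm _ _).trans ?_
          have h1 := hpX ω hωA j r (Ioc_subset_Icc_self hrj)
          rw [← hYX ω hωA] at h1
          have h2 : ‖σ i r (X r ω)‖ ≤ Cσ := (norm_le_pi_norm (fun i => σ i r (X r ω)) i).trans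
            (hCσ r (Ioc_subset_Icc_self hr) _ (hXK ω hωA r (Ioc_subset_Icc_self hr)))
          exact mul_le_mul h1 h2 (norm_nonneg _) hρ.le
      have h1 := le_trans hω hle
      rw [ENNReal.ofReal_le_ofReal_iff (by positivity)] at h1
      have h2 : m * (ρ * Cσ) ^ 2 * (t - s) ≤ ρ * (m * Cσ ^ 2 * (t - s)) := by
        have : 0 ≤ (m : ℝ) * Cσ ^ 2 * (t - s) := by positivity
        calc m * (ρ * Cσ) ^ 2 * (t - s) = ρ * (ρ * (m * Cσ ^ 2 * (t - s))) := by ring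
          _ ≤ 1 * (ρ * (m * Cσ ^ 2 * (t - s))) := by gcongr
          _ = _ := one_mul _
      linarith
    · rw [hA, compl_inter]
      refine (measure_union_le _ _).trans ((add_le_add hP₁ hP₂).trans ?_)
      rw [← ENNReal.ofReal_add (by positivity) (by positivity)]
      exact ENNReal.ofReal_le_ofReal (by linarith)
  -- the second order martingale
  have hmd := measure_grid_sum_le (P := P) (w := w) G hG (ι := Fin m × Fin m)
    (z := fun j q ω => dW w q.1 (G.t j) (G.t (j + 1)) ω * dW w q.2 (G.t j) (G.t (j + 1)) ω -
      if q.1 = q.2 then G.t (j + 1) - G.t j else 0)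
    (fun j q => isMDiff_dW_mul hw q.1 q.2 (hs.trans (G.mem j).1) (h01 j))
    (c := 2 * κ₄ + 2) (by positivity)
    (fun j q => integral_dW_mul_sub_sq_le hw q.1 q.2 (hs.trans (G.mem j).1) (h01 j) le_rfl)
    (ξ := fun j q ω => 1 / 2 * inner ℝ (Hj j ω (ξ j q.1 ω)) (ξ j q.2 ω))
    (fun j q => by
      have hH1 : StronglyMeasurable[augFiltration w P (G.t j)] fun ω => Hj j ω (ξ j q.1 ω) :=
        (isBoundedBilinearMap_apply.continuous).comp_stronglyMeasurable
          ((hHm j).prodMk (hξm j q.1))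
      exact (StronglyMeasurable.inner hH1 (hξm j q.2)).const_mul _)
    (C := C * Cσ * Cσ) (fun j q ω => by
      rw [abs_mul, abs_of_pos (by norm_num : (0 : ℝ) < 1 / 2)]
      have h1 : |inner ℝ (Hj j ω (ξ j q.1 ω)) (ξ j q.2 ω)| ≤ C * Cσ * Cσ := by
        refine (abs_real_inner_le_norm _ _).trans ?_
        gcongr
        · exact (ContinuousLinearMap.le_opNorm _ _).trans (mul_le_mul
            (hC _ (G.mem j) _ (hYK j ω)) (hξC j _ ω) (norm_nonneg _) hC0)
        · exact hξC j _ ω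
      have h2 : 0 ≤ |inner ℝ (Hj j ω (ξ j q.1 ω)) (ξ j q.2 ω)| := abs_nonneg _
      linarith) (ε := ε / 4) (by positivity)
  have hmd' := hmd.trans (ENNReal.ofReal_le_ofReal (show _ ≤ ε / 4 by
    rw [div_le_iff₀ (by positivity)]
    have h3 : h * c5 ≤ h₂ * c5 := mul_le_mul_of_nonneg_right (min_le_right _ _) (by positivity)
    have h4 : Fintype.card (Fin m × Fin m) ^ 2 * (C * Cσ * Cσ) ^ 2 * (2 * κ₄ + 2) * h * (t - s) =
      h * c5 := by rw [hc5]; ring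
    rw [h4]
    exact h3.trans (hh₂c.trans (le_of_eq (by ring)))))
  -- the remainders
  have hξσ : ∀ ω ∈ A, ∀ j, ∀ r ∈ Ioc (G.t j) (G.t (j + 1)), ∀ i,
      ‖σ i r (X r ω) - ξ j i ω‖ ≤ ρ := by
    intro ω hω j r hr i
    have hr' := Ioc_subset_Icc_self hr
    have h1 := hmod₅ _ (G.mem j) r (hstep j r hr') _ _ (hXK ω hω _ (G.mem j))
      (hXK ω hω r (hstep j r hr')) ((hdist j r hr').1.trans (hhδ.trans hle₅))
      ((hXmod ω hω _ (G.mem j) r (hstep j r hr') (hdist j r hr').1).1.trans hle₅)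
    rw [norm_sub_rev]
    simp only [hξ]
    rw [hYX ω hω]
    exact (norm_le_pi_norm ((fun i => σ i (G.t j) (X (G.t j) ω)) - fun i => σ i r (X r ω)) i).trans
      h1
  obtain ⟨hRm, hRi⟩ := hX.lintegral_remSq_le hw hs ht G hξm hξC hAm hξσ
  have hR := measure_inter_ge_le hAm hRm (κ := 2 * (2 + C ^ 2 + C) / ρ) (l := ε / 4)
    (by positivity) (by positivity) hRi
  have hR' := hR.trans (ENNReal.ofReal_le_ofReal (show _ ≤ ε / 4 by
    rw [div_le_iff₀ (by positivity)]
    have e : 2 * (2 + C ^ 2 + C) / ρ * (4 * n * m * ρ ^ 2 * (t - s)) =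
      ρ * (8 * (2 + C ^ 2 + C) * n * m * (t - s)) := by field_simp; ring
    rw [e]
    linarith))
  have hW := measure_inter_ge_le MeasurableSet.univ (measurable_sumSq hw G)
    (κ := 3 * ρ * (m * Cσ ^ 2)) (l := ε / 4) (by positivity) (by positivity)
    (by rw [Measure.restrict_univ]; exact (lintegral_sumSq hw hs G).le)
  have hW' := hW.trans (ENNReal.ofReal_le_ofReal (show _ ≤ ε / 4 by
    rw [div_le_iff₀ (by positivity)]
    linarith))
  have hP : P Aᶜ ≤ ENNReal.ofReal (ε / 4) := by
    rw [hA, compl_inter]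
    refine (measure_union_le _ _).trans ((add_le_add hP₁ hP₂).trans ?_)
    rw [← ENNReal.ofReal_add (by positivity) (by positivity)]
    exact ENNReal.ofReal_le_ofReal (by linarith)
  -- Four exceptional events of probability at most `ε / 4` each are removed: bad paths, a large
  -- second order martingale, large remainders, and a large sum of squared increments. Outside them
  -- the error is below `ε / 8 + 3 * (ε / 4) < ε`.
  refine le_trans (measure_mono ?_) (((measure_union_le _ _).trans (add_le_add
    ((measure_union_le _ _).trans (add_le_add ((measure_union_le _ _).trans
      (add_le_add hP hmd')) hR')) hW')).trans (le_of_eq ?_))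
  swap
  · rw [← ENNReal.ofReal_add (by positivity) (by positivity),
      ← ENNReal.ofReal_add (by positivity) (by positivity),
      ← ENNReal.ofReal_add (by positivity) (by positivity)]
    congr 1; ring
  intro ω hω
  by_contra hcon
  simp only [mem_union, mem_inter_iff, mem_compl_iff, mem_ofPred_eq, not_or, not_and, not_not,
    not_le, mem_univ, true_implies] at hcon
  obtain ⟨⟨⟨hωA, g1⟩, g2⟩, g3⟩ := hcon
  have g2 := g2 hωA
  obtain ⟨hxc, hβ, -, hBK⟩ := hbd ω hωA.1
  have hβ' := hβ.mono_set hsub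
  have hmart : ∀ j, mart X β (G.t (j + 1)) ω - mart X β (G.t j) ω =
      X (G.t (j + 1)) ω - X (G.t j) ω - ∫ r in (G.t j)..(G.t (j + 1)), β r ω := fun j =>
    mart_sub ω hβ (hs.trans (G.mem j).1) (h01 j) ((G.mem (j + 1)).2.trans ht)
  have hsum := abs_ito_sum_le hV htr (hxc.mono hsub) hβ' G hρ hρ1
    (fun j r hr => hmod₁ r (hstep j r hr) r (hstep j r hr) _ _ (hXK ω hωA _ (G.mem _))
      (hXK ω hωA r (hstep j r hr)) (by simpa using (hδ.trans_le hle₁).le)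
      ((hXmod ω hωA _ (G.mem _) r (hstep j r hr) (hdist j r hr).2).1.trans hle₁))
    (fun j r hr => hpX ω hωA j r hr)
    (fun j r hr => hmod₃ _ (G.mem j) r (hstep j r hr) _ _ (hXK ω hωA _ (G.mem j))
      (hXK ω hωA r (hstep j r hr)) ((hdist j r hr).1.trans (hhδ.trans hle₃))
      ((hXmod ω hωA _ (G.mem j) r (hstep j r hr) (hdist j r hr).1).1.trans hle₃))
    (fun j z hz => hmod₄ _ (G.mem j) _ (G.mem j) _ _ (by
        have hb := (convex_closedBall (0 : E n) K).segment_subset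
          (x := X (G.t j) ω) (y := X (G.t (j + 1)) ω) (by simpa using hXK ω hωA _ (G.mem j))
          (by simpa using hXK ω hωA _ (G.mem (j + 1))) hz
        simpa using hb) (hXK ω hωA _ (G.mem j)) (by simpa using (hδ.trans_le hle₄).le) (by
        have h1 := (hXmod ω hωA _ (G.mem (j + 1)) _ (G.mem j)
          (hdist j _ (left_mem_Icc.2 (h01 j))).2).1
        rw [segment_eq_image'] at hz
        obtain ⟨l, hl, rfl⟩ := hz
        rw [add_sub_cancel_left, norm_smul, Real.norm_eq_abs, abs_of_nonneg hl.1]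
        exact (mul_le_of_le_one_left (norm_nonneg _) hl.2).trans (h1.trans hle₄)))
    (fun j => hC _ (G.mem j) _ (hXK ω hωA _ (G.mem j)))
    (K := K) (by
      rw [← var_sub ω hβ hs hst ht]
      have : 0 ≤ ∫ r in (0 : ℝ)..s, ‖β r ω‖ :=
        intervalIntegral.integral_nonneg hs fun _ _ => norm_nonneg _
      have h5 : ∫ r in (0 : ℝ)..t, ‖β r ω‖ ≤ ∫ r in (0 : ℝ)..T, ‖β r ω‖ := by
        rw [← sub_nonneg, var_sub ω hβ (hs.trans hst) ht le_rfl]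
        exact intervalIntegral.integral_nonneg ht fun _ _ => norm_nonneg _
      linarith)
    (fun j => by
      rw [← var_sub ω hβ (hs.trans (G.mem j).1) (h01 j) ((G.mem (j + 1)).2.trans ht)]
      exact (le_abs_self _).trans (hXmod ω hωA _ (G.mem (j + 1)) _ (G.mem j)
        (hdist j _ (left_mem_Icc.2 (h01 j))).2).2)
    (fun j => ∑ i, dW w i (G.t j) (G.t (j + 1)) ω • ξ j i ω)
  have eS : ∑ j ∈ Finset.range G.N, 1 / 2 * (inner ℝ (H (G.t j) (X (G.t j) ω)
      (∑ i, dW w i (G.t j) (G.t (j + 1)) ω • ξ j i ω))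
          (∑ i, dW w i (G.t j) (G.t (j + 1)) ω • ξ j i ω)
      - tr (G.t j) (X (G.t j) ω) * (G.t (j + 1) - G.t j)) =
      ∑ j ∈ Finset.range G.N, ∑ q : Fin m × Fin m,
        1 / 2 * inner ℝ (Hj j ω (ξ j q.1 ω)) (ξ j q.2 ω) *
        (dW w q.1 (G.t j) (G.t (j + 1)) ω * dW w q.2 (G.t j) (G.t (j + 1)) ω -
          if q.1 = q.2 then G.t (j + 1) - G.t j else 0) := by
    refine Finset.sum_congr rfl fun j _ => ?_
    have e1 : tr (G.t j) (X (G.t j) ω) = ∑ i, inner ℝ (ξ j i ω) (Hj j ω (ξ j i ω)) := by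
      simp only [htrdef, hξ, hHj, hYX ω hωA]
    have e2 : H (G.t j) (X (G.t j) ω) = Hj j ω := by simp only [hHj, hYX ω hωA]
    rw [e1, e2, inner_sum_sum_sub, Finset.mul_sum]
    exact Finset.sum_congr rfl fun q _ => by ring
  have eR : ∑ j ∈ Finset.range G.N, ‖X (G.t (j + 1)) ω - X (G.t j) ω -
      (∫ r in (G.t j)..(G.t (j + 1)), β r ω) -
        ∑ i, dW w i (G.t j) (G.t (j + 1)) ω • ξ j i ω‖ ^ 2 = remSq w β X ξ G ω := by
    unfold remSq
    simp only [hmart]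
  have eZ : ∑ j ∈ Finset.range G.N, inner ℝ (p (G.t j) (X (G.t j) ω))
      (X (G.t (j + 1)) ω - X (G.t j) ω - ∫ r in (G.t j)..(G.t (j + 1)), β r ω) =
      ∑ j ∈ Finset.range G.N, inner ℝ (pj j ω)
        (mart X β (G.t (j + 1)) ω - mart X β (G.t j) ω) := by
    simp only [hmart, hpj, hYX ω hωA]
  have hD : ∑ j ∈ Finset.range G.N, ‖∑ i, dW w i (G.t j) (G.t (j + 1)) ω • ξ j i ω‖ ^ 2 ≤
      m * Cσ ^ 2 * sumSq w G ω := by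
    unfold sumSq
    rw [Finset.mul_sum]
    exact Finset.sum_le_sum fun j _ => norm_sum_dW_smul_sq_le (hξC j · ω) _
  rw [eS, eR, eZ] at hsum
  have hD' := mul_le_mul_of_nonneg_left hD (show 0 ≤ 3 * ρ by positivity)
  simp only [mem_ofPred_eq] at hω
  rw [abs_lt] at g1
  rw [abs_le] at hsum
  rw [le_abs] at hω
  rcases hω with hω | hω <;> linarith [hsum.1, hsum.2, g1.1, g1.2]

end ItoFormula

/-! ### Time averages and estimates for products with increments -/

section Averages

variable {Ω : Type*} [mΩ : MeasurableSpace Ω] {n m : ℕ}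
variable {w : Fin m → ℝ≥0 → Ω → ℝ} {P : Measure Ω}

theorem lintegral_ofReal_add_le {A : Set Ω} {f g : Ω → ℝ} (hf : Measurable f) {a b : ℝ}
    (ha : 0 ≤ a) (hb : 0 ≤ b) (h1 : ∫⁻ ω in A, ENNReal.ofReal (f ω) ∂P ≤ ENNReal.ofReal a)
    (h2 : ∫⁻ ω in A, ENNReal.ofReal (g ω) ∂P ≤ ENNReal.ofReal b) :
    ∫⁻ ω in A, ENNReal.ofReal (f ω + g ω) ∂P ≤ ENNReal.ofReal (a + b) := by
  rw [ENNReal.ofReal_add ha hb]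
  refine (lintegral_mono fun ω => ENNReal.ofReal_add_le).trans ?_
  rw [lintegral_add_left hf.ennreal_ofReal]
  exact add_le_add h1 h2

theorem lintegral_ofReal_mul_le {A : Set Ω} {f : Ω → ℝ} {a κ : ℝ} (hκ : 0 ≤ κ)
    (h : ∫⁻ ω in A, ENNReal.ofReal (f ω) ∂P ≤ ENNReal.ofReal a) :
    ∫⁻ ω in A, ENNReal.ofReal (κ * f ω) ∂P ≤ ENNReal.ofReal (κ * a) := by
  simp only [ENNReal.ofReal_mul hκ]
  rw [lintegral_const_mul' _ _ ENNReal.ofReal_ne_top]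
  exact mul_le_mul_right h _

theorem lintegral_ofReal_const_le [IsProbabilityMeasure P] (A : Set Ω) (c : ℝ) :
    ∫⁻ _ in A, ENNReal.ofReal c ∂P ≤ ENNReal.ofReal c := by
  rw [lintegral_const, Measure.restrict_apply_univ]
  exact mul_le_of_le_one_right zero_le prob_le_one

/-- Markov's inequality for the time average of a continuous process. -/
theorem measure_inter_abs_integral_ge_le [IsProbabilityMeasure P] {φ : ℝ → Ω → ℝ}
    (hm : ∀ θ ∈ Icc (0 : ℝ) 1, Measurable (φ θ))
    (hc : ∀ᵐ ω ∂P, ContinuousOn (fun θ => φ θ ω) (Icc 0 1)) {A : Set Ω} (hA : MeasurableSet A)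
    {c : ℝ} (hφ : ∀ θ ∈ Icc (0 : ℝ) 1, ∫⁻ ω in A, ENNReal.ofReal |φ θ ω| ∂P ≤ ENNReal.ofReal c)
    {ε : ℝ} (hε : 0 < ε) :
    P (A ∩ {ω | ε ≤ |∫ θ in (0 : ℝ)..1, φ θ ω|}) ≤ ENNReal.ofReal (c / ε) := by
  obtain ⟨B, hBs, hBm, hB0⟩ := exists_measurable_superset_of_null (ae_iff.1 hc)
  have hcB : ∀ ω ∉ B, ContinuousOn (fun θ => φ θ ω) (Icc 0 1) := fun ω hω => by
    by_contra h
    exact hω (hBs h)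
  -- The modified process is continuous in `θ` for every `ω` and measurable in `ω` for every `θ`,
  -- hence jointly measurable, so that Tonelli's theorem applies.
  set ψ : ℝ → Ω → ℝ := fun θ => Bᶜ.indicator (φ (projIcc (0 : ℝ) 1 zero_le_one θ)) with hψ
  have hψm : ∀ θ, Measurable (ψ θ) := fun θ => (hm _ (projIcc _ _ _ θ).2).indicator hBm.compl
  have hψc : ∀ ω, Continuous fun θ => ψ θ ω := by
    intro ω
    by_cases hω : ω ∈ B
    · simp [hψ, hω, continuous_const]
    · simp only [hψ, indicator_of_mem (show ω ∈ Bᶜ from hω)]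
      exact (continuousOn_iff_continuous_domRestrict.1 (hcB ω hω)).comp continuous_projIcc
  have hψj : Measurable (Function.uncurry ψ) :=
    measurable_uncurry_of_continuous_of_measurable hψc hψm
  have hψe : ∀ ω ∉ B, ∀ θ ∈ Icc (0 : ℝ) 1, ψ θ ω = φ θ ω := by
    intro ω hω θ hθ
    simp only [hψ, indicator_of_mem (show ω ∈ Bᶜ from hω), projIcc_of_mem _ hθ]
  set g : Ω → ℝ≥0∞ := fun ω => ∫⁻ θ in Ioc (0 : ℝ) 1, ENNReal.ofReal |ψ θ ω| with hg
  have hj : Measurable fun q : ℝ × Ω => ENNReal.ofReal |ψ q.1 q.2| :=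
    ENNReal.measurable_ofReal.comp (continuous_abs.measurable.comp hψj)
  have hgm : Measurable g := Measurable.lintegral_prod_left' (μ := volume.restrict (Ioc (0 : ℝ) 1))
      hj
  have hgi : ∫⁻ ω in A, g ω ∂P ≤ ENNReal.ofReal c := by
    have hsw := lintegral_lintegral_swap (μ := P.restrict A) (ν := volume.restrict (Ioc (0 : ℝ) 1))
      (f := fun ω θ => ENNReal.ofReal |ψ θ ω|) (hj.comp measurable_swap).aemeasurable
    rw [hg, hsw]
    have : ∀ θ ∈ Ioc (0 : ℝ) 1, ∫⁻ ω in A, ENNReal.ofReal |ψ θ ω| ∂P ≤ ENNReal.ofReal c := by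
      intro θ hθ
      refine le_trans (lintegral_mono fun ω => ?_) (hφ θ (Ioc_subset_Icc_self hθ))
      by_cases hω : ω ∈ B
      · simp [hψ, hω]
      · rw [hψe ω hω θ (Ioc_subset_Icc_self hθ)]
    refine (setLIntegral_mono' measurableSet_Ioc this).trans ?_
    simp
  have hmk := meas_ge_le_lintegral_div (μ := P.restrict A) hgm.aemeasurable (ε := ENNReal.ofReal ε)
    (by simpa using hε) ENNReal.ofReal_ne_top
  rw [Measure.restrict_apply' hA] at hmk
  have hsub : A ∩ {ω | ε ≤ |∫ θ in (0 : ℝ)..1, φ θ ω|} ⊆ ({ω | ENNReal.ofReal ε ≤ g ω} ∩ A) ∪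
      B := by
    rintro ω ⟨hωA, hω⟩
    by_cases hωB : ω ∈ B
    · exact Or.inr hωB
    refine Or.inl ⟨(ENNReal.ofReal_le_ofReal hω).trans ?_, hωA⟩
    rw [intervalIntegral.integral_of_le zero_le_one, ← Real.norm_eq_abs, ofReal_norm]
    refine (enorm_integral_le_lintegral_enorm _).trans (le_of_eq ?_)
    refine setLIntegral_congr_fun measurableSet_Ioc fun θ hθ => ?_
    rw [hψe ω hωB θ (Ioc_subset_Icc_self hθ), ← Real.norm_eq_abs, ofReal_norm]
  refine (measure_mono hsub).trans ((measure_union_le _ _).trans ?_)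
  rw [hB0, add_zero, ENNReal.ofReal_div_of_pos hε]
  exact hmk.trans (ENNReal.div_le_div_right hgi _)

theorem measurable_sum_dW_sq (hw : IsBrownianMotion w P) {a b : ℝ} (G : Grid a b) (s : ℕ → ℝ) :
    Measurable fun ω => ∑ j ∈ Finset.range G.N, ∑ k, dW w k (G.t j) (s j) ω ^ 2 :=
  Finset.measurable_fun_sum _ fun _ _ => Finset.measurable_fun_sum _ fun k _ =>
    (measurable_dW hw k _ _).pow_const 2

theorem lintegral_sum_dW_sq_le [IsProbabilityMeasure P] (hw : IsBrownianMotion w P) {a b : ℝ}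
    (ha : 0 ≤ a) (G : Grid a b) {s : ℕ → ℝ} (hs : ∀ j, s j ∈ Icc (G.t j) (G.t (j + 1)))
    (A : Set Ω) :
    ∫⁻ ω in A, ENNReal.ofReal (∑ j ∈ Finset.range G.N, ∑ k, dW w k (G.t j) (s j) ω ^ 2) ∂P ≤
      ENNReal.ofReal (m * (b - a)) := by
  have h0 : ∀ j, 0 ≤ G.t j := fun j => ha.trans (G.mem j).1
  have hint : ∀ j k, Integrable (fun ω => dW w k (G.t j) (s j) ω ^ 2) P := fun j k =>
    (memLp_dW hw k (h0 j) (hs j).1 2).integrable_sq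
  refine (lintegral_mono' Measure.restrict_le_self le_rfl).trans ?_
  rw [← ofReal_integral_eq_lintegral_ofReal
    (integrable_finsetSum _ fun j _ => integrable_finsetSum _ fun k _ => hint j k)
    (Eventually.of_forall fun ω => Finset.sum_nonneg fun j _ => Finset.sum_nonneg fun i _ =>
      sq_nonneg _)]
  refine ENNReal.ofReal_le_ofReal ?_
  rw [integral_finsetSum _ fun j _ => integrable_finsetSum _ fun k _ => hint j k]
  have e : ∀ j, ∫ ω, ∑ k, dW w k (G.t j) (s j) ω ^ 2 ∂P ≤ m * (G.t (j + 1) - G.t j) := by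
    intro j
    rw [integral_finsetSum _ fun i _ => hint j i]
    simp only [integral_dW_sq hw _ (h0 j) (hs j).1]
    simp only [Finset.sum_const, Finset.card_univ, Fintype.card_fin, nsmul_eq_mul]
    exact mul_le_mul_of_nonneg_left (by linarith [(hs j).2]) (by positivity)
  refine (Finset.sum_le_sum fun j _ => e j).trans ?_
  rw [← Finset.mul_sum, G.sum_step]

variable {T : ℝ} {σ : Fin m → ℝ → E n → E n} {β X : ℝ → Ω → E n}

theorem IsItoProcess.lintegral_sum_remainder_le [IsProbabilityMeasure P]
    (hw : IsBrownianMotion w P) (hX : IsItoProcess P w T σ β X) {a b : ℝ} (ha : 0 ≤ a)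
    (hb : b ≤ T) (G : Grid a b) {s : ℕ → ℝ} (hs : ∀ j, s j ∈ Icc (G.t j) (G.t (j + 1)))
    {ξ : ℕ → Fin m → Ω → E n}
    (hξ : ∀ j i, StronglyMeasurable[augFiltration w P (G.t j)] (ξ j i)) {C : ℝ}
    (hC : ∀ j i ω, ‖ξ j i ω‖ ≤ C) {A : Set Ω} (hA : MeasurableSet A) {η : ℝ}
    (hη : ∀ ω ∈ A, ∀ j, ∀ r ∈ Ioc (G.t j) (G.t (j + 1)), ∀ i, ‖σ i r (X r ω) - ξ j i ω‖ ≤ η) :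
    ∫⁻ ω in A, ENNReal.ofReal (∑ j ∈ Finset.range G.N, ‖mart X β (s j) ω - mart X β (G.t j) ω -
        ∑ i, dW w i (G.t j) (s j) ω • ξ j i ω‖ ^ 2) ∂P ≤
      ENNReal.ofReal (4 * n * m * η ^ 2 * (b - a)) := by
  have hsT : ∀ j, s j ≤ T := fun j => (hs j).2.trans ((G.mem (j + 1)).2.trans hb)
  have hm : ∀ j, Measurable fun ω => ‖mart X β (s j) ω - mart X β (G.t j) ω -
      ∑ i, dW w i (G.t j) (s j) ω • ξ j i ω‖ ^ 2 := fun j =>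
    hX.measurable_remainder hw (ha.trans (G.mem j).1) (hs j).1 (hsT j)
      fun i => ((hξ j i).mono (augFiltration_le _)).measurable
  simp only [ENNReal.ofReal_sum_of_nonneg fun _ _ => sq_nonneg _]
  rw [lintegral_finsetSum _ fun j _ => (hm j).ennreal_ofReal]
  refine (Finset.sum_le_sum fun j _ => hX.lintegral_remainder_le hw (ha.trans (G.mem j).1)
    (hs j).1 (hsT j) (hξ j) (hC j) hA
    fun ω hω r hr => hη ω hω j r ⟨hr.1, hr.2.trans (hs j).2⟩).trans ?_
  have h0 : ∀ j, 0 ≤ s j - G.t j := fun j => sub_nonneg.2 (hs j).1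
  rw [← ENNReal.ofReal_sum_of_nonneg fun j _ => mul_nonneg (by positivity) (h0 j),
    ← Finset.mul_sum, ← G.sum_step]
  refine ENNReal.ofReal_le_ofReal (mul_le_mul_of_nonneg_left (Finset.sum_le_sum fun j _ => ?_)
    (by positivity))
  linarith [(hs j).2]

/-- In the application `a` is a Brownian increment, `Δ` the step, `d` the norm of the noise, `B` the
variation of the drift and `R` the norm of the remainder. Since `Δ` and `B` are at most `ρ ^ 2`,
their products with `|a|` are absorbed into `ρ` times quantities with bounded sums; only `R ^ 2`
carries the factor `1 / ρ`. -/
theorem abs_mul_abs_le_of_taylor {a x Δ d B R L C ρ : ℝ} (hρ : 0 < ρ) (hΔ0 : 0 ≤ Δ)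
    (hB0 : 0 ≤ B) (hL : 0 ≤ L) (hC : 0 ≤ C) (hΔ : Δ ≤ ρ ^ 2) (hB : B ≤ ρ ^ 2)
    (hx : |x| ≤ L * Δ + ρ * d + C * (B + R)) :
    |a * x| ≤ ρ * ((L + 1 + 2 * C) * a ^ 2 + L * Δ + d ^ 2 + C * B) + C / ρ * R ^ 2 := by
  have key : ∀ y : ℝ, 0 ≤ y → y ≤ ρ ^ 2 → |a| * y ≤ ρ * (a ^ 2 + y) := by
    intro y hy hyρ
    have h1 : |a| * y * ρ ≤ ρ ^ 2 * (a ^ 2 + y) := by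
      have h2 : y * y ≤ ρ ^ 2 * y := mul_le_mul_of_nonneg_right hyρ hy
      have h3 := sq_nonneg (ρ * |a| - y)
      have h4 : 0 ≤ ρ * |a| * y := by positivity
      nlinarith [sq_abs a]
    have h5 : ρ * (|a| * y) ≤ ρ * (ρ * (a ^ 2 + y)) := by linarith
    exact le_of_mul_le_mul_left h5 hρ
  have h1 := mul_le_mul_of_nonneg_left (key Δ hΔ0 hΔ) hL
  have h2 := mul_le_mul_of_nonneg_left (key B hB0 hB) hC
  have h3 : |a| * d ≤ a ^ 2 + d ^ 2 := by
    nlinarith [sq_nonneg (|a| - d), sq_abs a, sq_nonneg d, sq_nonneg a]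
  have h4 : |a| * R ≤ ρ * a ^ 2 + 1 / ρ * R ^ 2 := by
    have e : ρ * a ^ 2 + 1 / ρ * R ^ 2 - |a| * R =
        1 / ρ * ((ρ * |a| - R) ^ 2 + ρ * |a| * R) := by
      field_simp
      rw [← sq_abs a]
      ring
    have h5 : 0 ≤ (ρ * |a| - R) ^ 2 + ρ * |a| * R := by
      nlinarith [sq_nonneg (ρ * |a|), sq_nonneg R, sq_nonneg (ρ * |a| - R / 2)]
    have h6 : 0 ≤ 1 / ρ * ((ρ * |a| - R) ^ 2 + ρ * |a| * R) := by positivity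
    linarith
  have h3' := mul_le_mul_of_nonneg_left h3 hρ.le
  have h4' := mul_le_mul_of_nonneg_left h4 hC
  rw [abs_mul]
  refine (mul_le_mul_of_nonneg_left hx (abs_nonneg a)).trans ?_
  have e : C / ρ * R ^ 2 = C * (1 / ρ * R ^ 2) := by ring
  rw [e]
  nlinarith

/-- The substitution `r = a + θ (b - a)` writes the mean over every cell as an integral over the
same interval `[0, 1]`. On a degenerate cell both sides vanish, because `c`, an increment of `w`,
does. -/
theorem average_eq_integral {f : ℝ → ℝ} {a b c : ℝ} (h : a = b → c = 0) :
    c / (b - a) * (∫ r in a..b, f r) = c * ∫ θ in (0 : ℝ)..1, f (a + θ * (b - a)) := by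
  by_cases hab : a = b
  · rw [h hab]; simp
  · have hne : b - a ≠ 0 := sub_ne_zero.2 (Ne.symm hab)
    have h1 := intervalIntegral.mul_integral_comp_add_mul (f := f) (a := 0) (b := 1) (b - a) a
    simp only [mul_zero, add_zero, mul_one, add_sub_cancel] at h1
    rw [← h1, div_mul_eq_mul_div, mul_div_assoc, mul_div_cancel_left₀ _ hne]
    simp only [mul_comm]

end Averages

/-! ### Stratonovich sums of functions of an Itô process -/

section StratonovichSums

variable {Ω : Type*} [mΩ : MeasurableSpace Ω] {n m : ℕ}
variable {w : Fin m → ℝ≥0 → Ω → ℝ} {P : Measure Ω}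
variable {T : ℝ} {σ : Fin m → ℝ → E n → E n} {β X : ℝ → Ω → E n}

theorem abs_riemann_sub_le {a b : ℝ} (G : Grid a b) {q : ℝ → ℝ} {q₀ : ℕ → ℝ} {ρ : ℝ}
    (hq : ContinuousOn q (Icc a b))
    (h : ∀ j, ∀ r ∈ Icc (G.t j) (G.t (j + 1)), |q₀ j - q r| ≤ ρ) :
    |∑ j ∈ Finset.range G.N, q₀ j * (G.t (j + 1) - G.t j) - ∫ r in a..b, q r| ≤ ρ * (b - a) := by
  have hi : ∀ j, IntervalIntegrable q volume (G.t j) (G.t (j + 1)) := fun j =>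
    (hq.mono (Icc_subset_Icc (G.mem j).1 (G.mem (j + 1)).2)).intervalIntegrable_of_Icc
      (G.mono (Nat.le_succ j))
  have e : ∫ r in a..b, q r = ∑ j ∈ Finset.range G.N, ∫ r in (G.t j)..(G.t (j + 1)), q r := by
    rw [intervalIntegral.sum_integral_adjacent_intervals (fun k _ => hi k), G.first,
      G.last _ le_rfl]
  rw [e, ← Finset.sum_sub_distrib, ← G.sum_step, Finset.mul_sum]
  refine (Finset.abs_sum_le_sum_abs _ _).trans (Finset.sum_le_sum fun j _ => ?_)
  have h1 : q₀ j * (G.t (j + 1) - G.t j) - ∫ r in (G.t j)..(G.t (j + 1)), q r =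
      ∫ r in (G.t j)..(G.t (j + 1)), (q₀ j - q r) := by
    rw [intervalIntegral.integral_sub (by simp) (hi j), intervalIntegral.integral_const,
      smul_eq_mul, mul_comm]
  have h2 := intervalIntegral.norm_integral_le_of_norm_le_const (a := G.t j) (b := G.t (j + 1))
    (f := fun r => q₀ j - q r) (C := ρ) (fun r hr => by
      rw [uIoc_of_le (G.mono (Nat.le_succ j))] at hr
      exact h j r (Ioc_subset_Icc_self hr))
  rw [abs_of_nonneg (G.step_nonneg j)] at h2
  rw [h1]
  exact h2

theorem abs_le_add_sq_div {ρ : ℝ} (hρ : 0 < ρ) (x : ℝ) : |x| ≤ ρ + 1 / ρ * x ^ 2 := by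
  have h1 : |x| * ρ ≤ ρ ^ 2 + x ^ 2 := by
    nlinarith [sq_abs x, sq_nonneg (|x| - ρ), mul_nonneg (abs_nonneg x) hρ.le]
  have h2 : ρ + 1 / ρ * x ^ 2 = (ρ ^ 2 + x ^ 2) / ρ := by field_simp
  rw [h2, le_div_iff₀ hρ]
  exact h1

set_option maxHeartbeats 1000000 in
/-- The sums defining the Stratonovich integral of `f(t, X)` differ from the Itô sums by half the
covariation. -/
theorem IsItoProcess.stratonovich_sum_tendsto [IsProbabilityMeasure P]
    (hw : IsBrownianMotion w P) (hX : IsItoProcess P w T σ β X) {t : ℝ} (h0 : 0 ≤ t) (ht : t ≤ T)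
    {f : ℝ → E n → ℝ} {f' : ℝ → E n → E n →L[ℝ] ℝ} {L : ℝ} (hL0 : 0 ≤ L)
    (hf : ContinuousOn (fun q : ℝ × E n => f q.1 q.2) (Icc 0 t ×ˢ univ))
    (hf' : ContinuousOn (fun q : ℝ × E n => f' q.1 q.2) (Icc 0 t ×ˢ univ))
    (hd : ∀ r ∈ Icc 0 t, ∀ x, HasFDerivAt (f r) (f' r x) x)
    (hL : ∀ r ∈ Icc 0 t, ∀ s ∈ Icc 0 t, ∀ x, |f r x - f s x| ≤ L * |r - s|) (i₀ : Fin m)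
    {ε : ℝ} (hε : 0 < ε) : ∃ h > 0, ∀ G : Grid 0 t, G.MeshLe h →
      P {ω | ε ≤ |∑ j ∈ Finset.range G.N, dW w i₀ (G.t j) (G.t (j + 1)) ω /
          (G.t (j + 1) - G.t j) * (∫ r in (G.t j)..(G.t (j + 1)), f r (X r ω)) -
        ∑ j ∈ Finset.range G.N, f (G.t j) (X (G.t j) ω) * dW w i₀ (G.t j) (G.t (j + 1)) ω -
        1 / 2 * ∫ r in (0 : ℝ)..t, f' r (X r ω) (σ i₀ r (X r ω))|} ≤ ENNReal.ofReal ε := by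
  have hsub : Icc 0 t ⊆ Icc 0 T := Icc_subset_Icc le_rfl ht
  have hσ : ∀ i, ContinuousOn (fun q : ℝ × E n => σ i q.1 q.2) (Icc 0 t ×ˢ univ) := fun i =>
    (hX.continuous_σ i).mono (prod_mono_left hsub)
  have hq : ContinuousOn (fun q : ℝ × E n => f' q.1 q.2 (σ i₀ q.1 q.2)) (Icc 0 t ×ˢ univ) :=
    hf'.clm_apply (hσ i₀)
  obtain ⟨K, hK, A₁, hA₁, hP₁, hbd⟩ := hX.exists_bound_event (ε := ε / 4) (by positivity)
  obtain ⟨C, hC0, hC⟩ := exists_bound_on_ball hf' K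
  obtain ⟨Cσ, hCσ0, hCσ⟩ := exists_bound_on_ball
    (f := fun r x => (fun i => σ i r x : Fin m → E n)) (continuousOn_pi_apply hσ) K
  -- `ρ * Ct` adds up the mean bounds of all terms in the pathwise estimate `hpt` below. The final
  -- `2` stands for `|S| ≤ ρ + S ^ 2 / ρ`, where `S ^ 2` has mean at most `ρ ^ 2`.
  set Ct : ℝ := ((L + 1 + 2 * (C + 1)) * (m * t) + (m * Cσ ^ 2) * (m * t) +
    (C + 1) * (4 * n * m * t) + (L * t + (C + 1) * K)) + 2 with hCt
  have hCt0 : 0 ≤ Ct := by positivity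
  obtain ⟨ρ, hρ, hρ1, hρc⟩ := exists_small (τ := min (ε / 2) (ε ^ 2 / 8)) (c := t + Ct)
    (by positivity) (by positivity)
  have hc1 : ρ * t ≤ ε / 2 := by
    refine le_trans ?_ (hρc.trans (min_le_left _ _))
    exact mul_le_mul_of_nonneg_left (by linarith) hρ.le
  have hc2 : ρ * Ct ≤ ε ^ 2 / 8 := by
    refine le_trans ?_ (hρc.trans (min_le_right _ _))
    exact mul_le_mul_of_nonneg_left (by linarith) hρ.le
  obtain ⟨δ₁, hδ₁, hmod₁⟩ := exists_modulus_on_ball hf' K hρ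
  obtain ⟨δ₂, hδ₂, hmod₂⟩ := exists_modulus_on_ball (f := fun r x => f' r x (σ i₀ r x)) hq K hρ
  obtain ⟨δ₃, hδ₃, hmod₃⟩ := exists_modulus_on_ball
    (f := fun r x => (fun i => σ i r x : Fin m → E n)) (continuousOn_pi_apply hσ) K hρ
  set δ := min δ₁ (min δ₂ δ₃) with hδdef
  have hδ : 0 < δ := by positivity
  have hle₁ : δ ≤ δ₁ := min_le_left _ _
  have hle₂ : δ ≤ δ₂ := (min_le_right _ _).trans (min_le_left _ _)
  have hle₃ : δ ≤ δ₃ := (min_le_right _ _).trans (min_le_right _ _)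
  obtain ⟨h₁, hh₁, A₂, hA₂, hP₂, hmodX⟩ := hX.exists_modulus_event (ε := ε / 4)
    (η := min δ (ρ ^ 2)) (by positivity) (by positivity)
  set c5 : ℝ := Fintype.card (Fin m) ^ 2 * (C * Cσ) ^ 2 * (2 * κ₄ + 2) * t with hc5
  have hκ := κ₄_nonneg
  -- The mesh is so small that the second order martingale has second moment at most `ρ ^ 2`.
  obtain ⟨h₂, hh₂, -, hh₂c⟩ := exists_small (τ := ρ ^ 2) (c := c5) (by positivity) (by positivity)
  refine ⟨min (min h₁ (min δ (ρ ^ 2))) h₂, by positivity, fun G hG => ?_⟩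
  set h := min (min h₁ (min δ (ρ ^ 2))) h₂ with hhdef
  have hhh₁ : h ≤ h₁ := (min_le_left _ _).trans (min_le_left _ _)
  have hhδ : h ≤ δ := (min_le_left _ _).trans ((min_le_right _ _).trans (min_le_left _ _))
  have hhρ : h ≤ ρ ^ 2 := (min_le_left _ _).trans ((min_le_right _ _).trans (min_le_right _ _))
  have h01 : ∀ j, G.t j ≤ G.t (j + 1) := fun j => G.mono (Nat.le_succ j)
  have hstep : ∀ j, ∀ r ∈ Icc (G.t j) (G.t (j + 1)), r ∈ Icc 0 t := fun j r hr =>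
    ⟨(G.mem j).1.trans hr.1, hr.2.trans (G.mem (j + 1)).2⟩
  have hdist : ∀ j, ∀ r ∈ Icc (G.t j) (G.t (j + 1)), |G.t j - r| ≤ h := by
    intro j r hr
    have := hG j
    rw [abs_sub_comm, abs_of_nonneg (sub_nonneg.2 hr.1)]
    linarith [hr.1, hr.2]
  -- truncated coefficients
  set Y : ℕ → Ω → E n := fun j ω => proj K (X (G.t j) ω) with hY
  have hYm : ∀ j, StronglyMeasurable[augFiltration w P (G.t j)] (Y j) := fun j =>
    (continuous_proj hK).comp_stronglyMeasurable (hX.adapted _ (hsub (G.mem j)))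
  have hYK : ∀ j ω, ‖Y j ω‖ ≤ K := fun j ω => norm_proj_le hK _
  set ξ : ℕ → Fin m → Ω → E n := fun j i ω => σ i (G.t j) (Y j ω) with hξ
  have hξm : ∀ j i, StronglyMeasurable[augFiltration w P (G.t j)] (ξ j i) := fun j i =>
    (continuous_slice (hσ i) (G.mem j)).comp_stronglyMeasurable (hYm j)
  have hξC : ∀ j i ω, ‖ξ j i ω‖ ≤ Cσ := fun j i ω =>
    (norm_le_pi_norm (fun i => σ i (G.t j) (Y j ω)) i).trans (hCσ _ (G.mem j) _ (hYK j ω))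
  set c : ℕ → Fin m → Ω → ℝ := fun j k ω => f' (G.t j) (Y j ω) (ξ j k ω) with hcdef
  have hcm : ∀ j k, StronglyMeasurable[augFiltration w P (G.t j)] (c j k) := fun j k =>
    (isBoundedBilinearMap_apply.continuous).comp_stronglyMeasurable
      (((continuous_slice hf' (G.mem j)).comp_stronglyMeasurable (hYm j)).prodMk (hξm j k))
  have hcC : ∀ j k ω, |c j k ω| ≤ C * Cσ := fun j k ω =>
    (ContinuousLinearMap.le_opNorm _ _).trans (mul_le_mul
      (hC _ (G.mem j) _ (hYK j ω)) (hξC j k ω) (norm_nonneg _) hC0)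
  set A := A₁ ∩ A₂ with hA
  have hAm : MeasurableSet A := hA₁.inter hA₂
  have hPA : P Aᶜ ≤ ENNReal.ofReal (ε / 2) := by
    rw [hA, compl_inter]
    refine (measure_union_le _ _).trans ((add_le_add hP₁ hP₂).trans ?_)
    rw [← ENNReal.ofReal_add (by positivity) (by positivity)]
    exact ENNReal.ofReal_le_ofReal (by linarith)
  have hYX : ∀ ω ∈ A, ∀ j, Y j ω = X (G.t j) ω := fun ω hω j =>
    proj_of_norm_le hK ((hbd ω hω.1).2.2.1 _ (hsub (G.mem j)))
  have hXK : ∀ ω ∈ A, ∀ r ∈ Icc 0 t, ‖X r ω‖ ≤ K := fun ω hω r hr => (hbd ω hω.1).2.2.1 r (hsub hr)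
  have hXmod : ∀ ω ∈ A, ∀ j, ∀ r ∈ Icc (G.t j) (G.t (j + 1)), ‖X (G.t j) ω - X r ω‖ ≤ δ ∧
      |(∫ u in (0 : ℝ)..(G.t j), ‖β u ω‖) - ∫ u in (0 : ℝ)..r, ‖β u ω‖| ≤ ρ ^ 2 := by
    intro ω hω j r hr
    obtain ⟨b1, b2⟩ := hmodX ω hω.2 _ (hsub (G.mem j)) r (hsub (hstep j r hr))
      ((hdist j r hr).trans hhh₁)
    exact ⟨b1.trans (min_le_left _ _), b2.trans (min_le_right _ _)⟩
  have hξσ : ∀ ω ∈ A, ∀ j, ∀ r ∈ Ioc (G.t j) (G.t (j + 1)), ∀ i,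
      ‖σ i r (X r ω) - ξ j i ω‖ ≤ ρ := by
    intro ω hω j r hr i
    have hr' := Ioc_subset_Icc_self hr
    have h1 := hmod₃ _ (G.mem j) r (hstep j r hr') _ _ (hXK ω hω _ (G.mem j))
      (hXK ω hω r (hstep j r hr')) ((hdist j r hr').trans (hhδ.trans hle₃))
      ((hXmod ω hω j r hr').1.trans hle₃)
    rw [norm_sub_rev]
    simp only [hξ]
    rw [hYX ω hω]
    exact (norm_le_pi_norm ((fun i => σ i (G.t j) (X (G.t j) ω)) - fun i => σ i r (X r ω)) i).trans
      h1
  -- the error of the sum with evaluation points `t_j + θ (t_{j+1} - t_j)`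
  set s : ℝ → ℕ → ℝ := fun θ j => G.t j + θ * (G.t (j + 1) - G.t j) with hs
  have hsmem : ∀ θ ∈ Icc (0 : ℝ) 1, ∀ j, s θ j ∈ Icc (G.t j) (G.t (j + 1)) := by
    intro θ hθ j
    have h1 := G.step_nonneg j
    constructor
    · have := mul_nonneg hθ.1 h1
      simp only [hs]; linarith
    · have := mul_le_of_le_one_left h1 hθ.2
      simp only [hs]; linarith
  -- At evaluation point `s θ j` the covariation with `w i₀` over the cell is `θ` times that over
  -- the whole cell. Integrating over `θ` turns the values of `f` into cell averages and `θ` into `1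
  -- / 2`.
  set φ : ℝ → Ω → ℝ := fun θ ω => ∑ j ∈ Finset.range G.N,
    (dW w i₀ (G.t j) (G.t (j + 1)) ω * (f (s θ j) (X (s θ j) ω) - f (G.t j) (X (G.t j) ω)) -
      θ * (c j i₀ ω * (G.t (j + 1) - G.t j))) with hφ
  have hfXm : ∀ r ∈ Icc 0 t, Measurable fun ω => f r (X r ω) := fun r hr =>
    ((continuous_slice hf hr).comp_stronglyMeasurable
      ((hX.adapted r (hsub hr)).mono (augFiltration_le _))).measurable
  have hφm : ∀ θ ∈ Icc (0 : ℝ) 1, Measurable (φ θ) := fun θ hθ =>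
    Finset.measurable_fun_sum _ fun j _ => ((measurable_dW hw _ _ _).mul
      ((hfXm _ (hstep j _ (hsmem θ hθ j))).sub (hfXm _ (G.mem j)))).sub
      ((((hcm j i₀).mono (augFiltration_le _)).measurable.mul_const _).const_mul _)
  have hsc : ∀ j, Continuous fun θ => s θ j := fun j => by simp only [hs]; fun_prop
  have hfc : ∀ ω, ContinuousOn (fun r => X r ω) (Icc 0 T) → ∀ j,
      ContinuousOn (fun θ => f (s θ j) (X (s θ j) ω)) (Icc 0 1) := fun ω hω j =>
    (continuousOn_comp hf (hω.mono hsub)).comp (hsc j).continuousOn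
      fun θ hθ => hstep j _ (hsmem θ hθ j)
  have hφc : ∀ᵐ ω ∂P, ContinuousOn (fun θ => φ θ ω) (Icc 0 1) := by
    filter_upwards [hX.cont] with ω hω
    exact continuousOn_finsetSum _ fun j _ => (continuousOn_const.mul
      ((hfc ω hω j).sub continuousOn_const)).sub (continuousOn_id.mul continuousOn_const)
  have hφle : ∀ θ ∈ Icc (0 : ℝ) 1,
      ∫⁻ ω in A, ENNReal.ofReal |φ θ ω| ∂P ≤ ENNReal.ofReal (ρ * Ct) := by
    intro θ hθ
    set W : Ω → ℝ := fun ω => ∑ j ∈ Finset.range G.N, ∑ k, dW w k (G.t j) (G.t (j + 1)) ω ^ 2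
      with hWdef
    set U : Ω → ℝ := fun ω => ∑ j ∈ Finset.range G.N, ∑ k, dW w k (G.t j) (s θ j) ω ^ 2 with hUdef
    set R : Ω → ℝ := fun ω => ∑ j ∈ Finset.range G.N, ‖mart X β (s θ j) ω - mart X β (G.t j) ω -
      ∑ i, dW w i (G.t j) (s θ j) ω • ξ j i ω‖ ^ 2 with hRdef
    set S : Ω → ℝ := fun ω => ∑ j ∈ Finset.range G.N, ∑ k, c j k ω *
      (dW w i₀ (G.t j) (G.t (j + 1)) ω * dW w k (G.t j) (s θ j) ω -
        if i₀ = k then s θ j - G.t j else 0) with hSdef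
    have hWm : Measurable W := measurable_sum_dW_sq hw G _
    have hUm : Measurable U := measurable_sum_dW_sq hw G _
    have hWi : ∫⁻ ω in A, ENNReal.ofReal (W ω) ∂P ≤ ENNReal.ofReal (m * t) := by
      have := lintegral_sum_dW_sq_le hw le_rfl G (s := fun j => G.t (j + 1))
        (fun j => right_mem_Icc.2 (h01 j)) A
      rwa [sub_zero] at this
    have hUi : ∫⁻ ω in A, ENNReal.ofReal (U ω) ∂P ≤ ENNReal.ofReal (m * t) := by
      have := lintegral_sum_dW_sq_le hw le_rfl G (hsmem θ hθ) A
      rwa [sub_zero] at this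
    have hRi : ∫⁻ ω in A, ENNReal.ofReal (R ω) ∂P ≤ ENNReal.ofReal (4 * n * m * ρ ^ 2 * t) := by
      have := hX.lintegral_sum_remainder_le hw le_rfl ht G (hsmem θ hθ) hξm hξC hAm hξσ
      rwa [sub_zero] at this
    obtain ⟨hS2, hSi⟩ := integral_grid_sum_sq_le (P := P) (w := w) G hG (ι := Fin m)
      (z := fun j k ω => dW w i₀ (G.t j) (G.t (j + 1)) ω * dW w k (G.t j) (s θ j) ω -
        if i₀ = k then s θ j - G.t j else 0)
      (fun j k => isMDiff_dW_mul_of_le hw i₀ k (G.mem j).1 (hsmem θ hθ j).1 (hsmem θ hθ j).2)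
      (c := 2 * κ₄ + 2) (by positivity)
      (fun j k => integral_dW_mul_sub_sq_le hw i₀ k (G.mem j).1 (hsmem θ hθ j).1 (hsmem θ hθ j).2)
      hcm hcC
    have hSm : Measurable S := Finset.measurable_fun_sum _ fun j _ =>
      Finset.measurable_fun_sum _ fun k _ => ((hcm j k).mono (augFiltration_le _)).measurable.mul
        (((measurable_dW hw _ _ _).mul (measurable_dW hw _ _ _)).sub_const _)
    have hSi' : ∫⁻ ω in A, ENNReal.ofReal (S ω ^ 2) ∂P ≤ ENNReal.ofReal (ρ ^ 2) := by
      refine (lintegral_mono' Measure.restrict_le_self le_rfl).trans ?_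
      rw [← ofReal_integral_eq_lintegral_ofReal hS2.integrable_sq
        (Eventually.of_forall fun ω => sq_nonneg _)]
      refine ENNReal.ofReal_le_ofReal (hSi.trans (le_trans ?_ hh₂c))
      have h3 : h * c5 ≤ h₂ * c5 := mul_le_mul_of_nonneg_right (min_le_right _ _) (by positivity)
      refine le_trans (le_of_eq ?_) h3
      rw [hc5, sub_zero]; ring
    -- the pathwise bound
    have hpt : ∀ ω ∈ A, |φ θ ω| ≤ ρ + (1 / ρ * S ω ^ 2 + (ρ * (L + 1 + 2 * (C + 1)) * W ω +
        (ρ * (m * Cσ ^ 2) * U ω + ((C + 1) / ρ * R ω + ρ * (L * t + (C + 1) * K))))) := by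
      intro ω hωA
      obtain ⟨hxc, hβ, -, hBK⟩ := hbd ω hωA.1
      set D : ℕ → E n := fun j => ∑ i, dW w i (G.t j) (s θ j) ω • ξ j i ω with hD
      set x : ℕ → ℝ := fun j => f (s θ j) (X (s θ j) ω) - f (G.t j) (X (G.t j) ω) -
        f' (G.t j) (X (G.t j) ω) (D j) with hx
      -- The linear part of the increment of `f` gives products of Brownian increments, whose means
      -- are exactly the subtracted terms; their fluctuation is `S`. The Taylor remainders `x j` are
      -- left over.
      have e1 : φ θ ω = S ω + ∑ j ∈ Finset.range G.N, dW w i₀ (G.t j) (G.t (j + 1)) ω * x j := by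
        simp only [hφ, hSdef, ← Finset.sum_add_distrib]
        refine Finset.sum_congr rfl fun j _ => ?_
        have e2 : f' (G.t j) (X (G.t j) ω) (D j) = ∑ k, dW w k (G.t j) (s θ j) ω * c j k ω := by
          simp only [hD, hcdef, map_sum, map_smul, smul_eq_mul, hYX ω hωA]
        have e3 : ∑ k, c j k ω * (dW w i₀ (G.t j) (G.t (j + 1)) ω * dW w k (G.t j) (s θ j) ω -
            if i₀ = k then s θ j - G.t j else 0) = dW w i₀ (G.t j) (G.t (j + 1)) ω *
            (∑ k, dW w k (G.t j) (s θ j) ω * c j k ω) - c j i₀ ω * (s θ j - G.t j) := by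
          simp only [mul_sub, Finset.sum_sub_distrib, mul_ite, mul_zero, Finset.sum_ite_eq,
            Finset.mem_univ, if_true, Finset.mul_sum]
          congr 1
          exact Finset.sum_congr rfl fun k _ => by ring
        rw [e3, hx]
        simp only [e2, hs]
        ring
      have hstepx : ∀ j, |dW w i₀ (G.t j) (G.t (j + 1)) ω * x j| ≤
          ρ * ((L + 1 + 2 * (C + 1)) * dW w i₀ (G.t j) (G.t (j + 1)) ω ^ 2 +
            L * (G.t (j + 1) - G.t j) + ‖D j‖ ^ 2 +
            (C + 1) * ∫ r in (G.t j)..(G.t (j + 1)), ‖β r ω‖) + (C + 1) / ρ *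
            ‖mart X β (s θ j) ω - mart X β (G.t j) ω - D j‖ ^ 2 := by
        intro j
        have hsj := hsmem θ hθ j
        have hsj0 := hstep j _ hsj
        have hmod := hXmod ω hωA j _ hsj
        have hiβ : ∀ {a b : ℝ}, 0 ≤ a → a ≤ b → b ≤ t →
            IntervalIntegrable (fun r => β r ω) volume a b := fun {a b} ha hab hb =>
          (intervalIntegrable_iff_integrableOn_Icc_of_le hab).2
            (hβ.mono_set (Icc_subset_Icc ha (hb.trans ht)))
        set B' := ∫ r in (G.t j)..(s θ j), ‖β r ω‖ with hB'
        have hvs := var_sub ω hβ (G.mem j).1 hsj.1 (hsj0.2.trans ht)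
        have hB'ρ : B' ≤ ρ ^ 2 := by
          rw [hB', ← hvs]
          have := hmod.2
          rw [abs_sub_comm] at this
          exact (le_abs_self _).trans this
        have hB'0 : 0 ≤ B' := intervalIntegral.integral_nonneg hsj.1 fun _ _ => norm_nonneg _
        have hB'B : B' ≤ ∫ r in (G.t j)..(G.t (j + 1)), ‖β r ω‖ :=
          intervalIntegral.integral_mono_interval le_rfl hsj.1 hsj.2
            (Eventually.of_forall fun _ => norm_nonneg _)
            (hiβ (G.mem j).1 (h01 j) (G.mem (j + 1)).2).norm
        have hmart := mart_sub (X := X) ω hβ (G.mem j).1 hsj.1 (hsj0.2.trans ht)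
        set I := ∫ r in (G.t j)..(s θ j), β r ω with hI
        have hIB : ‖I‖ ≤ B' := intervalIntegral.norm_integral_le_integral_norm hsj.1
        set Rj := mart X β (s θ j) ω - mart X β (G.t j) ω - D j with hRj
        have hdX : X (s θ j) ω - X (G.t j) ω = D j + (I + Rj) := by rw [hRj, hmart]; abel
        have hIR : ‖I + Rj‖ ≤ B' + ‖Rj‖ := (norm_add_le _ _).trans (by linarith)
        -- The remainder consists of a change in time, controlled by the Lipschitz bound; a first
        -- order Taylor error in space; and the derivative applied to the part `I + Rj` of the
        -- increment not captured by the noise `D j`.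
        have hxle : |x j| ≤ L * (G.t (j + 1) - G.t j) + ρ * ‖D j‖ + (C + 1) * (B' + ‖Rj‖) := by
          have t1 : |f (s θ j) (X (s θ j) ω) - f (G.t j) (X (s θ j) ω)| ≤
              L * (G.t (j + 1) - G.t j) := by
            refine (hL _ hsj0 _ (G.mem j) _).trans (mul_le_mul_of_nonneg_left ?_ hL0)
            rw [abs_of_nonneg (sub_nonneg.2 hsj.1)]
            linarith [hsj.2]
          have t2 : ‖f (G.t j) (X (s θ j) ω) - f (G.t j) (X (G.t j) ω) -
              f' (G.t j) (X (G.t j) ω) (X (s θ j) ω - X (G.t j) ω)‖ ≤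
              ρ * ‖X (s θ j) ω - X (G.t j) ω‖ := by
            refine (convex_segment (𝕜 := ℝ) (X (G.t j) ω)
              (X (s θ j) ω)).norm_image_sub_le_of_norm_hasFDerivWithin_le'
              (f' := f' (G.t j)) (fun z _ => (hd _ (G.mem j) z).hasFDerivWithinAt)
              (fun z hz => ?_) (left_mem_segment ℝ _ _) (right_mem_segment ℝ _ _)
            refine hmod₁ _ (G.mem j) _ (G.mem j) _ _ ?_ (hXK ω hωA _ (G.mem j))
              (by simpa using (hδ.trans_le hle₁).le) ?_
            · have hb := (convex_closedBall (0 : E n) K).segment_subset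
                (x := X (G.t j) ω) (y := X (s θ j) ω) (by simpa using hXK ω hωA _ (G.mem j))
                (by simpa using hXK ω hωA _ hsj0) hz
              simpa using hb
            · have h1 := hmod.1
              rw [norm_sub_rev] at h1
              rw [segment_eq_image'] at hz
              obtain ⟨l, hl, rfl⟩ := hz
              rw [add_sub_cancel_left, norm_smul, Real.norm_eq_abs, abs_of_nonneg hl.1]
              exact (mul_le_of_le_one_left (norm_nonneg _) hl.2).trans (h1.trans hle₁)
          have t3 : |f' (G.t j) (X (G.t j) ω) (I + Rj)| ≤ C * (B' + ‖Rj‖) :=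
            (ContinuousLinearMap.le_opNorm _ _).trans (mul_le_mul
              (hC _ (G.mem j) _ (hXK ω hωA _ (G.mem j))) hIR (norm_nonneg _) hC0)
          have t4 : ρ * ‖X (s θ j) ω - X (G.t j) ω‖ ≤ ρ * ‖D j‖ + (B' + ‖Rj‖) := by
            rw [hdX]
            have h1 : ρ * ‖D j + (I + Rj)‖ ≤ ρ * (‖D j‖ + (B' + ‖Rj‖)) :=
              mul_le_mul_of_nonneg_left ((norm_add_le _ _).trans (by linarith)) hρ.le
            have h2 : ρ * (B' + ‖Rj‖) ≤ 1 * (B' + ‖Rj‖) :=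
              mul_le_mul_of_nonneg_right hρ1 (by positivity)
            linarith
          have e4 : x j = (f (s θ j) (X (s θ j) ω) - f (G.t j) (X (s θ j) ω)) +
              (f (G.t j) (X (s θ j) ω) - f (G.t j) (X (G.t j) ω) -
              f' (G.t j) (X (G.t j) ω) (X (s θ j) ω - X (G.t j) ω)) +
              f' (G.t j) (X (G.t j) ω) (I + Rj) := by
            rw [hdX, map_add]
            simp only [hx]
            ring
          rw [e4]
          refine (abs_add_le _ _).trans ?_
          have t5 := abs_add_le (f (s θ j) (X (s θ j) ω) - f (G.t j) (X (s θ j) ω))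
            (f (G.t j) (X (s θ j) ω) - f (G.t j) (X (G.t j) ω) -
              f' (G.t j) (X (G.t j) ω) (X (s θ j) ω - X (G.t j) ω))
          rw [Real.norm_eq_abs] at t2
          linarith
        refine (abs_mul_abs_le_of_taylor hρ (G.step_nonneg j) hB'0 hL0 (by positivity)
          ((hG j).trans hhρ) hB'ρ hxle).trans ?_
        gcongr
      have hsumx := (Finset.abs_sum_le_sum_abs (fun j => dW w i₀ (G.t j) (G.t (j + 1)) ω * x j)
        (Finset.range G.N)).trans (Finset.sum_le_sum fun j _ => hstepx j)
      rw [Finset.sum_add_distrib, ← Finset.mul_sum, ← Finset.mul_sum, Finset.sum_add_distrib,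
        Finset.sum_add_distrib, Finset.sum_add_distrib, ← Finset.mul_sum, ← Finset.mul_sum,
        ← Finset.mul_sum, G.sum_step, sub_zero] at hsumx
      have s1 : ∑ j ∈ Finset.range G.N, dW w i₀ (G.t j) (G.t (j + 1)) ω ^ 2 ≤ W ω :=
        Finset.sum_le_sum fun j _ => Finset.single_le_sum
          (f := fun k => dW w k (G.t j) (G.t (j + 1)) ω ^ 2) (fun k _ => sq_nonneg _)
          (Finset.mem_univ i₀)
      have s2 : ∑ j ∈ Finset.range G.N, ‖D j‖ ^ 2 ≤ m * Cσ ^ 2 * U ω := by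
        simp only [hUdef]
        rw [Finset.mul_sum]
        exact Finset.sum_le_sum fun j _ => norm_sum_dW_smul_sq_le (hξC j · ω) _
      have s3 : ∑ j ∈ Finset.range G.N, ∫ r in (G.t j)..(G.t (j + 1)), ‖β r ω‖ ≤ K := by
        rw [intervalIntegral.sum_integral_adjacent_intervals (fun k _ =>
          ((intervalIntegrable_iff_integrableOn_Icc_of_le (h01 k)).2 (hβ.mono_set
            (Icc_subset_Icc (G.mem k).1 ((G.mem (k + 1)).2.trans ht)))).norm), G.first,
          G.last _ le_rfl]
        have h5 : ∫ r in (0 : ℝ)..t, ‖β r ω‖ ≤ ∫ r in (0 : ℝ)..T, ‖β r ω‖ := by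
          rw [← sub_nonneg, var_sub ω hβ h0 ht le_rfl]
          exact intervalIntegral.integral_nonneg ht fun _ _ => norm_nonneg _
        linarith
      have s4 := abs_le_add_sq_div hρ (S ω)
      rw [e1]
      refine (abs_add_le _ _).trans ?_
      have b1 := mul_le_mul_of_nonneg_left s1 (show 0 ≤ ρ * (L + 1 + 2 * (C + 1)) by positivity)
      have b2 := mul_le_mul_of_nonneg_left s2 hρ.le
      have b3 := mul_le_mul_of_nonneg_left s3 (show 0 ≤ ρ * (C + 1) by positivity)
      have b4 : ∑ j ∈ Finset.range G.N, ‖mart X β (s θ j) ω - mart X β (G.t j) ω - D j‖ ^ 2 = R ω :=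
        rfl
      rw [b4] at hsumx
      linarith
    refine (setLIntegral_mono' hAm fun ω hω => ENNReal.ofReal_le_ofReal (hpt ω hω)).trans ?_
    have hRm : Measurable R := Finset.measurable_fun_sum _ fun j _ =>
      hX.measurable_remainder hw (G.mem j).1 (hsmem θ hθ j).1
        ((hstep j _ (hsmem θ hθ j)).2.trans ht)
        fun i => ((hξm j i).mono (augFiltration_le _)).measurable
    have k1 := lintegral_ofReal_mul_le (κ := (C + 1) / ρ) (by positivity) hRi
    have k2 := lintegral_ofReal_add_le (hRm.const_mul _) (by positivity) (by positivity) k1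
      (lintegral_ofReal_const_le A (ρ * (L * t + (C + 1) * K)))
    have k3 := lintegral_ofReal_add_le (hUm.const_mul _) (by positivity) (by positivity)
      (lintegral_ofReal_mul_le (κ := ρ * (m * Cσ ^ 2)) (by positivity) hUi) k2
    have k4 := lintegral_ofReal_add_le (hWm.const_mul _) (by positivity) (by positivity)
      (lintegral_ofReal_mul_le (κ := ρ * (L + 1 + 2 * (C + 1))) (by positivity) hWi) k3
    have k5 := lintegral_ofReal_add_le ((hSm.pow_const 2).const_mul _) (by positivity)
      (by positivity) (lintegral_ofReal_mul_le (κ := 1 / ρ) (by positivity) hSi') k4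
    have k6 := lintegral_ofReal_add_le measurable_const hρ.le (by positivity)
      (lintegral_ofReal_const_le A ρ) k5
    refine k6.trans (ENNReal.ofReal_le_ofReal (le_of_eq ?_))
    rw [hCt]
    field_simp
    ring
  have hmk := measure_inter_abs_integral_ge_le hφm hφc hAm hφle (ε := ε / 2) (by positivity)
  have hmk' := hmk.trans (ENNReal.ofReal_le_ofReal (show _ ≤ ε / 4 by
    rw [div_le_iff₀ (by positivity)]; linarith))
  refine le_trans (measure_mono ?_) (((measure_union_le _ _).trans (add_le_add hPA hmk')).trans ?_)
  swap
  · rw [← ENNReal.ofReal_add (by positivity) (by positivity)]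
    exact ENNReal.ofReal_le_ofReal (by linarith)
  intro ω hω
  by_cases hωA : ω ∈ A
  swap
  · exact Or.inl hωA
  refine Or.inr ⟨hωA, ?_⟩
  obtain ⟨hxc, -⟩ := hbd ω hωA.1
  have hrie := abs_riemann_sub_le G (continuousOn_comp (f := fun r x => f' r x (σ i₀ r x)) hq
      (hxc.mono hsub))
    (q₀ := fun j => c j i₀ ω) (ρ := ρ) (fun j r hr => by
      have h1 := hmod₂ _ (G.mem j) r (hstep j r hr) _ _ (hXK ω hωA _ (G.mem j))
        (hXK ω hωA r (hstep j r hr)) ((hdist j r hr).trans (hhδ.trans hle₂))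
        ((hXmod ω hωA j r hr).1.trans hle₂)
      simpa only [hcdef, hξ, hYX ω hωA, Real.norm_eq_abs] using h1)
  have hint : ∫ θ in (0 : ℝ)..1, φ θ ω =
      ∑ j ∈ Finset.range G.N, dW w i₀ (G.t j) (G.t (j + 1)) ω /
          (G.t (j + 1) - G.t j) * (∫ r in (G.t j)..(G.t (j + 1)), f r (X r ω)) -
        ∑ j ∈ Finset.range G.N, f (G.t j) (X (G.t j) ω) * dW w i₀ (G.t j) (G.t (j + 1)) ω -
        1 / 2 * ∑ j ∈ Finset.range G.N, c j i₀ ω * (G.t (j + 1) - G.t j) := by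
    have i1 : ∀ j, IntervalIntegrable (fun θ => f (s θ j) (X (s θ j) ω)) volume 0 1 := fun j =>
      (hfc ω hxc j).intervalIntegrable_of_Icc zero_le_one
    have i2 : ∀ j, IntervalIntegrable (fun θ => dW w i₀ (G.t j) (G.t (j + 1)) ω *
        (f (s θ j) (X (s θ j) ω) - f (G.t j) (X (G.t j) ω))) volume 0 1 := fun j =>
      ((i1 j).sub intervalIntegrable_const).const_mul _
    have i3 : ∀ j, IntervalIntegrable (fun θ : ℝ => θ * (c j i₀ ω * (G.t (j + 1) - G.t j)))
        volume 0 1 := fun j => intervalIntegral.intervalIntegrable_id.mul_const _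
    simp only [hφ]
    rw [intervalIntegral.integral_finsetSum fun j _ => (i2 j).sub (i3 j), Finset.mul_sum,
      ← Finset.sum_sub_distrib, ← Finset.sum_sub_distrib]
    refine Finset.sum_congr rfl fun j _ => ?_
    rw [intervalIntegral.integral_sub (i2 j) (i3 j), intervalIntegral.integral_const_mul,
      intervalIntegral.integral_sub (i1 j) intervalIntegrable_const,
      intervalIntegral.integral_mul_const, intervalIntegral.integral_const, integral_id,
      average_eq_integral (f := fun r => f r (X r ω)) (fun he => by rw [he]; simp [dW])]
    simp only [hs, smul_eq_mul]
    ring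
  simp only [mem_ofPred_eq] at hω ⊢
  rw [hint]
  rw [abs_le] at hrie
  rw [le_abs] at hω ⊢
  rw [sub_zero] at hrie
  rcases hω with hω | hω
  · left; linarith [hrie.1, hrie.2]
  · right; linarith [hrie.1, hrie.2]

end StratonovichSums

/-! ### Partitions as grids and the mesh filter -/

section Partitions

/-- A partition as a grid. -/
def Partition.grid {a b : ℝ} (I : Partition a b) : Grid a b where
  N := I.N
  t := I.node
  mono := I.node_mono
  first := I.node_zero
  last _ hj := I.node_of_le hj

theorem Partition.grid_meshLe {a b : ℝ} (I : Partition a b) {h : ℝ} (h0 : 0 ≤ h)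
    (hI : I.mesh ≤ h) : I.grid.MeshLe h := by
  intro j
  by_cases hj : j < I.N
  · have h1 : I.pt (⟨j, hj⟩ : Fin I.N).succ - I.pt (⟨j, hj⟩ : Fin I.N).castSucc ≤ I.mesh :=
      le_ciSup (f := fun j : Fin I.N => I.pt j.succ - I.pt j.castSucc)
        (Set.finite_range _).bddAbove ⟨j, hj⟩
    rw [← I.node_succ, ← I.node_castSucc] at h1
    exact h1.trans hI
  · have h1 : I.node j = b := I.node_of_le (not_lt.1 hj)
    have h2 : I.node (j + 1) = b := I.node_of_le ((not_lt.1 hj).trans (Nat.le_succ j))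
    change I.node (j + 1) - I.node j ≤ h
    rw [h1, h2, sub_self]
    exact h0

theorem eventually_mesh_of_grid {a b : ℝ} {p : Grid a b → Prop} {h : ℝ} (hh : 0 < h)
    (hp : ∀ G : Grid a b, G.MeshLe h → p G) :
    ∀ᶠ I : Partition a b in comap Partition.mesh (𝓝 0), p I.grid := by
  refine ((eventually_lt_nhds hh).comap Partition.mesh).mono fun I hI => hp _ ?_
  exact I.grid_meshLe hh.le hI.le

/-- Limits along the mesh are unique only because partitions of arbitrarily small mesh exist. If `a
= b` the trivial partition has mesh zero as an empty supremum; otherwise uniform partitions serve.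
-/
theorem neBot_comap_mesh {a b : ℝ} (hab : a ≤ b) :
    NeBot (comap (Partition.mesh : Partition a b → ℝ) (𝓝 0)) := by
  rw [comap_neBot_iff]
  intro s hs
  obtain ⟨ε, hε, hεs⟩ := Metric.mem_nhds_iff.1 hs
  rcases hab.eq_or_lt with rfl | hlt
  · set I : Partition a a := ⟨0, fun _ => a, fun i j hij => by
      have := Fin.lt_def.1 hij
      omega, rfl, rfl⟩
    have hm : I.mesh = 0 := by simp [Partition.mesh]
    exact ⟨I, by rw [hm]; exact mem_of_mem_nhds hs⟩
  · obtain ⟨N, hN⟩ := exists_nat_gt ((b - a) / ε)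
    have hd : 0 < (b - a) / ((N : ℝ) + 1) := div_pos (sub_pos.2 hlt) (by positivity)
    set I : Partition a b := ⟨N + 1, fun j => a + (j : ℕ) * ((b - a) / ((N : ℝ) + 1)), by
      intro i j hij
      have : ((i : ℕ) : ℝ) < ((j : ℕ) : ℝ) := by exact_mod_cast hij
      simp only
      gcongr, by simp, by simp; field_simp; ring⟩ with hI
    refine ⟨I, hεs ?_⟩
    have hm : I.mesh = (b - a) / ((N : ℝ) + 1) := by
      have h1 : ∀ j : Fin (N + 1), I.pt j.succ - I.pt j.castSucc = (b - a) / ((N : ℝ) + 1) := by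
        intro j
        change a + ((j.succ : Fin (N + 1 + 1)) : ℕ) * ((b - a) / ((N : ℝ) + 1)) -
          (a + ((j.castSucc : Fin (N + 1 + 1)) : ℕ) * ((b - a) / ((N : ℝ) + 1))) = _
        rw [Fin.val_succ, Fin.val_castSucc]
        push_cast
        ring
      have h2 : I.mesh = ⨆ _ : Fin (N + 1), (b - a) / ((N : ℝ) + 1) := iSup_congr h1
      rw [h2, ciSup_const]
    rw [hm, Metric.mem_ball, Real.dist_eq, sub_zero, abs_of_pos hd, div_lt_iff₀ (by positivity)]
    rw [div_lt_iff₀ hε] at hN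
    nlinarith

end Partitions

/-! ### Stratonovich integrals of functions of an Itô process -/

section StratonovichIntegrals

variable {Ω : Type*} [mΩ : MeasurableSpace Ω] {n m : ℕ}
variable {w : Fin m → ℝ≥0 → Ω → ℝ} {P : Measure Ω}

/-- The Stratonovich integral is determined almost surely. -/
theorem stratonovichIntegral_ae_eq {F : Type*} [NormedAddCommGroup F] [NormedSpace ℝ F]
    {v : ℝ≥0 → Ω → ℝ} {y : ℝ → Ω → F} {a b : ℝ} (hab : a ≤ b) {Y : Ω → F}
    (h : IsStratonovichIntegral P v y a b Y) : stratonovichIntegral P v y a b =ᵐ[P] Y := by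
  have hex : StratonovichIntegrable P v y a b := ⟨Y, h⟩
  rw [stratonovichIntegral, dif_pos hex]
  have := neBot_comap_mesh hab
  exact tendstoInMeasure_ae_unique hex.choose_spec.tendsto h.tendsto

theorem stratonovichSum_apply {n : ℕ} (v : ℝ≥0 → Ω → ℝ) {y : ℝ → Ω → E n} {a b : ℝ}
    (I : Partition a b) {ω : Ω} (hy : IntegrableOn (fun r => y r ω) (Icc a b)) (κ : Fin n) :
    stratonovichSum v y I ω κ = ∑ j ∈ Finset.range I.grid.N,
      (v (I.grid.t (j + 1)).toNNReal ω - v (I.grid.t j).toNNReal ω) /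
        (I.grid.t (j + 1) - I.grid.t j) *
        ∫ r in (I.grid.t j)..(I.grid.t (j + 1)), y r ω κ := by
  set L : E n →L[ℝ] ℝ := EuclideanSpace.proj κ with hL
  have e : stratonovichSum v y I ω κ = L (stratonovichSum v y I ω) := rfl
  rw [e, stratonovichSum, map_sum, Finset.sum_range]
  refine Finset.sum_congr rfl fun j _ => ?_
  have h1 : I.grid.t j = I.pt j.castSucc := I.node_castSucc j
  have h2 : I.grid.t (j + 1) = I.pt j.succ := I.node_succ j
  have hi : IntervalIntegrable (fun r => y r ω) volume (I.grid.t j) (I.grid.t (j + 1)) :=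
    (intervalIntegrable_iff_integrableOn_Icc_of_le (I.grid.mono (Nat.le_succ j))).2
      (hy.mono_set (Icc_subset_Icc (I.grid.mem j).1 (I.grid.mem (j + 1)).2))
  rw [map_smul, smul_eq_mul, ← h1, ← h2, ← L.intervalIntegral_comp_comm hi, Partition.incr,
    ← h1, ← h2]
  rfl

variable {T : ℝ} {σ : Fin m → ℝ → E n → E n} {β X : ℝ → Ω → E n}

theorem IsItoProcess.stratonovich_sum_tendsto_add [IsProbabilityMeasure P]
    (hw : IsBrownianMotion w P) (hX : IsItoProcess P w T σ β X) {t : ℝ} (h0 : 0 ≤ t) (ht : t ≤ T)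
    {f : ℝ → E n → ℝ} {f' : ℝ → E n → E n →L[ℝ] ℝ} {L : ℝ} (hL0 : 0 ≤ L)
    (hf : ContinuousOn (fun q : ℝ × E n => f q.1 q.2) (Icc 0 t ×ˢ univ))
    (hf' : ContinuousOn (fun q : ℝ × E n => f' q.1 q.2) (Icc 0 t ×ˢ univ))
    (hd : ∀ r ∈ Icc 0 t, ∀ x, HasFDerivAt (f r) (f' r x) x)
    (hL : ∀ r ∈ Icc 0 t, ∀ s ∈ Icc 0 t, ∀ x, |f r x - f s x| ≤ L * |r - s|) (i₀ : Fin m)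
    {Y : Ω → ℝ} (hY : ItoLim P w (restrictIoc 0 t fun i r ω =>
      if i = i₀ then f r (X r ω) else 0) Y)
    {ε : ℝ} (hε : 0 < ε) : ∃ h > 0, ∀ G : Grid 0 t, G.MeshLe h →
      P {ω | ε ≤ |∑ j ∈ Finset.range G.N, dW w i₀ (G.t j) (G.t (j + 1)) ω /
          (G.t (j + 1) - G.t j) * (∫ r in (G.t j)..(G.t (j + 1)), f r (X r ω)) -
        (Y ω + 1 / 2 * ∫ r in (0 : ℝ)..t, f' r (X r ω) (σ i₀ r (X r ω)))|} ≤ ENNReal.ofReal ε := by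
  obtain ⟨h₁, hh₁, H₁⟩ := hX.stratonovich_sum_tendsto hw h0 ht hL0 hf hf' hd hL i₀
    (ε := ε / 2) (by positivity)
  have hac : AdaptedContinuous P w 0 t fun i r ω => if i = i₀ then f r (X r ω) else 0 := by
    have := hX.adaptedContinuous (a := 0) (b := t) le_rfl ht
      (f := fun i r x => if i = i₀ then f r x else 0) (fun i => by
        by_cases h : i = i₀
        · simpa [h] using hf
        · simpa [h] using continuousOn_const)
    exact this
  obtain ⟨h₂, hh₂, H₂⟩ := hac.gridInt_tendsto hw le_rfl h0 hY (ε := ε / 2) (by positivity)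
  refine ⟨min h₁ h₂, by positivity, fun G hG => ?_⟩
  have a1 := H₁ G fun j => (hG j).trans (min_le_left _ _)
  have a2 := H₂ G fun j => (hG j).trans (min_le_right _ _)
  have e : ∀ ω, gridInt w (fun i r ω => if i = i₀ then f r (X r ω) else 0) G ω =
      ∑ j ∈ Finset.range G.N, f (G.t j) (X (G.t j) ω) * dW w i₀ (G.t j) (G.t (j + 1)) ω := by
    intro ω
    simp [gridInt]
  have a3 := (measure_add_abs_le (P := P) (f := fun ω => ∑ j ∈ Finset.range G.N,
      dW w i₀ (G.t j) (G.t (j + 1)) ω /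
          (G.t (j + 1) - G.t j) * (∫ r in (G.t j)..(G.t (j + 1)), f r (X r ω)) -
        ∑ j ∈ Finset.range G.N, f (G.t j) (X (G.t j) ω) * dW w i₀ (G.t j) (G.t (j + 1)) ω -
        1 / 2 * ∫ r in (0 : ℝ)..t, f' r (X r ω) (σ i₀ r (X r ω)))
      (g := fun ω => gridInt w (fun i r ω => if i = i₀ then f r (X r ω) else 0) G ω - Y ω)
      (ε / 2) (ε / 2)).trans (add_le_add a1 a2)
  rw [← ENNReal.ofReal_add (by positivity) (by positivity), add_halves] at a3
  refine le_trans (measure_mono fun ω hω => ?_) a3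
  simp only [mem_ofPred_eq, e] at hω ⊢
  refine hω.trans (le_of_eq ?_)
  congr 1
  ring

/-- The divisor `n + 1` is not optimal, but it needs no separate treatment of dimension zero. -/
theorem exists_le_abs_apply {x : E n} {ε : ℝ} (hε : 0 < ε) (h : ε ≤ ‖x‖) :
    ∃ κ, ε / (n + 1) ≤ |x κ| := by
  by_contra! hcon
  have h1 : ‖x‖ ^ 2 ≤ n * (ε / (n + 1)) ^ 2 := by
    rw [EuclideanSpace.real_norm_sq_eq]
    refine (Finset.sum_le_card_nsmul Finset.univ _ ((ε / (n + 1)) ^ 2) fun κ _ => ?_).trans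
      (by simp)
    rw [← sq_abs]
    exact pow_le_pow_left₀ (abs_nonneg _) (hcon κ).le 2
  have h2 : ε ^ 2 ≤ n * (ε / (n + 1)) ^ 2 := (pow_le_pow_left₀ hε.le h 2).trans h1
  rw [div_pow, mul_div_assoc', le_div_iff₀ (by positivity)] at h2
  have h3 : 0 < ε ^ 2 := by positivity
  have h4 : (0 : ℝ) ≤ n := Nat.cast_nonneg n
  nlinarith [mul_nonneg h3.le h4, mul_nonneg h3.le (mul_nonneg h4 h4)]

/-- The Stratonovich integral of `f(t, X)`. -/
theorem IsItoProcess.isStratonovichIntegral [IsProbabilityMeasure P]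
    (hw : IsBrownianMotion w P) (hX : IsItoProcess P w T σ β X) {t : ℝ} (h0 : 0 ≤ t) (ht : t ≤ T)
    {f : ℝ → E n → E n} {f' : ℝ → E n → E n →L[ℝ] E n} {L : ℝ} (hL0 : 0 ≤ L)
    (hf : ContinuousOn (fun q : ℝ × E n => f q.1 q.2) (Icc 0 t ×ˢ univ))
    (hf' : ContinuousOn (fun q : ℝ × E n => f' q.1 q.2) (Icc 0 t ×ˢ univ))
    (hd : ∀ r ∈ Icc 0 t, ∀ x, HasFDerivAt (f r) (f' r x) x)
    (hL : ∀ r ∈ Icc 0 t, ∀ s ∈ Icc 0 t, ∀ x, ‖f r x - f s x‖ ≤ L * |r - s|) (i₀ : Fin m)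
    (hm : AEStronglyMeasurable (Function.uncurry fun r ω => f r (X r ω))
      ((volume.restrict (Icc 0 t)).prod P))
    {Y : Ω → E n} (hY : ∀ κ, ItoLim P w (restrictIoc 0 t fun i r ω =>
      if i = i₀ then f r (X r ω) κ else 0) (fun ω => Y ω κ)) :
    IsStratonovichIntegral P (w i₀) (fun r ω => f r (X r ω)) 0 t
      (fun ω => Y ω + (1 / 2 : ℝ) • ∫ r in (0 : ℝ)..t, f' r (X r ω) (σ i₀ r (X r ω))) := by
  have hsub : Icc 0 t ⊆ Icc 0 T := Icc_subset_Icc le_rfl ht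
  have hσ : ContinuousOn (fun q : ℝ × E n => σ i₀ q.1 q.2) (Icc 0 t ×ˢ univ) :=
    (hX.continuous_σ i₀).mono (prod_mono_left hsub)
  have hq : ContinuousOn (fun q : ℝ × E n => f' q.1 q.2 (σ i₀ q.1 q.2)) (Icc 0 t ×ˢ univ) :=
    hf'.clm_apply hσ
  have hint : ∀ᵐ ω ∂P, IntegrableOn (fun r => f r (X r ω)) (Icc 0 t) := by
    filter_upwards [hX.cont] with ω hω
    exact (continuousOn_comp hf (hω.mono hsub)).integrableOn_Icc
  have hint2 : ∀ᵐ ω ∂P, IntervalIntegrable (fun r => f' r (X r ω) (σ i₀ r (X r ω))) volume 0 t := by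
    filter_upwards [hX.cont] with ω hω
    exact (continuousOn_comp (f := fun r x => f' r x (σ i₀ r x)) hq
      (hω.mono hsub)).intervalIntegrable_of_Icc h0
  refine ⟨hm, hint, ?_⟩
  rw [tendstoInMeasure_iff_norm]
  intro ε hε
  rw [ENNReal.tendsto_nhds_zero]
  intro δ hδ
  -- The `n` coordinates are joined by a union bound, so each is allotted a probability `δ'` with `n
  -- * δ' ≤ δ`.
  obtain ⟨δ', hδ', hδδ⟩ : ∃ δ' : ℝ, 0 < δ' ∧ n * ENNReal.ofReal δ' ≤ δ := by
    rcases eq_or_ne δ ∞ with rfl | hδt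
    · exact ⟨1, one_pos, le_top⟩
    · refine ⟨δ.toReal / (n + 1), div_pos (ENNReal.toReal_pos hδ.ne' hδt) (by positivity), ?_⟩
      rw [← ENNReal.ofReal_natCast, ← ENNReal.ofReal_mul (by positivity)]
      refine (ENNReal.ofReal_le_ofReal (show _ ≤ δ.toReal by
        rw [mul_div_assoc', div_le_iff₀ (by positivity)]
        nlinarith [ENNReal.toReal_nonneg (a := δ)])).trans ENNReal.ofReal_toReal_le
  set η := min (ε / (n + 1)) δ' with hη
  have hη0 : 0 < η := by positivity
  have hev : ∀ κ : Fin n, ∀ᶠ I : Partition 0 t in comap Partition.mesh (𝓝 0),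
      P {ω | η ≤ |∑ j ∈ Finset.range I.grid.N, dW w i₀ (I.grid.t j) (I.grid.t (j + 1)) ω /
          (I.grid.t (j + 1) - I.grid.t j) *
            (∫ r in (I.grid.t j)..(I.grid.t (j + 1)), f r (X r ω) κ) -
        (Y ω κ + 1 / 2 * ∫ r in (0 : ℝ)..t, f' r (X r ω) (σ i₀ r (X r ω)) κ)|}
        ≤ ENNReal.ofReal η := by
    intro κ
    set l : E n →L[ℝ] ℝ := EuclideanSpace.proj κ with hl
    obtain ⟨h, hh, H⟩ := hX.stratonovich_sum_tendsto_add hw h0 ht hL0 (f := fun r x => l (f r x))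
      (f' := fun r x => l.comp (f' r x)) (l.continuous.comp_continuousOn hf)
      (continuousOn_const.clm_comp hf') (fun r hr x => l.hasFDerivAt.comp x (hd r hr x))
      (fun r hr s hs x => by
        rw [← map_sub]
        exact (PiLp.norm_apply_le (f r x - f s x) κ).trans (hL r hr s hs x)) i₀ (hY κ) hη0
    exact eventually_mesh_of_grid hh H
  filter_upwards [eventually_all.2 hev] with I hI
  refine le_trans ?_ hδδ
  have hunion : P {ω | ε ≤ ‖stratonovichSum (w i₀) (fun r ω => f r (X r ω)) I ω -
      (Y ω + (1 / 2 : ℝ) • ∫ r in (0 : ℝ)..t, f' r (X r ω) (σ i₀ r (X r ω)))‖} ≤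
      P (⋃ κ : Fin n, {ω | η ≤ |∑ j ∈ Finset.range I.grid.N,
        dW w i₀ (I.grid.t j) (I.grid.t (j + 1)) ω / (I.grid.t (j + 1) - I.grid.t j) *
            (∫ r in (I.grid.t j)..(I.grid.t (j + 1)), f r (X r ω) κ) -
        (Y ω κ + 1 / 2 * ∫ r in (0 : ℝ)..t, f' r (X r ω) (σ i₀ r (X r ω)) κ)|}) := by
    refine measure_mono_ae ?_
    filter_upwards [hint, hint2] with ω h1 h2 h3
    obtain ⟨κ, hκ⟩ := exists_le_abs_apply hε h3
    refine mem_iUnion.2 ⟨κ, (min_le_left _ _).trans (hκ.trans (le_of_eq ?_))⟩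
    set l : E n →L[ℝ] ℝ := EuclideanSpace.proj κ with hl
    have e1 : (∫ r in (0 : ℝ)..t, f' r (X r ω) (σ i₀ r (X r ω))) κ =
        ∫ r in (0 : ℝ)..t, f' r (X r ω) (σ i₀ r (X r ω)) κ := (l.intervalIntegral_comp_comm h2).symm
    rw [PiLp.sub_apply, PiLp.add_apply, PiLp.smul_apply, smul_eq_mul, e1,
      stratonovichSum_apply _ _ h1]
    rfl
  refine hunion.trans ((measure_iUnion_fintype_le _ _).trans
    ((Finset.sum_le_sum fun κ _ => (hI κ).trans
      (ENNReal.ofReal_le_ofReal (min_le_right _ _))).trans ?_))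
  simp

end StratonovichIntegrals

/-! ### Joint measurability, sections and time integrals -/

section JointMeasurability

variable {Ω : Type*} [mΩ : MeasurableSpace Ω] {P : Measure Ω}
variable {F : Type*} [NormedAddCommGroup F] [NormedSpace ℝ F] [MeasurableSpace F] [BorelSpace F]
  [SecondCountableTopology F]

theorem JointlyMeasurableOn.mono {β : Type*} [MeasurableSpace β] {𝒢 ℋ : MeasurableSpace Ω}
    (h : 𝒢 ≤ ℋ) {a t : ℝ} {u : ℝ → Ω → β} (hu : JointlyMeasurableOn 𝒢 a t u) :
    JointlyMeasurableOn ℋ a t u :=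
  Measurable.mono hu (sup_le_sup le_rfl (MeasurableSpace.comap_mono h)) le_rfl

theorem JointlyMeasurableOn.mono_right {β : Type*} [MeasurableSpace β] {a s t : ℝ} (hst : s ≤ t)
    {u : ℝ → Ω → β} (hu : JointlyMeasurableOn mΩ a t u) : JointlyMeasurableOn mΩ a s u := by
  have h : Measurable fun q : Icc a s × Ω =>
      ((⟨q.1, q.1.2.1, q.1.2.2.trans hst⟩ : Icc a t), q.2) :=
    ((measurable_subtype_coe.comp measurable_fst).subtype_mk).prodMk measurable_snd
  exact Measurable.comp hu h

/-- A section of a jointly measurable process. -/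
theorem JointlyMeasurableOn.section {β : Type*} [MeasurableSpace β] {a t r : ℝ} {u : ℝ → Ω → β}
    (hu : JointlyMeasurableOn mΩ a t u) (hr : r ∈ Icc a t) : Measurable (u r) := by
  have h : Measurable fun ω : Ω => ((⟨r, hr⟩ : Icc a t), ω) := measurable_const.prodMk measurable_id
  have h2 : Measurable ((fun q : Icc a t × Ω => u q.1 q.2) ∘ fun ω => (⟨r, hr⟩, ω)) :=
    Measurable.comp hu h
  exact h2

/-- Projecting time to `[a, t]` yields a process that is jointly measurable on the whole line and
unchanged on `[a, t]`; the Fubini-type statements are then available for it. -/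
theorem JointlyMeasurableOn.measurable_projIcc {β : Type*} [MeasurableSpace β] {a t : ℝ}
    (hat : a ≤ t) {u : ℝ → Ω → β} (hu : JointlyMeasurableOn mΩ a t u) :
    Measurable fun q : ℝ × Ω => u (projIcc a t hat q.1) q.2 := by
  have h : Measurable fun q : ℝ × Ω => (projIcc a t hat q.1, q.2) :=
    (continuous_projIcc.measurable.comp measurable_fst).prodMk measurable_snd
  exact Measurable.comp hu h

theorem JointlyMeasurableOn.aestronglyMeasurable {a t : ℝ} (hat : a ≤ t) {u : ℝ → Ω → F}
    (hu : JointlyMeasurableOn mΩ a t u) :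
    AEStronglyMeasurable (Function.uncurry u) ((volume.restrict (Icc a t)).prod P) := by
  refine ⟨_, (hu.measurable_projIcc hat).stronglyMeasurable, ?_⟩
  have h := (Measure.quasiMeasurePreserving_fst (μ := volume.restrict (Icc a t)) (ν := P)).ae
    (ae_restrict_mem measurableSet_Icc)
  filter_upwards [h] with q hq
  simp only [Function.uncurry, projIcc_of_mem hat hq]

theorem JointlyMeasurableOn.measurable_integral {a t r : ℝ} (hu' : r ∈ Icc a t) {u : ℝ → Ω → F}
    (hu : JointlyMeasurableOn mΩ a t u) : Measurable fun ω => ∫ s in a..r, u s ω := by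
  have hat := hu'.1.trans hu'.2
  have h1 := (hu.measurable_projIcc hat).stronglyMeasurable
  have h2 := (StronglyMeasurable.integral_prod_right' (ν := volume.restrict (Ioc a r))
    (h1.comp_measurable measurable_swap)).measurable
  convert h2 using 2 with ω
  rw [intervalIntegral.integral_of_le hu'.1]
  refine setIntegral_congr_fun measurableSet_Ioc fun s hs => ?_
  simp only [Function.comp, Prod.swap]
  rw [projIcc_of_mem hat ⟨hs.1.le, hs.2.trans hu'.2⟩]

end JointMeasurability

/-! ### From Itô solutions to Stratonovich solutions -/

namespace ControlProblem

variable {n m d : ℕ} {D : ControlProblem n m d}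
variable {Ω : Type*} [mΩ : MeasurableSpace Ω] {P : Measure Ω} {w : Fin m → ℝ≥0 → Ω → ℝ}

theorem norm_le_matNorm (A : Fin m → E n) (i : Fin m) : ‖A i‖ ≤ matNorm A := by
  refine Real.le_sqrt_of_sq_le ?_
  exact Finset.single_le_sum (f := fun i => ‖A i‖ ^ 2) (fun _ _ => sq_nonneg _) (Finset.mem_univ i)

/-- The Lipschitz assumption is stated jointly for `b` and `σ` and quantifies over controls, so it
says something about `σ` only if `U` is nonempty. -/
theorem StandingAssumptions.exists_lipschitz_time {p : ℝ} (hD : D.StandingAssumptions p)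
    (hU : D.U.Nonempty) : ∃ L, 0 ≤ L ∧ ∀ i, ∀ r ∈ Icc 0 D.T, ∀ s ∈ Icc 0 D.T, ∀ x,
      ‖D.σ i r x - D.σ i s x‖ ≤ L * |r - s| := by
  obtain ⟨C, hC⟩ := hD.lipschitz
  obtain ⟨u, hu⟩ := hU
  refine ⟨max C 0, le_max_right _ _, fun i r hr s hs x => ?_⟩
  have h := hC r hr s hs x x u hu
  rw [sub_self, norm_zero, add_zero] at h
  have h1 := norm_le_matNorm (fun i => D.σ i r x - D.σ i s x) i
  have h2 : C * |r - s| ≤ max C 0 * |r - s| :=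
    mul_le_mul_of_nonneg_right (le_max_left _ _) (abs_nonneg _)
  linarith [norm_nonneg (D.b r x u - D.b s x u)]

/-- Continuity of `b` is known only for controls in `U`, so the control is regarded as a process
with values in the subtype. -/
theorem jointlyMeasurableOn_b {p : ℝ} (hD : D.StandingAssumptions p) {t : ℝ} (ht : t ≤ D.T)
    {u : ℝ → Ω → E d} {X : ℝ → Ω → E n} (hu : JointlyMeasurableOn mΩ 0 t u)
    (hmem : ∀ t ∈ Icc 0 D.T, ∀ ω, u t ω ∈ D.U) (hX : JointlyMeasurableOn mΩ 0 t X) :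
    JointlyMeasurableOn mΩ 0 t fun s ω => D.b s (X s ω) (u s ω) := by
  have hc : Continuous fun q : Icc 0 t × E n × D.U => D.b q.1 q.2.1 q.2.2 := by
    refine hD.continuous_b.comp_continuous (f := fun q : Icc 0 t × E n × D.U =>
      ((q.1 : ℝ), q.2.1, (q.2.2 : E d))) (by fun_prop) fun q => ?_
    exact ⟨⟨q.1.2.1, q.1.2.2.trans ht⟩, mem_univ _, q.2.2.2⟩
  have h1 : Measurable fun q : Icc 0 t × Ω => (q.1, X q.1 q.2,
      (⟨u q.1 q.2, hmem _ ⟨q.1.2.1, q.1.2.2.trans ht⟩ _⟩ : D.U)) :=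
    measurable_fst.prodMk (Measurable.prodMk hX (Measurable.subtype_mk hu))
  exact hc.measurable.comp h1

theorem jointlyMeasurableOn_comp {F : Type*} [NormedAddCommGroup F] [MeasurableSpace F]
    [BorelSpace F] {f : ℝ → E n → F} {a t : ℝ}
    (hf : ContinuousOn (fun q : ℝ × E n => f q.1 q.2) (Icc a t ×ˢ univ)) {X : ℝ → Ω → E n}
    (hX : JointlyMeasurableOn mΩ a t X) : JointlyMeasurableOn mΩ a t fun s ω => f s (X s ω) := by
  have hc : Continuous fun q : Icc a t × E n => f q.1 q.2 :=
    hf.comp_continuous (f := fun q : Icc a t × E n => ((q.1 : ℝ), q.2)) (by fun_prop)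
      fun q => ⟨q.1.2, mem_univ _⟩
  have h1 : Measurable fun q : Icc a t × Ω => (q.1, X q.1 q.2) := measurable_fst.prodMk hX
  exact hc.measurable.comp h1

theorem Admissible.measurable_u {p : ℝ} {x : E n} {u : ℝ → Ω → E d} {X : ℝ → Ω → E n}
    (hT : 0 ≤ D.T) (h : D.Admissible P w p 0 x u X) : JointlyMeasurableOn mΩ 0 D.T u :=
  (h.progressive D.T (right_mem_Icc.2 hT)).mono (augFiltration_le _)

theorem Admissible.measurable_X {p : ℝ} {x : E n} {u : ℝ → Ω → E d} {X : ℝ → Ω → E n}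
    (hT : 0 ≤ D.T) (h : D.Admissible P w p 0 x u X) : JointlyMeasurableOn mΩ 0 D.T X :=
  (h.state.progressive D.T (right_mem_Icc.2 hT)).mono (augFiltration_le _)

/-- The state process of an admissible strategy. -/
theorem Admissible.isItoProcess_state {p : ℝ} (hD : D.StandingAssumptions p) {x : E n}
    {u : ℝ → Ω → E d} {X : ℝ → Ω → E n} (h : D.Admissible P w p 0 x u X) :
    IsItoProcess P w D.T D.σ (fun s ω => D.b s (X s ω) (u s ω)) X where
  nonneg := hD.T_pos.le
  continuous_σ := hD.continuous_σ
  adapted r hr := by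
    have h1 := @JointlyMeasurableOn.section Ω (augFiltration w P r) _ _ _ _ _ _
      (h.state.progressive r hr) (right_mem_Icc.2 hr.1)
    exact h1.stronglyMeasurable
  cont := h.state.continuous
  integrable := h.state.integrable
  measurable_mart r hr := by
    refine Measurable.sub ((h.measurable_X hD.T_pos.le).section hr) ?_
    exact (jointlyMeasurableOn_b hD le_rfl (h.measurable_u hD.T_pos.le) h.mem
      (h.measurable_X hD.T_pos.le)).measurable_integral hr
  measurable_var r hr := by
    have hb := jointlyMeasurableOn_b hD le_rfl (h.measurable_u hD.T_pos.le) h.mem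
      (h.measurable_X hD.T_pos.le)
    have hb' : JointlyMeasurableOn mΩ 0 D.T fun s ω => ‖D.b s (X s ω) (u s ω)‖ := Measurable.norm hb
    exact hb'.measurable_integral hr
  ito s t hs hst ht L := by
    have h1 := (h.state.equation t ⟨hs.trans hst, ht⟩).itoLim le_rfl L
    have h2 := (h.state.equation s ⟨hs, hst.trans ht⟩).itoLim le_rfl L
    have hpm : PathMeas P (restrictIoc 0 t fun i r ω => L (D.σ i r (X r ω))) :=
      pathMeas_restrictIoc (by
        filter_upwards [h.state.continuous] with ω hω i
        exact (L.continuous.comp_continuousOn (IsItoProcess.continuousOn_comp (hD.continuous_σ i)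
          hω)).mono (Ioc_subset_Icc_self.trans (Icc_subset_Icc le_rfl ht)))
    -- The equation gives integrals started at `0` only; the integral over `(s, t]` is the
    -- difference of those over `(0, t]` and `(0, s]`.
    have h3 := ItoLim.sub h1 h2 hpm
    refine (h3.congr_left fun i r ω => ?_).congr_right (Eventually.of_forall fun ω => ?_)
    · simp only [restrictIoc, indicator]
      by_cases h1 : r ∈ Ioc 0 t <;> by_cases h2 : r ∈ Ioc 0 s <;> by_cases h3 : r ∈ Ioc s t <;>
        simp only [h1, h2, h3, if_true, if_false, sub_self, sub_zero, zero_sub] <;>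
        simp only [mem_Ioc, not_and_or, not_lt, not_le] at h1 h2 h3 <;> exfalso
      · exact absurd h2.2 (not_le.2 h3.1)
      · rcases h2 with h2 | h2
        · exact absurd h1.1 (not_lt.2 h2)
        · rcases h3 with h3 | h3
          · exact absurd h2 (not_lt.2 h3)
          · exact absurd h1.2 (not_le.2 h3)
      · exact absurd h2.2 (not_le.2 h3.1)
      · rcases h1 with h1 | h1
        · exact absurd h2.1 (not_lt.2 h1)
        · exact absurd (h2.2.trans hst) (not_le.2 h1)
      · rcases h1 with h1 | h1
        · exact absurd (hs.trans_lt h3.1) (not_lt.2 h1)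
        · exact absurd h3.2 (not_le.2 h1)
    · simp only [mart, ← map_sub]
      congr 1
      abel

/-- Over an interval of length zero the Itô integral in the equation has integrand zero, hence
vanishes almost surely by uniqueness. -/
theorem Admissible.initial [IsProbabilityMeasure P] (hw : IsBrownianMotion w P) {p : ℝ}
    (hT : 0 ≤ D.T) {x : E n} {u : ℝ → Ω → E d} {X : ℝ → Ω → E n}
    (h : D.Admissible P w p 0 x u X) : ∀ᵐ ω ∂P, X 0 ω = x := by
  have h1 : ∀ κ : Fin n, ∀ᵐ ω ∂P, X 0 ω κ - x κ = 0 := by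
    intro κ
    have h2 := (h.state.equation 0 (left_mem_Icc.2 hT)).itoLim le_rfl
      (EuclideanSpace.proj κ : E n →L[ℝ] ℝ)
    have h3 := h2.ae_eq_on hw ItoLim.zero univ (Eventually.of_forall fun ω _ i => by
      simp [aemeasurable_const])
    filter_upwards [h3] with ω hω
    simpa using hω (mem_univ _)
  filter_upwards [ae_all_iff.2 h1] with ω hω
  ext κ
  exact sub_eq_zero.1 (hω κ)

theorem continuousOn_σσx {p : ℝ} (hD : D.StandingAssumptions p) :
    ContinuousOn (fun q : ℝ × E n => D.σσx q.1 q.2) (Icc 0 D.T ×ˢ univ) :=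
  continuousOn_finsetSum _ fun i _ => (hD.continuous_fderiv_σ i).clm_apply (hD.continuous_σ i)

/-- Non-anticipative strategies are anticipating controls with the same state process. -/
theorem Admissible.isAnticipatingPair [IsProbabilityMeasure P] (hw : IsBrownianMotion w P) {p : ℝ}
    (hD : D.StandingAssumptions p) {x : E n} {u : ℝ → Ω → E d} {X : ℝ → Ω → E n}
    (h : D.Admissible P w p 0 x u X) : D.IsAnticipatingPair P w x u X := by
  have hT := hD.T_pos.le
  have hXp := h.isItoProcess_state hD
  have hΩ : Nonempty Ω := nonempty_of_isProbabilityMeasure P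
  obtain ⟨L, hL0, hL⟩ := hD.exists_lipschitz_time
    ⟨u 0 hΩ.some, h.mem 0 (left_mem_Icc.2 hT) _⟩
  -- `Z i` is the Itô integral of `σⁱ` against `wⁱ` alone, built coordinate by coordinate from
  -- integrands with a single nonzero component. Together the `Z i` make up the martingale part of
  -- the state.
  have key : ∀ t ∈ Icc 0 D.T, ∃ Z : Fin m → Ω → E n, (∀ i, IsStratonovichIntegral P (w i)
      (fun r ω => D.σ i r (X r ω)) 0 t (fun ω => Z i ω + (1 / 2 : ℝ) •
        ∫ r in (0 : ℝ)..t, fderiv ℝ (D.σ i r) (X r ω) (D.σ i r (X r ω)))) ∧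
      ∀ᵐ ω ∂P, ∑ i, Z i ω = mart X (fun s ω => D.b s (X s ω) (u s ω)) t ω -
        mart X (fun s ω => D.b s (X s ω) (u s ω)) 0 ω := by
    intro t ht
    have hsub : Icc 0 t ⊆ Icc 0 D.T := Icc_subset_Icc le_rfl ht.2
    have hac : ∀ (i : Fin m) (κ : Fin n), AdaptedContinuous P w 0 t
        fun i' r ω => if i' = i then D.σ i r (X r ω) κ else 0 := by
      intro i κ
      have := hXp.adaptedContinuous (a := 0) (b := t) le_rfl ht.2
        (f := fun i' r x => if i' = i then D.σ i r x κ else 0) (fun i' => by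
          by_cases h : i' = i
          · simp only [h, if_true]
            exact (EuclideanSpace.proj κ : E n →L[ℝ] ℝ).continuous.comp_continuousOn
              ((hD.continuous_σ i).mono (prod_mono_left hsub))
          · simpa [h] using continuousOn_const)
      exact this
    choose Y hY using fun i κ => (hac i κ).exists_itoLim hw le_rfl ht.1
    refine ⟨fun i ω => WithLp.toLp 2 fun κ => Y i κ ω, fun i => ?_, ?_⟩
    · refine hXp.isStratonovichIntegral hw ht.1 ht.2 hL0 (f := D.σ i)
        (f' := fun r x => fderiv ℝ (D.σ i r) x)
        ((hD.continuous_σ i).mono (prod_mono_left hsub))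
        ((hD.continuous_fderiv_σ i).mono (prod_mono_left hsub))
        (fun r hr x => (hD.differentiable_σ i r (hsub hr) x).hasFDerivAt)
        (fun r hr s hs x => hL i r (hsub hr) s (hsub hs) x) i ?_ fun κ => hY i κ
      exact ((jointlyMeasurableOn_comp (hD.continuous_σ i) (h.measurable_X hT)).mono_right
          ht.2).aestronglyMeasurable
        ht.1
    · have hκ : ∀ κ : Fin n, ∀ᵐ ω ∂P, ∑ i, Y i κ ω =
          (EuclideanSpace.proj κ : E n →L[ℝ] ℝ)
            (mart X (fun s ω => D.b s (X s ω) (u s ω)) t ω -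
              mart X (fun s ω => D.b s (X s ω) (u s ω)) 0 ω) := by
        intro κ
        have h1 := ItoLim.sum (s := Finset.univ) (fun i _ => hY i κ)
          (fun i _ => (hac i κ).pathMeas)
        have h2 := hXp.ito 0 t le_rfl ht.1 ht.2 (EuclideanSpace.proj κ)
        have h3 := h1.ae_eq_on hw h2 univ ((PathMeas.sum (s := Finset.univ)
          fun i _ => (hac i κ).pathMeas).mono fun ω hω _ i => ⟨?_, hω i⟩)
        · filter_upwards [h3] with ω hω
          exact hω (mem_univ _)
        · refine Eventually.of_forall fun r => ?_
          by_cases hr : r ∈ Ioc 0 t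
          · simp [restrictIoc_of_mem hr]
          · simp [restrictIoc_of_notMem hr]
      filter_upwards [ae_all_iff.2 hκ] with ω hω
      ext κ
      have h4 : ∑ i, Y i κ ω = (mart X (fun s ω => D.b s (X s ω) (u s ω)) t ω -
        mart X (fun s ω => D.b s (X s ω) (u s ω)) 0 ω) κ := hω κ
      rw [← h4]
      simp
  refine ⟨h.progressive D.T (right_mem_Icc.2 hT), h.mem, h.state.progressive D.T
    (right_mem_Icc.2 hT), h.state.continuous, ?_, fun t ht i => ?_, fun t ht => ?_⟩
  · filter_upwards [h.state.continuous, h.state.integrable] with ω h1 h2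
    refine h2.sub (Integrable.smul (1 / 2 : ℝ) ?_)
    exact (IsItoProcess.continuousOn_comp (continuousOn_σσx hD) h1).integrableOn_Icc
  · obtain ⟨Z, hZ, -⟩ := key t ht
    exact ⟨_, hZ i⟩
  · obtain ⟨Z, hZ, hsum⟩ := key t ht
    have hsub : Icc 0 t ⊆ Icc 0 D.T := Icc_subset_Icc le_rfl ht.2
    filter_upwards [ae_all_iff.2 fun i => stratonovichIntegral_ae_eq ht.1 (hZ i), hsum,
      h.initial hw hT, h.state.continuous, h.state.integrable] with ω h1 h2 h3 h4 h5
    have i1 : IntervalIntegrable (fun s => D.b s (X s ω) (u s ω)) volume 0 t :=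
      (intervalIntegrable_iff_integrableOn_Icc_of_le ht.1).2 (h5.mono_set hsub)
    have i2 : ∀ i, IntervalIntegrable (fun r => fderiv ℝ (D.σ i r) (X r ω) (D.σ i r (X r ω)))
        volume 0 t := fun i => ((IsItoProcess.continuousOn_comp
          (f := fun r x => fderiv ℝ (D.σ i r) x (D.σ i r x))
          ((hD.continuous_fderiv_σ i).clm_apply (hD.continuous_σ i)) h4).mono
          hsub).intervalIntegrable_of_Icc ht.1
    have i3 : IntervalIntegrable (fun s => D.σσx s (X s ω)) volume 0 t :=
      ((IsItoProcess.continuousOn_comp (continuousOn_σσx hD) h4).mono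
        hsub).intervalIntegrable_of_Icc ht.1
    -- The half covariations in the Stratonovich integrals of `σⁱ` are exactly what `bbar` subtracts
    -- from the drift.
    have e1 : ∫ s in (0 : ℝ)..t, D.bbar s (X s ω) (u s ω) =
        (∫ s in (0 : ℝ)..t, D.b s (X s ω) (u s ω)) - (1 / 2 : ℝ) • ∑ i,
          ∫ r in (0 : ℝ)..t, fderiv ℝ (D.σ i r) (X r ω) (D.σ i r (X r ω)) := by
      have i4 : IntervalIntegrable (fun s => (1 / 2 : ℝ) • D.σσx s (X s ω)) volume 0 t :=
          i3.smul (1 / 2 : ℝ)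
      unfold bbar
      rw [intervalIntegral.integral_sub i1 i4, intervalIntegral.integral_smul]
      congr 2
      unfold σσx
      exact intervalIntegral.integral_finsetSum fun i _ => i2 i
    simp only [h1]
    rw [Finset.sum_add_distrib, h2, e1, ← Finset.smul_sum, mart, mart,
      intervalIntegral.integral_same, h3]
    abel

end ControlProblem

/-! ### Stopping, and Itô integral processes on a half-open interval -/

/-- The first index at which a decreasing sequence of conditions fails. -/
theorem exists_stop_index {p : ℕ → Prop} [DecidablePred p] (hp : ∀ j k, j ≤ k → p k → p j)
    (N : ℕ) : ∃ τ ≤ N, (∀ j < τ, p j) ∧ (τ < N → ¬ p τ) ∧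
      ∀ a : ℕ → ℝ, ∑ j ∈ Finset.range N, (if p j then a j else 0) = ∑ j ∈ Finset.range τ, a j := by
  induction N with
  | zero => exact ⟨0, le_rfl, by simp, by simp, by simp⟩
  | succ N ih =>
    obtain ⟨τ, hτN, h1, h2, h3⟩ := ih
    rcases hτN.lt_or_eq with hlt | rfl
    · refine ⟨τ, by omega, h1, fun _ => h2 hlt, fun a => ?_⟩
      rw [Finset.sum_range_succ, h3, if_neg fun h => h2 hlt (hp _ _ hlt.le h), add_zero]
    · by_cases hpτ : p τ
      · refine ⟨τ + 1, le_rfl, fun j hj => hp _ _ (by omega) hpτ, by simp, fun a => ?_⟩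
        rw [Finset.sum_range_succ, h3, if_pos hpτ, Finset.sum_range_succ]
      · exact ⟨τ, by omega, h1, fun _ => hpτ, fun a => by
          rw [Finset.sum_range_succ, h3, if_neg hpτ, add_zero]⟩

section ItoIntegralProcesses

variable {Ω : Type*} [mΩ : MeasurableSpace Ω] {m : ℕ}
variable {w : Fin m → ℝ≥0 → Ω → ℝ} {P : Measure Ω}

namespace Elementary

/-- The stochastic integral up to the `l`-th node. -/
def partialInt (S : Elementary w P) (l : ℕ) (ω : Ω) : ℝ := ∑ j ∈ Finset.range l, S.incr j ω

theorem stronglyMeasurable_partialInt [IsProbabilityMeasure P] (hw : IsBrownianMotion w P)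
    (S : Elementary w P) (l : ℕ) :
    StronglyMeasurable[augFiltration w P (S.t l)] (S.partialInt l) :=
  stronglyMeasurable_sum_of_isMDiff (P := P) S.filtration_mono l fun j _ => S.isMDiff_incr hw j

/-- The converse of `ofReal_quad_le`: at each time at most one interval contributes. -/
theorem sqDist_val_zero_le (S : Elementary w P) (ω : Ω) :
    sqDist S.val (fun _ _ _ => 0) ω ≤ ENNReal.ofReal (S.quad ω) := by
  have hpt : ∀ r, ∑ i, ‖S.val i r ω - 0‖ₑ ^ 2 ≤ ∑ j ∈ Finset.range S.N,
      (Ioc (S.t j) (S.t (j + 1))).indicator (fun _ => ENNReal.ofReal (∑ i, S.ξ j i ω ^ 2)) r := by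
    intro r
    simp only [sub_zero]
    by_cases hr : r ∈ Ioc (S.t 0) (S.t S.N)
    · obtain ⟨j, hj, hrj⟩ := exists_mem_Ioc hr
      refine le_trans (le_of_eq ?_) (Finset.single_le_sum (fun _ _ => zero_le)
        (Finset.mem_range.2 hj))
      rw [indicator_of_mem hrj, ENNReal.ofReal_sum_of_nonneg fun i _ => sq_nonneg _]
      exact Finset.sum_congr rfl fun i _ => by rw [S.val_of_mem hj hrj, enorm_sq_eq]
    · simp [S.val_of_notMem hr]
  refine (lintegral_mono hpt).trans (le_of_eq ?_)
  rw [lintegral_finsetSum _ fun j _ => measurable_const.indicator measurableSet_Ioc, quad,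
    ENNReal.ofReal_sum_of_nonneg fun j _ => S.qincr_nonneg j ω]
  refine Finset.sum_congr rfl fun j _ => ?_
  rw [lintegral_indicator measurableSet_Ioc, lintegral_const, Measure.restrict_apply_univ,
    Real.volume_Ioc, qincr, ← Finset.sum_mul,
    ENNReal.ofReal_mul (Finset.sum_nonneg fun i _ => sq_nonneg _)]

/-- Fourth moments of increments are of order `Δt ^ 2`, so their sum over a grid vanishes with the
mesh. This controls the overshoot when an integral is stopped on leaving an interval. -/
theorem integral_incr_pow_four_le [IsProbabilityMeasure P] (hw : IsBrownianMotion w P)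
    (S : Elementary w P) {K : ℝ} (hK : ∀ j i ω, |S.ξ j i ω| ≤ K) (j : ℕ) :
    Integrable (fun ω => S.incr j ω ^ 4) P ∧
      ∫ ω, S.incr j ω ^ 4 ∂P ≤ m ^ 4 * K ^ 4 * κ₄ * (S.t (j + 1) - S.t j) ^ 2 := by
  have hint : ∀ i, Integrable (fun ω => dW w i (S.t j) (S.t (j + 1)) ω ^ 4) P := by
    intro i
    have := (memLp_dW hw i (S.t_nonneg j) (S.t_le j) 4).integrable_norm_pow (p := 4) (by norm_num)
    simpa [Real.norm_eq_abs, Even.pow_abs (show Even 4 by decide)] using this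
  have hle : ∀ ω, S.incr j ω ^ 4 ≤ ∑ i, (m : ℝ) ^ 3 * K ^ 4 * dW w i (S.t j) (S.t (j + 1)) ω ^
      4 := by
    intro ω
    have h1 := sq_sum_le_card_mul_sum_sq (s := Finset.univ)
      (f := fun i => S.ξ j i ω * dW w i (S.t j) (S.t (j + 1)) ω)
    have h2 := sq_sum_le_card_mul_sum_sq (s := Finset.univ)
      (f := fun i => (S.ξ j i ω * dW w i (S.t j) (S.t (j + 1)) ω) ^ 2)
    have h3 : ∑ i, ((S.ξ j i ω * dW w i (S.t j) (S.t (j + 1)) ω) ^ 2) ^ 2 ≤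
        ∑ i, K ^ 4 * dW w i (S.t j) (S.t (j + 1)) ω ^ 4 := by
      refine Finset.sum_le_sum fun i _ => ?_
      have : S.ξ j i ω ^ 4 ≤ K ^ 4 := by
        rw [← Even.pow_abs (show Even 4 by decide)]
        exact pow_le_pow_left₀ (abs_nonneg _) (hK j i ω) 4
      calc _ = S.ξ j i ω ^ 4 * dW w i (S.t j) (S.t (j + 1)) ω ^ 4 := by ring
        _ ≤ _ := mul_le_mul_of_nonneg_right this (by positivity)
    simp only [Finset.card_univ, Fintype.card_fin] at h1 h2
    have h4 : S.incr j ω ^ 2 ≤ m * ∑ i, (S.ξ j i ω * dW w i (S.t j) (S.t (j + 1)) ω) ^ 2 := h1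
    calc S.incr j ω ^ 4 = (S.incr j ω ^ 2) ^ 2 := by ring
      _ ≤ (m * ∑ i, (S.ξ j i ω * dW w i (S.t j) (S.t (j + 1)) ω) ^ 2) ^ 2 :=
          pow_le_pow_left₀ (sq_nonneg _) h4 2
      _ = m ^ 2 * (∑ i, (S.ξ j i ω * dW w i (S.t j) (S.t (j + 1)) ω) ^ 2) ^ 2 := by ring
      _ ≤ m ^ 2 * (m * ∑ i, K ^ 4 * dW w i (S.t j) (S.t (j + 1)) ω ^ 4) :=
          mul_le_mul_of_nonneg_left (h2.trans (mul_le_mul_of_nonneg_left h3 (by positivity)))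
            (by positivity)
      _ = _ := by
          rw [Finset.mul_sum, Finset.mul_sum]
          exact Finset.sum_congr rfl fun i _ => by ring
  have hsum : Integrable (fun ω => ∑ i, (m : ℝ) ^ 3 * K ^ 4 *
      dW w i (S.t j) (S.t (j + 1)) ω ^ 4) P :=
    integrable_finsetSum _ fun i _ => (hint i).const_mul _
  have hi : Integrable (fun ω => S.incr j ω ^ 4) P := by
    refine hsum.mono' (((S.isMDiff_incr hw j).memLp.1.aemeasurable.pow_const
        4).aestronglyMeasurable)
      (Eventually.of_forall fun ω => ?_)
    rw [Real.norm_eq_abs, abs_of_nonneg (by positivity)]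
    exact hle ω
  refine ⟨hi, (integral_mono hi hsum hle).trans (le_of_eq ?_)⟩
  rw [integral_finsetSum _ fun i _ => (hint i).const_mul _]
  simp_rw [integral_const_mul, integral_dW_pow_four hw _ (S.t_nonneg j) (S.t_le j)]
  rw [Finset.sum_const, Finset.card_univ, Fintype.card_fin, nsmul_eq_mul]
  ring

/-- A step process stopped along a decreasing sequence of events. -/
theorem stopAt_int_eq (S : Elementary w P) {A : ℕ → Set Ω}
    (hA : ∀ j, MeasurableSet[augFiltration w P (S.t j)] (A j)) (hanti : Antitone A) (ω : Ω) :
    ∃ τ ≤ S.N, (∀ j < τ, ω ∈ A j) ∧ (τ < S.N → ω ∉ A τ) ∧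
      (S.stopAt A hA).int ω = S.partialInt τ ω ∧
      (S.stopAt A hA).quad ω = ∑ j ∈ Finset.range τ, S.qincr j ω := by
  classical
  obtain ⟨τ, h1, h2, h3, h4⟩ := exists_stop_index (p := fun j => ω ∈ A j)
    (fun j k hjk h => hanti hjk h) S.N
  refine ⟨τ, h1, h2, h3, ?_, ?_⟩
  · rw [partialInt, ← h4]
    refine Finset.sum_congr rfl fun j _ => ?_
    rw [stopAt_incr, indicator_apply]
  · rw [← h4]
    refine Finset.sum_congr rfl fun j _ => ?_
    rw [stopAt_qincr, indicator_apply]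

end Elementary

theorem pathMeas_restrictIoc_const (a b : ℝ) (ξ : Fin m → Ω → ℝ) :
    PathMeas P (restrictIoc a b fun i _ ω => ξ i ω) :=
  pathMeas_restrictIoc (Eventually.of_forall fun _ _ => continuousOn_const)

theorem AdaptedContinuous.sample_t {a b : ℝ} {Φ : Fin m → ℝ → Ω → ℝ}
    (h : AdaptedContinuous P w a b Φ) (ha : 0 ≤ a) (G : Grid a b) {K : ℝ} (hK : 0 ≤ K) :
    (h.sample ha G hK).t = G.t := rfl

theorem AdaptedContinuous.sample_N {a b : ℝ} {Φ : Fin m → ℝ → Ω → ℝ}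
    (h : AdaptedContinuous P w a b Φ) (ha : 0 ≤ a) (G : Grid a b) {K : ℝ} (hK : 0 ≤ K) :
    (h.sample ha G hK).N = G.N := rfl

theorem AdaptedContinuous.abs_sample_ξ_le {a b : ℝ} {Φ : Fin m → ℝ → Ω → ℝ}
    (h : AdaptedContinuous P w a b Φ) (ha : 0 ≤ a) (G : Grid a b) {K : ℝ} (hK : 0 ≤ K)
    (j : ℕ) (i : Fin m) (ω : Ω) : |(h.sample ha G hK).ξ j i ω| ≤ K := abs_clip_le hK _

/-- `N_t = ∑ᵢ ∫₀ᵗ Φⁱ dwⁱ` for `t < T`, with `Φ` adapted and continuous on `[0, T)` and `N`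
continuous on `[0, T]`. -/
structure IsItoIntegralProcess (P : Measure Ω) (w : Fin m → ℝ≥0 → Ω → ℝ) (T : ℝ)
    (Φ : Fin m → ℝ → Ω → ℝ) (N : ℝ → Ω → ℝ) : Prop where
  pos : 0 < T
  integrand : ∀ s < T, AdaptedContinuous P w 0 s Φ
  measurable : ∀ s < T, ∀ i, JointlyMeasurableOn mΩ 0 s (Φ i)
  adapted : ∀ t ∈ Ico 0 T, StronglyMeasurable[augFiltration w P t] (N t)
  cont : ∀ᵐ ω ∂P, ContinuousOn (fun t => N t ω) (Icc 0 T)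
  initial : ∀ ω, N 0 ω = 0
  ito : ∀ s t, 0 ≤ s → s ≤ t → t < T → ItoLim P w (restrictIoc s t Φ) (fun ω => N t ω - N s ω)

namespace IsItoIntegralProcess

variable {T : ℝ} {Φ : Fin m → ℝ → Ω → ℝ} {N : ℝ → Ω → ℝ}

/-- Lenglart's inequality for the error of a discretisation stopped along adapted events. -/
theorem measure_inter_stopped_le [IsProbabilityMeasure P] (hw : IsBrownianMotion w P)
    (hN : IsItoIntegralProcess P w T Φ N) {s : ℝ} (hsT : s < T) {K : ℝ} (hK : 0 ≤ K)
    (G : Grid 0 s) {B : ℕ → Set Ω}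
    (hBm : ∀ j, MeasurableSet[augFiltration w P (G.t j)] (B j)) {A : Set Ω} (hA : MeasurableSet A)
    {ρ ε : ℝ} (hρ : 0 < ρ) (hε : 0 < ε)
    (hgood : ∀ ω ∈ A, sqDist ((hN.integrand s hsT).sample le_rfl G hK).val (restrictIoc 0 s Φ) ω
      ≤ ENNReal.ofReal ρ) :
    P (A ∩ {ω | ε ≤ |∑ j ∈ Finset.range G.N, (B j).indicator (fun _ => (1 : ℝ)) ω *
      (((hN.integrand s hsT).sample le_rfl G hK).incr j ω - (N (G.t (j + 1)) ω - N (G.t j) ω))|})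
      ≤ ENNReal.ofReal (4 * ρ / ε ^ 2) := by
  have hΦ := hN.integrand s hsT
  have hGT : ∀ j, G.t j < T := fun j => (G.mem j).2.trans_lt hsT
  have hG0 : ∀ j, 0 ≤ G.t j := fun j => (G.mem j).1
  obtain ⟨S, hS, hSξ⟩ : ∃ S : Elementary w P, S = (hN.integrand s hsT).sample le_rfl G hK ∧
      ∀ j i ω, |S.ξ j i ω| ≤ K := ⟨_, rfl, AdaptedContinuous.abs_sample_ξ_le _ le_rfl G hK⟩
  have hSt : S.t = G.t := hS ▸ AdaptedContinuous.sample_t _ le_rfl G hK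
  have hSN : S.N = G.N := hS ▸ AdaptedContinuous.sample_N _ le_rfl G hK
  rw [← hS] at hgood ⊢
  clear hS
  have hχ1 : ∀ j ω, |(B j).indicator (fun _ => (1 : ℝ)) ω| ≤ 1 := by
    intro j ω
    simp only [indicator]
    split_ifs <;> simp
  have hχm : ∀ j, StronglyMeasurable[augFiltration w P (G.t j)]
      ((B j).indicator (fun _ => (1 : ℝ))) := fun j =>
    (@stronglyMeasurable_const _ _ (augFiltration w P (G.t j)) _ (1 : ℝ)).indicator (hBm j)
  have hΦj : ∀ j, AdaptedContinuous P w (G.t j) (G.t (j + 1)) Φ := fun j =>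
    hΦ.mono (hG0 j) (G.mem (j + 1)).2
  have hpm : ∀ j, PathMeas P (fun i r ω =>
      restrictIoc (G.t j) (G.t (j + 1)) (fun i _ ω => S.ξ j i ω) i r ω -
      restrictIoc (G.t j) (G.t (j + 1)) Φ i r ω) := fun j =>
    (pathMeas_restrictIoc_const _ _ (S.ξ j)).sub (hΦj j).pathMeas
  have hstep : ∀ j, ItoLim P w (fun i r ω =>
      restrictIoc (G.t j) (G.t (j + 1)) (fun i _ ω => S.ξ j i ω) i r ω -
      restrictIoc (G.t j) (G.t (j + 1)) Φ i r ω)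
      (fun ω => S.incr j ω - (N (G.t (j + 1)) ω - N (G.t j) ω)) := by
    intro j
    have h1 := itoLim_single (P := P) (w := w) (hG0 j) (G.mono (Nat.le_succ j)) (S.ξ j)
      (fun i => by have := S.adapted j i; rwa [hSt] at this) ⟨K, fun i ω => hSξ j i ω⟩
    have h2 := h1.sub (hN.ito _ _ (hG0 j) (G.mono (Nat.le_succ j)) (hGT _))
      (pathMeas_restrictIoc_const _ _ (S.ξ j))
    simpa only [Elementary.incr, hSt] using h2
  -- The indicator of `B j` is known at the start of the `j`-th cell and passes through the integral
  -- over that cell.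
  have hmul := fun j => (hstep j).mul hw (hpm j) (s := G.t j) (fun i r ω hr => by
      have : r ∉ Ioc (G.t j) (G.t (j + 1)) := fun h => absurd h.1 (not_lt.2 hr)
      simp only [restrictIoc_of_notMem this, sub_zero]) (hχm j) (hχ1 j)
  have hsum := ItoLim.sum (s := Finset.range G.N) (fun j _ => hmul j) (fun j _ => (hpm j).mul _)
  refine hsum.measure_inter_le hw (PathMeas.sum fun j _ => (hpm j).mul _) hA
    (δ := ρ) (ε := ε) hρ hε (Eventually.of_forall fun ω hω => ?_)
  refine le_trans (lintegral_mono fun r => ?_) (hgood ω hω)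
  refine Finset.sum_le_sum fun i _ => ?_
  have e : ∀ j, (B j).indicator (fun _ => (1 : ℝ)) ω *
      (restrictIoc (G.t j) (G.t (j + 1)) (fun i _ ω => S.ξ j i ω) i r ω -
        restrictIoc (G.t j) (G.t (j + 1)) Φ i r ω) = restrictIoc (G.t j) (G.t (j + 1))
      (fun i r ω => (B j).indicator (fun _ => (1 : ℝ)) ω * (S.ξ j i ω - Φ i r ω)) i r ω := by
    intro j
    by_cases hr : r ∈ Ioc (G.t j) (G.t (j + 1))
    · simp only [restrictIoc_of_mem hr]
    · simp only [restrictIoc_of_notMem hr, sub_zero, mul_zero]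
  simp only [e, sub_zero]
  by_cases hr : r ∈ Ioc 0 s
  · obtain ⟨j, hj, hrj⟩ := G.exists_mem hr
    rw [sum_restrictIoc_of_mem G (fun j i r ω => (B j).indicator (fun _ => (1 : ℝ)) ω *
      (S.ξ j i ω - Φ i r ω)) hj hrj, restrictIoc_of_mem hr,
      S.val_of_mem (j := j) (by rwa [hSN]) (hSt ▸ hrj), enorm_mul, mul_pow]
    have : ‖(B j).indicator (fun _ => (1 : ℝ)) ω‖ₑ ^ 2 ≤ 1 := by
      rw [enorm_sq_eq, ← ENNReal.ofReal_one]
      refine ENNReal.ofReal_le_ofReal ?_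
      rw [← sq_abs]; exact pow_le_one₀ (abs_nonneg _) (hχ1 j ω)
    exact mul_le_of_le_one_left zero_le this
  · rw [sum_restrictIoc_of_notMem G (fun j i r ω => (B j).indicator (fun _ => (1 : ℝ)) ω *
      (S.ξ j i ω - Φ i r ω)) hr]
    simp

/-- The sums `∑_{j < l} ∑ᵢ Φⁱ(t_j) (wⁱ(t_{j+1}) - wⁱ(t_j))` are uniformly close to the integral. -/
theorem exists_close [IsProbabilityMeasure P] (hw : IsBrownianMotion w P)
    (hN : IsItoIntegralProcess P w T Φ N) {s : ℝ} (h0s : 0 ≤ s) (hsT : s < T) {ε : ℝ}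
    (hε : 0 < ε) : ∃ h > 0, ∃ K, ∃ hK : 0 ≤ K, ∀ G : Grid 0 s, G.MeshLe h →
      ∃ A, MeasurableSet A ∧ P Aᶜ ≤ ENNReal.ofReal ε ∧ ∀ ω ∈ A,
        sqDist ((hN.integrand s hsT).sample le_rfl G hK).val (restrictIoc 0 s Φ) ω
          ≤ ENNReal.ofReal ε ∧
        ∀ l ≤ G.N, |((hN.integrand s hsT).sample le_rfl G hK).partialInt l ω - N (G.t l) ω| <
            ε := by
  classical
  set hΦ := hN.integrand s hsT
  set ρ : ℝ := min ε (ε / 2 * ε ^ 2 / 4) with hρ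
  have hρ0 : 0 < ρ := by positivity
  obtain ⟨h, hh, K, hK, A, hA, hPA, hgood⟩ := hΦ.exists_good le_rfl h0s (half_pos hε) hρ0
  refine ⟨h, hh, K, hK, fun G hG => ?_⟩
  set S := hΦ.sample le_rfl G hK with hS
  have hGT : ∀ j, G.t j < T := fun j => (G.mem j).2.trans_lt hsT
  have hG0 : ∀ j, 0 ≤ G.t j := fun j => (G.mem j).1
  have hSt : ∀ j, S.t j = G.t j := fun _ => rfl
  set M : ℕ → Ω → ℝ := fun l ω => S.partialInt l ω - N (G.t l) ω with hM
  have hMm : ∀ l, StronglyMeasurable[augFiltration w P (G.t l)] (M l) := fun l =>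
    (S.stronglyMeasurable_partialInt hw l).sub (hN.adapted _ ⟨hG0 l, hGT l⟩)
  -- The error is stopped as soon as it reaches `ε` at a node. If the stopped error ends below `ε`,
  -- stopping never took place, so a bound for a single variable controls the error at all nodes.
  set B : ℕ → Set Ω := fun j => {ω | ∀ l ≤ j, |M l ω| < ε} with hB
  have hBm : ∀ j, MeasurableSet[augFiltration w P (G.t j)] (B j) := by
    intro j
    have : B j = ⋂ l ∈ Finset.range (j + 1), {ω | |M l ω| < ε} := by
      ext ω
      simp [hB]
    rw [this]
    refine @Finset.measurableSet_biInter _ _ (augFiltration w P (G.t j)) _ _ fun l hl => ?_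
    have h1 := (hMm l).mono (augFiltration_mono (G.mono
        (Nat.lt_succ_iff.1 (Finset.mem_range.1 hl))))
    exact h1.measurable (measurableSet_lt (by fun_prop) (by fun_prop) :
      MeasurableSet {x : ℝ | |x| < ε})
  have hBanti : Antitone B := fun j k hjk ω hω l hl => hω l (hl.trans hjk)
  have hle := hN.measure_inter_stopped_le hw hsT hK G hBm hA hρ0 hε fun ω hω => (hgood G hG ω hω).1
  rw [← hS] at hle
  have e1 : 4 * ρ / ε ^ 2 ≤ ε / 2 := by
    rw [div_le_iff₀ (by positivity)]
    have : ρ ≤ ε / 2 * ε ^ 2 / 4 := min_le_right _ _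
    linarith
  have hMN : ∀ j ω, S.incr j ω - (N (G.t (j + 1)) ω - N (G.t j) ω) = M (j + 1) ω - M j ω := by
    intro j ω
    simp only [hM, Elementary.partialInt, Finset.sum_range_succ]
    ring
  have hM0 : ∀ ω, M 0 ω = 0 := by
    intro ω
    simp [hM, Elementary.partialInt, G.first, hN.initial]
  set C : Set Ω := toMeasurable P (A ∩ {ω | ε ≤ |∑ j ∈ Finset.range G.N,
    (B j).indicator (fun _ => (1 : ℝ)) ω * (S.incr j ω - (N (G.t (j + 1)) ω - N (G.t j) ω))|}) with
        hC
  refine ⟨A ∩ Cᶜ, hA.inter (measurableSet_toMeasurable _ _).compl, ?_, fun ω hω => ⟨?_, ?_⟩⟩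
  · rw [compl_inter, compl_compl]
    refine (measure_union_le _ _).trans ?_
    rw [hC, measure_toMeasurable]
    refine (add_le_add hPA (hle.trans (ENNReal.ofReal_le_ofReal e1))).trans (le_of_eq ?_)
    rw [← ENNReal.ofReal_add (by positivity) (by positivity), add_halves]
  · exact ((hgood G hG ω hω.1).1).trans (ENNReal.ofReal_le_ofReal (min_le_left _ _))
  · have hnot : ω ∉ {ω | ε ≤ |∑ j ∈ Finset.range G.N,
        (B j).indicator (fun _ => (1 : ℝ)) ω * (S.incr j ω - (N (G.t (j + 1)) ω - N (G.t j) ω))|}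
            := fun h =>
      hω.2 (subset_toMeasurable _ _ ⟨hω.1, h⟩)
    obtain ⟨τ, h1, h2, h3, h4⟩ := exists_stop_index (p := fun j => ω ∈ B j)
      (fun j k hjk h => hBanti hjk h) G.N
    have e2 : ∑ j ∈ Finset.range G.N, (B j).indicator (fun _ => (1 : ℝ)) ω *
        (S.incr j ω - (N (G.t (j + 1)) ω - N (G.t j) ω)) =
        M τ ω := by
      rw [Finset.sum_congr rfl (g := fun j => if ω ∈ B j then M (j + 1) ω - M j ω else 0),
        h4, Finset.sum_range_sub (fun j => M j ω), hM0, sub_zero]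
      intro j _
      simp only [hMN, indicator]
      split_ifs <;> simp
    have h5 : |M τ ω| < ε := by
      rw [← e2]
      exact not_le.1 hnot
    have h6 : ω ∈ B τ := by
      intro l hl
      rcases hl.lt_or_eq with hl | rfl
      · exact h2 l hl l le_rfl
      · exact h5
    have h7 : τ = G.N := by
      by_contra hne
      exact h3 (lt_of_le_of_ne h1 hne) h6
    rw [← h7]
    exact h6

end IsItoIntegralProcess

end ItoIntegralProcesses

/-! ### Finite quadratic variation up to the terminal time -/

section QuadraticVariation

variable {Ω : Type*} [mΩ : MeasurableSpace Ω] {m : ℕ}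
variable {w : Fin m → ℝ≥0 → Ω → ℝ} {P : Measure Ω}

namespace Elementary

/-- The events on which the stochastic integral is bounded by `c` at the nodes `t 0, …, t j`. -/
def absLe (S : Elementary w P) (c : ℝ) (j : ℕ) : Set Ω := {ω | ∀ l ≤ j, |S.partialInt l ω| ≤ c}

theorem measurableSet_absLe [IsProbabilityMeasure P] (hw : IsBrownianMotion w P)
    (S : Elementary w P) (c : ℝ) (j : ℕ) :
    MeasurableSet[augFiltration w P (S.t j)] (S.absLe c j) := by
  have : S.absLe c j = ⋂ l ∈ Finset.range (j + 1), {ω | |S.partialInt l ω| ≤ c} := by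
    ext ω
    simp [absLe]
  rw [this]
  refine @Finset.measurableSet_biInter _ _ (augFiltration w P (S.t j)) _ _ fun l hl => ?_
  have h1 := (S.stronglyMeasurable_partialInt hw l).mono
    (S.filtration_mono (Nat.lt_succ_iff.1 (Finset.mem_range.1 hl)))
  exact h1.measurable (measurableSet_le (by fun_prop) (by fun_prop) :
    MeasurableSet {x : ℝ | |x| ≤ c})

theorem antitone_absLe (S : Elementary w P) (c : ℝ) : Antitone (S.absLe c) :=
  fun _ _ hjk _ hω l hl => hω l (hl.trans hjk)

/-- When the integral is stopped on exceeding `c`, it overshoots by at most one increment `y`, so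
its square is at most `2 c² + 2 y² ≤ 2 c² + 1 + y⁴`. By the isometry this bounds the mean quadratic
variation of the stopped process. -/
theorem integral_stopAt_absLe_quad_le [IsProbabilityMeasure P] (hw : IsBrownianMotion w P)
    (S : Elementary w P) (c : ℝ)
    (hint : ∀ j, Integrable (fun ω => S.incr j ω ^ 4) P)
    (h4 : ∑ j ∈ Finset.range S.N, ∫ ω, S.incr j ω ^ 4 ∂P ≤ 1) :
    ∫ ω, (S.stopAt (S.absLe c) (S.measurableSet_absLe hw c)).quad ω ∂P ≤ 2 * c ^ 2 + 2 := by
  rw [← integral_int_sq hw]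
  have hpt : ∀ ω, (S.stopAt (S.absLe c) (S.measurableSet_absLe hw c)).int ω ^ 2 ≤
      (2 * c ^ 2 + 1) + ∑ j ∈ Finset.range S.N, S.incr j ω ^ 4 := by
    intro ω
    obtain ⟨τ, h1, h2, -, h3, -⟩ := S.stopAt_int_eq (S.measurableSet_absLe hw c)
      (S.antitone_absLe c) ω
    rw [h3]
    have hnn : 0 ≤ ∑ j ∈ Finset.range S.N, S.incr j ω ^ 4 :=
      Finset.sum_nonneg fun j _ => by positivity
    rcases Nat.eq_zero_or_pos τ with rfl | hτ
    · simp only [partialInt, Finset.range_zero, Finset.sum_empty]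
      nlinarith
    · obtain ⟨j, rfl⟩ := Nat.exists_eq_succ_of_ne_zero hτ.ne'
      have h4 : |S.partialInt j ω| ≤ c := h2 j (Nat.lt_succ_self j) j le_rfl
      have h5 : S.incr j ω ^ 4 ≤ ∑ j ∈ Finset.range S.N, S.incr j ω ^ 4 :=
        Finset.single_le_sum (f := fun j => S.incr j ω ^ 4) (fun _ _ => by positivity)
          (Finset.mem_range.2 h1)
      have h6 : S.partialInt (j + 1) ω = S.partialInt j ω + S.incr j ω :=
        Finset.sum_range_succ _ _
      have h7 : S.partialInt j ω ^ 2 ≤ c ^ 2 := by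
        rw [← sq_abs]; exact pow_le_pow_left₀ (abs_nonneg _) h4 2
      rw [Nat.succ_eq_add_one, h6]
      nlinarith [sq_nonneg (S.partialInt j ω - S.incr j ω), sq_nonneg (S.incr j ω ^ 2 - 1)]
  have hsum : Integrable (fun ω => ∑ j ∈ Finset.range S.N, S.incr j ω ^ 4) P :=
    integrable_finsetSum _ fun j _ => hint j
  refine (integral_mono (memLp_int hw _).integrable_sq
    ((integrable_const (2 * c ^ 2 + 1)).add hsum) hpt).trans ?_
  have e := integral_add (integrable_const (μ := P) (2 * c ^ 2 + 1)) hsum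
  simp only [Pi.add_apply]
  rw [e, integral_const, probReal_univ, one_smul, integral_finsetSum _ fun j _ => hint j]
  linarith

end Elementary

theorem measure_le_of_integral_le [IsProbabilityMeasure P] {f : Ω → ℝ} (hf : Integrable f P)
    (h0 : ∀ ω, 0 ≤ f ω) {c l : ℝ} (hl : 0 < l) (hc : ∫ ω, f ω ∂P ≤ c) :
    P {ω | l ≤ f ω} ≤ ENNReal.ofReal (c / l) := by
  have h1 := meas_ge_le_lintegral_div (μ := P) hf.1.aemeasurable.ennreal_ofReal
    (ε := ENNReal.ofReal l) (by simpa using hl) ENNReal.ofReal_ne_top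
  rw [← ofReal_integral_eq_lintegral_ofReal hf (Eventually.of_forall h0)] at h1
  rw [ENNReal.ofReal_div_of_pos hl]
  refine le_trans (measure_mono fun ω hω => ?_)
    (h1.trans (ENNReal.div_le_div_right (ENNReal.ofReal_le_ofReal hc) _))
  exact ENNReal.ofReal_le_ofReal hω

namespace IsItoIntegralProcess

variable {T : ℝ} {Φ : Fin m → ℝ → Ω → ℝ} {N : ℝ → Ω → ℝ}

/-- While `N` stays in `[-k, k]`, a close discretisation stays in `[-k-1, k+1]` and is not stopped,
so Markov's inequality applies to its quadratic variation. The level `2 * l + 2` comes from the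
triangle inequality with discretisation error at most `1`. The bound does not depend on `s`. -/
theorem measure_le_sqDist_le [IsProbabilityMeasure P] (hw : IsBrownianMotion w P)
    (hN : IsItoIntegralProcess P w T Φ N) {s : ℝ} (h0s : 0 ≤ s) (hsT : s < T) {k l : ℝ}
    (hl : 0 < l) :
    P {ω | (∀ t ∈ Icc 0 s, |N t ω| ≤ k) ∧
      ENNReal.ofReal (2 * l + 2) ≤ sqDist (restrictIoc 0 s Φ) (fun _ _ _ => 0) ω} ≤
      ENNReal.ofReal ((2 * (k + 1) ^ 2 + 2) / l) := by
  refine ENNReal.le_of_forall_pos_le_add fun τ hτ _ => ?_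
  set ε : ℝ := min τ 1 with hε
  have hε0 : 0 < ε := by positivity
  obtain ⟨h, hh, K, hK, hclose⟩ := hN.exists_close hw h0s hsT hε0
  set c : ℝ := m ^ 4 * K ^ 4 * κ₄ with hc
  have hc0 : 0 ≤ c := mul_nonneg (by positivity) κ₄_nonneg
  -- A mesh of at most `ρ` makes the sum of the fourth moments of the increments at most `1`.
  obtain ⟨ρ, hρ0, -, hρ⟩ := exists_small one_pos (c := c * s) (by positivity)
  obtain ⟨G, hG⟩ := Grid.exists_meshLe h0s (h := min h ρ) (by positivity)
  obtain ⟨A, hA, hPA, hgood⟩ := hclose G fun j => (hG j).trans (min_le_left _ _)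
  set S := (hN.integrand s hsT).sample le_rfl G hK with hS
  have hξ : ∀ j i ω, |S.ξ j i ω| ≤ K := AdaptedContinuous.abs_sample_ξ_le _ le_rfl G hK
  have hSt : S.t = G.t := AdaptedContinuous.sample_t _ le_rfl G hK
  have hSN : S.N = G.N := AdaptedContinuous.sample_N _ le_rfl G hK
  have h4 : ∑ j ∈ Finset.range S.N, ∫ ω, S.incr j ω ^ 4 ∂P ≤ 1 := by
    calc ∑ j ∈ Finset.range S.N, ∫ ω, S.incr j ω ^ 4 ∂P
        ≤ ∑ j ∈ Finset.range G.N, c * ρ * (G.t (j + 1) - G.t j) := by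
          rw [hSN]
          refine Finset.sum_le_sum fun j _ => (S.integral_incr_pow_four_le hw hξ j).2.trans ?_
          rw [hSt, ← hc, sq, mul_assoc c]
          have h1 := G.step_nonneg j
          have h2 := (hG j).trans (min_le_right _ _)
          exact mul_le_mul_of_nonneg_left (mul_le_mul_of_nonneg_right h2 h1) hc0
      _ = ρ * (c * s) := by rw [← Finset.mul_sum, G.sum_step]; ring
      _ ≤ 1 := hρ
  set S' := S.stopAt (S.absLe (k + 1)) (S.measurableSet_absLe hw (k + 1)) with hS'
  have hq : ∫ ω, S'.quad ω ∂P ≤ 2 * (k + 1) ^ 2 + 2 :=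
    S.integral_stopAt_absLe_quad_le hw _
      (fun j => (S.integral_incr_pow_four_le hw hξ j).1) h4
  have hq0 : ∀ ω, 0 ≤ S'.quad ω := fun ω => Finset.sum_nonneg fun j _ => S'.qincr_nonneg j ω
  have hP := measure_le_of_integral_le S'.integrable_quad hq0 hl hq
  have hcover : P {ω | (∀ t ∈ Icc 0 s, |N t ω| ≤ k) ∧
      ENNReal.ofReal (2 * l + 2) ≤ sqDist (restrictIoc 0 s Φ) (fun _ _ _ => 0) ω} ≤
      P ({ω | l ≤ S'.quad ω} ∪ Aᶜ) := by
    refine measure_mono_ae ?_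
    filter_upwards [(hN.integrand s hsT).pathMeas] with ω hpm hω
    by_cases hωA : ω ∈ A
    · left
      obtain ⟨g1, g2⟩ := hgood ω hωA
      obtain ⟨σ, h1, -, h3, -, h5⟩ := S.stopAt_int_eq (S.measurableSet_absLe hw (k + 1))
        (S.antitone_absLe (k + 1)) ω
      have h6 : ∀ j, j ≤ S.N → ω ∈ S.absLe (k + 1) j := by
        intro j hj l hl
        have h7 := g2 l (hl.trans (hj.trans hSN.le))
        have h8 := hω.1 (G.t l) (G.mem l)
        have h9 : ε ≤ 1 := min_le_right _ _
        have h10 := abs_add_le (S.partialInt l ω - N (G.t l) ω) (N (G.t l) ω)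
        rw [sub_add_cancel] at h10
        linarith
      have h7 : σ = S.N := by
        by_contra hne
        exact h3 (lt_of_le_of_ne h1 hne) (h6 _ h1)
      have h8 : S'.quad ω = S.quad ω := by
        rw [h5, h7]; rfl
      have h9 := sqDist_triangle (Φ := restrictIoc 0 s Φ) (Ψ := S.val) (Ξ := fun _ _ _ => 0)
        (ω := ω) hpm (fun i => (S.measurable_val i ω).aemeasurable)
      rw [sqDist_comm] at g1
      have h10 := hω.2.trans (h9.trans (add_le_add (mul_le_mul_right g1 2)
        (mul_le_mul_right (S.sqDist_val_zero_le ω) 2)))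
      have hqn : 0 ≤ S.quad ω := h8 ▸ hq0 ω
      rw [← ENNReal.ofReal_ofNat, ← ENNReal.ofReal_mul (by norm_num),
        ← ENNReal.ofReal_mul (by norm_num), ← ENNReal.ofReal_add (by positivity) (by positivity),
        ENNReal.ofReal_le_ofReal_iff (by positivity)] at h10
      have h11 : ε ≤ 1 := min_le_right _ _
      change l ≤ S'.quad ω
      rw [h8]
      linarith
    · exact Or.inr hωA
  refine hcover.trans ((measure_union_le _ _).trans (add_le_add hP (hPA.trans ?_)))
  rw [← ENNReal.ofReal_coe_nnreal]
  exact ENNReal.ofReal_le_ofReal (min_le_left _ _)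

/-- The quadratic variation on `[0, T)` of a continuous stochastic integral is finite. -/
theorem ae_sqDist_lt_top [IsProbabilityMeasure P] (hw : IsBrownianMotion w P)
    (hN : IsItoIntegralProcess P w T Φ N) :
    ∀ᵐ ω ∂P, sqDist (fun i r ω => (Ioo 0 T).indicator (fun r => Φ i r ω) r) (fun _ _ _ => 0) ω < ∞
        := by
  have hT := hN.pos
  obtain ⟨s, hsmono, hsT, hslim⟩ := exists_seq_strictMono_tendsto' hT
  set Q : Ω → ℝ≥0∞ :=
    sqDist (fun i r ω => (Ioo 0 T).indicator (fun r => Φ i r ω) r) (fun _ _ _ => 0) with hQ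
  set R : ℕ → Ω → ℝ≥0∞ := fun n => sqDist (restrictIoc 0 (s n) Φ) (fun _ _ _ => 0) with hR
  have e : ∀ (B : Set ℝ), MeasurableSet B → ∀ ω, ∫⁻ r, ∑ i,
      ‖B.indicator (fun r => Φ i r ω) r - 0‖ₑ ^ 2 =
      ∫⁻ r in B, ∑ i, ‖Φ i r ω‖ₑ ^ 2 := by
    intro B hB ω
    rw [← lintegral_indicator hB]
    refine lintegral_congr fun r => ?_
    by_cases hr : r ∈ B <;> simp [hr]
  have hU : (⋃ n, Ioc 0 (s n)) = Ioo 0 T := by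
    ext r
    simp only [mem_iUnion]
    constructor
    · rintro ⟨n, h1, h2⟩
      exact ⟨h1, h2.trans_lt (hsT n).2⟩
    · rintro ⟨h1, h2⟩
      obtain ⟨n, hn⟩ := (hslim.eventually (lt_mem_nhds h2)).exists
      exact ⟨n, h1, hn.le⟩
  have hmonoI : Monotone fun n => Ioc 0 (s n) := fun i j hij =>
    Ioc_subset_Ioc_right (hsmono.monotone hij)
  have hRmono : ∀ ω, Monotone fun n => R n ω := by
    intro ω i j hij
    simp only [hR]
    unfold sqDist restrictIoc
    rw [e _ measurableSet_Ioc, e _ measurableSet_Ioc]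
    exact lintegral_mono_set (hmonoI hij)
  have hQR : ∀ ω, Q ω = ⨆ n, R n ω := by
    intro ω
    have h1 := setLIntegral_iUnion_of_directed (μ := volume) (fun r => ∑ i, ‖Φ i r ω‖ₑ ^ 2)
      (s := fun n => Ioc 0 (s n)) hmonoI.directed_le
    simp only [hQ, hR]
    unfold sqDist restrictIoc
    rw [e _ measurableSet_Ioo, ← hU, h1]
    exact iSup_congr fun n => (e _ measurableSet_Ioc ω).symm
  -- The bound is uniform in `s < T`, so it survives `s → T`, and then `l → ∞` makes it zero. Each
  -- path is bounded by some `k`, being continuous on the compact interval `[0, T]`.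
  have hk : ∀ k : ℕ, P {ω | (∀ t ∈ Icc 0 T, |N t ω| ≤ k) ∧ Q ω = ∞} = 0 := by
    intro k
    have hbound : ∀ l : ℝ, 0 < l → P {ω | (∀ t ∈ Icc 0 T, |N t ω| ≤ k) ∧ Q ω = ∞} ≤
        ENNReal.ofReal ((2 * ((k : ℝ) + 1) ^ 2 + 2) / l) := by
      intro l hl
      set W : ℕ → Set Ω := fun n => {ω | (∀ t ∈ Icc 0 T, |N t ω| ≤ k) ∧
        ENNReal.ofReal (2 * l + 2) ≤ R n ω} with hW
      have hWmono : Monotone W := fun i j hij ω hω => ⟨hω.1, hω.2.trans (hRmono ω hij)⟩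
      have hsub : {ω | (∀ t ∈ Icc 0 T, |N t ω| ≤ k) ∧ Q ω = ∞} ⊆ ⋃ n, W n := by
        rintro ω ⟨h1, h2⟩
        rw [hQR] at h2
        have h3 : ENNReal.ofReal (2 * l + 2) < ⨆ n, R n ω := by
          rw [h2]; exact ENNReal.ofReal_lt_top
        obtain ⟨n, hn⟩ := lt_iSup_iff.1 h3
        exact mem_iUnion.2 ⟨n, h1, hn.le⟩
      refine (measure_mono hsub).trans ?_
      rw [hWmono.directed_le.measure_iUnion]
      refine iSup_le fun n => (measure_mono ?_).trans
        (hN.measure_le_sqDist_le hw (hsT n).1.le (hsT n).2 hl)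
      exact fun ω hω => ⟨fun t ht => hω.1 t ⟨ht.1, ht.2.trans (hsT n).2.le⟩, hω.2⟩
    have hlim : Tendsto (fun n : ℕ => ENNReal.ofReal ((2 * ((k : ℝ) + 1) ^ 2 + 2) / ((n : ℝ) + 1)))
        atTop (𝓝 0) := by
      have := tendsto_const_div_atTop_nhds_zero_nat (2 * ((k : ℝ) + 1) ^ 2 + 2)
      have h2 := (tendsto_add_atTop_iff_nat 1).2 this
      simpa using ENNReal.tendsto_ofReal h2
    exact le_antisymm (ge_of_tendsto' hlim fun n => hbound _ (by positivity)) zero_le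
  have hall : P (⋃ k : ℕ, {ω | (∀ t ∈ Icc 0 T, |N t ω| ≤ k) ∧ Q ω = ∞}) = 0 :=
    measure_iUnion_null hk
  have hae := measure_eq_zero_iff_ae_notMem.1 hall
  filter_upwards [hae, hN.cont] with ω h1 h2
  by_contra hcon
  obtain ⟨C, hC⟩ := isCompact_Icc.exists_bound_of_continuousOn h2
  obtain ⟨k, hk⟩ := exists_nat_ge C
  exact h1 (mem_iUnion.2 ⟨k, fun t ht => (hC t ht).trans hk, not_lt_top_iff.1 hcon⟩)

end IsItoIntegralProcess

end QuadraticVariation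

/-! ### The terminal value as an Itô integral -/

section TerminalValue

variable {Ω : Type*} [mΩ : MeasurableSpace Ω] {m : ℕ}
variable {w : Fin m → ℝ≥0 → Ω → ℝ} {P : Measure Ω}

theorem sqDist_indicator_zero (Φ : Fin m → ℝ → Ω → ℝ) {B : Set ℝ} (hB : MeasurableSet B) (ω : Ω) :
    sqDist (fun i r ω => B.indicator (fun r => Φ i r ω) r) (fun _ _ _ => 0) ω =
      ∫⁻ r in B, ∑ i, ‖Φ i r ω‖ₑ ^ 2 := by
  unfold sqDist
  rw [← lintegral_indicator hB]
  refine lintegral_congr fun r => ?_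
  by_cases hr : r ∈ B <;> simp [hr]

theorem JointlyMeasurableOn.measurable_setLIntegral {s t : ℝ} (hs : 0 ≤ s) (hst : s ≤ t)
    {Φ : Fin m → ℝ → Ω → ℝ} (h : ∀ i, JointlyMeasurableOn mΩ 0 t (Φ i)) :
    Measurable fun ω => ∫⁻ r in Ioc s t, ∑ i, ‖Φ i r ω‖ₑ ^ 2 := by
  have h0t := hs.trans hst
  have h1 : Measurable fun q : Ω × ℝ => ∑ i, ‖Φ i (projIcc 0 t h0t q.2) q.1‖ₑ ^ 2 :=
    Finset.measurable_fun_sum _ fun i _ =>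
      ((((h i).measurable_projIcc h0t).comp measurable_swap).enorm).pow_const 2
  have h2 := h1.lintegral_prod_right' (ν := volume.restrict (Ioc s t))
  convert h2 using 2 with ω
  refine setLIntegral_congr_fun measurableSet_Ioc fun r hr => ?_
  simp only
  rw [projIcc_of_mem h0t ⟨hs.trans hr.1.le, hr.2⟩]

/-- The nodes of `S`, followed by `T`. -/
noncomputable def Elementary.toPartition (S : Elementary w P) {s T : ℝ} (h0 : S.t 0 = 0)
    (hN : S.t S.N = s) (hsT : s < T) (hmono : ∀ j < S.N, S.t j < S.t (j + 1)) : Partition 0 T where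
  N := S.N + 1
  pt := fun j => if (j : ℕ) ≤ S.N then S.t j else T
  strictMono := by
    refine Fin.strictMono_iff_lt_succ.2 fun j => ?_
    have hj := j.2
    simp only [Fin.val_castSucc, Fin.val_succ]
    rw [if_pos (by omega)]
    split_ifs with h
    · exact hmono j (by omega)
    · have : (j : ℕ) = S.N := by omega
      rw [this, hN]
      exact hsT
  first := by simp [h0]
  last := by simp

/-- The step process with the coefficients of `S` on `[0, s]` and zero on `(s, T]`. -/
noncomputable def Elementary.toStep (S : Elementary w P) {s T : ℝ} (h0 : S.t 0 = 0)
    (hN : S.t S.N = s) (hsT : s < T) (hmono : ∀ j < S.N, S.t j < S.t (j + 1)) :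
    StepProcess (augFiltration w P) m ℝ 0 T where
  part := S.toPartition h0 hN hsT hmono
  coeff := fun j i ω => if (j : ℕ) < S.N then S.ξ j i ω else 0
  adapted := fun j i => by
    have hj : (j : ℕ) < S.N + 1 := j.2
    have e : (S.toPartition h0 hN hsT hmono).pt j.castSucc = S.t j :=
      if_pos (Nat.lt_succ_iff.1 hj)
    rw [e]
    by_cases h : (j : ℕ) < S.N
    · simp only [h, if_true]
      exact S.adapted j i
    · simp only [h, if_false]
      exact @stronglyMeasurable_const _ _ (_) _ _
  bounded := by
    obtain ⟨C, hC⟩ := S.bounded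
    refine ⟨max C 0, fun j i ω => ?_⟩
    by_cases h : (j : ℕ) < S.N
    · simp only [h, if_true]
      exact (hC _ _ _).trans (le_max_left _ _)
    · simp [h]

theorem Elementary.toStep_val (S : Elementary w P) {s T : ℝ} (h0 : S.t 0 = 0)
    (hN : S.t S.N = s) (hsT : s < T) (hmono : ∀ j < S.N, S.t j < S.t (j + 1)) (i : Fin m) (r : ℝ)
    (ω : Ω) : (S.toStep h0 hN hsT hmono).val i r ω = S.val i r ω := by
  have h1 : (S.toStep h0 hN hsT hmono).val i r ω =
      ∑ j ∈ Finset.range (S.N + 1), (Ioc (if j ≤ S.N then S.t j else T)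
        (if j + 1 ≤ S.N then S.t (j + 1) else T)).indicator
          (fun _ => if j < S.N then S.ξ j i ω else 0) r :=
    Fin.sum_univ_eq_sum_range (fun j : ℕ => (Ioc (if j ≤ S.N then S.t j else T)
        (if j + 1 ≤ S.N then S.t (j + 1) else T)).indicator
          (fun _ => if j < S.N then S.ξ j i ω else 0) r) (S.N + 1)
  rw [h1, Finset.sum_range_succ, Elementary.val]
  simp only [lt_self_iff_false, if_false, indicator_zero, add_zero]
  refine Finset.sum_congr rfl fun j hj => ?_
  have hj' := Finset.mem_range.1 hj
  rw [if_pos hj'.le, if_pos (Nat.succ_le_of_lt hj')]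
  simp only [hj', if_true]

theorem Elementary.toStep_integral (S : Elementary w P) {s T : ℝ} (h0 : S.t 0 = 0)
    (hN : S.t S.N = s) (hsT : s < T) (hmono : ∀ j < S.N, S.t j < S.t (j + 1)) (ω : Ω) :
    (S.toStep h0 hN hsT hmono).integral w ω = S.int ω := by
  have h1 : (S.toStep h0 hN hsT hmono).integral w ω =
      ∑ j ∈ Finset.range (S.N + 1), ∑ i, dW w i (if j ≤ S.N then S.t j else T)
        (if j + 1 ≤ S.N then S.t (j + 1) else T) ω * (if j < S.N then S.ξ j i ω else 0) :=
    Fin.sum_univ_eq_sum_range (fun j : ℕ => ∑ i, dW w i (if j ≤ S.N then S.t j else T)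
        (if j + 1 ≤ S.N then S.t (j + 1) else T) ω * (if j < S.N then S.ξ j i ω else 0)) (S.N + 1)
  rw [h1, Finset.sum_range_succ, Elementary.int]
  simp only [lt_self_iff_false, if_false, mul_zero, Finset.sum_const_zero, add_zero]
  refine Finset.sum_congr rfl fun j hj => ?_
  have hj' := Finset.mem_range.1 hj
  rw [if_pos hj'.le, if_pos (Nat.succ_le_of_lt hj')]
  simp only [hj', if_true, Elementary.incr]
  exact Finset.sum_congr rfl fun i _ => mul_comm _ _

theorem isItoIntegral_of_approx {Φ : Fin m → ℝ → Ω → ℝ} {a b : ℝ} {Y : Ω → ℝ}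
    (h : ∀ ε : ℝ, 0 < ε → ∃ S : StepProcess (augFiltration w P) m ℝ a b,
      P {ω | ENNReal.ofReal ε ≤ ∫⁻ t in Icc a b, ∑ i, ‖S.val i t ω - Φ i t ω‖ₑ ^ 2}
        ≤ ENNReal.ofReal ε ∧
      P {ω | ε ≤ |S.integral w ω - Y ω|} ≤ ENNReal.ofReal ε) : IsItoIntegral P w Φ a b Y := by
  choose S h1 h2 using fun k : ℕ => h (1 / ((k : ℝ) + 1)) (by positivity)
  have hlim : Tendsto (fun k : ℕ => ENNReal.ofReal (1 / ((k : ℝ) + 1))) atTop (𝓝 0) := by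
    simpa using ENNReal.tendsto_ofReal tendsto_one_div_add_atTop_nhds_zero_nat
  refine ⟨S, fun ε hε => ?_, fun ε hε => ?_⟩ <;>
    refine tendsto_of_tendsto_of_tendsto_of_le_of_le' tendsto_const_nhds hlim
      (Eventually.of_forall fun _ => zero_le) ?_ <;>
    filter_upwards [hlim.eventually (gt_mem_nhds hε)] with k hk
  · exact (measure_mono fun ω hω => hk.le.trans hω).trans (h1 k)
  · refine (measure_mono fun ω hω => ?_).trans (h2 k)
    simp only [mem_ofPred_eq] at hω ⊢
    rw [edist_dist, Real.dist_eq] at hω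
    have := hk.le.trans hω
    rwa [ENNReal.ofReal_le_ofReal_iff (abs_nonneg _)] at this

theorem Grid.uniform_lt {a b : ℝ} (hab : a < b) (N : ℕ) {j : ℕ}
    (hj : j < (Grid.uniform hab.le N).N) :
    (Grid.uniform hab.le N).t j < (Grid.uniform hab.le N).t (j + 1) := by
  have hj' : j < N + 1 := hj
  simp only [Grid.uniform]
  rw [min_eq_left hj'.le, min_eq_left (Nat.succ_le_of_lt hj')]
  have h2 : 0 < (b - a) / ((N : ℝ) + 1) := div_pos (sub_pos.2 hab) (by positivity)
  push_cast
  linarith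

namespace IsItoIntegralProcess

variable {T : ℝ} {Φ : Fin m → ℝ → Ω → ℝ} {N : ℝ → Ω → ℝ}

/-- `N s` tends to `N T` by continuity of the paths, and the tail of the quadratic variation tends
to zero because the total is finite. -/
theorem exists_tail_le [IsProbabilityMeasure P] (hw : IsBrownianMotion w P)
    (hN : IsItoIntegralProcess P w T Φ N) {ε : ℝ} (hε : 0 < ε) {s₀ : ℝ} (hs₀ : s₀ < T) :
    ∃ s, 0 < s ∧ s₀ < s ∧ s < T ∧ P {ω | ε ≤ |N T ω - N s ω|} ≤ ENNReal.ofReal ε ∧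
      P {ω | ENNReal.ofReal ε ≤ ∫⁻ r in Ioo s T, ∑ i, ‖Φ i r ω‖ₑ ^ 2} ≤ ENNReal.ofReal ε := by
  obtain ⟨s, hsmono, hsT, hslim⟩ := exists_seq_strictMono_tendsto' (max_lt hN.pos hs₀)
  have hs0 : ∀ n, 0 < s n := fun n => (le_max_left _ _).trans_lt (hsT n).1
  have hss : ∀ n, s₀ < s n := fun n => (le_max_right _ _).trans_lt (hsT n).1
  have hε' : (0 : ℝ≥0∞) < ENNReal.ofReal ε := by simpa using hε
  -- convergence of the integral
  have hlimN : TendstoInMeasure P (fun n => N (s n)) atTop (N T) := by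
    refine tendstoInMeasure_of_tendsto_ae (fun n => ?_) ?_
    · exact ((hN.adapted _ ⟨(hs0 n).le, (hsT n).2⟩).mono (augFiltration_le _)).aestronglyMeasurable
    · filter_upwards [hN.cont] with ω hω
      exact ((hω T (right_mem_Icc.2 hN.pos.le)).tendsto).comp
        (tendsto_nhdsWithin_iff.2 ⟨hslim, Eventually.of_forall fun n =>
          ⟨(hs0 n).le, (hsT n).2.le⟩⟩)
  have h1 : ∀ᶠ n in atTop, P {ω | ε ≤ |N T ω - N (s n) ω|} ≤ ENNReal.ofReal ε := by
    have := hlimN (ENNReal.ofReal ε) hε'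
    filter_upwards [this.eventually (ge_mem_nhds hε')] with n hn
    refine (measure_mono fun ω hω => ?_).trans hn
    simp only [mem_ofPred_eq] at hω ⊢
    rw [edist_comm, edist_dist, Real.dist_eq]
    exact ENNReal.ofReal_le_ofReal hω
  -- convergence of the quadratic variation
  have hIoc : ∀ n, Measurable fun ω => ∫⁻ r in Ioc 0 (s n), ∑ i, ‖Φ i r ω‖ₑ ^ 2 := fun n =>
    JointlyMeasurableOn.measurable_setLIntegral le_rfl (hs0 n).le (hN.measurable _ (hsT n).2)
  have hmonoI : ∀ k, Monotone fun n => Ioc (s k) (s n) := fun k i j hij =>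
    Ioc_subset_Ioc_right (hsmono.monotone hij)
  have hU : ∀ k, (⋃ n, Ioc (s k) (s n)) = Ioo (s k) T := by
    intro k
    ext r
    simp only [mem_iUnion]
    constructor
    · rintro ⟨n, h1, h2⟩
      exact ⟨h1, h2.trans_lt (hsT n).2⟩
    · rintro ⟨h1, h2⟩
      obtain ⟨n, hn⟩ := (hslim.eventually (lt_mem_nhds h2)).exists
      exact ⟨n, h1, hn.le⟩
  have hIoo : ∀ k, Measurable fun ω => ∫⁻ r in Ioo (s k) T, ∑ i, ‖Φ i r ω‖ₑ ^ 2 := by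
    intro k
    have : (fun ω => ∫⁻ r in Ioo (s k) T, ∑ i, ‖Φ i r ω‖ₑ ^ 2) =
        fun ω => ⨆ n, ∫⁻ r in Ioc (s k) (s n), ∑ i, ‖Φ i r ω‖ₑ ^ 2 := by
      funext ω
      rw [← setLIntegral_iUnion_of_directed _ (hmonoI k).directed_le, hU]
    rw [this]
    refine Measurable.iSup fun n => ?_
    rcases le_total (s k) (s n) with h | h
    · exact JointlyMeasurableOn.measurable_setLIntegral (hs0 k).le h (hN.measurable _ (hsT n).2)
    · simp [Ioc_eq_empty (not_lt.2 h)]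
  obtain ⟨n₀, hn₀⟩ := exists_measure_compl_le (P := P)
    (A := fun n => {ω | ∫⁻ r in Ioo (s n) T, ∑ i, ‖Φ i r ω‖ₑ ^ 2 < ENNReal.ofReal ε})
    (fun n => measurableSet_lt (hIoo n) measurable_const)
    (fun i j hij ω hω => lt_of_le_of_lt
      (lintegral_mono_set (Ioo_subset_Ioo_left (hsmono.monotone hij))) hω)
    (by
      filter_upwards [hN.ae_sqDist_lt_top hw] with ω hω
      rw [sqDist_indicator_zero Φ measurableSet_Ioo] at hω
      have h2 : Tendsto (fun n => ∫⁻ r in Ioo (s n) T, ∑ i, ‖Φ i r ω‖ₑ ^ 2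
          ∂(volume.restrict (Ioo 0 T))) atTop (𝓝 0) := by
        refine tendsto_setLIntegral_zero hω.ne ?_
        have h3 : ∀ n, (volume.restrict (Ioo 0 T)) (Ioo (s n) T) = ENNReal.ofReal (T - s n) := by
          intro n
          rw [Measure.restrict_apply measurableSet_Ioo, inter_eq_left.2
            (Ioo_subset_Ioo_left (hs0 n).le), Real.volume_Ioo]
        simp only [Function.comp_def, h3]
        have := ENNReal.tendsto_ofReal (hslim.const_sub T)
        simpa using this
      obtain ⟨n, hn⟩ := (h2.eventually (gt_mem_nhds hε')).exists
      refine ⟨n, ?_⟩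
      rwa [Measure.restrict_restrict measurableSet_Ioo,
        inter_eq_left.2 (Ioo_subset_Ioo_left (hs0 n).le)] at hn) hε'
  obtain ⟨n, hn, hnn⟩ := (h1.and (eventually_ge_atTop n₀)).exists
  refine ⟨s n, hs0 n, hss n, (hsT n).2, hn, (measure_mono fun ω hω => ?_).trans hn₀⟩
  simp only [mem_compl_iff, mem_ofPred_eq, not_lt] at hω ⊢
  exact hω.trans (lintegral_mono_set (Ioo_subset_Ioo_left (hsmono.monotone hnn)))

/-- The terminal value is the Itô integral over `[0, T]`. -/
theorem isItoIntegral [IsProbabilityMeasure P] (hw : IsBrownianMotion w P)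
    (hN : IsItoIntegralProcess P w T Φ N) : IsItoIntegral P w Φ 0 T (N T) := by
  refine isItoIntegral_of_approx fun ε hε => ?_
  obtain ⟨s, h0s, -, hsT, htN, htQ⟩ := hN.exists_tail_le hw (ε := ε / 4) (by positivity) hN.pos
  obtain ⟨h, hh, K, hK, hclose⟩ := hN.exists_close hw h0s.le hsT (ε := ε / 4) (by positivity)
  obtain ⟨n, hn⟩ := exists_nat_gt ((s - 0) / h)
  set G := Grid.uniform h0s.le n with hG
  have hGm : G.MeshLe h := by
    refine fun j => (Grid.uniform_meshLe h0s.le n j).trans ?_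
    rw [div_le_iff₀ (by positivity)]
    rw [div_lt_iff₀ hh] at hn
    nlinarith
  obtain ⟨A, hA, hPA, hgood⟩ := hclose G hGm
  set S := (hN.integrand s hsT).sample le_rfl G hK with hS
  have hadd : ENNReal.ofReal (ε / 4) + ENNReal.ofReal (ε / 4) ≤ ENNReal.ofReal ε := by
    rw [← ENNReal.ofReal_add (by positivity) (by positivity)]
    exact ENNReal.ofReal_le_ofReal (by linarith)
  have hS0 : S.t 0 = 0 := G.first
  have hSs : S.t S.N = s := G.last _ le_rfl
  have hSm : ∀ j < S.N, S.t j < S.t (j + 1) := fun j hj => Grid.uniform_lt h0s n hj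
  -- The discretisation on `[0, s]` is continued by zero up to `T`. The cost is the tail of the
  -- quadratic variation in the first estimate and `N T - N s` in the second.
  refine ⟨S.toStep hS0 hSs hsT hSm, ?_, ?_⟩
  · refine (measure_mono_ae ?_).trans ((measure_union_le Aᶜ _).trans
      ((add_le_add hPA htQ).trans hadd))
    filter_upwards [(hN.integrand s hsT).pathMeas] with ω hpm hω
    by_contra hcon
    obtain ⟨hωA, htail⟩ := not_or.1 hcon
    replace hωA := not_not.1 hωA
    rw [mem_ofPred_eq, not_le] at htail
    obtain ⟨g1, -⟩ := hgood ω hωA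
    have h1 := sqDist_triangle (Φ := S.val) (Ψ := restrictIoc 0 s Φ)
      (Ξ := fun i r ω => (Ioo 0 T).indicator (fun r => Φ i r ω) r) (ω := ω)
      (fun i => (S.measurable_val i ω).aemeasurable) hpm
    have h2 : sqDist (restrictIoc 0 s Φ)
        (fun i r ω => (Ioo 0 T).indicator (fun r => Φ i r ω) r) ω =
        ∫⁻ r in Ioo s T, ∑ i, ‖Φ i r ω‖ₑ ^ 2 := by
      unfold sqDist
      rw [← lintegral_indicator measurableSet_Ioo]
      refine lintegral_congr fun r => ?_
      by_cases hr : r ∈ Ioc 0 s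
      · have h3 : r ∈ Ioo 0 T := ⟨hr.1, hr.2.trans_lt hsT⟩
        have h4 : r ∉ Ioo s T := fun h => absurd hr.2 (not_le.2 h.1)
        simp [restrictIoc_of_mem hr, h3, h4]
      · by_cases h3 : r ∈ Ioo s T
        · have h4 : r ∈ Ioo 0 T := ⟨h0s.trans h3.1, h3.2⟩
          simp [restrictIoc_of_notMem hr, h3, h4]
        · have h4 : r ∉ Ioo 0 T := fun h => by
            rcases le_or_gt r s with h5 | h5
            · exact hr ⟨h.1, h5⟩
            · exact h3 ⟨h5, h.2⟩
          simp [restrictIoc_of_notMem hr, h3, h4]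
    -- The end points are discarded as a null set: nothing is known about the integrand at `T`.
    have h3 : ∫⁻ t in Icc 0 T, ∑ i, ‖(S.toStep hS0 hSs hsT hSm).val i t ω -
        Φ i t ω‖ₑ ^ 2 ≤ sqDist S.val (fun i r ω => (Ioo 0 T).indicator (fun r => Φ i r ω) r) ω := by
      rw [← setLIntegral_congr (Ioo_ae_eq_Icc (μ := volume) (a := 0) (b := T)),
        ← lintegral_indicator measurableSet_Ioo]
      refine lintegral_mono fun r => ?_
      by_cases hr : r ∈ Ioo 0 T
      · simp [hr, S.toStep_val hS0 hSs hsT hSm]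
      · simp [hr]
    rw [h2] at h1
    refine absurd (le_trans hω (h3.trans h1)) (not_le.2 ?_)
    have h5 : ∀ x, x < ENNReal.ofReal (ε / 4) → 2 * x < 2 * ENNReal.ofReal (ε / 4) := fun x hx =>
      (ENNReal.mul_lt_mul_iff_right (by simp) (by simp)).2 hx
    refine (ENNReal.add_lt_add_of_le_of_lt ?_ (mul_le_mul_right g1 2) (h5 _ htail)).trans_le ?_
    · exact ENNReal.mul_ne_top (by simp) (g1.trans_lt ENNReal.ofReal_lt_top).ne
    · rw [← add_mul, show (2 : ℝ≥0∞) + 2 = ENNReal.ofReal 4 by norm_num,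
        ← ENNReal.ofReal_mul (by norm_num)]
      exact ENNReal.ofReal_le_ofReal (by linarith)
  · refine (measure_mono fun ω hω => ?_).trans ((measure_union_le Aᶜ _).trans
      ((add_le_add hPA htN).trans hadd))
    by_contra hcon
    obtain ⟨hωA, htail⟩ := not_or.1 hcon
    replace hωA := not_not.1 hωA
    rw [mem_ofPred_eq, not_le] at htail
    obtain ⟨-, g2⟩ := hgood ω hωA
    have h1 := g2 G.N le_rfl
    rw [G.last _ le_rfl] at h1
    have h2 : S.partialInt G.N ω = S.int ω := rfl
    rw [h2] at h1
    rw [mem_ofPred_eq, S.toStep_integral hS0 hSs hsT hSm] at hω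
    have h3 := abs_sub_le (S.int ω) (N s ω) (N T ω)
    rw [abs_sub_comm (N s ω)] at h3
    linarith [htail]

end IsItoIntegralProcess

end TerminalValue

/-! ### The sign and the vanishing of the mean -/

section Expectation

variable {Ω : Type*} [mΩ : MeasurableSpace Ω] {m : ℕ}
variable {w : Fin m → ℝ≥0 → Ω → ℝ} {P : Measure Ω}

/-- This is `|Y| ≤ a + Y² / (4 a)`. The free parameter `a` balances the probability of `B` against
the second moment. -/
theorem setIntegral_abs_le [IsProbabilityMeasure P] {Y : Ω → ℝ} (hY : MemLp Y 2 P) (B : Set Ω)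
    {a c : ℝ} (ha : 0 < a) (hc : ∫ ω, Y ω ^ 2 ∂P ≤ c) :
    ∫ ω in B, |Y ω| ∂P ≤ a * P.real B + c / (4 * a) := by
  have hi := hY.integrable_sq
  have h1 : ∫ ω in B, |Y ω| ∂P ≤ ∫ ω in B, (a + Y ω ^ 2 / (4 * a)) ∂P := by
    refine integral_mono ((hY.integrable one_le_two).abs.integrableOn)
      ((integrable_const a).add (hi.div_const _)).integrableOn fun ω => ?_
    have : |Y ω| * (4 * a) ≤ a * (4 * a) + Y ω ^ 2 := by
      rw [← sq_abs]
      nlinarith [sq_nonneg (|Y ω| - 2 * a)]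
    rw [← le_div_iff₀ (by positivity)] at this
    refine this.trans (le_of_eq ?_)
    field_simp
  refine h1.trans ?_
  rw [integral_add (integrable_const a).integrableOn (hi.div_const _).integrableOn,
    integral_const, integral_div, smul_eq_mul, measureReal_restrict_apply_univ, mul_comm]
  gcongr
  exact (setIntegral_le_integral hi (Eventually.of_forall fun ω => sq_nonneg _)).trans hc

/-- Fatou's lemma along a subsequence; positive parts suffice, because `N + G` will be nonnegative.
-/
theorem lintegral_ofReal_le_of_approx {N G : Ω → ℝ} (hG : AEMeasurable G P) {c : ℝ}
    (h : ∀ ε : ℝ, 0 < ε → ∃ Y : Ω → ℝ, AEMeasurable Y P ∧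
      ∫⁻ ω, ENNReal.ofReal (Y ω + G ω) ∂P ≤ ENNReal.ofReal (c + ε) ∧
      P {ω | ε ≤ |Y ω - N ω|} ≤ ENNReal.ofReal ε) :
    ∫⁻ ω, ENNReal.ofReal (N ω + G ω) ∂P ≤ ENNReal.ofReal c := by
  choose Y hYm hY1 hY2 using fun k : ℕ => h (1 / ((k : ℝ) + 1)) (by positivity)
  have hlim0 : Tendsto (fun k : ℕ => 1 / ((k : ℝ) + 1)) atTop (𝓝 0) :=
    tendsto_one_div_add_atTop_nhds_zero_nat
  have hlim : Tendsto (fun k : ℕ => ENNReal.ofReal (1 / ((k : ℝ) + 1))) atTop (𝓝 0) := by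
    simpa using ENNReal.tendsto_ofReal hlim0
  have hYN : TendstoInMeasure P Y atTop N := by
    intro ε hε
    refine tendsto_of_tendsto_of_tendsto_of_le_of_le' tendsto_const_nhds hlim
      (Eventually.of_forall fun _ => zero_le) ?_
    filter_upwards [hlim.eventually (gt_mem_nhds hε)] with k hk
    refine (measure_mono fun ω hω => ?_).trans (hY2 k)
    simp only [mem_ofPred_eq] at hω ⊢
    rw [edist_dist, Real.dist_eq] at hω
    have := hk.le.trans hω
    rwa [ENNReal.ofReal_le_ofReal_iff (abs_nonneg _)] at this
  obtain ⟨ns, hns, hae⟩ := hYN.exists_seq_tendsto_ae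
  have h1 : ∫⁻ ω, ENNReal.ofReal (N ω + G ω) ∂P ≤
      ∫⁻ ω, liminf (fun k => ENNReal.ofReal (Y (ns k) ω + G ω)) atTop ∂P := by
    refine lintegral_mono_ae ?_
    filter_upwards [hae] with ω hω
    exact ((ENNReal.tendsto_ofReal (hω.add_const (G ω))).liminf_eq).ge
  refine h1.trans ((lintegral_liminf_le' fun k => ((hYm _).add hG).ennreal_ofReal).trans ?_)
  have h2 : Tendsto (fun k => ENNReal.ofReal (c + 1 / ((ns k : ℝ) + 1))) atTop
      (𝓝 (ENNReal.ofReal c)) := by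
    have := (hlim0.comp hns.tendsto_atTop).const_add c
    simpa using ENNReal.tendsto_ofReal this
  rw [← h2.liminf_eq]
  exact liminf_le_liminf (Eventually.of_forall fun k => hY1 (ns k))

theorem abs_clip_le_abs {K : ℝ} (hK : 0 ≤ K) (x : ℝ) : |clip K x| ≤ |x| := by
  unfold clip
  rcases le_total K x with h | h
  · rw [min_eq_left h, max_eq_right (by linarith), abs_of_nonneg hK]
    exact h.trans (le_abs_self x)
  · rw [min_eq_right h]
    rcases le_total (-K) x with h' | h'
    · rw [max_eq_right h']
    · rw [max_eq_left h', abs_neg, abs_of_nonneg hK, abs_of_nonpos (by linarith)]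
      linarith

namespace IsItoIntegralProcess

variable {T : ℝ} {Φ : Fin m → ℝ → Ω → ℝ} {N : ℝ → Ω → ℝ}

theorem exists_sqDist_bound [IsProbabilityMeasure P] (hN : IsItoIntegralProcess P w T Φ N) {s : ℝ}
    (h0s : 0 ≤ s) (hsT : s < T) {ε : ℝ} (hε : 0 < ε) : ∃ R : ℝ, 0 ≤ R ∧ ∃ A, MeasurableSet A ∧
      P Aᶜ ≤ ENNReal.ofReal ε ∧
      ∀ ω ∈ A, sqDist (restrictIoc 0 s Φ) (fun _ _ _ => 0) ω ≤ ENNReal.ofReal R := by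
  have hΦ := hN.integrand s hsT
  have hm : ∀ r ∈ Icc 0 s, Measurable fun ω => (fun i => Φ i r ω : Fin m → ℝ) := fun r hr =>
    measurable_pi_lambda _ fun i => ((hΦ.adapted r hr i).mono (augFiltration_le _)).measurable
  have hc : ∀ᵐ ω ∂P, ContinuousOn (fun r => (fun i => Φ i r ω : Fin m → ℝ)) (Icc 0 s) := by
    filter_upwards [hΦ.cont] with ω hω
    exact continuousOn_pi.2 hω
  obtain ⟨K, A, hA, hPA, hgood⟩ := exists_bound hm hc (η := ENNReal.ofReal ε) (by simpa using hε)
  refine ⟨m * (K : ℝ) ^ 2 * (s - 0), by rw [sub_zero]; positivity, A, hA, hPA, fun ω hω => ?_⟩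
  refine sqDist_le_of_abs_le (fun r hr i => restrictIoc_of_notMem hr _ _ _) fun r hr i => ?_
  rw [restrictIoc_of_mem hr, sub_zero]
  exact (norm_le_pi_norm (fun i => Φ i r ω) i).trans ((hgood ω hω).2 r (Ioc_subset_Icc_self hr))

/-- `Y` is a discretised integral, stopped when it strays from `N` or when its quadratic variation
exceeds `c`. It has mean zero. On the good event its value is within `θ` of `N` at some node and
hence at least `-G - θ`; off that event it is controlled by its second moment. Thus the positive
part of `Y + G` has mean at most `E G + ε`. -/
theorem exists_approx_of_lower_bound [IsProbabilityMeasure P] (hw : IsBrownianMotion w P)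
    (hN : IsItoIntegralProcess P w T Φ N) {G : Ω → ℝ} (hG0 : ∀ ω, 0 ≤ G ω) (hG : Integrable G P)
    (hlow : ∀ t ∈ Icc 0 T, ∀ᵐ ω ∂P, -G ω ≤ N t ω) {s : ℝ} (h0s : 0 ≤ s) (hsT : s < T) {ε : ℝ}
    (hε : 0 < ε) : ∃ Y : Ω → ℝ, AEMeasurable Y P ∧
      ∫⁻ ω, ENNReal.ofReal (Y ω + G ω) ∂P ≤ ENNReal.ofReal (∫ ω, G ω ∂P + ε) ∧
      P {ω | ε ≤ |Y ω - N s ω|} ≤ ENNReal.ofReal ε := by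
  classical
  obtain ⟨R, hR0, A₁, hA₁, hPA₁, hR⟩ := hN.exists_sqDist_bound h0s hsT (half_pos hε)
  -- On the good events the quadratic variation of the discretisation is at most `2 * θ + 2 * R ≤
  -- c`, so this level is never exceeded there.
  set c : ℝ := 2 * R + 2 with hc
  have hc0 : 0 < c := by positivity
  -- The exceptional event contributes `c / ε * P Aᶜ + ε / 4`, by `setIntegral_abs_le` with `a = c /
  -- ε`; hence `θ` must also be small relative to `ε / c`.
  obtain ⟨θ, hθ0, hθ1, hθ⟩ := exists_small (τ := ε) hε (c := 4 * c / ε + 4) (by positivity)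
  have hθε : 4 * θ ≤ ε := by
    have : 0 ≤ θ * (4 * c / ε) := by positivity
    nlinarith
  have hθc : c / ε * θ ≤ ε / 4 := by
    have : θ * (4 * c / ε) ≤ ε := by nlinarith
    have e : θ * (4 * c / ε) = 4 * (c / ε * θ) := by ring
    linarith
  obtain ⟨h, hh, K, hK, hclose⟩ := hN.exists_close hw h0s hsT hθ0
  obtain ⟨Gr, hGr⟩ := Grid.exists_meshLe h0s hh
  obtain ⟨A, hA, hPA, hgood⟩ := hclose Gr hGr
  set S := (hN.integrand s hsT).sample le_rfl Gr hK with hS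
  have hSt : S.t = Gr.t := AdaptedContinuous.sample_t _ le_rfl Gr hK
  have hSN : S.N = Gr.N := AdaptedContinuous.sample_N _ le_rfl Gr hK
  set B : ℕ → Set Ω := fun j => {ω | ∀ l ≤ j, |S.partialInt l ω - N (Gr.t l) ω| < θ} ∩
    S.quadLe c j with hB
  have hBm : ∀ j, MeasurableSet[augFiltration w P (S.t j)] (B j) := by
    intro j
    refine MeasurableSet.inter ?_ (S.measurableSet_quadLe c j)
    have : {ω | ∀ l ≤ j, |S.partialInt l ω - N (Gr.t l) ω| < θ} =
        ⋂ l ∈ Finset.range (j + 1), {ω | |S.partialInt l ω - N (Gr.t l) ω| < θ} := by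
      ext ω
      simp
    rw [this]
    refine @Finset.measurableSet_biInter _ _ (augFiltration w P (S.t j)) _ _ fun l hl => ?_
    have h0 := hN.adapted (Gr.t l) ⟨(Gr.mem l).1, (Gr.mem l).2.trans_lt hsT⟩
    rw [← hSt] at h0
    have h1 := ((S.stronglyMeasurable_partialInt hw l).sub h0).mono
      (S.filtration_mono (Nat.lt_succ_iff.1 (Finset.mem_range.1 hl)))
    rw [hSt] at h1
    exact h1.measurable (measurableSet_lt (by fun_prop) (by fun_prop) :
      MeasurableSet {x : ℝ | |x| < θ})
  have hBanti : Antitone B := by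
    intro j k hjk ω hω
    refine ⟨fun l hl => hω.1 l (hl.trans hjk), ?_⟩
    have h1 : ∑ l ∈ Finset.range (k + 1), S.qincr l ω ≤ c := hω.2
    refine le_trans ?_ h1
    exact Finset.sum_le_sum_of_subset_of_nonneg (Finset.range_subset_range.2 (by omega))
      fun l _ _ => S.qincr_nonneg l ω
  set S' := S.stopAt B hBm with hS'
  have hq : ∫ ω, S'.int ω ^ 2 ∂P ≤ c := by
    rw [S'.integral_int_sq hw]
    have : ∫ ω, S'.quad ω ∂P ≤ ∫ _, c ∂P := by
      refine integral_mono S'.integrable_quad (integrable_const _) fun ω => ?_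
      obtain ⟨τ, -, h2, -, -, h5⟩ := S.stopAt_int_eq hBm hBanti ω
      simp only
      rw [h5]
      rcases Nat.eq_zero_or_pos τ with rfl | hτ
      · simpa using hc0.le
      · obtain ⟨j, rfl⟩ := Nat.exists_eq_succ_of_ne_zero hτ.ne'
        exact (h2 j (Nat.lt_succ_self j)).2
    simpa using this
  have hYL := S'.memLp_int hw
  have hYi := hYL.integrable one_le_two
  refine ⟨S'.int, hYi.1.aemeasurable, ?_, ?_⟩
  · have habs := setIntegral_abs_le hYL Aᶜ (a := c / ε) (by positivity) hq
    have hPA' : P.real Aᶜ ≤ θ := ENNReal.toReal_le_of_le_ofReal hθ0.le hPA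
    have e1 : c / (4 * (c / ε)) = ε / 4 := by field_simp
    have hind : Integrable (Aᶜ.indicator fun ω => |S'.int ω|) P := hYi.abs.indicator hA.compl
    have i1 : Integrable (fun ω => S'.int ω + G ω) P := hYi.add hG
    have i2 : Integrable (fun ω => S'.int ω + G ω + θ) P := i1.add (integrable_const θ)
    have i3 : Integrable (fun ω => S'.int ω + G ω + θ + Aᶜ.indicator (fun ω => |S'.int ω|) ω) P :=
      i2.add hind
    have hnn : ∀ᵐ ω ∂P, 0 ≤ S'.int ω + G ω + θ + Aᶜ.indicator (fun ω => |S'.int ω|) ω := by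
      have hl : ∀ᵐ ω ∂P, ∀ l : ℕ, -G ω ≤ N (Gr.t l) ω := ae_all_iff.2 fun l =>
        hlow _ ⟨(Gr.mem l).1, (Gr.mem l).2.trans hsT.le⟩
      filter_upwards [hl] with ω hω
      by_cases hωA : ω ∈ A
      · obtain ⟨τ, h1, -, -, h4, -⟩ := S.stopAt_int_eq hBm hBanti ω
        rw [indicator_of_notMem (by simpa using hωA), add_zero, h4]
        have h5 := (abs_lt.1 ((hgood ω hωA).2 τ (h1.trans hSN.le))).1
        have h6 := hω τ
        linarith
      · rw [indicator_of_mem (by simpa using hωA)]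
        have := neg_abs_le (S'.int ω)
        linarith [hG0 ω]
    calc ∫⁻ ω, ENNReal.ofReal (S'.int ω + G ω) ∂P
        ≤ ∫⁻ ω, ENNReal.ofReal
          (S'.int ω + G ω + θ + Aᶜ.indicator (fun ω => |S'.int ω|) ω) ∂P := by
          refine lintegral_mono fun ω => ENNReal.ofReal_le_ofReal ?_
          have : 0 ≤ Aᶜ.indicator (fun ω => |S'.int ω|) ω :=
            indicator_nonneg (fun _ _ => abs_nonneg _) _
          linarith
      _ = ENNReal.ofReal (∫ ω, (S'.int ω + G ω + θ + Aᶜ.indicator (fun ω => |S'.int ω|) ω) ∂P) :=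
          (ofReal_integral_eq_lintegral_ofReal i3 hnn).symm
      _ ≤ ENNReal.ofReal (∫ ω, G ω ∂P + ε) := by
          apply ENNReal.ofReal_le_ofReal
          rw [integral_add i2 hind, integral_add i1 (integrable_const θ), integral_add hYi hG,
            integral_indicator hA.compl, S'.integral_int hw, integral_const, probReal_univ,
                one_smul]
          rw [e1] at habs
          have : c / ε * P.real Aᶜ ≤ c / ε * θ :=
            mul_le_mul_of_nonneg_left hPA' (by positivity)
          linarith
  · have hcover : P {ω | ε ≤ |S'.int ω - N s ω|} ≤ P (Aᶜ ∪ A₁ᶜ) := by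
      refine measure_mono_ae ?_
      filter_upwards [(hN.integrand s hsT).pathMeas] with ω hpm hω
      by_contra hcon
      obtain ⟨hωA, hωA₁⟩ := not_or.1 hcon
      replace hωA := not_not.1 hωA
      replace hωA₁ := not_not.1 hωA₁
      obtain ⟨g1, g2⟩ := hgood ω hωA
      obtain ⟨τ, h1, -, h3, h4, -⟩ := S.stopAt_int_eq hBm hBanti ω
      have h5 := sqDist_triangle (Φ := S.val) (Ψ := restrictIoc 0 s Φ) (Ξ := fun _ _ _ => 0)
        (ω := ω) (fun i => (S.measurable_val i ω).aemeasurable) hpm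
      have h6 : ENNReal.ofReal (S.quad ω) ≤ sqDist S.val (fun _ _ _ => 0) ω := by
        simpa [sqDist] using S.ofReal_quad_le ω
      have h7 := h6.trans (h5.trans (add_le_add (mul_le_mul_right g1 2)
        (mul_le_mul_right (hR ω hωA₁) 2)))
      rw [← ENNReal.ofReal_ofNat, ← ENNReal.ofReal_mul (by norm_num),
        ← ENNReal.ofReal_mul (by norm_num), ← ENNReal.ofReal_add (by positivity) (by positivity),
        ENNReal.ofReal_le_ofReal_iff (by positivity)] at h7
      have h8 : τ = S.N := by
        by_contra hne
        refine h3 (lt_of_le_of_ne h1 hne) ⟨fun l hl => g2 l (hl.trans (h1.trans hSN.le)), ?_⟩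
        refine le_trans (Finset.sum_le_sum_of_subset_of_nonneg (Finset.range_subset_range.2
          (Nat.succ_le_of_lt (lt_of_le_of_ne h1 hne))) fun l _ _ => S.qincr_nonneg l ω) ?_
        refine h7.trans ?_
        rw [hc]
        linarith
      have h9 := g2 τ (h1.trans hSN.le)
      have h10 : ε ≤ |S'.int ω - N s ω| := hω
      rw [hS', h4, h8, hSN] at h10
      rw [h8, hSN, Gr.last _ le_rfl] at h9
      linarith
    refine hcover.trans ((measure_union_le _ _).trans ((add_le_add hPA hPA₁).trans ?_))
    rw [← ENNReal.ofReal_add (by positivity) (by positivity)]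
    exact ENNReal.ofReal_le_ofReal (by linarith)

/-- A stochastic integral bounded below by an integrable random variable has nonpositive mean. -/
theorem integrable_and_integral_nonpos [IsProbabilityMeasure P] (hw : IsBrownianMotion w P)
    (hN : IsItoIntegralProcess P w T Φ N) {G : Ω → ℝ} (hG0 : ∀ ω, 0 ≤ G ω) (hG : Integrable G P)
    (hlow : ∀ t ∈ Icc 0 T, ∀ᵐ ω ∂P, -G ω ≤ N t ω) :
    Integrable (N T) P ∧ ∫ ω, N T ω ∂P ≤ 0 := by
  have hNT : AEMeasurable (N T) P :=
    ((hN.isItoIntegral hw).itoLim le_rfl (ContinuousLinearMap.id ℝ ℝ)).aemeasurable hw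
  have hs : ∀ s, 0 ≤ s → s < T →
      ∫⁻ ω, ENNReal.ofReal (N s ω + G ω) ∂P ≤ ENNReal.ofReal (∫ ω, G ω ∂P) := fun s h0s hsT =>
    lintegral_ofReal_le_of_approx hG.1.aemeasurable fun ε hε =>
      hN.exists_approx_of_lower_bound hw hG0 hG hlow h0s hsT hε
  -- As `N T + G` is nonnegative, this one inequality contains both integrability of `N T` and the
  -- sign of its mean.
  have hT : ∫⁻ ω, ENNReal.ofReal (N T ω + G ω) ∂P ≤ ENNReal.ofReal (∫ ω, G ω ∂P) := by
    refine lintegral_ofReal_le_of_approx hG.1.aemeasurable fun ε hε => ?_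
    obtain ⟨s, h0s, -, hsT, htN, -⟩ := hN.exists_tail_le hw hε hN.pos
    refine ⟨N s, ((hN.adapted s ⟨h0s.le, hsT⟩).mono (augFiltration_le _)).measurable.aemeasurable,
      (hs s h0s.le hsT).trans (ENNReal.ofReal_le_ofReal (by linarith)), ?_⟩
    simpa only [abs_sub_comm] using htN
  have hnn : 0 ≤ᵐ[P] fun ω => N T ω + G ω := by
    filter_upwards [hlow T (right_mem_Icc.2 hN.pos.le)] with ω hω
    simp only [Pi.zero_apply]
    linarith
  have hi : Integrable (fun ω => N T ω + G ω) P :=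
    (lintegral_ofReal_ne_top_iff_integrable (hNT.add hG.1.aemeasurable).aestronglyMeasurable
      hnn).1 (hT.trans_lt ENNReal.ofReal_lt_top).ne
  have hi2 : Integrable (N T) P := by
    have := hi.sub hG
    simpa only [add_sub_cancel_right, Pi.sub_def] using this
  refine ⟨hi2, ?_⟩
  rw [← ofReal_integral_eq_lintegral_ofReal hi hnn,
    ENNReal.ofReal_le_ofReal_iff (integral_nonneg hG0), integral_add hi2 hG] at hT
  linarith

/-- Properties of the discretised integral, stopped when the integrand is large. -/
theorem exists_approx_of_integrable_bound [IsProbabilityMeasure P] (hw : IsBrownianMotion w P)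
    (hN : IsItoIntegralProcess P w T Φ N) {Z : Ω → ℝ} (hZ0 : ∀ ω, 0 ≤ Z ω) (hZ : Integrable Z P)
    (hle : ∀ᵐ ω ∂P, ∀ t ∈ Ico 0 T, ∑ i, Φ i t ω ^ 2 ≤ Z ω ^ 2) {k : ℝ} (hk : 0 < k) {ε : ℝ}
    (hε : 0 < ε) : ∃ Y : Ω → ℝ, MemLp Y 2 P ∧ ∫ ω, Y ω ∂P = 0 ∧
      ∫ ω, Y ω ^ 2 ∂P ≤ k * T * ∫ ω, Z ω ∂P ∧ ∃ A, MeasurableSet A ∧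
        P.real Aᶜ ≤ 2 * ε ∧ ∀ᵐ ω ∂P, ω ∈ A → Z ω ≤ k → |N T ω - Y ω| ≤ 2 * ε := by
  classical
  obtain ⟨s, h0s, -, hsT, htN, -⟩ := hN.exists_tail_le hw hε hN.pos
  obtain ⟨h, hh, K, hK, hclose⟩ := hN.exists_close hw h0s.le hsT hε
  obtain ⟨Gr, hGr⟩ := Grid.exists_meshLe h0s.le hh
  obtain ⟨A, hA, hPA, hgood⟩ := hclose Gr hGr
  set S := (hN.integrand s hsT).sample le_rfl Gr hK with hS
  have hSt : S.t = Gr.t := AdaptedContinuous.sample_t _ le_rfl Gr hK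
  have hSN : S.N = Gr.N := AdaptedContinuous.sample_N _ le_rfl Gr hK
  have hSξ : ∀ j i ω, S.ξ j i ω ^ 2 ≤ Φ i (Gr.t j) ω ^ 2 := fun j i ω =>
    sq_le_sq.2 (abs_clip_le_abs hK _)
  set B : ℕ → Set Ω := fun j => {ω | ∀ l ≤ j, ∑ i, Φ i (Gr.t l) ω ^ 2 ≤ k ^ 2} with hB
  have hBm : ∀ j, MeasurableSet[augFiltration w P (S.t j)] (B j) := by
    intro j
    have : B j = ⋂ l ∈ Finset.range (j + 1), {ω | ∑ i, Φ i (Gr.t l) ω ^ 2 ≤ k ^ 2} := by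
      ext ω
      simp [hB]
    rw [this]
    refine @Finset.measurableSet_biInter _ _ (augFiltration w P (S.t j)) _ _ fun l hl => ?_
    have h1 : StronglyMeasurable[augFiltration w P (S.t j)] fun ω => ∑ i, Φ i (Gr.t l) ω ^ 2 := by
      refine Finset.stronglyMeasurable_fun_sum _ fun i _ => ?_
      refine (((hN.integrand s hsT).adapted _ (Gr.mem l) i).pow 2).mono (augFiltration_mono ?_)
      rw [hSt]
      exact Gr.mono (Nat.lt_succ_iff.1 (Finset.mem_range.1 hl))
    exact h1.measurable (measurableSet_Iic (a := k ^ 2))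
  have hBanti : Antitone B := fun j l hjl ω hω i hi => hω i (hi.trans hjl)
  set S' := S.stopAt B hBm with hS'
  set C : Set Ω := toMeasurable P {ω | ε ≤ |N T ω - N s ω|} with hC
  refine ⟨S'.int, S'.memLp_int hw, S'.integral_int hw, ?_, A ∩ Cᶜ,
    hA.inter (measurableSet_toMeasurable _ _).compl, ?_, ?_⟩
  · rw [S'.integral_int_sq hw, ← integral_const_mul]
    refine integral_mono_ae S'.integrable_quad (hZ.const_mul _) ?_
    filter_upwards [hle] with ω hω
    obtain ⟨τ, h1, h2, -, -, h5⟩ := S.stopAt_int_eq hBm hBanti ω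
    rw [h5]
    calc ∑ j ∈ Finset.range τ, S.qincr j ω
        ≤ ∑ j ∈ Finset.range τ, k * Z ω * (Gr.t (j + 1) - Gr.t j) := by
          refine Finset.sum_le_sum fun j hj => ?_
          have h6 : S.qincr j ω = (∑ i, S.ξ j i ω ^ 2) * (Gr.t (j + 1) - Gr.t j) := by
            rw [Elementary.qincr, ← Finset.sum_mul, hSt]
          have h7 : ∑ i, S.ξ j i ω ^ 2 ≤ ∑ i, Φ i (Gr.t j) ω ^ 2 :=
            Finset.sum_le_sum fun i _ => hSξ j i ω
          have h8 := h2 j (Finset.mem_range.1 hj) j le_rfl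
          have h9 := hω (Gr.t j) ⟨(Gr.mem j).1, (Gr.mem j).2.trans_lt hsT⟩
          rw [h6]
          -- Before stopping, the squared integrand is at most both `k ^ 2` and `Z ^ 2`, hence at
          -- most `k * Z`. The second moment is thus controlled by the first moment of `Z`.
          refine mul_le_mul_of_nonneg_right (h7.trans ?_) (Gr.step_nonneg j)
          rcases le_total k (Z ω) with hkZ | hkZ
          · exact h8.trans (by nlinarith)
          · exact h9.trans (by nlinarith [hZ0 ω])
      _ = k * Z ω * (Gr.t τ - Gr.t 0) := by
          rw [← Finset.mul_sum, Finset.sum_range_sub]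
      _ ≤ k * Z ω * T := by
          have := (Gr.mem τ).2
          rw [Gr.first]
          exact mul_le_mul_of_nonneg_left (by linarith) (mul_nonneg hk.le (hZ0 ω))
      _ = k * T * Z ω := by ring
  · refine ENNReal.toReal_le_of_le_ofReal (by positivity) ?_
    rw [compl_inter, compl_compl]
    refine (measure_union_le _ _).trans ?_
    rw [hC, measure_toMeasurable]
    refine (add_le_add hPA htN).trans (le_of_eq ?_)
    rw [← ENNReal.ofReal_add hε.le hε.le, two_mul]
  · filter_upwards [hle] with ω hω hωA hZk
    obtain ⟨τ, h1, -, h3, h4, -⟩ := S.stopAt_int_eq hBm hBanti ω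
    have h5 : τ = S.N := by
      by_contra hne
      refine h3 (lt_of_le_of_ne h1 hne) fun l _ => ?_
      refine (hω (Gr.t l) ⟨(Gr.mem l).1, (Gr.mem l).2.trans_lt hsT⟩).trans ?_
      exact pow_le_pow_left₀ (hZ0 ω) hZk 2
    have h6 := (hgood ω hωA.1).2 Gr.N le_rfl
    rw [Gr.last _ le_rfl] at h6
    have h7 : |N T ω - N s ω| < ε := by
      by_contra hcon
      exact hωA.2 (subset_toMeasurable _ _ (not_lt.1 hcon))
    rw [hS', h4, h5, hSN]
    have h8 := abs_sub_le (N T ω) (N s ω) (S.partialInt Gr.N ω)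
    rw [abs_sub_comm (N s ω)] at h8
    linarith

/-- A stochastic integral whose integrand is bounded by an integrable random variable has mean
zero. -/
theorem integral_eq_zero [IsProbabilityMeasure P] (hw : IsBrownianMotion w P)
    (hN : IsItoIntegralProcess P w T Φ N) {Z : Ω → ℝ} (hZ0 : ∀ ω, 0 ≤ Z ω) (hZm : Measurable Z)
    (hZ : Integrable Z P)
    (hle : ∀ᵐ ω ∂P, ∀ t ∈ Ico 0 T, ∑ i, Φ i t ω ^ 2 ≤ Z ω ^ 2) (hNT : Integrable (N T) P) :
    ∫ ω, N T ω ∂P = 0 := by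
  have hT := hN.pos
  have hz : 0 ≤ ∫ ω, Z ω ∂P := integral_nonneg hZ0
  -- Absolute continuity of the integral.
  have hsmall : ∀ f : Ω → ℝ, Integrable f P → ∀ η : ℝ, 0 < η → ∃ δ : ℝ, 0 < δ ∧
      ∀ B : Set Ω, P.real B ≤ δ → ∫ ω in B, |f ω| ∂P ≤ η := by
    intro f hf η hη
    have h1 : ∫⁻ ω, ‖f ω‖ₑ ∂P ≠ ∞ := hf.2.ne
    obtain ⟨δ, hδ, hδ'⟩ := exists_pos_setLIntegral_lt_of_measure_lt h1
      (ε := ENNReal.ofReal η) (by simpa using hη)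
    obtain ⟨δ₁, h2, h3⟩ := ENNReal.lt_iff_exists_nnreal_btwn.1 hδ
    refine ⟨δ₁, by simpa using h2, fun B hB => ?_⟩
    have h4 : P B < δ := by
      refine lt_of_le_of_lt ?_ h3
      rw [measureReal_def] at hB
      rw [← ENNReal.ofReal_toReal (measure_ne_top P B), ← ENNReal.ofReal_coe_nnreal]
      exact ENNReal.ofReal_le_ofReal hB
    have h5 := (hδ' B h4).le
    have h6 : ∫⁻ ω in B, ‖f ω‖ₑ ∂P = ENNReal.ofReal (∫ ω in B, |f ω| ∂P) := by
      rw [ofReal_integral_eq_lintegral_ofReal hf.abs.integrableOn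
        (Eventually.of_forall fun ω => abs_nonneg _)]
      exact lintegral_congr fun ω => Real.enorm_eq_ofReal_abs _
    rwa [h6, ENNReal.ofReal_le_ofReal_iff hη.le] at h5
  have hbound : ∀ η : ℝ, 0 < η → |∫ ω, N T ω ∂P| ≤ 6 * η := by
    intro η hη
    set z : ℝ := ∫ ω, Z ω ∂P with hzdef
    -- The isometry gives only `E Y ^ 2 ≤ k * T * z`, which grows with `k`. In `setIntegral_abs_le`
    -- the parameter is `a = b * k`: the second moment then costs `T * z / (4 * b) ≤ η`, and the
    -- level set costs `b * k * P(Z > k)`, which is at most `η` because `k * P(Z > k)` is bounded by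
    -- the integral of `Z` over `Z > k`.
    set b : ℝ := T * z / (4 * η) + 1 with hb
    have hb0 : 0 < b := by positivity
    have hbz : T * z / (4 * b) ≤ η := by
      rw [div_le_iff₀ (by positivity), hb]
      have : η * (4 * (T * z / (4 * η) + 1)) = T * z + 4 * η := by field_simp
      linarith
    obtain ⟨δ, hδ0, hδ⟩ := hsmall _ hNT η hη
    obtain ⟨δ', hδ'0, hδ'⟩ := hsmall _ hZ (η / b) (by positivity)
    set k : ℝ := z / min (δ / 2) δ' + 1 with hk
    have hμ : 0 < min (δ / 2) δ' := by positivity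
    have hk0 : 0 < k := by positivity
    have hPk : P.real {ω | k < Z ω} ≤ min (δ / 2) δ' := by
      have h1 := measure_le_of_integral_le hZ hZ0 hk0 hzdef.ge
      have h2 : P {ω | k < Z ω} ≤ ENNReal.ofReal (min (δ / 2) δ') := by
        refine (measure_mono fun ω (hω : k < Z ω) => hω.le).trans
          (h1.trans (ENNReal.ofReal_le_ofReal ?_))
        rw [div_le_iff₀ hk0, hk]
        have : min (δ / 2) δ' * (z / min (δ / 2) δ' + 1) = z + min (δ / 2) δ' := by field_simp
        linarith
      exact ENNReal.toReal_le_of_le_ofReal hμ.le h2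
    have hmk : MeasurableSet {ω | k < Z ω} := measurableSet_lt measurable_const hZm
    have hkP : k * P.real {ω | k < Z ω} ≤ η / b := by
      refine le_trans ?_ (hδ' _ (hPk.trans (min_le_right _ _)))
      have : ∫ _ in {ω | k < Z ω}, k ∂P ≤ ∫ ω in {ω | k < Z ω}, |Z ω| ∂P := by
        refine setIntegral_mono_on (integrable_const k).integrableOn hZ.abs.integrableOn hmk
          fun ω hω => (le_of_lt hω).trans (le_abs_self _)
      rw [setIntegral_const, smul_eq_mul, mul_comm] at this
      exact this
    obtain ⟨ε, hε0, -, hε⟩ := exists_small (τ := min η (δ / 2)) (by positivity)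
      (c := 2 * (b * k) + 2) (by positivity)
    have hbk : 0 < b * k := by positivity
    have hε1 : 2 * ε ≤ δ / 2 := by
      have := hε.trans (min_le_right _ _)
      nlinarith [mul_pos hε0 hbk]
    have hε2 : 2 * ε ≤ η := by
      have := hε.trans (min_le_left _ _)
      nlinarith [mul_pos hε0 hbk]
    have hε3 : b * k * (2 * ε) ≤ η := by
      have := hε.trans (min_le_left _ _)
      nlinarith [mul_pos hε0 hbk]
    obtain ⟨Y, hYL, hY0, hY2, A, hA, hPA, hYA⟩ :=
      hN.exists_approx_of_integrable_bound hw hZ0 hZ hle hk0 hε0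
    have hYi := hYL.integrable one_le_two
    set B : Set Ω := Aᶜ ∪ {ω | k < Z ω} with hB
    have hBm : MeasurableSet B := hA.compl.union hmk
    have hPB : P.real B ≤ 2 * ε + P.real {ω | k < Z ω} :=
      (measureReal_union_le _ _).trans (by gcongr)
    have hd : Integrable (fun ω => N T ω - Y ω) P := hNT.sub hYi
    have h1 : |∫ ω, N T ω ∂P| ≤ ∫ ω, |N T ω - Y ω| ∂P := by
      have : ∫ ω, N T ω ∂P = ∫ ω, (N T ω - Y ω) ∂P := by
        rw [integral_sub hNT hYi, hY0, sub_zero]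
      rw [this]
      exact abs_integral_le_integral_abs
    have h2 : ∫ ω in Bᶜ, |N T ω - Y ω| ∂P ≤ 2 * ε := by
      have h3 : ∫ ω in Bᶜ, |N T ω - Y ω| ∂P ≤ ∫ _ in Bᶜ, 2 * ε ∂P := by
        refine setIntegral_mono_on_ae hd.abs.integrableOn (integrable_const _).integrableOn
          hBm.compl ?_
        filter_upwards [hYA] with ω hω hωB
        obtain ⟨h4, h5⟩ := not_or.1 hωB
        exact hω (not_not.1 h4) (not_lt.1 h5)
      refine h3.trans ?_
      rw [setIntegral_const, smul_eq_mul]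
      exact mul_le_of_le_one_left (by positivity) measureReal_le_one
    have h3 : ∫ ω in B, |N T ω - Y ω| ∂P ≤ ∫ ω in B, |N T ω| ∂P + ∫ ω in B, |Y ω| ∂P := by
      rw [← integral_add hNT.abs.integrableOn hYi.abs.integrableOn]
      exact integral_mono hd.abs.integrableOn (hNT.abs.add hYi.abs).integrableOn
        fun ω => abs_sub _ _
    have h4 : ∫ ω in B, |N T ω| ∂P ≤ η :=
      hδ B (hPB.trans (by linarith [hPk.trans (min_le_left _ _)]))
    have h5 := setIntegral_abs_le hYL B (a := b * k) hbk hY2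
    have h6 : k * T * z / (4 * (b * k)) = T * z / (4 * b) := by field_simp
    have h7 : b * k * P.real B ≤ b * k * (2 * ε) + b * (k * P.real {ω | k < Z ω}) := by
      have := mul_le_mul_of_nonneg_left hPB hbk.le
      linarith
    have h8 : b * (k * P.real {ω | k < Z ω}) ≤ η := by
      have := mul_le_mul_of_nonneg_left hkP hb0.le
      rwa [mul_div_cancel₀ _ hb0.ne'] at this
    rw [h6] at h5
    have h9 := integral_add_compl hBm hd.abs
    linarith
  by_contra hne
  have h1 : 0 < |∫ ω, N T ω ∂P| := abs_pos.2 hne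
  have h2 := hbound (|∫ ω, N T ω ∂P| / 12) (by positivity)
  linarith

end IsItoIntegralProcess

end Expectation

/-! ### Moment bounds along admissible strategies -/

theorem JointlyMeasurableOn.measurable_lintegral {Ω : Type*} [mΩ : MeasurableSpace Ω] {a t : ℝ}
    (hat : a ≤ t) {f : ℝ → Ω → ℝ≥0∞} (hf : JointlyMeasurableOn mΩ a t f) :
    Measurable fun ω => ∫⁻ r in Icc a t, f r ω := by
  have h1 := (((hf.measurable_projIcc hat)).comp measurable_swap).lintegral_prod_right'
    (ν := volume.restrict (Icc a t))
  convert h1 using 2 with ω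
  refine setLIntegral_congr_fun measurableSet_Icc fun r hr => ?_
  simp only [Function.comp, Prod.swap]
  rw [projIcc_of_mem hat hr]

theorem JointlyMeasurableOn.aestronglyMeasurable_path {Ω : Type*} [mΩ : MeasurableSpace Ω] {a t : ℝ}
    (hat : a ≤ t) {f : ℝ → Ω → ℝ} (hf : JointlyMeasurableOn mΩ a t f) (ω : Ω) :
    AEStronglyMeasurable (fun r => f r ω) (volume.restrict (Icc a t)) := by
  have h : Measurable fun r => f (projIcc a t hat r) ω :=
    (hf.measurable_projIcc hat).comp (measurable_id.prodMk measurable_const)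
  refine h.aestronglyMeasurable.congr ?_
  filter_upwards [ae_restrict_mem measurableSet_Icc] with r hr
  rw [projIcc_of_mem hat hr]

namespace ControlProblem

variable {n m d : ℕ} {D : ControlProblem n m d}
variable {Ω : Type*} [mΩ : MeasurableSpace Ω] {P : Measure Ω} {w : Fin m → ℝ≥0 → Ω → ℝ}

/-- The supremum over all times need not be measurable; it is replaced by a supremum over a
countable dense set, which dominates the whole path by continuity. -/
theorem Admissible.exists_state_bound {p : ℝ} (hT : 0 ≤ D.T) {x : E n}
    {u : ℝ → Ω → E d} {X : ℝ → Ω → E n} (h : D.Admissible P w p 0 x u X) :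
    ∃ M : Ω → ℝ, (∀ ω, 0 ≤ M ω) ∧ Measurable M ∧ Integrable M P ∧
      ∀ᵐ ω ∂P, ∀ t ∈ Icc 0 D.T, ‖X t ω‖ ^ p ≤ M ω := by
  obtain ⟨Q, hQc, hQ⟩ := TopologicalSpace.exists_countable_dense (Icc 0 D.T)
  set S : Ω → ℝ≥0∞ := fun ω => ⨆ q ∈ Q, ‖X q ω‖ₑ ^ p with hS
  have hSm : Measurable S := Measurable.biSup Q hQc fun q _ =>
    (((h.measurable_X hT).section q.2).enorm).pow_const p
  have hSle : ∫⁻ ω, S ω ∂P < ∞ := by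
    refine lt_of_le_of_lt (lintegral_mono fun ω => ?_) h.moment_X
    exact iSup₂_le fun q _ => le_iSup₂ (f := fun t (_ : t ∈ Icc 0 D.T) => ‖X t ω‖ₑ ^ p) q.1 q.2
  refine ⟨fun ω => (S ω).toReal, fun ω => ENNReal.toReal_nonneg, hSm.ennreal_toReal,
    integrable_toReal_of_lintegral_ne_top hSm.aemeasurable hSle.ne, ?_⟩
  filter_upwards [h.state.continuous, ae_lt_top' hSm.aemeasurable hSle.ne] with ω hc hlt t ht
  have hcont : Continuous fun q : Icc 0 D.T => ‖X q ω‖ₑ ^ p :=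
    ENNReal.continuous_rpow_const.comp (continuousOn_iff_continuous_domRestrict.1 hc).enorm
  have hcl : IsClosed {q : Icc 0 D.T | ‖X q ω‖ₑ ^ p ≤ S ω} := isClosed_le hcont continuous_const
  have hsub : Q ⊆ {q : Icc 0 D.T | ‖X q ω‖ₑ ^ p ≤ S ω} := fun q hq =>
    le_iSup₂ (f := fun (q : Icc 0 D.T) (_ : q ∈ Q) => ‖X q ω‖ₑ ^ p) q hq
  have h1 : ‖X t ω‖ₑ ^ p ≤ S ω := by
    have := hcl.closure_subset_iff.2 hsub (hQ.closure_eq ▸ mem_univ (⟨t, ht⟩ : Icc 0 D.T))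
    exact this
  have h2 := ENNReal.toReal_mono hlt.ne h1
  rwa [← ENNReal.toReal_rpow, toReal_enorm] at h2

/-- The growth of `g` reduces this to the moments of the state and of the control that are part of
admissibility. -/
theorem Admissible.exists_running_reward_bound [IsProbabilityMeasure P] {p : ℝ} (hp : 0 ≤ p)
    (hD : D.StandingAssumptions p) {x : E n} {u : ℝ → Ω → E d} {X : ℝ → Ω → E n}
    (h : D.Admissible P w p 0 x u X) : ∃ Q : Ω → ℝ, (∀ ω, 0 ≤ Q ω) ∧ Integrable Q P ∧
      ∀ᵐ ω ∂P, IntegrableOn (fun t => D.g t (X t ω) (u t ω)) (Icc 0 D.T) ∧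
        ∫ t in Icc 0 D.T, |D.g t (X t ω) (u t ω)| ≤ Q ω := by
  have hT := hD.T_pos.le
  have hX := h.measurable_X hT
  have hu := h.measurable_u hT
  obtain ⟨C, hC⟩ := hD.growth_g
  have hg : JointlyMeasurableOn mΩ 0 D.T fun t ω => D.g t (X t ω) (u t ω) := by
    have h1 : Measurable fun q : Icc 0 D.T × Ω => (q.1, X q.1 q.2,
        (⟨u q.1 q.2, h.mem _ q.1.2 _⟩ : D.U)) :=
      measurable_fst.prodMk (Measurable.prodMk hX (Measurable.subtype_mk hu))
    exact hD.measurable_g.comp h1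
  have hge : JointlyMeasurableOn mΩ 0 D.T fun t ω => ‖D.g t (X t ω) (u t ω)‖ₑ := Measurable.enorm hg
  have hXe : JointlyMeasurableOn mΩ 0 D.T fun t ω => ‖X t ω‖ₑ ^ p :=
    Measurable.pow_const (Measurable.enorm hX) p
  have hue : JointlyMeasurableOn mΩ 0 D.T fun t ω => ‖u t ω‖ₑ ^ p :=
    Measurable.pow_const (Measurable.enorm hu) p
  have hXue : JointlyMeasurableOn mΩ 0 D.T fun t ω => ‖X t ω‖ₑ ^ p + ‖u t ω‖ₑ ^ p :=
    Measurable.add hXe hue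
  set c : ℝ≥0∞ := ENNReal.ofReal |C| with hc
  have hle : ∀ ω, ∀ t ∈ Icc 0 D.T, ‖D.g t (X t ω) (u t ω)‖ₑ ≤
      c * (1 + (‖X t ω‖ₑ ^ p + ‖u t ω‖ₑ ^ p)) := by
    intro ω t ht
    have h1 := hC t ht (X t ω) (u t ω) (h.mem t ht ω)
    have h2 : |D.g t (X t ω) (u t ω)| ≤ |C| * (1 + (‖X t ω‖ ^ p + ‖u t ω‖ ^ p)) := by
      rw [← add_assoc]
      refine h1.trans (mul_le_mul_of_nonneg_right (le_abs_self C) (by positivity))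
    rw [Real.enorm_eq_ofReal_abs]
    refine (ENNReal.ofReal_le_ofReal h2).trans (le_of_eq ?_)
    rw [ENNReal.ofReal_mul (abs_nonneg _), ENNReal.ofReal_add (by norm_num) (by positivity),
      ENNReal.ofReal_add (by positivity) (by positivity), ENNReal.ofReal_one,
      ← ENNReal.ofReal_rpow_of_nonneg (norm_nonneg _) hp, ofReal_norm,
      ← ENNReal.ofReal_rpow_of_nonneg (norm_nonneg _) hp, ofReal_norm]
  have hI : ∀ ω, ∫⁻ t in Icc 0 D.T, ‖D.g t (X t ω) (u t ω)‖ₑ ≤ c * (ENNReal.ofReal D.T +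
      (ENNReal.ofReal D.T * (⨆ t ∈ Icc 0 D.T, ‖X t ω‖ₑ ^ p) +
        ∫⁻ t in Icc 0 D.T, ‖u t ω‖ₑ ^ p)) := by
    intro ω
    have hvol : ∀ a : ℝ≥0∞, ∫⁻ _ in Icc 0 D.T, a = ENNReal.ofReal D.T * a := by
      intro a
      rw [lintegral_const, Measure.restrict_apply_univ, Real.volume_Icc, sub_zero, mul_comm]
    have e : ∫⁻ t in Icc 0 D.T, ‖D.g t (X t ω) (u t ω)‖ₑ ≤ ∫⁻ t in Icc 0 D.T,
        c * (1 + ((⨆ t ∈ Icc 0 D.T, ‖X t ω‖ₑ ^ p) + ‖u t ω‖ₑ ^ p)) := by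
      refine setLIntegral_mono' measurableSet_Icc fun t ht => (hle ω t ht).trans ?_
      gcongr
      exact le_iSup₂ (f := fun t (_ : t ∈ Icc 0 D.T) => ‖X t ω‖ₑ ^ p) t ht
    rw [lintegral_const_mul' _ _ ENNReal.ofReal_ne_top, lintegral_add_left measurable_const,
      lintegral_add_left measurable_const, hvol, hvol, mul_one] at e
    exact e
  have hfin : ∫⁻ ω, (∫⁻ t in Icc 0 D.T, ‖D.g t (X t ω) (u t ω)‖ₑ) ∂P < ∞ := by
    refine lt_of_le_of_lt (lintegral_mono hI) ?_
    rw [lintegral_const_mul' _ _ ENNReal.ofReal_ne_top, lintegral_add_left measurable_const,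
      lintegral_add_right _ (hue.measurable_lintegral hT),
      lintegral_const_mul' _ _ ENNReal.ofReal_ne_top, lintegral_const, measure_univ, mul_one]
    exact ENNReal.mul_lt_top ENNReal.ofReal_lt_top (ENNReal.add_lt_top.2 ⟨ENNReal.ofReal_lt_top,
      ENNReal.add_lt_top.2 ⟨ENNReal.mul_lt_top ENNReal.ofReal_lt_top h.moment_X, h.moment_u⟩⟩)
  have hm := (hge.measurable_lintegral hT).aemeasurable (μ := P)
  refine ⟨fun ω => (∫⁻ t in Icc 0 D.T, ‖D.g t (X t ω) (u t ω)‖ₑ).toReal,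
    fun ω => ENNReal.toReal_nonneg, integrable_toReal_of_lintegral_ne_top hm hfin.ne, ?_⟩
  filter_upwards [ae_lt_top' hm hfin.ne] with ω hω
  refine ⟨⟨hg.aestronglyMeasurable_path hT ω, hω⟩, le_of_eq ?_⟩
  exact integral_norm_eq_lintegral_enorm (hg.aestronglyMeasurable_path hT ω)

end ControlProblem

/-! ### The penalty as a stochastic integral, and the HJB inequality -/

namespace ControlProblem

variable {n m d : ℕ} {D : ControlProblem n m d}
variable {Ω : Type*} [mΩ : MeasurableSpace Ω] {P : Measure Ω} {w : Fin m → ℝ≥0 → Ω → ℝ}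

theorem IsC12.c12On {V : ℝ → E n → ℝ} (hV : D.IsC12 V) {s t : ℝ} (hs : 0 ≤ s) (ht : t < D.T) :
    C12On s t V (D.dt V) (grad V) (hess V) := by
  have hsub : Icc s t ⊆ Ico 0 D.T := fun r hr => ⟨hs.trans hr.1, hr.2.trans_lt ht⟩
  have hsub' : Icc s t ×ˢ (univ : Set (E n)) ⊆ Ico 0 D.T ×ˢ univ := prod_mono_left hsub
  exact ⟨fun r hr x => (hV.diff_t r (hsub hr) x).hasDerivWithinAt.mono
      (hsub.trans Ico_subset_Icc_self),
    fun r hr x => (hV.diff_x r (hsub hr) x).hasGradientAt,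
    fun r hr x => (hV.diff_xx r (hsub hr) x).hasFDerivAt,
    hV.cont_t.mono hsub', hV.cont_x.mono hsub', hV.cont_xx.mono hsub'⟩

/-- Passing from `b` to `bbar` removes half of `⟨V_x, σσx⟩`, and the generator contains half of the
trace term; these two halves form half of the correction. -/
theorem A_eq (V : ℝ → E n → ℝ) (u : ℝ → Ω → E d) (X : ℝ → Ω → E n) (s : ℝ) (ω : Ω) :
    D.A V s (X s ω) (u s ω) = (D.dt V s (X s ω) +
      inner ℝ (grad V s (X s ω)) (D.bbar s (X s ω) (u s ω))) + 1 / 2 * D.correction V X s ω := by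
  rw [A, correction, bbar, inner_sub_right, inner_smul_right]
  ring

variable (D) in
/-- The process `V(t, X_t) - V(0, X_0) - ∫₀ᵗ A^u V(s, X_s) ds`. -/
noncomputable def valueIntegral (V : ℝ → E n → ℝ) (u : ℝ → Ω → E d) (X : ℝ → Ω → E n) (t : ℝ)
    (ω : Ω) : ℝ :=
  V t (X t ω) - V 0 (X 0 ω) - ∫ s in (0 : ℝ)..t, D.A V s (X s ω) (u s ω)

theorem StratonovichItoFormula.integrable_A {V : ℝ → E n → ℝ} {u : ℝ → Ω → E d}
    {X : ℝ → Ω → E n} (hf : D.StratonovichItoFormula P w V u X)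
    (hc : ∀ᵐ ω ∂P, IntegrableOn (fun t => D.correction V X t ω) (Icc 0 D.T)) :
    ∀ᵐ ω ∂P, IntegrableOn (fun s => D.A V s (X s ω) (u s ω)) (Icc 0 D.T) := by
  filter_upwards [hf.integrable, hc] with ω h1 h2
  simp only [A_eq]
  exact h1.add (h2.const_mul _)

/-- The penalty is the terminal value of `valueIntegral`. -/
theorem StratonovichItoFormula.valuePenalty_ae_eq (hT : 0 ≤ D.T) {V : ℝ → E n → ℝ}
    {u : ℝ → Ω → E d} {X : ℝ → Ω → E n} (hf : D.StratonovichItoFormula P w V u X)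
    (hc : ∀ᵐ ω ∂P, IntegrableOn (fun t => D.correction V X t ω) (Icc 0 D.T)) :
    D.valuePenalty P w V u X =ᵐ[P] D.valueIntegral V u X D.T := by
  filter_upwards [hf.integrable, hc, hf.formula D.T (right_mem_Icc.2 hT)] with ω h1 h2 h3
  have i1 := (intervalIntegrable_iff_integrableOn_Icc_of_le hT).2 h1
  have i2 := (intervalIntegrable_iff_integrableOn_Icc_of_le hT).2 h2
  rw [valuePenalty, valueIntegral, h3]
  simp only [A_eq]
  rw [intervalIntegral.integral_add i1 (i2.const_mul _), intervalIntegral.integral_const_mul]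
  ring

/-- For an admissible strategy, `valueIntegral` is the stochastic integral of `V_xᵀ σ`. -/
theorem Admissible.isItoIntegralProcess_valueIntegral [IsProbabilityMeasure P]
    (hw : IsBrownianMotion w P)
    {p : ℝ} (hD : D.StandingAssumptions p) {V : ℝ → E n → ℝ} (hV : D.IsC12 V) (hVp : D.IsCp p V)
    {x : E n} {u : ℝ → Ω → E d} {X : ℝ → Ω → E n} (h : D.Admissible P w p 0 x u X)
    (hA : ∀ᵐ ω ∂P, IntegrableOn (fun s => D.A V s (X s ω) (u s ω)) (Icc 0 D.T)) :
    IsItoIntegralProcess P w D.T (D.integrand V X) (D.valueIntegral V u X) := by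
  have hT := hD.T_pos.le
  have hX := h.isItoProcess_state hD
  have hcont : ∀ i, ∀ s < D.T, ContinuousOn
      (fun q : ℝ × E n => (inner ℝ (grad V q.1 q.2) (D.σ i q.1 q.2) : ℝ)) (Icc 0 s ×ˢ univ) :=
    fun i s hs => ContinuousOn.inner (hV.c12On le_rfl hs).cont_x
      ((hD.continuous_σ i).mono (prod_mono_left (Icc_subset_Icc le_rfl hs.le)))
  refine ⟨hD.T_pos, fun s hs => ?_, fun s hs i => ?_, fun t ht => ?_, ?_, fun ω => ?_,
    fun s t hs hst ht => ?_⟩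
  · exact hX.adaptedContinuous le_rfl hs.le
      (f := fun i r x => inner ℝ (grad V r x) (D.σ i r x)) fun i => hcont i s hs
  · have hXs : JointlyMeasurableOn mΩ 0 s X := (h.measurable_X hT).mono_right hs.le
    exact jointlyMeasurableOn_comp (f := fun r x => inner ℝ (grad V r x) (D.σ i r x))
      (hcont i s hs) hXs
  · have hXt := h.state.progressive t ⟨ht.1, ht.2.le⟩
    have hut := h.progressive t ⟨ht.1, ht.2.le⟩
    have hC := hV.c12On le_rfl ht.2
    have h1 : ∀ r ∈ Icc 0 t, Measurable[augFiltration w P t] fun ω => V r (X r ω) := fun r hr =>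
      (hV.diff_x r ⟨hr.1, hr.2.trans_lt ht.2⟩).continuous.measurable.comp
        (@JointlyMeasurableOn.section Ω (augFiltration w P t) _ _ _ _ _ _ hXt hr)
    have hσ : ∀ i, ContinuousOn (fun q : ℝ × E n => D.σ i q.1 q.2) (Icc 0 t ×ˢ univ) := fun i =>
      (hD.continuous_σ i).mono (prod_mono_left (Icc_subset_Icc le_rfl ht.2.le))
    have htr : ContinuousOn (fun q : ℝ × E n => D.traceTerm V q.1 q.2) (Icc 0 t ×ˢ univ) :=
      continuousOn_finsetSum _ fun i _ => ContinuousOn.inner (hσ i) (hC.cont_xx.clm_apply (hσ i))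
    have m1 := @jointlyMeasurableOn_comp n Ω (augFiltration w P t) ℝ _ _ _ _ _ _ hC.cont_t _ hXt
    have m2 := @jointlyMeasurableOn_comp n Ω (augFiltration w P t) (E n) _ _ _ _ _ _ hC.cont_x _ hXt
    have m3 := @jointlyMeasurableOn_comp n Ω (augFiltration w P t) ℝ _ _ _ _ _ _ htr _ hXt
    have m4 := @jointlyMeasurableOn_b n m d D Ω (augFiltration w P t) p hD t ht.2.le u X hut h.mem
      hXt
    have m5 : JointlyMeasurableOn (augFiltration w P t) 0 t
        fun s ω => D.A V s (X s ω) (u s ω) :=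
      Measurable.add (Measurable.add m1 (Measurable.inner m2 m4)) (Measurable.const_mul m3 _)
    have m6 := @JointlyMeasurableOn.measurable_integral Ω (augFiltration w P t) ℝ _ _ _ _ _ 0 t t
      (right_mem_Icc.2 ht.1) _ m5
    exact (((h1 t (right_mem_Icc.2 ht.1)).sub (h1 0 (left_mem_Icc.2 ht.1))).sub
      m6).stronglyMeasurable
  -- Continuity up to `T` uses only continuity of `V` and integrability of the generator along the
  -- path, not the derivatives of `V` at `T`.
  · filter_upwards [h.state.continuous, hA] with ω h1 h2
    have h3 := intervalIntegral.continuousOn_primitive_interval (a := 0) (b := D.T) (μ := volume)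
      (f := fun s => D.A V s (X s ω) (u s ω)) (by rwa [uIcc_of_le hT])
    rw [uIcc_of_le hT] at h3
    exact ((IsItoProcess.continuousOn_comp hVp.cont h1).sub continuousOn_const).sub h3
  · simp [valueIntegral]
  · have h1 := hX.ito_formula hw hs hst ht.le (hV.c12On hs ht)
    refine h1.congr_right ?_
    filter_upwards [hA] with ω hω
    have hi : IntervalIntegrable (fun s => D.A V s (X s ω) (u s ω)) volume 0 D.T :=
      (intervalIntegrable_iff_integrableOn_Icc_of_le hT).2 hω
    have i1 := hi.mono_set (c := 0) (d := s) (by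
      rw [uIcc_of_le hs, uIcc_of_le hT]; exact Icc_subset_Icc le_rfl (hst.trans ht.le))
    have i2 := hi.mono_set (c := s) (d := t) (by
      rw [uIcc_of_le hst, uIcc_of_le hT]; exact Icc_subset_Icc hs ht.le)
    have h2 := intervalIntegral.integral_add_adjacent_intervals i1 i2
    simp only [valueIntegral, ← h2]
    simp only [A, traceTerm]
    ring

variable {p : ℝ} {V : ℝ → E n → ℝ} {ustar : ℝ → E n → E d}

theorem VerificationAssumptions.g_add_A_nonpos (hver : D.VerificationAssumptions P w p V ustar)
    {t : ℝ} (ht : t ∈ Ico 0 D.T) (x : E n) {u : E d} (hu : u ∈ D.U) :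
    D.g t x u + D.A V t x u ≤ 0 := by
  have h1 := (hver.isGreatest t ht x).2 ⟨u, hu, rfl⟩
  rwa [hver.hjb t ht x] at h1

/-- The HJB inequality along a path. -/
theorem VerificationAssumptions.integral_le (hver : D.VerificationAssumptions P w p V ustar)
    {u : ℝ → Ω → E d} {X : ℝ → Ω → E n} (hmem : ∀ t ∈ Icc 0 D.T, ∀ ω, u t ω ∈ D.U) {ω : Ω}
    (hg : IntegrableOn (fun t => D.g t (X t ω) (u t ω)) (Icc 0 D.T))
    (hA : IntegrableOn (fun s => D.A V s (X s ω) (u s ω)) (Icc 0 D.T)) {t : ℝ}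
    (ht : t ∈ Icc 0 D.T) :
    (∫ s in (0 : ℝ)..t, D.g s (X s ω) (u s ω)) + ∫ s in (0 : ℝ)..t,
        D.A V s (X s ω) (u s ω) ≤ 0 := by
  have hsub : Icc 0 t ⊆ Icc 0 D.T := Icc_subset_Icc le_rfl ht.2
  have i1 := (intervalIntegrable_iff_integrableOn_Icc_of_le ht.1).2 (hg.mono_set hsub)
  have i2 := (intervalIntegrable_iff_integrableOn_Icc_of_le ht.1).2 (hA.mono_set hsub)
  -- The end points are dropped because the HJB equation is assumed only before `T`.
  rw [← intervalIntegral.integral_add i1 i2, intervalIntegral.integral_of_le ht.1,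
    integral_Ioc_eq_integral_Ioo]
  refine setIntegral_nonpos measurableSet_Ioo fun s hs => ?_
  exact hver.g_add_A_nonpos ⟨hs.1.le, hs.2.trans_le ht.2⟩ _
    (hmem s ⟨hs.1.le, hs.2.le.trans ht.2⟩ ω)

/-- The value process of an admissible strategy is bounded below by an integrable random
variable. -/
theorem Admissible.exists_lower_bound [IsProbabilityMeasure P] (hw : IsBrownianMotion w P)
    (hp : 0 ≤ p) (hD : D.StandingAssumptions p) (hver : D.VerificationAssumptions P w p V ustar)
    {x : E n} {u : ℝ → Ω → E d} {X : ℝ → Ω → E n} (h : D.Admissible P w p 0 x u X)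
    (hA : ∀ᵐ ω ∂P, IntegrableOn (fun s => D.A V s (X s ω) (u s ω)) (Icc 0 D.T)) :
    ∃ G : Ω → ℝ, (∀ ω, 0 ≤ G ω) ∧ Integrable G P ∧
      ∀ t ∈ Icc 0 D.T, ∀ᵐ ω ∂P, -G ω ≤ D.valueIntegral V u X t ω := by
  have hT := hD.T_pos.le
  obtain ⟨M, hM0, -, hMi, hM⟩ := h.exists_state_bound hT
  obtain ⟨Q, hQ0, hQi, hQ⟩ := h.exists_running_reward_bound hp hD
  obtain ⟨C, hC⟩ := hver.isCp.growth
  refine ⟨fun ω => |C| * (1 + M ω) + |V 0 x| + Q ω, fun ω => ?_, ?_, fun t ht => ?_⟩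
  · have := hM0 ω
    have := hQ0 ω
    positivity
  · exact ((((integrable_const 1).add hMi).const_mul _).add (integrable_const _)).add hQi
  · filter_upwards [hM, hQ, hA, h.initial hw hT] with ω h1 h2 h3 h4
    -- The HJB inequality trades `-∫ A^u V`, over which there is no moment control, for `∫ g`, which
    -- is dominated by `Q`.
    have h5 := hver.integral_le h.mem h2.1 h3 ht
    have h6 : |V t (X t ω)| ≤ |C| * (1 + M ω) := by
      refine (hC t ht _).trans ?_
      have h7 := h1 t ht
      have h8 : 0 ≤ ‖X t ω‖ ^ p := by positivity
      exact (mul_le_mul_of_nonneg_right (le_abs_self C) (by positivity)).trans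
        (mul_le_mul_of_nonneg_left (by linarith) (abs_nonneg C))
    have h9 : |∫ s in (0 : ℝ)..t, D.g s (X s ω) (u s ω)| ≤ Q ω := by
      refine le_trans ?_ h2.2
      rw [intervalIntegral.integral_of_le ht.1]
      refine abs_integral_le_integral_abs.trans ?_
      refine setIntegral_mono_set h2.1.abs (Eventually.of_forall fun s => abs_nonneg _)
        (Eventually.of_forall ?_)
      exact Ioc_subset_Icc_self.trans (Icc_subset_Icc le_rfl ht.2)
    have h10 := neg_abs_le (V t (X t ω))
    have h11 := neg_abs_le (∫ s in (0 : ℝ)..t, D.g s (X s ω) (u s ω))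
    have h12 := le_abs_self (V 0 x)
    rw [valueIntegral, h4]
    linarith

/-- The initial state of an anticipating control. -/
theorem IsAnticipatingPair.initial (hT : 0 ≤ D.T) {x : E n}
    {u : ℝ → Ω → E d} {X : ℝ → Ω → E n} (h : D.IsAnticipatingPair P w x u X) :
    ∀ᵐ ω ∂P, X 0 ω = x := by
  have h0 : (0 : ℝ) ∈ Icc 0 D.T := left_mem_Icc.2 hT
  have key : ∀ i, stratonovichIntegral P (w i) (fun s ω => D.σ i s (X s ω)) 0 0 =ᵐ[P]
      fun _ => 0 := by
    intro i
    obtain ⟨Y, hY⟩ := h.stratonovich 0 h0 i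
    refine stratonovichIntegral_ae_eq le_rfl ⟨hY.measurable, hY.integrable, fun ε hε => ?_⟩
    refine tendsto_const_nhds.congr fun I => ?_
    -- Nodes increasing strictly from `0` to `0` leave only the trivial partition, so all
    -- Stratonovich sums are empty and zero is the limit.
    have hN : I.N = 0 := by
      by_contra hne
      have h1 := I.strictMono (show (0 : Fin (I.N + 1)) < Fin.last I.N from
        Fin.pos_iff_ne_zero.2 fun h => hne (by simpa [Fin.ext_iff] using h))
      rw [I.first, I.last] at h1
      exact lt_irrefl _ h1
    have hs : ∀ ω, stratonovichSum (w i) (fun s ω => D.σ i s (X s ω)) I ω = 0 := by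
      intro ω
      have : IsEmpty (Fin I.N) := hN ▸ Fin.isEmpty
      exact Finset.sum_of_isEmpty _
    simp [hs, hε.ne']
  filter_upwards [h.equation 0 h0, ae_all_iff.2 key] with ω h1 h2
  rw [h1]
  simp [h2]

/-- The objective of the inner problem along a state process. -/
theorem IsAnticipatingPair.innerObjective_ae_eq (hT : 0 ≤ D.T)
    (hver : D.VerificationAssumptions P w p V ustar) {x : E n}
    {u : ℝ → Ω → E d} {X : ℝ → Ω → E n} (h : D.IsAnticipatingPair P w x u X)
    (hf : D.StratonovichItoFormula P w V u X)
    (hc : ∀ᵐ ω ∂P, IntegrableOn (fun t => D.correction V X t ω) (Icc 0 D.T)) :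
    ∀ᵐ ω ∂P, IntegrableOn (fun t => D.g t (X t ω) (u t ω)) (Icc 0 D.T) →
      D.innerObjective (D.valuePenalty P w V) u X ω = ((V 0 x +
        ((∫ t in (0 : ℝ)..D.T, D.g t (X t ω) (u t ω)) +
          ∫ t in (0 : ℝ)..D.T, D.A V t (X t ω) (u t ω)) : ℝ) : EReal) := by
  filter_upwards [hf.valuePenalty_ae_eq hT hc, h.initial hT] with ω h1 h2 hg
  rw [innerObjective, if_pos hg, h1, valueIntegral, h2, hver.terminal]
  congr 1
  ring

end ControlProblem

end ControlledDiffusion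

/-! ### The duality theorem -/

theorem theorem5 {Ω : Type*} [MeasurableSpace Ω] (P : Measure Ω) [IsProbabilityMeasure P]
    {n m d : ℕ} (w : Fin m → ℝ≥0 → Ω → ℝ) (hw : IsBrownianMotion w P)
    (D : ControlProblem n m d) (p : ℝ) (hp : 2 ≤ p) (hD : D.StandingAssumptions p)
    (V : ℝ → E n → ℝ) (ustar : ℝ → E n → E d)
    (hV : D.IsValueFunction P w p V)
    (hver : D.VerificationAssumptions P w p V ustar)
    (hito : ∀ x u X, D.IsAnticipatingPair P w x u X → D.StratonovichItoFormula P w V u X)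
    (hcorr : ∀ x u X, D.IsAnticipatingPair P w x u X →
      ∀ᵐ ω ∂P, IntegrableOn (fun t => D.correction V X t ω) (Icc 0 D.T)) :
    -- (1) reduction to the Itô integral, dual feasibility, zero mean
    ((∀ x u X, D.Admissible P w p 0 x u X →
        IsItoIntegral P w (D.integrand V X) 0 D.T (D.valuePenalty P w V u X)) ∧
      D.DualFeasible P w p (D.valuePenalty P w V) ∧
      ((∃ C : ℝ, ∀ t ∈ Ico 0 D.T, ∀ x,
          √(∑ i, (inner ℝ (ControlProblem.grad V t x) (D.σ i t x)) ^ 2) ≤ C * (1 + ‖x‖ ^ p)) →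
        ∀ x u X, D.Admissible P w p 0 x u X → ∫ ω, D.valuePenalty P w V u X ω ∂P = 0)) ∧
    -- (2) strong duality, in expectation and almost surely, attained at the feedback `ustar`
    (∀ x, ∃ Z : Ω → ℝ,
      IsEssSup P (D.innerObjectives P w (D.valuePenalty P w V) x) (fun ω => (Z ω : EReal)) ∧
      Integrable Z P ∧ V 0 x = ∫ ω, Z ω ∂P ∧
      (∀ᵐ ω ∂P, Z ω = V 0 x) ∧
      ∀ X, D.Admissible P w p 0 x (ControlProblem.feedback ustar X) X →
        D.IsAnticipatingPair P w x (ControlProblem.feedback ustar X) X ∧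
        ∀ᵐ ω ∂P, D.innerObjective (D.valuePenalty P w V) (ControlProblem.feedback ustar X) X ω
          = (V 0 x : EReal)) := by
  have hT := hD.T_pos.le
  have hp0 : 0 ≤ p := by linarith
  have hA : ∀ x u X, D.Admissible P w p 0 x u X →
      ∀ᵐ ω ∂P, IntegrableOn (fun s => D.A V s (X s ω) (u s ω)) (Icc 0 D.T) := fun x u X h =>
    have hpair := h.isAnticipatingPair hw hD
    (hito x u X hpair).integrable_A (hcorr x u X hpair)
  have hproc : ∀ x u X, D.Admissible P w p 0 x u X →
      IsItoIntegralProcess P w D.T (D.integrand V X) (D.valueIntegral V u X) := fun x u X h =>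
    h.isItoIntegralProcess_valueIntegral hw hD hver.isC12 hver.isCp (hA x u X h)
  have heq : ∀ x u X, D.Admissible P w p 0 x u X →
      D.valuePenalty P w V u X =ᵐ[P] D.valueIntegral V u X D.T := fun x u X h =>
    have hpair := h.isAnticipatingPair hw hD
    (hito x u X hpair).valuePenalty_ae_eq hT (hcorr x u X hpair)
  have hmean : ∀ x u X, D.Admissible P w p 0 x u X →
      Integrable (D.valueIntegral V u X D.T) P ∧ ∫ ω, D.valueIntegral V u X D.T ω ∂P ≤ 0 := by
    intro x u X h
    obtain ⟨G, hG0, hG, hlow⟩ := h.exists_lower_bound hw hp0 hD hver (hA x u X h)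
    exact (hproc x u X h).integrable_and_integral_nonpos hw hG0 hG hlow
  refine ⟨⟨fun x u X h => ?_, fun x u X h => ?_, ?_⟩, fun x => ?_⟩
  · obtain ⟨S, hS, hY⟩ := (hproc x u X h).isItoIntegral hw
    exact ⟨S, hS, hY.congr_right (heq x u X h).symm⟩
  · obtain ⟨h1, h2⟩ := hmean x u X h
    exact ⟨h1.congr (heq x u X h).symm, (integral_congr_ae (heq x u X h)).trans_le h2⟩
  · rintro ⟨C, hC⟩ x u X h
    obtain ⟨M, hM0, hMm, hMi, hM⟩ := h.exists_state_bound hT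
    rw [integral_congr_ae (heq x u X h)]
    refine (hproc x u X h).integral_eq_zero hw (Z := fun ω => |C| * (1 + M ω)) (fun ω => ?_)
      ((hMm.const_add 1).const_mul _) (((integrable_const 1).add hMi).const_mul _) ?_
      (hmean x u X h).1
    · have := hM0 ω
      positivity
    · filter_upwards [hM] with ω hω t ht
      have h1 := hω t ⟨ht.1, ht.2.le⟩
      have h2 : (0 : ℝ) ≤ ‖X t ω‖ ^ p := by positivity
      rw [← Real.sqrt_le_left (mul_nonneg (abs_nonneg C) (by linarith [hM0 ω]))]
      exact (hC t ht (X t ω)).trans ((mul_le_mul_of_nonneg_right (le_abs_self C)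
        (by positivity)).trans (mul_le_mul_of_nonneg_left (by linarith) (abs_nonneg C)))
  · have hopt : ∀ X, D.Admissible P w p 0 x (ControlProblem.feedback ustar X) X →
        ∀ᵐ ω ∂P, D.innerObjective (D.valuePenalty P w V) (ControlProblem.feedback ustar X) X ω
          = (V 0 x : EReal) := by
      intro X h
      have hpair := h.isAnticipatingPair hw hD
      obtain ⟨Q, -, -, hQ⟩ := h.exists_running_reward_bound hp0 hD
      filter_upwards [hpair.innerObjective_ae_eq hT hver (hito _ _ _ hpair) (hcorr _ _ _ hpair), hQ,
        hA _ _ _ h] with ω h1 h2 h3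
      have i1 := (intervalIntegrable_iff_integrableOn_Icc_of_le hT).2 h2.1
      have i2 := (intervalIntegrable_iff_integrableOn_Icc_of_le hT).2 h3
      -- Along the feedback the integrand of the objective vanishes identically on `(0, T)` by the
      -- HJB equation.
      have h0 : ∫ s in Ioo 0 D.T, (D.g s (X s ω) (ControlProblem.feedback ustar X s ω)
          + D.A V s (X s ω) (ControlProblem.feedback ustar X s ω)) = 0 :=
        setIntegral_eq_zero_of_forall_eq_zero fun s hs => hver.hjb s ⟨hs.1.le, hs.2⟩ (X s ω)
      rw [h1 h2.1, ← intervalIntegral.integral_add i1 i2, intervalIntegral.integral_of_le hT,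
        integral_Ioc_eq_integral_Ioo, h0, add_zero]
    -- The essential supremum is the constant `V 0 x`: the HJB inequality makes it an upper bound
    -- for every anticipating control, and the feedback strategy, itself a member of the family,
    -- attains it almost surely. Controls with non-integrable running reward contribute `⊥`.
    refine ⟨fun _ => V 0 x, ⟨aemeasurable_const, ?_, ?_⟩, integrable_const _, by simp, by simp,
      fun X h => ⟨h.isAnticipatingPair hw hD, hopt X h⟩⟩
    · rintro _ ⟨u, X, hpair, rfl⟩
      filter_upwards [hpair.innerObjective_ae_eq hT hver (hito _ _ _ hpair) (hcorr _ _ _ hpair),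
        (hito _ _ _ hpair).integrable_A (hcorr _ _ _ hpair)] with ω h1 h2
      by_cases hg : IntegrableOn (fun t => D.g t (X t ω) (u t ω)) (Icc 0 D.T)
      · rw [h1 hg, EReal.coe_le_coe_iff]
        linarith [hver.integral_le hpair.mem hg h2 (right_mem_Icc.2 hT)]
      · rw [ControlProblem.innerObjective, if_neg hg]
        exact bot_le
    · intro Z' _ hZ'
      obtain ⟨X, hX⟩ := hver.admissible x
      filter_upwards [hZ' _ ⟨_, X, hX.isAnticipatingPair hw hD, rfl⟩, hopt X hX] with ω h1 h2
      rwa [h2] at h1
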